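/- Let $d,n\ge 1$, $c>0$. Let $\sigma_1\in C_c^\infty(\mathbb R^d)$ and $\sigma_2\in C_c^\infty(\mathbb R^n)$ be non-negative and radially symmetric ("form functions"), let $V\in W^{2,\infty}_{\rm loc}(\mathbb R^d)$ satisfy $V(x)\ge -C(1+|x|^2)$ for some $C\ge0$ and all $x$, and let $\Psi_0,\Psi_1\in L^2(\mathbb R^d\times\mathbb R^n)$. Consider the Vlasov–Wave system $$\partial_t f+v\cdot\nabla_xf-\nabla_x(V+\Phi)\cdot\nabla_vf=0,\qquad \Phi(t,x)=\int_{\mathbb R^d\times\mathbb R^n}\Psi(t,z,y)\sigma_1(x-z)\sigma_2(y)\,dy\,dz,$$ $$\partial_{tt}^2\Psi-c^2\Delta_y\Psi=-\sigma_2(y)\int_{\mathbb R^d}\sigma_1(x-z)\rho(t,z)\,dz,\qquad \rho(t,x)=\int_{\mathbb R^d}f(t,x,v)\,dv,$$ with $f|_{t=0}=f_0$, $\Psi|_{t=0}=\Psi_0$, $\partial_t\Psi|_{t=0}=\Psi_1$. A weak solution on $[0,T]$ is a pair $f\in C([0,T];L^1(\mathbb R^d\times\mathbb R^d))$, $\Psi\in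 C([0,T];L^2(\mathbb R^d\times\mathbb R^n))$ satisfying both equations, with their initial data, in the sense of distributions on $[0,T)$. Notation. With $\widehat{\cdot}$ the Fourier transform in $y$, $\widehat u(\xi)=\int_{\mathbb R^n} e^{-i\xi\cdot y}u(y)\,dy$, put $$\Phi_0(t,x)=\frac1{(2\pi)^{n}}\iint\sigma_1(x-z)\Big(\widehat{\Psi_0}(z,\xi)\cos(c|\xi|t)+\widehat{\Psi_1}(z,\xi)\tfrac{\sin(c|\xi|t)}{c|\xi|}\Big)\widehat{\sigma_2}(\xi)\,dz\,d\xi,$$ $p(t)=(2\pi)^{-n}\int\frac{\sin(c|\xi|t)}{c|\xi|}|\widehat{\sigma_2}(\xi)|^2d\xi$, $\Sigma=\sigma_1*\sigma_1$, and $\mathcal L(g)(t,x)=\int_0^tp(t-s)\langle g(s),\Sigma(x-\cdot)\otimes 1_v\rangle\,ds$; let $|||\mathcal L|||_t$ be the norm of $\mathcal L$ as an operator from $C([0,t];(W^{1,\infty}(\mathbb R^d\times\mathbb R^d))')$ to $C^1([0,t];L^\infty(\mathbb R^d))$. Here $\|w\|_{W^{1,\infty}}=\max(\|w\|_{L^\infty},\|\nabla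 w\|_{L^\infty})$, the dual carries the dual norm, and $\|\Phi\|_{C^1([0,t];L^\infty)}=\sup_{[0,t]}\|\Phi\|_{L^\infty}+\sup_{[0,t]}\|\partial_t\Phi\|_{L^\infty}$. Let $R(N,t,x,v)$ be the least function, non-decreasing in $N$ and in $t$, such that for every $\Phi\in C([0,\infty);W^{2,\infty}(\mathbb R^d))\cap C^1([0,\infty);L^\infty(\mathbb R^d))$ the solution of $\dot X=\xi$, $\dot\xi=-\nabla V(X)-\nabla\Phi(t,X)$, $(X,\xi)(0)=(x,v)$ satisfies $|(X,\xi)(t)|\le R(\|\Phi\|_{C^1([0,t];L^\infty)},t,x,v)$ for all $t\ge 0$. For $R_0,T\in(0,\infty)$ put $r(t,x,v)=R(\|\Phi_0\|_{C^1([0,t];L^\infty)}+|||\mathcal L|||_tR_0,t,x,v)$, and let $E_{R_0,T}$ be the set of $f_0\in L^1(\mathbb R^d\times\mathbb R^d)$ with $f_0\ge0$, $\|f_0\|_{L^1}\le R_0$ and $$\int_{\mathbb R^d\times\mathbb R^d}f_0(x,v)\exp\Big(\int_0^T\|\nabla^2V\|_{L^\infty(B(0,r(t,x,v)))}\,dt\Big)dv\,dx<\infty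 .$$ Statement. 1. Let $R_0,T\in(0,\infty)$ and $f_0\in E_{R_0,T}$. There is a unique weak solution $(f,\Psi)$ on $[0,T]$, and $f\ge0$. It depends continuously on $(\sigma_1,\sigma_2,\Psi_0,\Psi_1,f_0)$: for every $\varepsilon>0$ there is $\delta>0$ such that, for all form functions $\sigma_1',\sigma_2'$, all $\Psi_0',\Psi_1'\in L^2(\mathbb R^d\times\mathbb R^n)$ and all $0\le f_0'\in L^1(\mathbb R^d\times\mathbb R^d)$ that are $\delta$-close to $\sigma_1,\sigma_2,\Psi_0,\Psi_1,f_0$ in $W^{3,2}(\mathbb R^d)$, $L^2(\mathbb R^n)$, $L^2$, $L^2$, $L^1$ respectively, every weak solution $(f',\Psi')$ on $[0,T]$ for these data satisfies $\|f'(t)-f(t)\|_{L^1}<\varepsilon$ and $\|\Psi'(t)-\Psi(t)\|_{L^2}<\varepsilon$ for all $t\in[0,T]$. 2. For every $f_0\in L^1(\mathbb R^d\times\mathbb R^d)$ with $f_0\ge0$ there are $f\in C([0,\infty);L^1(\mathbb R^d\times\mathbb R^d))$, $f\ge0$, and $\Psi\in C([0,\infty);L^2(\mathbb R^d\times\mathbb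 R^n))$ such that $(f,\Psi)$ is a weak solution on $[0,T]$ for every $T>0$. 3. Let $0\le f_0\in L^1(\mathbb R^d\times\mathbb R^d)$ and suppose that the initial energy is finite: $\nabla_y\Psi_0\in L^2(\mathbb R^d\times\mathbb R^n)$ and $\big(\frac{|v|^2}2+V(x)\big)f_0\in L^1(\mathbb R^d\times\mathbb R^d)$. Then every weak solution $(f,\Psi)$ on $[0,T]$, $T>0$, satisfies $\Psi\in C^1([0,T];L^2)$, $\nabla_y\Psi\in C([0,T];L^2)$, $f(t)\big(\frac{|v|^2}2+V+\Phi(t)\big)\in L^1$ for all $t\in[0,T]$, and the total energy $$\frac12\int|\partial_t\Psi(t)|^2dx\,dy+\frac{c^2}2\int|\nabla_y\Psi(t)|^2dx\,dy+\int f(t,x,v)\Big(\frac{|v|^2}2+V(x)+\Phi(t,x)\Big)dv\,dx$$ is, for all $t\in[0,T]$, equal to its initial value, computed from $f_0,\Psi_0,\Psi_1$. -/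

import Mathlib

open MeasureTheory Filter Topology Set
open scoped ENNReal FourierTransform Laplacian

noncomputable section

namespace VlasovWave

/-- Euclidean space `ℝᵏ`. -/
abbrev Rd (k : ℕ) := EuclideanSpace ℝ (Fin k)

/-! ### Weak derivatives -/

section Weak

variable {X : Type*} [NormedAddCommGroup X] [NormedSpace ℝ X]

/-- Test functions: smooth with compact support. -/
def IsTest (φ : X → ℝ) : Prop := ContDiff ℝ (⊤ : ℕ∞) φ ∧ HasCompactSupport φ

theorem IsTest.fderiv_apply {φ : X → ℝ} (h : IsTest φ) (e : X) :
    IsTest (fun x => fderiv ℝ φ x e) :=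
  ⟨(h.1.fderiv_right (m := ((⊤ : ℕ∞) : WithTop ℕ∞)) (by simp)).clm_apply contDiff_const, h.2.fderiv_apply ℝ e⟩

variable [MeasureSpace X]

/-- `w` is the weak derivative of `u` in the direction `e`. -/
structure IsWeakDerivAlong (u : X → ℝ) (e : X) (w : X → ℝ) : Prop where
  locInt : LocallyIntegrable u
  locInt_deriv : LocallyIntegrable w
  integral_eq : ∀ φ : X → ℝ, IsTest φ → ∫ x, u x * fderiv ℝ φ x e = -∫ x, w x * φ x

theorem IsTest.integrable_mul [BorelSpace X] {φ u : X → ℝ} (h : IsTest φ)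
    (hu : LocallyIntegrable u) : Integrable (fun x => u x * φ x) :=
  hu.integrable_smul_right_of_hasCompactSupport h.1.continuous h.2

theorem IsWeakDerivAlong.congr {u u' w w' : X → ℝ} {e : X} (h : IsWeakDerivAlong u e w)
    (hu : u =ᵐ[volume] u') (hw : w =ᵐ[volume] w') : IsWeakDerivAlong u' e w' := by
  refine ⟨h.locInt.congr hu, h.locInt_deriv.congr hw, fun φ hφ => ?_⟩
  have h1 : ∫ x, u x * fderiv ℝ φ x e = ∫ x, u' x * fderiv ℝ φ x e :=
    integral_congr_ae (by filter_upwards [hu] with x hx using by rw [hx])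
  have h2 : ∫ x, w x * φ x = ∫ x, w' x * φ x :=
    integral_congr_ae (by filter_upwards [hw] with x hx using by rw [hx])
  rw [← h1, ← h2]
  exact h.integral_eq φ hφ

theorem IsWeakDerivAlong.add [BorelSpace X] {u u' w w' : X → ℝ} {e : X}
    (h : IsWeakDerivAlong u e w) (h' : IsWeakDerivAlong u' e w') :
    IsWeakDerivAlong (fun x => u x + u' x) e (fun x => w x + w' x) := by
  refine ⟨h.locInt.add h'.locInt, h.locInt_deriv.add h'.locInt_deriv, fun φ hφ => ?_⟩
  simp only [add_mul]
  rw [integral_add ((hφ.fderiv_apply e).integrable_mul h.locInt)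
      ((hφ.fderiv_apply e).integrable_mul h'.locInt),
    integral_add (hφ.integrable_mul h.locInt_deriv) (hφ.integrable_mul h'.locInt_deriv),
    h.integral_eq φ hφ, h'.integral_eq φ hφ]
  ring

theorem IsWeakDerivAlong.const_mul {u w : X → ℝ} {e : X} (a : ℝ)
    (h : IsWeakDerivAlong u e w) :
    IsWeakDerivAlong (fun x => a * u x) e (fun x => a * w x) := by
  refine ⟨h.locInt.smul a, h.locInt_deriv.smul a, fun φ hφ => ?_⟩
  simp only [mul_assoc, integral_const_mul]
  rw [h.integral_eq φ hφ]
  ring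

theorem IsWeakDerivAlong.zero (e : X) : IsWeakDerivAlong (fun _ : X => 0) e (fun _ => 0) :=
  ⟨locallyIntegrable_zero, locallyIntegrable_zero, fun φ _ => by simp⟩

end Weak

section Sobolev

variable {d n : ℕ}

/-- `G` is the weak gradient of `u` on `ℝᵈ`. -/
def HasWeakGradient (u : Rd d → ℝ) (G : Rd d → Rd d) : Prop :=
  ∀ e, IsWeakDerivAlong u e (fun x => inner ℝ (G x) e)

/-- `H` is the weak derivative of the vector field `G` on `ℝᵈ` (the weak Hessian of `u` when `G` is
the weak gradient of `u`); `H x e e'` is the derivative of `⟪G, e'⟫` in the direction `e`. -/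
def HasWeakJacobian (G : Rd d → Rd d) (H : Rd d → Rd d →L[ℝ] Rd d →L[ℝ] ℝ) : Prop :=
  ∀ e e', IsWeakDerivAlong (fun x => inner ℝ (G x) e') e (fun x => H x e e')

/-- `G` is the weak gradient of `ψ : ℝᵈ × ℝⁿ → ℝ` with respect to the second variable. -/
def HasWeakGradientSnd (ψ : Rd d × Rd n → ℝ) (G : Rd d × Rd n → Rd n) : Prop :=
  ∀ e : Rd n, IsWeakDerivAlong ψ (0, e) (fun q => inner ℝ (G q) e)

/-- The norm of `W^{2,∞}(ℝᵈ)` (infinite outside this space). The weak derivatives are unique almost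
everywhere, so the infimum only selects them. -/
def w2infNorm (u : Rd d → ℝ) : ℝ≥0∞ :=
  ⨅ (G : Rd d → Rd d) (H : Rd d → Rd d →L[ℝ] Rd d →L[ℝ] ℝ)
    (_ : HasWeakGradient u G) (_ : HasWeakJacobian G H),
    eLpNorm u ∞ volume + eLpNorm G ∞ volume + eLpNorm H ∞ volume

/-- `V` is (the continuous representative of) an element of `W^{2,∞}_loc(ℝᵈ)`. Such a `V` is
automatically `C¹`, so that its classical gradient is meaningful everywhere. -/
def MemW2infLoc (V : Rd d → ℝ) : Prop :=
  Continuous V ∧ ∃ (G : Rd d → Rd d) (H : Rd d → Rd d →L[ℝ] Rd d →L[ℝ] ℝ),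
    HasWeakGradient V G ∧ HasWeakJacobian G H ∧
    ∀ r : ℝ, eLpNorm G ∞ (volume.restrict (Metric.ball 0 r)) < ∞ ∧
      eLpNorm H ∞ (volume.restrict (Metric.ball 0 r)) < ∞

/-- The `L^∞` norm of the weak Hessian of `V` on the ball `B(0, r)`, `r ∈ [0, ∞]`. -/
def hessianBound (V : Rd d → ℝ) (r : ℝ≥0∞) : ℝ≥0∞ :=
  ⨅ (G : Rd d → Rd d) (H : Rd d → Rd d →L[ℝ] Rd d →L[ℝ] ℝ)
    (_ : HasWeakGradient V G) (_ : HasWeakJacobian G H),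
    eLpNorm H ∞ (volume.restrict {x | ‖x‖ₑ < r})

/-- The norm of `W^{3,2}(ℝᵈ)` on smooth functions. -/
def w32Norm (u : Rd d → ℝ) : ℝ≥0∞ :=
  ∑ k ∈ Finset.range 4, eLpNorm (iteratedFDeriv ℝ k u) 2 volume

/-- The Sobolev space `W^{1,∞}(ℝᵈ × ℝᵈ)`: pairs made of a bounded function and of its bounded weak
gradient, with the norm `max (‖u‖_∞, ‖∇u‖_∞)` (and `∇u` measured by the Euclidean norm). -/
def W1inf (d : ℕ) : Submodule ℝ
    (Lp ℝ ∞ (volume : Measure (Rd d × Rd d)) ×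
      Lp (WithLp 2 (Rd d × Rd d)) ∞ (volume : Measure (Rd d × Rd d))) where
  carrier := {w | ∀ e, IsWeakDerivAlong (w.1 : Rd d × Rd d → ℝ) e
    (fun z => inner ℝ ((w.2 : Rd d × Rd d → WithLp 2 (Rd d × Rd d)) z) (WithLp.toLp 2 e))}
  add_mem' := by
    intro a b ha hb e
    refine ((ha e).add (hb e)).congr (Lp.coeFn_add a.1 b.1).symm ?_
    filter_upwards [Lp.coeFn_add a.2 b.2] with z hz
    rw [Prod.snd_add, hz, Pi.add_apply, inner_add_left]
  zero_mem' := by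
    intro e
    refine (IsWeakDerivAlong.zero e).congr (Lp.coeFn_zero _ _ _).symm ?_
    filter_upwards [Lp.coeFn_zero (WithLp 2 (Rd d × Rd d)) ∞
      (volume : Measure (Rd d × Rd d))] with z hz
    rw [Prod.snd_zero, hz, Pi.zero_apply, inner_zero_left]
  smul_mem' := by
    intro a w hw e
    refine ((hw e).const_mul a).congr (Lp.coeFn_smul a w.1).symm ?_
    filter_upwards [Lp.coeFn_smul a w.2] with z hz
    rw [Prod.smul_snd, hz, Pi.smul_apply, real_inner_smul_left]

/-- The topological dual `(W^{1,∞}(ℝᵈ × ℝᵈ))'` with the dual norm. -/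
abbrev W1infDual (d : ℕ) := StrongDual ℝ (W1inf d)

open Classical in
/-- The value of `ℓ ∈ (W^{1,∞})'` at the function `g ∈ W^{1,∞}(ℝᵈ × ℝᵈ)` (zero by convention if
`g` does not belong to this space). -/
def pairing (ℓ : W1infDual d) (g : Rd d × Rd d → ℝ) : ℝ :=
  if h : ∃ w : W1inf d, (w.1.1 : Rd d × Rd d → ℝ) =ᵐ[volume] g then ℓ h.choose else 0

end Sobolev

/-! ### Assumptions on the parameters -/

section Assumptions

variable {d n : ℕ}

/-- Form functions: smooth, compactly supported, non-negative, radially symmetric. -/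
structure IsFormFunction {k : ℕ} (σ : Rd k → ℝ) : Prop where
  smooth : ContDiff ℝ (⊤ : ℕ∞) σ
  compactSupport : HasCompactSupport σ
  nonneg : ∀ x, 0 ≤ σ x
  radial : ∀ x y, ‖x‖ = ‖y‖ → σ x = σ y

/-- External potentials: `V ∈ W^{2,∞}_loc` and `V(x) ≥ -C (1 + |x|²)`. -/
structure IsExternalPotential (V : Rd d → ℝ) : Prop where
  regular : MemW2infLoc V
  lower_bound : ∃ C : ℝ, 0 ≤ C ∧ ∀ x, -C * (1 + ‖x‖ ^ 2) ≤ V x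

end Assumptions

/-- Particle densities: `L¹(ℝᵈ × ℝᵈ)`. -/
abbrev Density (d : ℕ) := Lp ℝ 1 (volume : Measure (Rd d × Rd d))

/-- States of the vibrating field: `L²(ℝᵈ × ℝⁿ)`. -/
abbrev WaveField (d n : ℕ) := Lp ℝ 2 (volume : Measure (Rd d × Rd n))

/-! ### The Vlasov–Wave system -/

section System

variable {d n : ℕ}

/-- The self-consistent potential `Φ(x) = ∫∫ Ψ(z,y) σ₁(x-z) σ₂(y) dy dz`. -/
def potential (σ₁ : Rd d → ℝ) (σ₂ : Rd n → ℝ) (Ψ : WaveField d n) (x : Rd d) : ℝ :=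
  ∫ q : Rd d × Rd n, Ψ q * σ₁ (x - q.1) * σ₂ q.2

/-- The macroscopic density `ρ(x) = ∫ f(x,v) dv`. -/
def macroDensity (f : Density d) (x : Rd d) : ℝ := ∫ v : Rd d, f (x, v)

/-- `f` satisfies `∂ₜf + v·∇ₓf - ∇ₓ(V+Φ)·∇ᵥf = 0` on `(0,T)` with `f(0) = f₀`, in the sense of
distributions. The test function depends on `(t,(x,v))`, and
`fderiv ℝ φ (t, z) (1, z.2, -∇(V+Φ))` is `∂ₜφ + v·∇ₓφ - ∇ₓ(V+Φ)·∇ᵥφ`. -/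
def IsWeakVlasov (T : ℝ) (V : Rd d → ℝ) (Φ : ℝ → Rd d → ℝ) (f₀ : Density d)
    (f : ℝ → Density d) : Prop :=
  ∀ φ : ℝ × (Rd d × Rd d) → ℝ, IsTest φ → tsupport φ ⊆ Iio T ×ˢ univ →
    (∫ t in Icc 0 T, ∫ z : Rd d × Rd d,
        f t z * fderiv ℝ φ (t, z) (1, (z.2, -gradient (fun x => V x + Φ t x) z.1)))
      + ∫ z : Rd d × Rd d, f₀ z * φ (0, z) = 0

/-- `Ψ` satisfies `∂ₜₜΨ - c² Δ_y Ψ = -σ₂(y) ∫ σ₁(x-z) ρ(t,z) dz` on `(0,T)` with `Ψ(0) = Ψ₀` and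
`∂ₜΨ(0) = Ψ₁`, in the sense of distributions. -/
def IsWeakWave (T c : ℝ) (σ₁ : Rd d → ℝ) (σ₂ : Rd n → ℝ) (Ψ₀ Ψ₁ : WaveField d n)
    (f : ℝ → Density d) (Ψ : ℝ → WaveField d n) : Prop :=
  ∀ φ : ℝ × (Rd d × Rd n) → ℝ, IsTest φ → tsupport φ ⊆ Iio T ×ˢ univ →
    (∫ t in Icc 0 T, ∫ q : Rd d × Rd n,
        Ψ t q * (iteratedDeriv 2 (fun s => φ (s, q)) t
          - c ^ 2 * (Δ (fun y => φ (t, (q.1, y)))) q.2))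
      = -(∫ t in Icc 0 T, ∫ q : Rd d × Rd n,
            σ₂ q.2 * (∫ z, σ₁ (q.1 - z) * macroDensity (f t) z) * φ (t, q))
        + (∫ q : Rd d × Rd n, Ψ₁ q * φ (0, q))
        - ∫ q : Rd d × Rd n, Ψ₀ q * deriv (fun s => φ (s, q)) 0

/-- `(f,Ψ)`, with `f ∈ C([0,T]; L¹)` and `Ψ ∈ C([0,T]; L²)`, is a weak solution on `[0,T]` of the
Vlasov–Wave system with data `f₀, Ψ₀, Ψ₁`. -/
structure IsWeakSolution (T c : ℝ) (V : Rd d → ℝ) (σ₁ : Rd d → ℝ) (σ₂ : Rd n → ℝ)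
    (Ψ₀ Ψ₁ : WaveField d n) (f₀ : Density d) (f : ℝ → Density d) (Ψ : ℝ → WaveField d n) : Prop where
  continuous_density : ContinuousOn f (Icc 0 T)
  continuous_field : ContinuousOn Ψ (Icc 0 T)
  vlasov : IsWeakVlasov T V (fun t => potential σ₁ σ₂ (Ψ t)) f₀ f
  wave : IsWeakWave T c σ₁ σ₂ Ψ₀ Ψ₁ f Ψ

end System

/-! ### The class of initial densities -/

section InitialDensities

variable {d n : ℕ}

/-- The time derivative (one-sided at `0`) of `Φ : [0,∞) × ℝᵈ → ℝ`. -/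
def timeDeriv (Φ : ℝ → Rd d → ℝ) (t : ℝ) (x : Rd d) : ℝ :=
  derivWithin (fun s => Φ s x) (Ici 0) t

/-- The norm of `C¹([0,t]; L^∞(ℝᵈ))`. -/
def c1Norm (Φ : ℝ → Rd d → ℝ) (t : ℝ) : ℝ≥0∞ :=
  (⨆ s ∈ Icc 0 t, eLpNorm (Φ s) ∞ volume) + ⨆ s ∈ Icc 0 t, eLpNorm (timeDeriv Φ s) ∞ volume

/-- `Φ ∈ C⁰([0,∞); W^{2,∞}(ℝᵈ)) ∩ C¹([0,∞); L^∞(ℝᵈ))`, each `Φ(t)` being the continuous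
representative. -/
structure IsRegularPotential (Φ : ℝ → Rd d → ℝ) : Prop where
  continuous_space : ∀ t, 0 ≤ t → Continuous (Φ t)
  memW2inf : ∀ t, 0 ≤ t → w2infNorm (Φ t) < ∞
  continuous_time : ∀ t, 0 ≤ t → Tendsto (fun s => w2infNorm (fun x => Φ s x - Φ t x))
    (𝓝[Ici 0] t) (𝓝 0)
  hasDeriv_time : ∀ t, 0 ≤ t → Tendsto
    (fun s => eLpNorm (fun x => (s - t)⁻¹ * (Φ s x - Φ t x) - timeDeriv Φ t x) ∞ volume)
    (𝓝[Ici 0 \ {t}] t) (𝓝 0)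
  continuous_deriv_time : ∀ t, 0 ≤ t → Tendsto
    (fun s => eLpNorm (fun x => timeDeriv Φ s x - timeDeriv Φ t x) ∞ volume)
    (𝓝[Ici 0] t) (𝓝 0)

/-- `(X, ξ)` solves on `[0,s]` the characteristic system `X' = ξ`, `ξ' = -∇V(X) - ∇Φ(t,X)` with
`(X,ξ)(0) = (x,v)`. -/
structure IsCharacteristic (V : Rd d → ℝ) (Φ : ℝ → Rd d → ℝ) (s : ℝ) (x v : Rd d)
    (X ξ : ℝ → Rd d) : Prop where
  init_pos : X 0 = x
  init_vel : ξ 0 = v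
  deriv_pos : ∀ t ∈ Icc 0 s, HasDerivWithinAt X (ξ t) (Icc 0 s) t
  deriv_vel : ∀ t ∈ Icc 0 s,
    HasDerivWithinAt ξ (-gradient V (X t) - gradient (Φ t) (X t)) (Icc 0 s) t

/-- The least bound for characteristic curves: `charBound V N t x v` is the smallest function,
non-decreasing in `N` and `t`, such that every characteristic curve starting from `(x,v)` in a
potential `Φ` satisfies `|(X,ξ)(t)| ≤ charBound V ‖Φ‖_{C¹([0,t];L^∞)} t x v`. -/
def charBound (V : Rd d → ℝ) (N : ℝ≥0∞) (t : ℝ) (x v : Rd d) : ℝ≥0∞ :=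
  ⨆ (Φ : ℝ → Rd d → ℝ) (_ : IsRegularPotential Φ) (s : ℝ) (_ : s ∈ Icc 0 t)
    (_ : c1Norm Φ s ≤ N) (X : ℝ → Rd d) (ξ : ℝ → Rd d) (_ : IsCharacteristic V Φ s x v X ξ),
    ENNReal.ofReal (Real.sqrt (‖X s‖ ^ 2 + ‖ξ s‖ ^ 2))

/-- The multiplier `sin(c|ξ|t)/(c|ξ|)` in the frequency variable `η = ξ/2π` of Mathlib's Fourier
transform. -/
def sinMultiplier {n : ℕ} (c t : ℝ) (η : Rd n) : ℝ :=
  Real.sin (2 * Real.pi * c * ‖η‖ * t) / (2 * Real.pi * c * ‖η‖)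

/-- The multiplier `cos(c|ξ|t)`, `ξ = 2πη`. -/
def cosMultiplier {n : ℕ} (c t : ℝ) (η : Rd n) : ℝ :=
  Real.cos (2 * Real.pi * c * ‖η‖ * t)

open Classical in
/-- The Fourier transform in `y` of `Ψ(x,·)`, which belongs to `L²(ℝⁿ)` for almost every `x`. -/
def fourierSnd (Ψ : WaveField d n) (x : Rd d) : Rd n → ℂ :=
  if h : MemLp (fun y => ((Ψ (x, y) : ℝ) : ℂ)) 2 (volume : Measure (Rd n)) then
    (𝓕 (h.toLp _) : Lp ℂ 2 (volume : Measure (Rd n)))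
  else 0

/-- The Fourier transform of the form function `σ₂`. -/
def fourierForm (σ₂ : Rd n → ℝ) : Rd n → ℂ := 𝓕 (fun y => ((σ₂ y : ℝ) : ℂ))

/-- `p(t) = (2π)⁻ⁿ ∫ sin(c|ξ|t)/(c|ξ|) |σ̂₂(ξ)|² dξ`. -/
def memoryKernel (c : ℝ) (σ₂ : Rd n → ℝ) (t : ℝ) : ℝ :=
  ∫ η : Rd n, sinMultiplier c t η * ‖fourierForm σ₂ η‖ ^ 2

/-- `Φ₀(t,x) = (2π)⁻ⁿ ∫∫ σ₁(x-z) (Ψ̂₀(z,ξ) cos(c|ξ|t) + Ψ̂₁(z,ξ) sin(c|ξ|t)/(c|ξ|)) σ̂₂(ξ) dξ dz`,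
the potential created by the free evolution of the initial field. -/
def freePotential (c : ℝ) (σ₁ : Rd d → ℝ) (σ₂ : Rd n → ℝ) (Ψ₀ Ψ₁ : WaveField d n)
    (t : ℝ) (x : Rd d) : ℝ :=
  (∫ z : Rd d, (σ₁ (x - z) : ℂ) * ∫ η : Rd n,
    (fourierSnd Ψ₀ z η * cosMultiplier c t η + fourierSnd Ψ₁ z η * sinMultiplier c t η)
      * fourierForm σ₂ η).re

/-- `Σ = σ₁ ∗ σ₁`. -/
def selfConv (σ₁ : Rd d → ℝ) (x : Rd d) : ℝ := ∫ z, σ₁ (x - z) * σ₁ z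

/-- The interaction operator on `(W^{1,∞})'`-valued curves:
`𝓛(f)(t,x) = ∫₀ᵗ p(t-s) ⟨f(s), Σ(x-·) ⊗ 1ᵥ⟩ ds`. -/
def interaction (c : ℝ) (σ₁ : Rd d → ℝ) (σ₂ : Rd n → ℝ) (f : ℝ → W1infDual d)
    (t : ℝ) (x : Rd d) : ℝ :=
  ∫ s in (0 : ℝ)..t, memoryKernel c σ₂ (t - s) * pairing (f s) (fun z => selfConv σ₁ (x - z.1))

/-- The norm of `𝓛` as an operator from `C([0,t]; (W^{1,∞}(ℝᵈ×ℝᵈ))')` to `C¹([0,t]; L^∞(ℝᵈ))`. -/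
def interactionNorm (c : ℝ) (σ₁ : Rd d → ℝ) (σ₂ : Rd n → ℝ) (t : ℝ) : ℝ≥0∞ :=
  ⨆ (f : C(ℝ, W1infDual d)) (_ : ∀ s ∈ Icc 0 t, ‖f s‖ ≤ 1), c1Norm (interaction c σ₁ σ₂ f) t

/-- The radius `r(t,x,v) = R(‖Φ₀‖_{C¹([0,t];L^∞)} + |||𝓛||| R₀, t, x, v)`. -/
def radius (c : ℝ) (V : Rd d → ℝ) (σ₁ : Rd d → ℝ) (σ₂ : Rd n → ℝ) (Ψ₀ Ψ₁ : WaveField d n)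
    (R₀ t : ℝ) (x v : Rd d) : ℝ≥0∞ :=
  charBound V (c1Norm (freePotential c σ₁ σ₂ Ψ₀ Ψ₁) t
    + interactionNorm c σ₁ σ₂ t * ENNReal.ofReal R₀) t x v

/-- `K(f₀) = ∫∫ f₀(x,v) exp (∫₀ᵀ ‖∇²V‖_{L^∞(B(0,r(t,x,v)))} dt) dv dx`. -/
def weightedMass (c : ℝ) (V : Rd d → ℝ) (σ₁ : Rd d → ℝ) (σ₂ : Rd n → ℝ) (Ψ₀ Ψ₁ : WaveField d n)
    (R₀ T : ℝ) (f₀ : Density d) : ℝ≥0∞ :=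
  ∫⁻ z : Rd d × Rd d, ENNReal.ofReal (f₀ z) *
    EReal.exp ((∫⁻ t in Icc 0 T,
      hessianBound V (radius c V σ₁ σ₂ Ψ₀ Ψ₁ R₀ t z.1 z.2) : ℝ≥0∞) : EReal)

/-- The set `E_{R₀,T}` of initial densities. -/
def admissibleDensities (c : ℝ) (V : Rd d → ℝ) (σ₁ : Rd d → ℝ) (σ₂ : Rd n → ℝ)
    (Ψ₀ Ψ₁ : WaveField d n) (R₀ T : ℝ) : Set (Density d) :=
  {f₀ | 0 ≤ f₀ ∧ ‖f₀‖ ≤ R₀ ∧ weightedMass c V σ₁ σ₂ Ψ₀ Ψ₁ R₀ T f₀ < ∞}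

end InitialDensities

/-! ### Energy -/

section Energy

variable {d n : ℕ}

/-- The particle energy density `f (|v|²/2 + V + Φ)`. -/
def particleEnergyDensity (V Φ : Rd d → ℝ) (f : Density d) (z : Rd d × Rd d) : ℝ :=
  f z * (‖z.2‖ ^ 2 / 2 + V z.1 + Φ z.1)

/-- The total energy of a state with density `f`, field `Ψ`, field velocity `Ψt` and transverse
field gradient `G`. -/
def totalEnergy (c : ℝ) (V : Rd d → ℝ) (σ₁ : Rd d → ℝ) (σ₂ : Rd n → ℝ) (f : Density d)
    (Ψ Ψt : WaveField d n) (G : Lp (Rd n) 2 (volume : Measure (Rd d × Rd n))) : ℝ :=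
  1 / 2 * (∫ q : Rd d × Rd n, |Ψt q| ^ 2) + c ^ 2 / 2 * (∫ q : Rd d × Rd n, ‖G q‖ ^ 2)
    + ∫ z : Rd d × Rd d, particleEnergyDensity V (potential σ₁ σ₂ Ψ) f z

end Energy

end VlasovWave

end

open VlasovWave

open MeasureTheory Filter Topology Set Metric
open scoped ENNReal FourierTransform Laplacian Convolution SchwartzMap LineDeriv

noncomputable section

namespace VlasovWave

theorem integral_ext {X E : Type*} [MeasurableSpace X] {μ : Measure X} [NormedAddCommGroup E] [NormedSpace ℝ E] {f g : X → E}
    (h : ∀ x, f x = g x) : ∫ x, f x ∂μ = ∫ x, g x ∂μ := by simp only [h]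

variable {T m₀ : ℝ} {k m : ℝ → ℝ}

/-- Every test function on `(-∞, T)` has, on `[0, ∞)`, a test function as primitive. -/
theorem exists_isTest_deriv_eq {θ : ℝ → ℝ} (hθ : IsTest θ) (hs : tsupport θ ⊆ Iio T) :
    ∃ χ : ℝ → ℝ, IsTest χ ∧ tsupport χ ⊆ Iio T ∧ ∀ t, 0 ≤ t → HasDerivAt χ (θ t) t := by
  obtain ⟨T', hT'T, hT'⟩ : ∃ T' < T, tsupport θ ⊆ Iic T' := by
    rcases (tsupport θ).eq_empty_or_nonempty with h | h
    · exact ⟨T - 1, by linarith, by simp [h]⟩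
    · exact ⟨sSup (tsupport θ), hs (hθ.2.isCompact.sSup_mem h), fun x hx => le_csSup hθ.2.isCompact.bddAbove hx⟩
  set P : ℝ → ℝ := fun t => ∫ s in T'..t, θ s with hP
  have hPd : ∀ t, HasDerivAt P (θ t) t := fun t => intervalIntegral.integral_hasDerivAt_right (hθ.1.continuous.intervalIntegrable _ _)
      (hθ.1.continuous.stronglyMeasurableAtFilter _ _) hθ.1.continuous.continuousAt
  have hPs : ContDiff ℝ (⊤ : ℕ∞) P := by
    rw [contDiff_infty_iff_deriv]
    refine ⟨fun t => (hPd t).differentiableAt, ?_⟩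
    rw [show deriv P = θ from funext fun t => (hPd t).deriv]
    exact hθ.1
  have hP0 : ∀ t, T' ≤ t → P t = 0 := by
    intro t ht
    refine intervalIntegral.integral_zero_ae (ae_of_all _ fun s hs => ?_)
    rw [uIoc_of_le ht] at hs
    by_contra h
    exact absurd (hT' (subset_tsupport _ h)) (not_le.2 hs.1)
  refine ⟨fun t => Real.smoothTransition (t + 2) * P t, ⟨?_, ?_⟩, ?_, ?_⟩
  · exact (Real.smoothTransition.contDiff.comp (contDiff_id.add contDiff_const)).mul hPs
  · refine HasCompactSupport.of_support_subset_isCompact (isCompact_Icc (a := -2) (b := T')) ?_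
    intro t ht
    rw [Function.mem_support] at ht
    constructor
    · by_contra h
      exact ht (by rw [Real.smoothTransition.zero_of_nonpos (by linarith), zero_mul])
    · by_contra h
      exact ht (by rw [hP0 t (by linarith), mul_zero])
  · refine (closure_minimal (t := Iic T') ?_ isClosed_Iic).trans (Iic_subset_Iio.2 hT'T)
    intro t ht
    by_contra h
    exact ht (by simp only; rw [hP0 t (not_le.1 h).le, mul_zero])
  · intro t ht
    refine (hPd t).congr_of_eventuallyEq ?_
    filter_upwards [Ioi_mem_nhds (show (-1 : ℝ) < t by linarith)] with s hs
    rw [Real.smoothTransition.one_of_one_le (by rw [mem_Ioi] at hs; linarith), one_mul]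

/-- A continuous function on `[0,T]` which annihilates all test functions on `(-∞,T)` vanishes. -/
theorem eqOn_zero_of_integral_test (hT : 0 < T) {N : ℝ → ℝ} (hN : ContinuousOn N (Icc 0 T))
    (h : ∀ χ : ℝ → ℝ, IsTest χ → tsupport χ ⊆ Iio T → ∫ t in Icc 0 T, χ t * N t = 0) : ∀ t ∈ Icc 0 T, N t = 0 := by
  have h1 : ∀ᵐ t, t ∈ Ioo 0 T → N t = 0 := by
    refine isOpen_Ioo.ae_eq_zero_of_integral_contDiff_smul_eq_zero ((hN.mono Ioo_subset_Icc_self).locallyIntegrableOn measurableSet_Ioo) ?_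
    intro g hg hgc hgs
    rw [← h g ⟨hg, hgc⟩ (hgs.trans Ioo_subset_Iio_self), setIntegral_eq_integral_of_forall_compl_eq_zero]
    · rfl
    · intro t ht
      rw [image_eq_zero_of_notMem_tsupport (fun h' => ht (Ioo_subset_Icc_self (hgs h'))), zero_mul]
  have h2 : EqOn N 0 (Ioo 0 T) := by
    refine Measure.eqOn_open_of_ae_eq (μ := volume) ?_ isOpen_Ioo (hN.mono Ioo_subset_Icc_self) continuousOn_const
    exact (ae_restrict_iff' measurableSet_Ioo).2 h1
  have h3 : EqOn N 0 (closure (Ioo 0 T)) := by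
    refine h2.of_subset_closure ?_ continuousOn_const subset_closure subset_rfl
    rwa [closure_Ioo hT.ne]
  rw [closure_Ioo hT.ne] at h3
  exact h3

theorem integral_test_mul_deriv (hT : 0 < T) {M : ℝ → ℝ} (hk : ContinuousOn k (Icc 0 T)) (hM : ∀ t ∈ Icc 0 T, M t = m₀ + ∫ s in 0..t, k s)
    {χ : ℝ → ℝ} (hχ : IsTest χ) (hs : tsupport χ ⊆ Iio T) : (∫ t in Icc 0 T, deriv χ t * M t) = -(∫ t in Icc 0 T, χ t * k t) - χ 0 * m₀ := by
  have hM0 : M 0 = m₀ := by rw [hM 0 ⟨le_rfl, hT.le⟩]; simp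
  have hMc : ContinuousOn M (Icc 0 T) := by
    have : ContinuousOn (fun t => m₀ + ∫ s in 0..t, k s) (Icc 0 T) := by
      have := intervalIntegral.continuousOn_primitive_interval (a := 0) (b := T) (f := k) (μ := volume)
        (by rw [uIcc_of_le hT.le]; exact hk.integrableOn_Icc)
      rw [uIcc_of_le hT.le] at this
      exact continuousOn_const.add this
    exact this.congr hM
  have hd : ∀ t ∈ Ioo 0 T, HasDerivAt M (k t) t := by
    intro t ht
    have h1 : HasDerivAt (fun t => m₀ + ∫ s in 0..t, k s) (k t) t := by
      refine HasDerivAt.const_add _ ?_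
      refine intervalIntegral.integral_hasDerivAt_right ?_ ?_ (hk.continuousAt (Icc_mem_nhds ht.1 ht.2))
      · exact (hk.mono (by rw [uIcc_of_le ht.1.le]; exact Icc_subset_Icc_right ht.2.le)).intervalIntegrable
      · exact ⟨Ioo 0 T, Ioo_mem_nhds ht.1 ht.2, (hk.mono Ioo_subset_Icc_self).aestronglyMeasurable measurableSet_Ioo⟩
    refine h1.congr_of_eventuallyEq ?_
    filter_upwards [Ioo_mem_nhds ht.1 ht.2] with s hs using hM s (Ioo_subset_Icc_self hs)
  have hχT : χ T = 0 := image_eq_zero_of_notMem_tsupport fun h => lt_irrefl T (hs h)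
  have hχd : Continuous (deriv χ) := hχ.1.continuous_deriv (by simp)
  have hi1 : IntervalIntegrable (fun t => deriv χ t * M t) volume 0 T := (hχd.continuousOn.mul (by rwa [uIcc_of_le hT.le])).intervalIntegrable
  have hi2 : IntervalIntegrable (fun t => χ t * k t) volume 0 T := (hχ.1.continuous.continuousOn.mul (by rwa [uIcc_of_le hT.le])).intervalIntegrable
  have key : ∫ t in 0..T, (deriv χ t * M t + χ t * k t) = χ T * M T - χ 0 * M 0 := by
    refine intervalIntegral.integral_eq_sub_of_hasDerivAt_of_le hT.le
      (f := fun t => χ t * M t) (hχ.1.continuous.continuousOn.mul hMc) (fun t ht => ?_) (hi1.add hi2)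
    exact ((hχ.1.differentiable (by simp)) t).hasDerivAt.mul (hd t ht)
  rw [intervalIntegral.integral_add hi1 hi2, hχT, hM0] at key
  rw [integral_Icc_eq_integral_Ioc, integral_Icc_eq_integral_Ioc, ← intervalIntegral.integral_of_le hT.le, ← intervalIntegral.integral_of_le hT.le]
  linarith

/-- `m' = k`, `m(0) = m₀` in the sense of distributions on `[0,T)`. -/
theorem eq_add_integral_of_test (hT : 0 < T) (hm : ContinuousOn m (Icc 0 T)) (hk : ContinuousOn k (Icc 0 T))
    (h : ∀ χ : ℝ → ℝ, IsTest χ → tsupport χ ⊆ Iio T → (∫ t in Icc 0 T, (deriv χ t * m t + χ t * k t)) + χ 0 * m₀ = 0) :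
    ∀ t ∈ Icc 0 T, m t = m₀ + ∫ s in 0..t, k s := by
  set M : ℝ → ℝ := fun t => m₀ + ∫ s in 0..t, k s with hM
  have hMc : ContinuousOn M (Icc 0 T) := by
    have := intervalIntegral.continuousOn_primitive_interval (a := 0) (b := T) (f := k) (μ := volume)
      (by rw [uIcc_of_le hT.le]; exact hk.integrableOn_Icc)
    rw [uIcc_of_le hT.le] at this
    exact continuousOn_const.add this
  have key := eqOn_zero_of_integral_test hT (hm.sub hMc) ?_
  · intro t ht
    exact sub_eq_zero.1 (key t ht)
  · intro θ hθ hs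
    obtain ⟨χ, hχ, hχs, hχd⟩ := exists_isTest_deriv_eq hθ hs
    have h1 := h χ hχ hχs
    have h2 := integral_test_mul_deriv hT hk (fun t _ => rfl) hχ hχs (M := M) (m₀ := m₀)
    have hχd' : Continuous (deriv χ) := hχ.1.continuous_deriv (by simp)
    have i1 : IntegrableOn (fun t => deriv χ t * m t) (Icc 0 T) := (hχd'.continuousOn.mul hm).integrableOn_Icc
    have i2 : IntegrableOn (fun t => χ t * k t) (Icc 0 T) := (hχ.1.continuous.continuousOn.mul hk).integrableOn_Icc
    have i3 : IntegrableOn (fun t => deriv χ t * M t) (Icc 0 T) := (hχd'.continuousOn.mul hMc).integrableOn_Icc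
    rw [integral_add i1 i2] at h1
    have h3 : ∫ t in Icc 0 T, θ t * (m - M) t = ∫ t in Icc 0 T, (deriv χ t * m t - deriv χ t * M t) := by
      refine setIntegral_congr_fun measurableSet_Icc fun t ht => ?_
      simp only [Pi.sub_apply]
      rw [(hχd t ht.1).deriv, mul_sub]
    rw [h3, integral_sub i1 i3]
    linarith

/-- `m'' = k`, `m(0) = m₀`, `m'(0) = m₁` in the sense of distributions on `[0,T)`. -/
theorem eq_add_integral_integral_of_test (hT : 0 < T) {m₁ : ℝ} (hm : ContinuousOn m (Icc 0 T)) (hk : ContinuousOn k (Icc 0 T))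
    (h : ∀ χ : ℝ → ℝ, IsTest χ → tsupport χ ⊆ Iio T → (∫ t in Icc 0 T, (deriv (deriv χ) t * m t - χ t * k t)) = χ 0 * m₁ - deriv χ 0 * m₀) :
    ∀ t ∈ Icc 0 T, m t = m₀ + ∫ s in 0..t, (m₁ + ∫ r in 0..s, k r) := by
  set K : ℝ → ℝ := fun t => m₁ + ∫ s in 0..t, k s with hK
  have hKc : ContinuousOn K (Icc 0 T) := by
    have := intervalIntegral.continuousOn_primitive_interval (a := 0) (b := T) (f := k) (μ := volume)
      (by rw [uIcc_of_le hT.le]; exact hk.integrableOn_Icc)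
    rw [uIcc_of_le hT.le] at this
    exact continuousOn_const.add this
  refine eq_add_integral_of_test hT hm hKc fun θ hθ hs => ?_
  obtain ⟨χ, hχ, hχs, hχd⟩ := exists_isTest_deriv_eq hθ hs
  have h1 := h χ hχ hχs
  have h2 := integral_test_mul_deriv hT hk (fun t _ => rfl) hχ hχs (M := K) (m₀ := m₁)
  have e1 : ∀ t ∈ Ici (0:ℝ), deriv χ t = θ t := fun t ht => (hχd t ht).deriv
  have e2 : ∀ t ∈ Ioi (0:ℝ), deriv (deriv χ) t = deriv θ t := fun t ht => Filter.EventuallyEq.deriv_eq (by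
      filter_upwards [Ioi_mem_nhds ht] with s hs using e1 s (mem_Ici.2 (le_of_lt hs)))
  have hχd' : Continuous (deriv χ) := hχ.1.continuous_deriv (by simp)
  have hθd' : Continuous (deriv θ) := hθ.1.continuous_deriv (by simp)
  have i1 : IntegrableOn (fun t => deriv θ t * m t) (Icc 0 T) := (hθd'.continuousOn.mul hm).integrableOn_Icc
  have i2 : IntegrableOn (fun t => χ t * k t) (Icc 0 T) := (hχ.1.continuous.continuousOn.mul hk).integrableOn_Icc
  have i3 : IntegrableOn (fun t => θ t * K t) (Icc 0 T) := (hθ.1.continuous.continuousOn.mul hKc).integrableOn_Icc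
  have h3 : (∫ t in Icc 0 T, (deriv (deriv χ) t * m t - χ t * k t)) = ∫ t in Icc 0 T, (deriv θ t * m t - χ t * k t) := by
    rw [integral_Icc_eq_integral_Ioc, integral_Icc_eq_integral_Ioc]
    refine setIntegral_congr_fun measurableSet_Ioc fun t ht => ?_
    rw [e2 t ht.1]
  have h4 : ∫ t in Icc 0 T, deriv χ t * K t = ∫ t in Icc 0 T, θ t * K t := setIntegral_congr_fun measurableSet_Icc fun t ht => by rw [e1 t ht.1]
  rw [h3, integral_sub i1 i2, e1 0 self_mem_Ici] at h1
  rw [h4] at h2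
  rw [integral_add i1 i3]
  linarith

theorem norm_le_integral_mul_exp_of_monotone {E : Type*} [NormedAddCommGroup E] [NormedSpace ℝ E] {f f' : ℝ → E} {k α : ℝ → ℝ} {b : ℝ}
    (hf : ContinuousOn f (Icc 0 b)) (hf' : ∀ x ∈ Ico 0 b, HasDerivWithinAt f (f' x) (Ici x) x) (h0 : f 0 = 0) (hk : Monotone k) (hk0 : ∀ x, 0 ≤ k x)
    (hα : Continuous α) (hα0 : ∀ x, 0 ≤ α x) (bound : ∀ x ∈ Ico 0 b, ‖f' x‖ ≤ k x * ‖f x‖ + α x) :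
    ∀ t ∈ Icc 0 b, ‖f t‖ ≤ (∫ s in 0..t, α s) * Real.exp (∫ s in 0..t, k s) := by
  have hki : ∀ a b, IntervalIntegrable k volume a b := fun a b => hk.intervalIntegrable
  have hKd : ∀ x, HasDerivWithinAt (fun t => ∫ s in 0..t, k s) (Function.rightLim k x) (Ici x) x := by
    intro x
    refine intervalIntegral.integral_hasDerivWithinAt_of_tendsto_ae_right (hki _ _) (t := Ioi x)
      hk.measurable.stronglyMeasurable.stronglyMeasurableAtFilter ?_
    exact (hk.tendsto_rightLim x).mono_left inf_le_left
  have hKc : Continuous (fun t => ∫ s in 0..t, k s) := intervalIntegral.continuous_primitive hki 0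
  have main : ∀ ε > 0, ∀ t ∈ Icc 0 b, ‖f t‖ ≤ (ε + ∫ s in 0..t, (α s + ε)) * Real.exp (∫ s in 0..t, k s) := by
    intro ε hε
    have hAd : ∀ x, HasDerivAt (fun t => ε + ∫ s in 0..t, (α s + ε)) (α x + ε) x := fun x =>
      (intervalIntegral.integral_hasDerivAt_right ((hα.add continuous_const).intervalIntegrable _ _)
        ((hα.add continuous_const).stronglyMeasurableAtFilter _ _)
        (hα.add continuous_const).continuousAt).const_add ε
    intro t ht
    refine image_norm_le_of_norm_deriv_right_lt_deriv_boundary' hf hf'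
      (B := fun t => (ε + ∫ s in 0..t, (α s + ε)) * Real.exp (∫ s in 0..t, k s))
      (by simp [h0, hε.le])
      (Continuous.continuousOn ((continuous_iff_continuousAt.2 fun x => (hAd x).continuousAt).mul hKc.rexp))
      (fun x _ => (hAd x).hasDerivWithinAt.mul (hKd x).exp) ?_ ht
    intro x hx hB
    have h1 := bound x hx
    have h2 : k x ≤ Function.rightLim k x := hk.le_rightLim le_rfl
    have h3 : 1 ≤ Real.exp (∫ s in 0..x, k s) := Real.one_le_exp (intervalIntegral.integral_nonneg hx.1 fun s _ => hk0 s)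
    have h4 : k x * ‖f x‖ ≤ Function.rightLim k x * ‖f x‖ := by gcongr
    have h5 : α x + ε ≤ (α x + ε) * Real.exp (∫ s in 0..x, k s) := le_mul_of_one_le_right (by linarith [hα0 x]) h3
    have h6 : Function.rightLim k x * ‖f x‖ = (ε + ∫ s in 0..x, (α s + ε)) *
        (Real.exp (∫ s in 0..x, k s) * Function.rightLim k x) := by rw [hB]; ring
    rw [← h6]
    linarith
  intro t ht
  have hlim : Tendsto (fun ε : ℝ => (ε + ∫ s in 0..t, (α s + ε)) * Real.exp (∫ s in 0..t, k s))
      (𝓝[>] 0) (𝓝 ((0 + ((∫ s in 0..t, α s) + t * 0)) * Real.exp (∫ s in 0..t, k s))) := by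
    refine Tendsto.mono_left ?_ nhdsWithin_le_nhds
    have : ∀ ε : ℝ, ∫ s in 0..t, (α s + ε) = (∫ s in 0..t, α s) + t * ε := by
      intro ε
      rw [intervalIntegral.integral_add (hα.intervalIntegrable _ _) (by simp)]
      simp
    simp only [this]
    have hc : Continuous fun ε : ℝ => (ε + ((∫ s in 0..t, α s) + t * ε)) * Real.exp (∫ s in 0..t, k s) := by fun_prop
    exact hc.tendsto 0
  have := ge_of_tendsto hlim (by filter_upwards [self_mem_nhdsWithin] with ε hε using main ε hε t ht)
  simpa using this

section Mollify

variable {X : Type*} [NormedAddCommGroup X] [NormedSpace ℝ X] [FiniteDimensional ℝ X]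
  [MeasureSpace X] [BorelSpace X] [(volume : Measure X).IsAddHaarMeasure]

open scoped Convolution

variable {u w φ : X → ℝ}

theorem IsTest.differentiable_convolution (hφ : IsTest φ) (hu : LocallyIntegrable u) :
    Differentiable ℝ (φ ⋆[ContinuousLinearMap.lsmul ℝ ℝ, volume] u) := fun x =>
  (hφ.2.hasFDerivAt_convolution_left _ (hφ.1.of_le (by norm_cast)) hu x).differentiableAt

theorem IsWeakDerivAlong.fderiv_convolution {e : X} (h : IsWeakDerivAlong u e w) (hφ : IsTest φ) (x : X) :
    fderiv ℝ (φ ⋆[ContinuousLinearMap.lsmul ℝ ℝ, volume] u) x e = (φ ⋆[ContinuousLinearMap.lsmul ℝ ℝ, volume] w) x := by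
  have h1 := hφ.2.hasFDerivAt_convolution_left (ContinuousLinearMap.lsmul ℝ ℝ) (μ := volume) (hφ.1.of_le (by norm_cast)) h.locInt x
  rw [h1.fderiv]
  have hψ : IsTest (fun y => φ (x - y)) := ⟨hφ.1.comp (contDiff_const.sub contDiff_id), hφ.2.comp_homeomorph (Homeomorph.subLeft x)⟩
  have hd : ∀ y, fderiv ℝ (fun y => φ (x - y)) y e = -fderiv ℝ φ (x - y) e := by
    intro y
    have := ((hφ.1.differentiable (by simp)) (x - y)).hasFDerivAt.comp y ((hasFDerivAt_const x y).sub (hasFDerivAt_id y))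
    rw [show (fun y => φ (x - y)) = φ ∘ fun y => x - y from rfl, this.fderiv]
    simp
  have h2 := h.integral_eq _ hψ
  have hc : ConvolutionExists (fderiv ℝ φ) u ((ContinuousLinearMap.lsmul ℝ ℝ).precompL X) volume := (hφ.2.fderiv ℝ).convolutionExists_left _
      (hφ.1.continuous_fderiv (by simp)) h.locInt
  rw [convolution, ContinuousLinearMap.integral_apply (hc x), convolution]
  simp only [ContinuousLinearMap.precompL_apply, ContinuousLinearMap.lsmul_apply, smul_eq_mul]
  rw [← integral_sub_left_eq_self (fun t => φ t * w (x - t)) volume x, ← integral_sub_left_eq_self (fun t => fderiv ℝ φ t e * u (x - t)) volume x]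
  simp only [sub_sub_cancel, hd, mul_neg, integral_neg] at h2 ⊢
  rw [neg_inj] at h2
  simpa only [mul_comm] using h2

theorem abs_convolution_le {B ε : ℝ} (hφ : Continuous φ) (hc : HasCompactSupport φ) (h0 : ∀ x, 0 ≤ φ x) (h1 : ∫ x, φ x = 1)
    (hs : Function.support φ ⊆ ball 0 ε) (x : X) (hw : ∀ᵐ y, y ∈ ball x ε → |w y| ≤ B) :
    |(φ ⋆[ContinuousLinearMap.lsmul ℝ ℝ, volume] w) x| ≤ B := by
  rw [convolution]
  simp only [ContinuousLinearMap.lsmul_apply, smul_eq_mul]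
  have hi : Integrable φ := hφ.integrable_of_hasCompactSupport hc
  have hw' : ∀ᵐ t, x - t ∈ ball x ε → |w (x - t)| ≤ B := (quasiMeasurePreserving_sub_left (volume : Measure X) x).ae hw
  have : ‖∫ t, φ t * w (x - t)‖ ≤ ∫ t, φ t * B := by
    refine norm_integral_le_of_norm_le (hi.mul_const B) ?_
    filter_upwards [hw'] with t ht
    by_cases hφt : φ t = 0
    · simp [hφt]
    · rw [norm_mul, Real.norm_of_nonneg (h0 t), Real.norm_eq_abs]
      refine mul_le_mul_of_nonneg_left (ht ?_) (h0 t)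
      have := hs hφt
      rw [mem_ball_zero_iff] at this
      rw [mem_ball_iff_norm]
      simpa using this
  rwa [integral_mul_const, h1, one_mul, Real.norm_eq_abs] at this

end Mollify

section WeakHessian

variable {d : ℕ}

open scoped Convolution

variable {B : ℝ}

/-- A uniform quadratic Taylor bound passes to the pointwise limit. -/
theorem fderiv_lipschitz_of_tendsto {X : Type*} [NormedAddCommGroup X] [NormedSpace ℝ X] [FiniteDimensional ℝ X] {u : ℕ → X → ℝ} {V : X → ℝ}
    {s : Set X} (hs : IsOpen s) (hsc : Convex ℝ s) (hB : 0 ≤ B) (hu : ∀ n, ∀ x ∈ s, DifferentiableAt ℝ (u n) x)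
    (hL : ∀ n, ∀ x ∈ s, ∀ y ∈ s, ‖fderiv ℝ (u n) x - fderiv ℝ (u n) y‖ ≤ B * ‖x - y‖) (hV : ∀ x ∈ s, Tendsto (fun n => u n x) atTop (𝓝 (V x)))
    {x y : X} (hx : x ∈ s) (hy : y ∈ s) : DifferentiableAt ℝ V x ∧ ‖fderiv ℝ V x - fderiv ℝ V y‖ ≤ B * ‖x - y‖ := by
  have taylor : ∀ n, ∀ x ∈ s, ∀ y ∈ s, ‖u n y - u n x - fderiv ℝ (u n) x (y - x)‖ ≤ B * ‖y - x‖ * ‖y - x‖ := by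
    intro n x hx y hy
    refine (convex_segment x y).norm_image_sub_le_of_norm_fderiv_le' (fun z hz => hu n z (hsc.segment_subset hx hy hz)) (fun z hz => ?_)
      (left_mem_segment ℝ x y) (right_mem_segment ℝ x y)
    refine (hL n z (hsc.segment_subset hx hy hz) x hx).trans ?_
    gcongr
    exact norm_sub_le_of_mem_segment hz
  have bdd : ∀ x ∈ s, ∃ C, ∀ n, ‖fderiv ℝ (u n) x‖ ≤ C := by
    intro x hx
    refine banach_steinhaus fun h => ?_
    obtain ⟨δ, hδ, hδs⟩ : ∃ δ : ℝ, 0 < δ ∧ x + δ • h ∈ s := by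
      have : Tendsto (fun δ : ℝ => x + δ • h) (𝓝[>] 0) (𝓝 (x + (0:ℝ) • h)) := by
        refine Tendsto.mono_left (Continuous.tendsto (by fun_prop) _) nhdsWithin_le_nhds
      have h1 : ∀ᶠ δ : ℝ in 𝓝[>] 0, x + δ • h ∈ s := this (hs.mem_nhds (by simpa using hx))
      obtain ⟨δ, h2, h3⟩ := (h1.and self_mem_nhdsWithin).exists
      exact ⟨δ, h3, h2⟩
    obtain ⟨C1, hC1⟩ := (hV x hx).norm.isBoundedUnder_le.bddAbove_range
    obtain ⟨C2, hC2⟩ := (hV _ hδs).norm.isBoundedUnder_le.bddAbove_range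
    refine ⟨δ⁻¹ * (B * ‖δ • h‖ * ‖δ • h‖ + C2 + C1), fun n => ?_⟩
    have h1 := taylor n x hx _ hδs
    rw [add_sub_cancel_left] at h1
    have h2 : ‖u n x‖ ≤ C1 := hC1 ⟨n, rfl⟩
    have h3 : ‖u n (x + δ • h)‖ ≤ C2 := hC2 ⟨n, rfl⟩
    have h4 : fderiv ℝ (u n) x h = δ⁻¹ * fderiv ℝ (u n) x (δ • h) := by rw [map_smul, smul_eq_mul, ← mul_assoc, inv_mul_cancel₀ hδ.ne', one_mul]
    rw [h4, norm_mul, Real.norm_of_nonneg (by positivity)]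
    gcongr
    have h5 : fderiv ℝ (u n) x (δ • h) = u n (x + δ • h) - u n x - (u n (x + δ • h) - u n x - fderiv ℝ (u n) x (δ • h)) := by ring
    rw [h5]
    refine (norm_sub_le _ _).trans ?_
    have := norm_sub_le (u n (x + δ • h)) (u n x)
    linarith
  obtain ⟨C1, hC1⟩ := bdd x hx
  obtain ⟨C2, hC2⟩ := bdd y hy
  obtain ⟨p, -, ψ, hψ, hp⟩ := tendsto_subseq_of_bounded
    (s := closedBall 0 C1 ×ˢ closedBall 0 C2)
    (Metric.isBounded_closedBall.prod Metric.isBounded_closedBall)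
    (x := fun n => (fderiv ℝ (u n) x, fderiv ℝ (u n) y)) (fun n => ⟨by simpa using hC1 n, by simpa using hC2 n⟩)
  have lim : ∀ x ∈ s, ∀ a, Tendsto (fun n => fderiv ℝ (u (ψ n)) x) atTop (𝓝 a) → HasFDerivAt V a x := by
    intro x hx a ha
    have hT : ∀ y ∈ s, ‖V y - V x - a (y - x)‖ ≤ B * ‖y - x‖ * ‖y - x‖ := by
      intro y hy
      refine le_of_tendsto (x := atTop) (Tendsto.norm ?_) (.of_forall fun n => taylor (ψ n) x hx y hy)
      refine (((hV y hy).comp hψ.tendsto_atTop).sub ((hV x hx).comp hψ.tendsto_atTop)).sub ?_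
      exact ((ContinuousLinearMap.apply ℝ ℝ (y - x)).continuous.tendsto a).comp ha
    refine HasFDerivAt.of_isLittleO ?_
    have h1 : (fun y => V y - V x - a (y - x)) =O[𝓝 x] fun y => ‖y - x‖ ^ 2 := by
      refine Asymptotics.IsBigO.of_bound B ?_
      filter_upwards [hs.mem_nhds hx] with y hy
      rw [norm_pow, norm_norm, pow_two, ← mul_assoc]
      exact hT y hy
    refine h1.trans_isLittleO ?_
    have h2 : (fun y : X => ‖y - x‖ ^ 2) =o[𝓝 x] fun y => ‖y - x‖ ^ 1 := by
      refine (Asymptotics.isLittleO_pow_pow one_lt_two).comp_tendsto ?_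
      have : Continuous fun y : X => ‖y - x‖ := by fun_prop
      simpa using this.tendsto x
    simpa using h2.norm_right.trans_isBigO (by
      simpa using! (Asymptotics.isBigO_refl (fun y : X => y - x) (𝓝 x)).norm_left)
  have e1 := lim x hx p.1 ((continuous_fst.tendsto p).comp hp)
  have e2 := lim y hy p.2 ((continuous_snd.tendsto p).comp hp)
  refine ⟨e1.differentiableAt, ?_⟩
  rw [e1.fderiv, e2.fderiv]
  refine le_of_tendsto (((continuous_fst.sub continuous_snd).norm.tendsto p).comp hp) (.of_forall fun n => ?_)
  exact hL (ψ n) x hx y hy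

theorem fderiv_lipschitz_of_weakHessian {V : Rd d → ℝ} (hV : Continuous V) {G : Rd d → Rd d} {H : Rd d → Rd d →L[ℝ] Rd d →L[ℝ] ℝ}
    (hG : HasWeakGradient V G) (hH : HasWeakJacobian G H) {r : ℝ} (hB : 0 ≤ B) (hb : ∀ᵐ z, z ∈ ball (0 : Rd d) r → ‖H z‖ ≤ B) {x y : Rd d}
    (hx : ‖x‖ < r) (hy : ‖y‖ < r) : DifferentiableAt ℝ V x ∧ ‖fderiv ℝ V x - fderiv ℝ V y‖ ≤ B * ‖x - y‖ := by
  obtain ⟨r', hr', hr'r⟩ := exists_between (max_lt hx hy)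
  have hδ : 0 < r - r' := by linarith
  set bump : ℕ → ContDiffBump (0 : Rd d) := fun n => ⟨(r - r') / (2 * (n + 1)), (r - r') / (n + 1), by positivity, by
      gcongr; have : (0:ℝ) ≤ n := n.cast_nonneg; linarith⟩ with hbump
  set φ : ℕ → Rd d → ℝ := fun n => (bump n).normed volume
  have hφ : ∀ n, IsTest (φ n) := fun n => ⟨(bump n).contDiff_normed, (bump n).hasCompactSupport_normed⟩
  set u : ℕ → Rd d → ℝ := fun n => (φ n) ⋆[ContinuousLinearMap.lsmul ℝ ℝ, volume] V
  have hfd : ∀ n x e, fderiv ℝ (u n) x e = (φ n ⋆[ContinuousLinearMap.lsmul ℝ ℝ, volume] (fun z => inner ℝ (G z) e)) x :=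
    fun n x e => (hG e).fderiv_convolution (hφ n) x
  refine fderiv_lipschitz_of_tendsto (u := u) (s := ball 0 r') Metric.isOpen_ball
    (convex_ball _ _) hB (fun n x _ => (hφ n).differentiable_convolution hV.locallyIntegrable x) ?_ ?_
    (by simpa using (le_max_left _ _).trans_lt hr') (by simpa using (le_max_right _ _).trans_lt hr')
  · intro n x hx y hy
    refine ContinuousLinearMap.opNorm_le_bound _ (by positivity) fun e => ?_
    rw [sub_apply, hfd, hfd]
    have := (convex_ball (0 : Rd d) r').norm_image_sub_le_of_norm_fderiv_le (𝕜 := ℝ)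
      (f := φ n ⋆[ContinuousLinearMap.lsmul ℝ ℝ, volume] (fun z => inner ℝ (G z) e)) (C := B * ‖e‖)
      (fun z _ => (hφ n).differentiable_convolution (hG e).locInt_deriv z) (fun z hz => ?_) hy hx
    · linarith
    · refine ContinuousLinearMap.opNorm_le_bound _ (by positivity) fun e' => ?_
      rw [(hH e' e).fderiv_convolution (hφ n), Real.norm_eq_abs]
      refine abs_convolution_le (ε := r - r') (hφ n).1.continuous (hφ n).2 (fun x => (bump n).nonneg_normed x) (bump n).integral_normed ?_ z ?_
      · rw [(bump n).support_normed_eq]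
        refine ball_subset_ball ?_
        simp only [hbump]
        exact div_le_self hδ.le (by linarith [(n.cast_nonneg : (0:ℝ) ≤ n)])
      · filter_upwards [hb] with w hw hwz
        have hw' : ‖H w‖ ≤ B := by
          apply hw
          rw [mem_ball_zero_iff] at hz ⊢
          rw [mem_ball_iff_norm] at hwz
          calc ‖w‖ = ‖(w - z) + z‖ := by rw [sub_add_cancel]
            _ ≤ ‖w - z‖ + ‖z‖ := norm_add_le _ _
            _ < r := by linarith
        calc |H w e' e| ≤ ‖H w e'‖ * ‖e‖ := (H w e').le_opNorm e
          _ ≤ (‖H w‖ * ‖e'‖) * ‖e‖ := by gcongr; exact (H w).le_opNorm e'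
          _ ≤ (B * ‖e'‖) * ‖e‖ := by gcongr
          _ = B * ‖e‖ * ‖e'‖ := by ring
  · intro x _
    refine ContDiffBump.convolution_tendsto_right_of_continuous (φ := bump) ?_ hV x
    simp only [hbump]
    exact tendsto_const_nhds.div_atTop (tendsto_atTop_add_const_right _ _ tendsto_natCast_atTop_atTop)

end WeakHessian

section External

variable {d : ℕ} {V : Rd d → ℝ}

variable {r : ℝ≥0∞} {x y : Rd d}

theorem edist_gradient_le_of_fderiv {V : Rd d → ℝ} (x y : Rd d) : ‖gradient V x - gradient V y‖ = ‖fderiv ℝ V x - fderiv ℝ V y‖ := by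
  rw [gradient, gradient, ← map_sub, LinearIsometryEquiv.norm_map]

section
variable (hV : MemW2infLoc V)
include hV

theorem MemW2infLoc.exists_lipschitz (r : ℝ) : ∃ B : ℝ, 0 ≤ B ∧ ∀ x y : Rd d, ‖x‖ < r → ‖y‖ < r →
      DifferentiableAt ℝ V x ∧ ‖gradient V x - gradient V y‖ ≤ B * ‖x - y‖ := by
  obtain ⟨hc, G, H, hG, hH, hb⟩ := hV
  refine ⟨(eLpNorm H ∞ (volume.restrict (ball 0 r))).toReal, by positivity, fun x y hx hy => ?_⟩
  rw [edist_gradient_le_of_fderiv]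
  refine fderiv_lipschitz_of_weakHessian hc hG hH (by positivity) ?_ hx hy
  rw [← ae_restrict_iff' Metric.isOpen_ball.measurableSet]
  filter_upwards [ae_le_eLpNormEssSup (f := H) (μ := volume.restrict (ball 0 r))] with z hz
  rw [← eLpNorm_exponent_top] at hz
  have := ENNReal.toReal_mono (hb r).2.ne hz
  simpa using this

theorem MemW2infLoc.differentiable : Differentiable ℝ V := fun x =>
  let ⟨_, _, h⟩ := hV.exists_lipschitz (‖x‖ + 1)
  (h x x (by linarith) (by linarith)).1

theorem MemW2infLoc.continuous_gradient : Continuous (gradient V) := by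
  rw [continuous_iff_continuousAt]
  intro x
  obtain ⟨B, hB, h⟩ := hV.exists_lipschitz (‖x‖ + 1)
  rw [ContinuousAt, tendsto_iff_norm_sub_tendsto_zero]
  have h1 : Tendsto (fun y => B * ‖y - x‖) (𝓝 x) (𝓝 0) := by
    have : Continuous fun y => B * ‖y - x‖ := by fun_prop
    simpa using this.tendsto x
  refine squeeze_zero' (.of_forall fun _ => norm_nonneg _) ?_ h1
  have : ∀ᶠ y in 𝓝 x, ‖y‖ < ‖x‖ + 1 := continuous_norm.continuousAt.eventually_lt_const (by linarith)
  filter_upwards [this] with y hy using (h y x hy (by linarith)).2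

/-- The gradient of `V` is Lipschitz on `B(0, r)` with the constant `‖∇²V‖_{L^∞(B(0,r))}`. -/
theorem MemW2infLoc.enorm_gradient_sub_le (hx : ‖x‖ₑ < r) (hy : ‖y‖ₑ < r) : ‖gradient V x - gradient V y‖ₑ ≤ hessianBound V r * ‖x - y‖ₑ := by
  rcases eq_or_ne x y with rfl | hxy
  · simp
  have h0 : ‖x - y‖ₑ ≠ 0 := by simpa [sub_eq_zero] using hxy
  rw [← ENNReal.div_le_iff h0 enorm_ne_top]
  refine le_iInf fun G => le_iInf fun H => le_iInf fun hG => le_iInf fun hH => ?_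
  rw [ENNReal.div_le_iff h0 enorm_ne_top]
  set b := eLpNorm H ∞ (volume.restrict {x | ‖x‖ₑ < r}) with hb
  rcases eq_or_ne b ∞ with hbt | hbt
  · rw [hbt, ENNReal.top_mul h0]; exact le_top
  obtain ⟨r', hr', hr'r⟩ := ENNReal.lt_iff_exists_nnreal_btwn.1 (max_lt hx hy)
  have key := (fderiv_lipschitz_of_weakHessian hV.1 hG hH (r := r') (B := b.toReal) (by positivity) ?_
    (x := x) (y := y) ?_ ?_).2
  · rw [← edist_gradient_le_of_fderiv] at key
    rw [← ENNReal.ofReal_toReal hbt, ← ofReal_norm, ← ofReal_norm, ← ENNReal.ofReal_mul (by positivity)]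
    exact ENNReal.ofReal_le_ofReal key
  · have hm : MeasurableSet {x : Rd d | ‖x‖ₑ < r} := measurableSet_lt measurable_enorm measurable_const
    have h1 := ae_le_eLpNormEssSup (f := H) (μ := volume.restrict {x | ‖x‖ₑ < r})
    rw [ae_restrict_iff' hm] at h1
    filter_upwards [h1] with z hz hzr
    have hz' := hz ?_
    · rw [← eLpNorm_exponent_top, ← hb] at hz'
      simpa using ENNReal.toReal_mono hbt hz'
    · refine lt_trans ?_ hr'r
      rw [mem_ball_zero_iff] at hzr
      rw [← ofReal_norm, ENNReal.ofReal_lt_coe_iff (norm_nonneg _)]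
      exact hzr
  · have := (le_max_left _ _).trans_lt hr'
    rwa [← ofReal_norm, ENNReal.ofReal_lt_coe_iff (norm_nonneg _)] at this
  · have := (le_max_right _ _).trans_lt hr'
    rwa [← ofReal_norm, ENNReal.ofReal_lt_coe_iff (norm_nonneg _)] at this

theorem MemW2infLoc.enorm_gradient_sub_le' (hx : ‖x‖ₑ ≤ r) (hy : ‖y‖ₑ ≤ r) : ‖gradient V x - gradient V y‖ₑ ≤ hessianBound V r * ‖x - y‖ₑ := by
  rcases eq_or_ne r 0 with rfl | hr
  · obtain rfl : x = 0 := by simpa using hx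
    obtain rfl : y = 0 := by simpa using hy
    simp
  rcases eq_or_ne (hessianBound V r) ∞ with ht | ht
  · rcases eq_or_ne x y with rfl | hxy
    · simp
    · rw [ht, ENNReal.top_mul (by simpa [sub_eq_zero] using hxy)]; exact le_top
  have hlt : ∀ z : Rd d, ‖z‖ₑ ≤ r → ∀ θ ∈ Ioo (0:ℝ) 1, ‖θ • z‖ₑ < r := by
    intro z hz θ hθ
    rcases eq_or_ne z 0 with rfl | hz0
    · simpa using hr.bot_lt
    · refine lt_of_lt_of_le ?_ hz
      rw [← ofReal_norm, ← ofReal_norm, norm_smul, Real.norm_of_nonneg hθ.1.le]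
      have : 0 < ‖z‖ := norm_pos_iff.2 hz0
      exact (ENNReal.ofReal_lt_ofReal_iff this).2 (by nlinarith [hθ.2])
  have hcg := hV.continuous_gradient
  have hsc : ∀ z : Rd d, Tendsto (fun θ : ℝ => θ • z) (𝓝[<] 1) (𝓝 z) := fun z => by
    have : Continuous fun θ : ℝ => θ • z := by fun_prop
    simpa using (this.tendsto 1).mono_left nhdsWithin_le_nhds
  refine le_of_tendsto_of_tendsto (((hcg.tendsto x).comp (hsc x)).sub ((hcg.tendsto y).comp (hsc y))).enorm
    (ENNReal.Tendsto.const_mul ((hsc x).sub (hsc y)).enorm (Or.inr ht)) ?_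
  filter_upwards [Ioo_mem_nhdsLT (show (0:ℝ) < 1 by norm_num)] with θ hθ
  exact hV.enorm_gradient_sub_le (hlt x hx θ hθ) (hlt y hy θ hθ)

end

end External

section Curves

variable {E : Type*} [NormedAddCommGroup E] [NormedSpace ℝ E]

variable {a c s t ε : ℝ}

/-- A function with `‖f'‖ ≤ K ‖f‖ + ε` grows at most exponentially, in both directions. -/
theorem norm_le_mul_exp_of_deriv {f f' : ℝ → E} {K : ℝ} (hK : 0 ≤ K) (hε : 0 ≤ ε) (hf : ∀ t ∈ Icc a c, HasDerivAt f (f' t) t)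
    (hb : ∀ t ∈ Icc a c, ‖f' t‖ ≤ K * ‖f t‖ + ε) (hs : s ∈ Icc a c) (ht : t ∈ Icc a c) : ‖f t‖ ≤ (‖f s‖ + ε) * Real.exp ((K + 1) * |t - s|) := by
  have fw : ∀ {f f' : ℝ → E} {a c : ℝ}, (∀ t ∈ Icc a c, HasDerivAt f (f' t) t) → (∀ t ∈ Icc a c, ‖f' t‖ ≤ K * ‖f t‖ + ε) →
      ∀ {s t : ℝ}, s ∈ Icc a c → t ∈ Icc a c → s ≤ t → ‖f t‖ ≤ (‖f s‖ + ε) * Real.exp ((K + 1) * (t - s)) := by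
    intro f f' a c hf hb s t hs ht hst
    have hsub : Icc s t ⊆ Icc a c := Icc_subset_Icc hs.1 ht.2
    have hK1 : K + 1 ≠ 0 := by positivity
    have := norm_le_gronwallBound_of_norm_deriv_right_le (K := K + 1) (ε := ε) (fun r hr => (hf r (hsub hr)).continuousAt.continuousWithinAt)
      (fun r hr => (hf r (hsub (Ico_subset_Icc_self hr))).hasDerivWithinAt) le_rfl
      (fun r hr => (hb r (hsub (Ico_subset_Icc_self hr))).trans (by linarith [norm_nonneg (f r)])) t ⟨hst, le_rfl⟩
    rw [gronwallBound_of_K_ne_0 hK1] at this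
    have h2 : ε / (K + 1) ≤ ε := div_le_self hε (by linarith)
    have h3 : 1 ≤ Real.exp ((K + 1) * (t - s)) := Real.one_le_exp (mul_nonneg (by positivity) (sub_nonneg.2 hst))
    nlinarith
  rcases le_total s t with hst | hst
  · rw [abs_of_nonneg (sub_nonneg.2 hst)]
    exact fw hf hb hs ht hst
  · have hn : ∀ r ∈ Icc (-c) (-a), -r ∈ Icc a c := fun r hr => ⟨by linarith [hr.2], by linarith [hr.1]⟩
    have := fw (f := fun r => f (-r)) (f' := fun r => -(f' (-r))) (a := -c) (c := -a)
      (fun r hr => by simpa using! (hf (-r) (hn r hr)).scomp r (hasDerivAt_neg r))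
      (fun r hr => by simpa using hb _ (hn r hr)) (s := -s) (t := -t)
      ⟨by linarith [hs.2], by linarith [hs.1]⟩ ⟨by linarith [ht.2], by linarith [ht.1]⟩ (by linarith)
    rw [abs_of_nonpos (sub_nonpos.2 hst)]
    simp only [neg_neg] at this
    rwa [show -(t - s) = -t - -s by ring]

theorem norm_sub_le_of_curves {b₁ b₂ : ℝ → E → E} {γ₁ γ₂ : ℝ → E} {S : Set E} {K : NNReal} (hε : 0 ≤ ε)
    (h₁ : ∀ t ∈ Icc a c, HasDerivAt γ₁ (b₁ t (γ₁ t)) t) (h₂ : ∀ t ∈ Icc a c, HasDerivAt γ₂ (b₂ t (γ₂ t)) t) (hS₁ : ∀ t ∈ Icc a c, γ₁ t ∈ S)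
    (hS₂ : ∀ t ∈ Icc a c, γ₂ t ∈ S) (hL : ∀ t ∈ Icc a c, LipschitzOnWith K (b₁ t) S) (hb : ∀ t ∈ Icc a c, ∀ z ∈ S, ‖b₁ t z - b₂ t z‖ ≤ ε)
    (hs : s ∈ Icc a c) (ht : t ∈ Icc a c) : ‖γ₁ t - γ₂ t‖ ≤ (‖γ₁ s - γ₂ s‖ + ε) * Real.exp ((K + 1) * |t - s|) :=
  norm_le_mul_exp_of_deriv (f := fun t => γ₁ t - γ₂ t) K.2 hε (fun r hr => (h₁ r hr).sub (h₂ r hr)) (fun r hr =>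
    (norm_sub_le_norm_sub_add_norm_sub _ (b₁ r (γ₂ r)) _).trans (add_le_add
      (by rw [← dist_eq_norm, ← dist_eq_norm]; exact (hL r hr).dist_le_mul _ (hS₁ r hr) _ (hS₂ r hr)) (hb r hr _ (hS₂ r hr)))) hs ht

end Curves

abbrev Phase (d : ℕ) := Rd d × Rd d

variable {d : ℕ}

variable {V : Rd d → ℝ} {F : ℝ → Rd d → Rd d} {L M : ℝ → ℝ} {s : ℝ}

/-- A continuous force field, bounded by `M T` and `L T`-Lipschitz in space on `[-T, T]`. -/
structure IsForce (F : ℝ → Rd d → Rd d) (M L : ℝ → ℝ) : Prop where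
  continuous : Continuous (Function.uncurry F)
  bound : ∀ T t x, |t| ≤ T → ‖F t x‖ ≤ M T
  lipschitz : ∀ T t x y, |t| ≤ T → ‖F t x - F t y‖ ≤ L T * ‖x - y‖

def vfield (V : Rd d → ℝ) (F : ℝ → Rd d → Rd d) (t : ℝ) (z : Phase d) : Phase d := (z.2, -gradient V z.1 + F t z.1)

section
variable (hV : IsExternalPotential V)
include hV

theorem IsExternalPotential.differentiable : Differentiable ℝ V := hV.regular.differentiable

theorem continuous_vfield (hF : Continuous (Function.uncurry F)) : Continuous fun p : ℝ × Phase d => vfield V F p.1 p.2 := by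
  have h1 : Continuous (gradient V) := hV.regular.continuous_gradient
  have h2 : Continuous fun p : ℝ × Phase d => F p.1 p.2.1 := hF.comp (continuous_fst.prodMk (continuous_fst.comp continuous_snd))
  exact (continuous_snd.comp continuous_snd).prodMk ((h1.comp (continuous_fst.comp continuous_snd)).neg.add h2)

theorem exists_lipschitz_vfield (M L : ℝ → ℝ) (T R : ℝ) : ∃ K : NNReal, ∀ F : ℝ → Rd d → Rd d, IsForce F M L → ∀ t, |t| ≤ T →
      LipschitzOnWith K (vfield V F t) (closedBall 0 R) := by
  obtain ⟨B, hB, h⟩ := hV.regular.exists_lipschitz (R + 1)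
  refine ⟨NNReal.mk (1 + (B + |L T|)) (by positivity), fun F hF t ht => LipschitzOnWith.of_dist_le_mul fun z hz w hw => ?_⟩
  rw [mem_closedBall_zero_iff] at hz hw
  have hz1 : ‖z.1‖ < R + 1 := by linarith [norm_fst_le z]
  have hw1 : ‖w.1‖ < R + 1 := by linarith [norm_fst_le w]
  rw [dist_eq_norm, dist_eq_norm, NNReal.coe_mk]
  have e1 : ‖z.1 - w.1‖ ≤ ‖z - w‖ := norm_fst_le (z - w)
  have e2 : ‖z.2 - w.2‖ ≤ ‖z - w‖ := norm_snd_le (z - w)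
  have h1 := (h z.1 w.1 hz1 hw1).2
  have h2 := hF.lipschitz T t z.1 w.1 ht
  have h3 : L T * ‖z.1 - w.1‖ ≤ |L T| * ‖z.1 - w.1‖ := by gcongr; exact le_abs_self _
  simp only [vfield, Prod.mk_sub_mk, Prod.norm_mk]
  refine max_le ?_ ?_
  · nlinarith [norm_nonneg (z - w), abs_nonneg (L T)]
  · rw [show -gradient V z.1 + F t z.1 - (-gradient V w.1 + F t w.1) = -(gradient V z.1 - gradient V w.1) + (F t z.1 - F t w.1) by abel]
    refine (norm_add_le _ _).trans ?_
    rw [norm_neg]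
    have h4 : B * ‖z.1 - w.1‖ ≤ B * ‖z - w‖ := by gcongr
    have h5 : |L T| * ‖z.1 - w.1‖ ≤ |L T| * ‖z - w‖ := by gcongr
    nlinarith [norm_nonneg (z - w)]

/-- A priori bound for the curves of the (possibly slowed down) vector field. -/
theorem exists_curve_bound (M T R : ℝ) : ∃ R' : ℝ, 0 ≤ R' ∧ ∀ (F : ℝ → Rd d → Rd d) (χ : ℝ → ℝ) (γ : ℝ → Phase d) (a c : ℝ), -T ≤ a → c ≤ T →
      (∀ t ∈ Icc a c, ∀ x, ‖F t x‖ ≤ M) → (∀ t, χ t ∈ Icc (0:ℝ) 1) →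
      (∀ t ∈ Icc a c, HasDerivAt γ (χ t • vfield V F t (γ t)) t) →
      ∀ s ∈ Icc a c, ‖γ s‖ ≤ R → ∀ t ∈ Icc a c, ‖γ t‖ ≤ R' := by
  obtain ⟨C, hC, hlow⟩ := hV.lower_bound
  obtain ⟨A, hA⟩ : ∃ A, ∀ x ∈ closedBall (0 : Rd d) R, ‖V x‖ ≤ A :=
    (isCompact_closedBall _ _).exists_bound_of_continuousOn hV.regular.1.continuousOn
  set K := 1 + M ^ 2 + 2 * (C + 1) with hK
  have hK0 : 0 ≤ K := by positivity
  set g := R ^ 2 / 2 + |A| + (C + 1) * (1 + R ^ 2) with hg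
  have hg0 : 0 ≤ g := by positivity
  refine ⟨1 + 2 * (g * Real.exp ((K + 1) * (2 * |T|))), by positivity, ?_⟩
  intro F χ γ a c ha hc hF hχ hγ s hs hγs t ht
  set G : Phase d → ℝ := fun z => ‖z.2‖ ^ 2 / 2 + V z.1 + (C + 1) * (1 + ‖z.1‖ ^ 2) with hG
  have hGlow : ∀ z, ‖z.2‖ ^ 2 / 2 + ‖z.1‖ ^ 2 + 1 ≤ G z := fun z => by
    have := hlow z.1
    simp only [hG]
    nlinarith
  have hGd : ∀ r ∈ Icc a c, HasDerivAt (fun r => G (γ r)) (χ r * (inner ℝ (γ r).2 (F r (γ r).1) + 2 * (C + 1) * inner ℝ (γ r).1 (γ r).2)) r := by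
    intro r hr
    have h1 : HasDerivAt (fun r => (γ r).1) (χ r • (γ r).2) r := (hγ r hr).fst
    have h2 : HasDerivAt (fun r => (γ r).2) (χ r • (-gradient V (γ r).1 + F r (γ r).1)) r := (hγ r hr).snd
    have h3 : HasDerivAt (fun r => V (γ r).1) (inner ℝ (gradient V (γ r).1) (χ r • (γ r).2)) r := by
      have := (hV.differentiable (γ r).1).hasGradientAt.hasFDerivAt.comp_hasDerivAt r h1
      simpa using! this
    have := ((h2.norm_sq.div_const 2).add h3).add (((h1.norm_sq.const_add 1)).const_mul (C + 1))
    refine this.congr_deriv ?_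
    simp only [inner_smul_right, inner_add_right, inner_neg_right]
    rw [real_inner_comm (γ r).2 (gradient V (γ r).1)]
    ring
  have hbd : ∀ r ∈ Icc a c, |χ r * (inner ℝ (γ r).2 (F r (γ r).1) + 2 * (C + 1) * inner ℝ (γ r).1 (γ r).2)| ≤ K * |G (γ r)| := by
    intro r hr
    have hl := hGlow (γ r)
    have hGn : 0 ≤ G (γ r) := by nlinarith [sq_nonneg ‖(γ r).2‖, sq_nonneg ‖(γ r).1‖]
    rw [abs_mul, abs_of_nonneg (hχ r).1, abs_of_nonneg hGn]
    have i1 : |(inner ℝ (γ r).2 (F r (γ r).1) : ℝ)| ≤ ‖(γ r).2‖ * M := (abs_real_inner_le_norm _ _).trans (by gcongr; exact hF r hr _)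
    have i2 : |(inner ℝ (γ r).1 (γ r).2 : ℝ)| ≤ ‖(γ r).1‖ * ‖(γ r).2‖ := abs_real_inner_le_norm _ _
    have i3 : |(inner ℝ (γ r).2 (F r (γ r).1) + 2 * (C + 1) * inner ℝ (γ r).1 (γ r).2 : ℝ)|
        ≤ ‖(γ r).2‖ * M + 2 * (C + 1) * (‖(γ r).1‖ * ‖(γ r).2‖) := by
      refine (abs_add_le _ _).trans (add_le_add i1 ?_)
      rw [abs_mul, abs_of_nonneg (by positivity : 0 ≤ 2 * (C + 1))]
      gcongr
    have i4 : ‖(γ r).2‖ * M ≤ (1 + M ^ 2) * G (γ r) := by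
      nlinarith [sq_nonneg (‖(γ r).2‖ - M), sq_nonneg ‖(γ r).1‖, sq_nonneg ‖(γ r).2‖, sq_nonneg M,
        mul_nonneg (sq_nonneg M) hGn, mul_nonneg (sq_nonneg M) (sq_nonneg ‖(γ r).1‖),
        mul_nonneg (sq_nonneg M) (sq_nonneg ‖(γ r).2‖)]
    have i5 : ‖(γ r).1‖ * ‖(γ r).2‖ ≤ G (γ r) := by nlinarith [sq_nonneg (‖(γ r).2‖ - ‖(γ r).1‖), sq_nonneg ‖(γ r).1‖]
    have i6 : ‖(γ r).2‖ * M + 2 * (C + 1) * (‖(γ r).1‖ * ‖(γ r).2‖) ≤ K * G (γ r) := by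
      have : 2 * (C + 1) * (‖(γ r).1‖ * ‖(γ r).2‖) ≤ 2 * (C + 1) * G (γ r) := by gcongr
      rw [hK]; linarith
    calc _ ≤ 1 * |(inner ℝ (γ r).2 (F r (γ r).1) + 2 * (C + 1) * inner ℝ (γ r).1 (γ r).2 : ℝ)| := by
          gcongr; exact (hχ r).2
      _ ≤ _ := by rw [one_mul]; exact i3.trans i6
  have key := norm_le_mul_exp_of_deriv hK0 le_rfl hGd (fun r hr => (hbd r hr).trans_eq (add_zero _).symm) hs ht
  rw [add_zero, Real.norm_eq_abs, Real.norm_eq_abs] at key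
  have hR : 0 ≤ R := (norm_nonneg _).trans hγs
  have hGs : |G (γ s)| ≤ g := by
    have hl := hGlow (γ s)
    rw [abs_of_nonneg (by nlinarith [sq_nonneg ‖(γ s).2‖, sq_nonneg ‖(γ s).1‖])]
    have j1 : ‖(γ s).1‖ ≤ R := (norm_fst_le _).trans hγs
    have j2 : ‖(γ s).2‖ ≤ R := (norm_snd_le _).trans hγs
    have j3 := hA (γ s).1 (by simpa using j1)
    have j4 : V (γ s).1 ≤ |A| := (le_abs_self _).trans (j3.trans (le_abs_self _))
    simp only [hG, hg]
    gcongr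
  have htime : |t - s| ≤ 2 * |T| := by
    have := le_abs_self T
    rw [abs_le]; constructor <;> linarith [hs.1, hs.2, ht.1, ht.2]
  have hGt : |G (γ t)| ≤ g * Real.exp ((K + 1) * (2 * |T|)) := by
    refine key.trans ?_
    gcongr
  have hl := hGlow (γ t)
  have hGt' := (le_abs_self _).trans hGt
  rw [Prod.norm_def]
  refine max_le ?_ ?_ <;>
  nlinarith [sq_nonneg (‖(γ t).1‖ - 1), sq_nonneg (‖(γ t).2‖ - 1), sq_nonneg ‖(γ t).2‖, sq_nonneg ‖(γ t).1‖]

theorem exists_local_curve (hF : IsForce F M L) {N : ℝ} (hs : |s| < N) (z : Phase d) :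
    ∃ γ : ℝ → Phase d, γ s = z ∧ ∀ t, |t| < N → HasDerivAt γ (vfield V F t (γ t)) t := by
  obtain ⟨R', hR', hbound⟩ := exists_curve_bound hV (M N) N ‖z‖
  obtain ⟨K, hK⟩ := exists_lipschitz_vfield hV M L N (R' + 2)
  have hN : 0 < N := (abs_nonneg s).trans_lt hs
  have hs' := abs_lt.1 hs
  set Bd : ℝ := ‖gradient V 0‖ + |M N| + K * (R' + 2) with hBd
  have hBd0 : 0 ≤ Bd := by positivity
  have hbd : ∀ t, |t| ≤ N → ∀ w ∈ closedBall (0 : Phase d) (R' + 2), ‖vfield V F t w‖ ≤ Bd := by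
    intro t ht w hw
    have h1 := (hK F hF t ht).dist_le_mul w hw 0 (by simp; positivity)
    rw [dist_eq_norm, dist_zero_right] at h1
    have h2 : ‖vfield V F t 0‖ ≤ ‖gradient V 0‖ + |M N| := by
      simp only [vfield, Prod.norm_mk, Prod.fst_zero, Prod.snd_zero, norm_zero]
      refine max_le (by positivity) ((norm_add_le _ _).trans ?_)
      rw [norm_neg]
      gcongr
      exact (hF.bound N t _ ht).trans (le_abs_self _)
    have h3 : ‖vfield V F t w‖ ≤ ‖vfield V F t w - vfield V F t 0‖ + ‖vfield V F t 0‖ := norm_le_norm_sub_add _ _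
    have h4 : (K : ℝ) * ‖w‖ ≤ K * (R' + 2) := by gcongr; simpa using hw
    linarith
  set χ : Phase d → ℝ := fun w => max 0 (min 1 (R' + 2 - ‖w‖)) with hχ
  have hχ01 : ∀ w, χ w ∈ Icc (0:ℝ) 1 := fun w => ⟨le_max_left _ _, max_le zero_le_one (min_le_left _ _)⟩
  have hχL : ∀ w w', |χ w - χ w'| ≤ ‖w - w'‖ := by
    intro w w'
    refine (abs_max_sub_max_le_max _ _ _ _).trans (max_le (by simp) ((abs_min_sub_min_le_max _ _ _ _).trans (max_le (by simp) ?_)))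
    rw [sub_sub_sub_cancel_left, abs_sub_comm]
    exact abs_norm_sub_norm_le w w'
  have hχ0 : ∀ w, w ∉ closedBall (0 : Phase d) (R' + 2) → χ w = 0 := by
    intro w hw
    rw [mem_closedBall_zero_iff, not_le] at hw
    exact max_eq_left ((min_le_right _ _).trans (by linarith))
  have hχ1 : ∀ w, ‖w‖ ≤ R' → χ w = 1 := by
    intro w hw
    simp only [hχ]
    rw [min_eq_left (by linarith), max_eq_right zero_le_one]
  set b : ℝ → Phase d → Phase d := fun t w => χ w • vfield V F t w with hb
  have hbn : ∀ t, |t| ≤ N → ∀ w, ‖b t w‖ ≤ Bd := by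
    intro t ht w
    by_cases hw : w ∈ closedBall (0 : Phase d) (R' + 2)
    · simp only [hb, norm_smul, Real.norm_of_nonneg (hχ01 w).1]
      calc χ w * ‖vfield V F t w‖ ≤ 1 * Bd := by
            gcongr
            · exact (hχ01 w).2
            · exact hbd t ht w hw
        _ = Bd := one_mul _
    · simp [hb, hχ0 w hw, hBd0]
  have hbL1 : ∀ t, |t| ≤ N → ∀ w w', w ∈ closedBall (0 : Phase d) (R' + 2) → ‖b t w - b t w'‖ ≤ (K + Bd) * ‖w - w'‖ := by
    intro t ht w w' hw
    have h3 : |χ w - χ w'| * ‖vfield V F t w‖ ≤ ‖w - w'‖ * Bd := by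
      gcongr
      · exact hχL w w'
      · exact hbd t ht w hw
    by_cases hw' : w' ∈ closedBall (0 : Phase d) (R' + 2)
    · have e : b t w - b t w' = χ w' • (vfield V F t w - vfield V F t w') + (χ w - χ w') • vfield V F t w := by
        simp only [hb, smul_sub, sub_smul]; abel
      rw [e]
      refine (norm_add_le _ _).trans ?_
      rw [norm_smul, norm_smul, Real.norm_of_nonneg (hχ01 w').1, Real.norm_eq_abs, add_mul]
      have h1 := (hK F hF t ht).dist_le_mul w hw w' hw'
      rw [dist_eq_norm, dist_eq_norm] at h1
      have h2 : χ w' * ‖vfield V F t w - vfield V F t w'‖ ≤ 1 * (K * ‖w - w'‖) := by gcongr; exact (hχ01 w').2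
      linarith
    · rw [hχ0 w' hw', sub_zero] at h3
      simp only [hb]
      rw [hχ0 w' hw', zero_smul, sub_zero, norm_smul, Real.norm_eq_abs, add_mul]
      have h4 : (0 : ℝ) ≤ K * ‖w - w'‖ := by positivity
      linarith
  have hbL : ∀ t, |t| ≤ N → LipschitzWith (K + (NNReal.mk Bd hBd0)) (b t) := by
    intro t ht
    refine LipschitzWith.of_dist_le_mul fun w w' => ?_
    rw [dist_eq_norm, dist_eq_norm, NNReal.coe_add, NNReal.coe_mk]
    by_cases hw : w ∈ closedBall (0 : Phase d) (R' + 2)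
    · exact hbL1 t ht w w' hw
    · by_cases hw' : w' ∈ closedBall (0 : Phase d) (R' + 2)
      · rw [norm_sub_rev, norm_sub_rev w w']
        exact hbL1 t ht w' w hw'
      · simp only [hb, hχ0 w hw, hχ0 w' hw', zero_smul, sub_self, norm_zero]
        positivity
  have hPL : IsPicardLindelof b (tmin := -N) (tmax := N) ⟨s, ⟨hs'.1.le, hs'.2.le⟩⟩ z
      (NNReal.mk (Bd * (2 * N)) (by positivity)) 0 (NNReal.mk Bd hBd0) (K + (NNReal.mk Bd hBd0)) := by
    refine ⟨fun t ht => (hbL t (abs_le.2 ht)).lipschitzOnWith, fun w _ => ?_, fun t ht w _ => hbn t (abs_le.2 ht) w, ?_⟩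
    · exact (((continuous_vfield hV hF.continuous).along_fst).const_smul (χ w)).continuousOn
    · rw [NNReal.coe_mk, NNReal.coe_mk, NNReal.coe_zero, sub_zero]
      refine mul_le_mul_of_nonneg_left ?_ hBd0
      refine max_le (by linarith) (by linarith)
  obtain ⟨γ, hγs, hγ⟩ := hPL.exists_eq_forall_mem_Icc_hasDerivWithinAt₀
  have hγ' : ∀ t, |t| < N → HasDerivAt γ (b t (γ t)) t := fun t ht =>
    (hγ t (abs_le.1 ht.le)).hasDerivAt (Icc_mem_nhds (abs_lt.1 ht).1 (abs_lt.1 ht).2)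
  refine ⟨γ, hγs, fun t ht => ?_⟩
  have hin : ‖γ t‖ ≤ R' := by
    set T := max |s| |t|
    have hT : T < N := max_lt hs ht
    refine hbound F (fun r => χ (γ r)) γ (-T) T (by linarith) hT.le (fun r hr x => hF.bound N r x ((abs_le.2 hr).trans hT.le)) (fun r => hχ01 _)
      (fun r hr => hγ' r ((abs_le.2 hr).trans_lt hT)) s (abs_le.1 (le_max_left _ _)) (by rw [hγs])
      t (abs_le.1 (le_max_right _ _))
  have := hγ' t ht
  simp only [hb] at this
  rwa [hχ1 _ hin, one_smul] at this

theorem curve_eq_of_eq (hF : IsForce F M L) {a c : ℝ} {γ₁ γ₂ : ℝ → Phase d} (h₁ : ∀ t ∈ Icc a c, HasDerivAt γ₁ (vfield V F t (γ₁ t)) t)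
    (h₂ : ∀ t ∈ Icc a c, HasDerivAt γ₂ (vfield V F t (γ₂ t)) t) {t : ℝ} (hs : s ∈ Icc a c) (ht : t ∈ Icc a c) (h : γ₁ s = γ₂ s) : γ₁ t = γ₂ t := by
  have hc : ∀ γ : ℝ → Phase d, (∀ t ∈ Icc a c, HasDerivAt γ (vfield V F t (γ t)) t) → ∃ R, ∀ t ∈ Icc a c, ‖γ t‖ ≤ R := fun γ hγ =>
    isCompact_Icc.exists_bound_of_continuousOn fun t ht => (hγ t ht).continuousAt.continuousWithinAt
  obtain ⟨R₁, hR₁⟩ := hc γ₁ h₁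
  obtain ⟨R₂, hR₂⟩ := hc γ₂ h₂
  obtain ⟨K, hK⟩ := exists_lipschitz_vfield hV M L (max |a| |c|) (max R₁ R₂)
  have := norm_sub_le_of_curves (b₁ := vfield V F) (b₂ := vfield V F) (S := closedBall 0 (max R₁ R₂))
    le_rfl h₁ h₂ (fun t ht => by simpa using Or.inl (hR₁ t ht)) (fun t ht => by simpa using Or.inr (hR₂ t ht))
    (fun t ht => hK F hF t (abs_le_max_abs_abs ht.1 ht.2)) (fun t _ z _ => by simp) hs ht
  rw [h] at this
  simpa [sub_eq_zero] using this

theorem exists_global_curve (hF : IsForce F M L) (s : ℝ) (z : Phase d) : ∃ γ : ℝ → Phase d, γ s = z ∧ ∀ t, HasDerivAt γ (vfield V F t (γ t)) t := by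
  have hN : ∀ n : ℕ, |s| < |s| + 1 + n := fun n => by linarith [(n.cast_nonneg : (0:ℝ) ≤ n)]
  choose γ hγs hγ using fun n : ℕ => exists_local_curve hV hF (hN n) z
  have heq : ∀ n m : ℕ, ∀ t, |t| < |s| + 1 + n → |t| < |s| + 1 + m → γ n t = γ m t := by
    intro n m t hn hm
    set T := max |s| |t|
    refine curve_eq_of_eq hV hF (a := -T) (c := T) (s := s) (fun r hr => hγ n r ((abs_le.2 hr).trans_lt (max_lt (hN n) hn)))
      (fun r hr => hγ m r ((abs_le.2 hr).trans_lt (max_lt (hN m) hm)))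
      (abs_le.1 (le_max_left _ _)) (abs_le.1 (le_max_right _ _)) ((hγs n).trans (hγs m).symm)
  have hlt : ∀ t, |t| < |s| + 1 + (⌈|t|⌉₊ : ℕ) := fun t => by have := Nat.le_ceil |t|; linarith [abs_nonneg s]
  refine ⟨fun t => γ ⌈|t|⌉₊ t, hγs _, fun t => ?_⟩
  refine (hγ ⌈|t|⌉₊ t (hlt t)).congr_of_eventuallyEq ?_
  have : ∀ᶠ r in 𝓝 t, |r| < |s| + 1 + (⌈|t|⌉₊ : ℕ) := continuous_abs.continuousAt.eventually_lt_const (hlt t)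
  filter_upwards [this] with r hr using heq _ _ r (hlt r) hr

end

open Classical in
/-- The flow of the phase-space vector field: `flow V F s t z` is the position at time `t` of the curve through `z` at time `s`. -/
def flow (V : Rd d → ℝ) (F : ℝ → Rd d → Rd d) (s t : ℝ) (z : Phase d) : Phase d :=
  if h : ∃ γ : ℝ → Phase d, γ s = z ∧ ∀ t, HasDerivAt γ (vfield V F t (γ t)) t then h.choose t else z

section Flow

variable {V : Rd d → ℝ} {F : ℝ → Rd d → Rd d} {M L : ℝ → ℝ}

section
variable (hV : IsExternalPotential V)
include hV

section
variable (hF : IsForce F M L)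
include hF

theorem flow_self (s : ℝ) (z : Phase d) : flow V F s s z = z := by
  rw [flow, dif_pos (exists_global_curve hV hF s z)]
  exact (exists_global_curve hV hF s z).choose_spec.1

theorem hasDerivAt_flow (s t : ℝ) (z : Phase d) : HasDerivAt (fun t => flow V F s t z) (vfield V F t (flow V F s t z)) t := by
  simp only [flow, dif_pos (exists_global_curve hV hF s z)]
  exact (exists_global_curve hV hF s z).choose_spec.2 t

theorem eq_flow {γ : ℝ → Phase d} {a c : ℝ} (h : ∀ t ∈ Icc a c, HasDerivAt γ (vfield V F t (γ t)) t) {s t : ℝ} (hs : s ∈ Icc a c) (ht : t ∈ Icc a c) :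
    γ t = flow V F s t (γ s) :=
  curve_eq_of_eq hV hF h (fun t _ => hasDerivAt_flow hV hF s t _) hs ht (flow_self hV hF s _).symm

theorem flow_flow (r s t : ℝ) (z : Phase d) : flow V F s t (flow V F r s z) = flow V F r t z :=
  (eq_flow hV hF (γ := fun t => flow V F r t z) (a := min s t) (c := max s t) (fun t _ => hasDerivAt_flow hV hF r t z)
    ⟨min_le_left _ _, le_max_left _ _⟩ ⟨min_le_right _ _, le_max_right _ _⟩).symm

theorem flow_inv (s t : ℝ) (z : Phase d) : flow V F s t (flow V F t s z) = z := by rw [flow_flow hV hF, flow_self hV hF]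

end

theorem exists_flow_bound (M L : ℝ → ℝ) (T R : ℝ) : ∃ R' : ℝ, 0 ≤ R' ∧ ∀ F : ℝ → Rd d → Rd d,
    IsForce F M L → ∀ s t, |s| ≤ T → |t| ≤ T → ∀ z : Phase d, ‖z‖ ≤ R → ‖flow V F s t z‖ ≤ R' := by
  obtain ⟨R', hR', h⟩ := exists_curve_bound hV (M T) T R
  refine ⟨R', hR', fun F hF s t hs ht z hz => ?_⟩
  refine h F (fun _ => 1) (fun t => flow V F s t z) (-T) T le_rfl le_rfl (fun r hr x => hF.bound T r x (abs_le.2 hr)) (fun _ => ⟨zero_le_one, le_rfl⟩)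
    (fun r _ => by simpa using hasDerivAt_flow hV hF s r z) s (abs_le.1 hs)
    (by simpa [flow_self hV hF] using hz) t (abs_le.1 ht)

/-- Lipschitz dependence of the flow on the initial point and on the force, locally uniformly. -/
theorem exists_flow_lipschitz (M L : ℝ → ℝ) (T R : ℝ) : ∃ K R' : ℝ, 0 ≤ K ∧
    ∀ (F₁ F₂ : ℝ → Rd d → Rd d), IsForce F₁ M L → IsForce F₂ M L → ∀ ε, 0 ≤ ε →
    (∀ t, |t| ≤ T → ∀ x, ‖x‖ ≤ R' → ‖F₁ t x - F₂ t x‖ ≤ ε) → ∀ s t, |s| ≤ T → |t| ≤ T →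
    ∀ z w : Phase d, ‖z‖ ≤ R → ‖w‖ ≤ R → ‖flow V F₁ s t z - flow V F₂ s t w‖ ≤ K * (‖z - w‖ + ε) := by
  obtain ⟨R', hR', h⟩ := exists_flow_bound hV M L T R
  obtain ⟨K, hK⟩ := exists_lipschitz_vfield hV M L T R'
  refine ⟨Real.exp ((K + 1) * (2 * T)), R', by positivity, fun F₁ F₂ hF₁ hF₂ ε hε hd s t hs ht z w hz hw => ?_⟩
  have := norm_sub_le_of_curves (b₁ := vfield V F₁) (b₂ := vfield V F₂) (S := closedBall 0 R')
    (γ₁ := fun t => flow V F₁ s t z) (γ₂ := fun t => flow V F₂ s t w) (a := -T) (c := T) hε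
    (fun r _ => hasDerivAt_flow hV hF₁ s r z) (fun r _ => hasDerivAt_flow hV hF₂ s r w)
    (fun r hr => by simpa using h F₁ hF₁ s r hs (abs_le.2 hr) z hz)
    (fun r hr => by simpa using h F₂ hF₂ s r hs (abs_le.2 hr) w hw)
    (fun r hr => hK F₁ hF₁ r (abs_le.2 hr)) (fun r hr y hy => ?_) (abs_le.1 hs) (abs_le.1 ht)
  · simp only [flow_self hV hF₁, flow_self hV hF₂] at this
    rw [mul_comm]
    refine this.trans ?_
    gcongr
    have h1 := abs_le.1 hs
    have h2 := abs_le.1 ht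
    rw [abs_le]; constructor <;> linarith [h1.1, h1.2, h2.1, h2.2]
  · simp only [vfield, Prod.mk_sub_mk, sub_self, add_sub_add_left_eq_sub, Prod.norm_mk, norm_zero]
    refine max_le hε (hd r (abs_le.2 hr) _ ?_)
    rw [mem_closedBall_zero_iff] at hy
    exact (norm_fst_le y).trans hy

theorem continuous_flow (hF : IsForce F M L) (s : ℝ) : Continuous fun p : ℝ × Phase d => flow V F s p.1 p.2 := by
  rw [continuous_iff_continuousAt]
  rintro ⟨t, z⟩
  obtain ⟨K, R', hK, h⟩ := exists_flow_lipschitz hV M L (max |s| (|t| + 1)) (‖z‖ + 1)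
  rw [ContinuousAt, tendsto_iff_norm_sub_tendsto_zero]
  have h1 : Tendsto (fun p : ℝ × Phase d => K * (‖p.2 - z‖ + 0) + ‖flow V F s p.1 z - flow V F s t z‖)
      (𝓝 (t, z)) (𝓝 (K * (‖z - z‖ + 0) + ‖flow V F s t z - flow V F s t z‖)) := by
    have hc : Continuous fun r => flow V F s r z := continuous_iff_continuousAt.2 fun r => (hasDerivAt_flow hV hF s r z).continuousAt
    have : Continuous fun p : ℝ × Phase d => K * (‖p.2 - z‖ + 0) + ‖flow V F s p.1 z - flow V F s t z‖ := by fun_prop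
    exact this.tendsto (t, z)
  simp only [sub_self, norm_zero, add_zero, mul_zero] at h1
  refine squeeze_zero' (.of_forall fun _ => norm_nonneg _) ?_ h1
  have e1 : ∀ᶠ p : ℝ × Phase d in 𝓝 (t, z), |p.1| < |t| + 1 := (continuous_fst.abs.tendsto (t, z)).eventually_lt_const (by simp)
  have e2 : ∀ᶠ p : ℝ × Phase d in 𝓝 (t, z), ‖p.2‖ < ‖z‖ + 1 := (continuous_snd.norm.tendsto (t, z)).eventually_lt_const (by simp)
  filter_upwards [e1, e2] with p hp1 hp2
  have h2 := h F F hF hF 0 le_rfl (fun _ _ _ _ => by simp) s p.1 (le_max_left _ _) (hp1.le.trans (le_max_right _ _)) p.2 z hp2.le (by linarith)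
  rw [add_zero] at h2
  refine (norm_sub_le_norm_sub_add_norm_sub _ (flow V F s p.1 z) _).trans ?_
  gcongr

end

end Flow

variable {d : ℕ}

instance {m n : ℕ} : (volume : Measure (Rd m × Rd n)).IsAddHaarMeasure := Measure.prod.instIsAddHaarMeasure _ _

/-- One step of the symplectic Euler scheme. -/
def shear (B : Rd d → Rd d) (h : ℝ) (z : Phase d) : Phase d := (z.1 + h • z.2, z.2 + h • B (z.1 + h • z.2))

theorem measurePreserving_shear {B : Rd d → Rd d} (hB : Continuous B) (h : ℝ) :
    MeasurePreserving (shear B h) (volume : Measure (Phase d)) volume := by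
  have skew : ∀ A : Rd d → Rd d, Continuous A → MeasurePreserving (fun z : Phase d => (z.1, z.2 + A z.1)) volume volume := fun A hA =>
    (MeasurePreserving.id (volume : Measure (Rd d))).skew_product (g := fun x v => v + A x)
      (continuous_snd.add (hA.comp continuous_fst)).measurable (ae_of_all _ fun x => (measurePreserving_add_right volume (A x)).map_eq)
  have hs : MeasurePreserving (Prod.swap : Phase d → Phase d) volume volume := Measure.measurePreserving_swap
  exact (skew _ (hB.const_smul h)).comp (hs.comp ((skew _ (continuous_id.const_smul h)).comp hs))

theorem eventually_forall_of_continuous {Y : Type*} [TopologicalSpace Y] {K : Set Y} (hK : IsCompact K) {f : ℝ × Y → ℝ} (hf : Continuous f) {ε : ℝ}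
    (h0 : ∀ y ∈ K, f (0, y) < ε) : ∀ᶠ h in 𝓝 (0:ℝ), ∀ y ∈ K, f (h, y) < ε :=
  hK.eventually_forall_of_forall_eventually fun y hy => (hf.tendsto (0, y)).eventually_lt_const (h0 y hy)

section Liouville

variable {V : Rd d → ℝ} {F : ℝ → Rd d → Rd d} {M L : ℝ → ℝ}

variable {g : Phase d → ℝ}

section
variable (hV : IsExternalPotential V) (hF : IsForce F M L)
include hV hF

theorem flow_sub_shear_isLittleO (r : ℝ) {K : Set (Phase d)} (hK : IsCompact K) {ε : ℝ} (hε : 0 < ε) : ∀ᶠ h in 𝓝 (0:ℝ), ∀ y ∈ K,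
      ‖flow V F r (r + h) y - shear (fun x => -gradient V x + F r x) h y‖ ≤ ε * |h| := by
  set B : Rd d → Rd d := fun x => -gradient V x + F r x with hB
  have hBc : Continuous B := hV.regular.continuous_gradient.neg.add hF.continuous.along_snd
  have hbc := continuous_vfield hV hF.continuous
  have hfc : Continuous fun p : ℝ × Phase d => flow V F r (r + p.1) p.2 :=
    (continuous_flow hV hF r).comp ((continuous_const.add continuous_fst).prodMk continuous_snd)
  have e1 := eventually_forall_of_continuous hK (ε := ε / 2)
    (f := fun p => ‖vfield V F (r + p.1) (flow V F r (r + p.1) p.2) - vfield V F r p.2‖)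
    (by
      have h1 : Continuous fun p : ℝ × Phase d => vfield V F (r + p.1) (flow V F r (r + p.1) p.2) :=
        hbc.comp ((continuous_const.add continuous_fst).prodMk hfc)
      have h2 : Continuous fun p : ℝ × Phase d => vfield V F r p.2 := hbc.comp (continuous_const.prodMk continuous_snd)
      exact (h1.sub h2).norm)
    (fun y _ => by simp [flow_self hV hF, hε])
  have e2 := eventually_forall_of_continuous hK (ε := ε / 2)
    (f := fun p => ‖B (p.2.1 + p.1 • p.2.2) - B p.2.1‖) (by fun_prop) (fun y _ => by simp [hε])
  obtain ⟨δ, hδ, hball⟩ := Metric.eventually_nhds_iff.1 e1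
  filter_upwards [e2, ball_mem_nhds 0 hδ] with h he2 hh y hy
  have hh' : |h| < δ := by simpa using hh
  have s1 : ‖flow V F r (r + h) y - y - h • vfield V F r y‖ ≤ ε / 2 * |h| := by
    have hder : ∀ τ ∈ uIcc (0:ℝ) h, HasDerivWithinAt (fun τ => flow V F r (r + τ) y - τ • vfield V F r y)
        (vfield V F (r + τ) (flow V F r (r + τ) y) - vfield V F r y) (uIcc 0 h) τ := by
      intro τ _
      have h1 := (hasDerivAt_flow hV hF r (r + τ) y).comp_const_add r τ
      have h2 : HasDerivAt (fun τ : ℝ => τ • vfield V F r y) (vfield V F r y) τ := by simpa using (hasDerivAt_id τ).smul_const (vfield V F r y)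
      exact (h1.sub h2).hasDerivWithinAt
    have := (convex_uIcc (0:ℝ) h).norm_image_sub_le_of_norm_hasDerivWithin_le (C := ε / 2) hder (fun τ hτ => (hball (by
        rw [dist_zero_right, Real.norm_eq_abs]
        refine lt_of_le_of_lt ?_ hh'
        simpa using abs_sub_left_of_mem_uIcc hτ) y hy).le) left_mem_uIcc right_mem_uIcc
    simpa [flow_self hV hF, sub_right_comm] using this
  have s2 : ‖shear B h y - y - h • vfield V F r y‖ ≤ ε / 2 * |h| := by
    have : shear B h y - y - h • vfield V F r y = (0, h • (B (y.1 + h • y.2) - B y.1)) := by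
      ext1
      · simp [shear, vfield]
      · simp only [shear, vfield, Prod.snd_sub, Prod.smul_snd, hB, smul_sub]
        abel
    rw [this, Prod.norm_mk, norm_zero, norm_smul, Real.norm_eq_abs, mul_comm]
    refine max_le (by positivity) ?_
    gcongr
    exact (he2 y hy).le
  calc _ = ‖(flow V F r (r + h) y - y - h • vfield V F r y) - (shear B h y - y - h • vfield V F r y)‖ := by
        congr 1; abel
    _ ≤ _ := (norm_sub_le _ _).trans (by linarith)

theorem integral_comp_flow_of_lipschitz {Kg : NNReal} (hg : LipschitzWith Kg g) (hgc : HasCompactSupport g) (s t : ℝ) :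
    ∫ z, g (flow V F s t z) = ∫ z, g z := by
  suffices H : ∀ r, HasDerivAt (fun r => ∫ y, g (flow V F r t y)) 0 r by
    have h1 := is_const_of_deriv_eq_zero (fun r => (H r).differentiableAt) (fun r => (H r).deriv) s t
    simpa [flow_self hV hF] using h1
  intro r
  obtain ⟨R, hR⟩ := hgc.isCompact.isBounded.subset_closedBall 0
  set T := max (|r| + 1) |t| with hT
  obtain ⟨R₁, hR₁, hbd⟩ := exists_flow_bound hV M L T R
  obtain ⟨K, R₂, hK, hlip⟩ := exists_flow_lipschitz hV M L T (R₁ + 2)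
  set B : Rd d → Rd d := fun x => -gradient V x + F r x with hB
  have hBc : Continuous B := hV.regular.continuous_gradient.neg.add hF.continuous.along_snd
  set K₂ := closedBall (0 : Phase d) (R₁ + 1) with hK₂
  have hK₂c : IsCompact K₂ := isCompact_closedBall _ _
  have hgz : ∀ z, g z ≠ 0 → ‖z‖ ≤ R := fun z hz => by simpa using hR (subset_tsupport _ hz)
  have hshc : Continuous fun p : ℝ × Phase d => shear B p.1 p.2 := by unfold shear; fun_prop
  have hfc : Continuous fun p : ℝ × Phase d => flow V F r (r + p.1) p.2 :=
    (continuous_flow hV hF r).comp ((continuous_const.add continuous_fst).prodMk continuous_snd)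
  -- the inverse of the shear
  have e0 := eventually_forall_of_continuous (isCompact_closedBall (0 : Phase d) R₁) (ε := R₁ + 1)
    (f := fun p => ‖((p.2.1 - p.1 • (p.2.2 - p.1 • B p.2.1), p.2.2 - p.1 • B p.2.1) : Phase d)‖)
    (by fun_prop) (fun y hy => by
      rw [mem_closedBall_zero_iff] at hy
      simp only [zero_smul, sub_zero, Prod.mk.eta]; linarith)
  have e1 := eventually_forall_of_continuous hK₂c (ε := R₁ + 2) (f := fun p => ‖shear B p.1 p.2‖) hshc.norm (fun y hy => by
      rw [mem_closedBall_zero_iff] at hy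
      simp only [shear, zero_smul, add_zero, Prod.mk.eta]; linarith)
  have e2 := eventually_forall_of_continuous hK₂c (ε := R₁ + 2) (f := fun p => ‖flow V F r (r + p.1) p.2‖) hfc.norm (fun y hy => by
      rw [mem_closedBall_zero_iff] at hy
      simp only [add_zero, flow_self hV hF]; linarith)
  rw [hasDerivAt_iff_isLittleO_nhds_zero]
  refine Asymptotics.IsLittleO.of_bound fun ε hε => ?_
  set C := volume.real K₂ * (Kg * K) + 1 with hC
  have hC0 : 0 < C := by positivity
  filter_upwards [e0, e1, e2, flow_sub_shear_isLittleO hV hF r hK₂c (div_pos hε hC0), ball_mem_nhds 0 one_pos] with h h0 h1 h2 h3 hh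
  have hh' : |h| < 1 := by simpa using hh
  have hrT : |r| ≤ T := (by linarith : |r| ≤ |r| + 1).trans (le_max_left _ _)
  have hrhT : |r + h| ≤ T := ((abs_add_le r h).trans (by linarith)).trans (le_max_left _ _)
  have htT : |t| ≤ T := le_max_right _ _
  set u : Phase d → ℝ := fun y => g (flow V F (r + h) t y) with hu
  have hus : ∀ y, u y ≠ 0 → ‖y‖ ≤ R₁ := by
    intro y hy
    have := hbd F hF t (r + h) htT hrhT _ (hgz _ hy)
    rwa [flow_inv hV hF] at this
  have hur : ∀ y, u (flow V F r (r + h) y) = g (flow V F r t y) := fun y => by simp only [hu, flow_flow hV hF]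
  have huc : Continuous u := hg.continuous.comp ((continuous_flow hV hF (r + h)).along_snd)
  have hi1 : Function.support (fun y => u (flow V F r (r + h) y)) ⊆ K₂ := by
    intro y hy
    rw [Function.mem_support, hur] at hy
    have := hbd F hF t r htT hrT _ (hgz _ hy)
    rw [flow_inv hV hF] at this
    rw [hK₂, mem_closedBall_zero_iff]; linarith
  have hi2 : Function.support (fun y => u (shear B h y)) ⊆ K₂ := by
    intro y hy
    have h4 := h0 (shear B h y) (by simpa using hus _ hy)
    rw [hK₂, mem_closedBall_zero_iff]
    simp only [shear, add_sub_cancel_right, Prod.mk.eta] at h4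
    exact h4.le
  have hint : ∀ f : Phase d → ℝ, Continuous f → Function.support f ⊆ K₂ → ∫ y, f y = ∫ y in K₂, f y :=
    fun f _ hs => (setIntegral_eq_integral_of_forall_compl_eq_zero fun x hx => by by_contra h; exact hx (hs h)).symm
  have hc1 : Continuous fun y => u (flow V F r (r + h) y) := huc.comp hfc.along_snd
  have hc2 : Continuous fun y => u (shear B h y) := huc.comp hshc.along_snd
  have key : (∫ y, u y) - ∫ y, g (flow V F r t y) = ∫ y in K₂, (u (shear B h y) - u (flow V F r (r + h) y)) := by
    rw [integral_sub (hc2.continuousOn.integrableOn_compact hK₂c) (hc1.continuousOn.integrableOn_compact hK₂c), ← hint _ hc2 hi2, ← hint _ hc1 hi1]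
    simp only [hur]
    congr 1
    conv_lhs => rw [← (measurePreserving_shear hBc h).map_eq]
    exact integral_map (measurePreserving_shear hBc h).measurable.aemeasurable huc.aestronglyMeasurable
  have hpt : ∀ y ∈ K₂, ‖u (shear B h y) - u (flow V F r (r + h) y)‖ ≤ Kg * K * (ε / C) * |h| := by
    intro y hy
    have a1 : ‖u (shear B h y) - u (flow V F r (r + h) y)‖ ≤ Kg * ‖flow V F (r + h) t (shear B h y) - flow V F (r + h) t (flow V F r (r + h) y)‖ := by
      simpa [dist_eq_norm] using hg.dist_le_mul (flow V F (r + h) t (shear B h y)) (flow V F (r + h) t (flow V F r (r + h) y))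
    have a2 := hlip F F hF hF 0 le_rfl (fun _ _ _ _ => by simp) (r + h) t hrhT htT (shear B h y) (flow V F r (r + h) y) (h1 y hy).le (h2 y hy).le
    have a3 := h3 y hy
    rw [norm_sub_rev] at a3
    calc _ ≤ Kg * (K * (‖shear B h y - flow V F r (r + h) y‖ + 0)) := a1.trans (by gcongr)
      _ ≤ Kg * (K * (ε / C * |h| + 0)) := by gcongr
      _ = _ := by ring
  have hfin := norm_setIntegral_le_of_norm_le_const (μ := volume) hK₂c.measure_lt_top hpt
  rw [← key] at hfin
  have hle : Kg * K * (ε / C) * |h| * volume.real K₂ ≤ ε * |h| := by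
    have : Kg * K * (ε / C) * |h| * volume.real K₂ = (volume.real K₂ * (Kg * K)) / C * (ε * |h|) := by field_simp
    rw [this]
    have h5 : (volume.real K₂ * (Kg * K)) / C ≤ 1 := by rw [div_le_one hC0]; linarith
    calc _ ≤ 1 * (ε * |h|) := by gcongr
      _ = _ := one_mul _
  simpa using hfin.trans hle

theorem continuous_flow_snd (s t : ℝ) : Continuous (flow V F s t) := (continuous_flow hV hF s).along_snd

theorem integral_comp_flow (hg : Continuous g) (hgc : HasCompactSupport g) (s t : ℝ) : ∫ z, g (flow V F s t z) = ∫ z, g z := by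
  have hfc := continuous_flow_snd hV hF s t
  obtain ⟨R, hR⟩ := hgc.isCompact.isBounded.subset_closedBall 0
  have hg0 : ∀ x, R < ‖x‖ → g x = 0 := fun x hx => image_eq_zero_of_notMem_tsupport fun h => hx.not_ge (by simpa using hR h)
  obtain ⟨R', hR', hbd⟩ := exists_flow_bound hV M L (max |s| |t|) (R + 1)
  have hfz : ∀ z, R' < ‖z‖ → R + 1 < ‖flow V F s t z‖ := fun z hz => by
    by_contra h
    have := hbd F hF t s (le_max_right _ _) (le_max_left _ _) _ (not_lt.1 h)
    rw [flow_inv hV hF] at this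
    linarith
  set K := closedBall (0 : Phase d) (max R' (R + 1))
  have hK : IsCompact K := isCompact_closedBall _ _
  have hi : ∀ w : Phase d → ℝ, Continuous w → (∀ z ∉ K, w z = 0) → Integrable w := fun w hw h2 =>
    hw.integrable_of_hasCompactSupport (HasCompactSupport.intro hK h2)
  have hb : ∀ (w : Phase d → ℝ) (η : ℝ), (∀ z, ‖w z‖ ≤ η) → (∀ z ∉ K, w z = 0) → ‖∫ z, w z‖ ≤ η * volume.real K := fun w η h1 h2 => by
    rw [← setIntegral_eq_integral_of_forall_compl_eq_zero h2]
    exact norm_setIntegral_le_of_norm_le_const hK.measure_lt_top fun z _ => h1 z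
  have hK' : ∀ z ∉ K, R' < ‖z‖ ∧ R + 1 < ‖z‖ := fun z hz => by simpa [K] using hz
  refine eq_of_forall_dist_le fun e he => ?_
  set η := e / (2 * (volume.real K + 1)) with hη
  have hη0 : 0 < η := by positivity
  obtain ⟨δ, hδ, hu⟩ := Metric.uniformContinuous_iff.1 (hgc.uniformContinuous_of_continuous hg) η hη0
  obtain ⟨g', hg', hgg⟩ := hg.exists_contDiff_dist_le_of_forall_mem_ball_dist_le (lt_min hδ one_pos)
  have hg'0 : ∀ x, R + 1 < ‖x‖ → g' x = 0 := fun x hx => by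
    have h0 := hg0 x (by linarith)
    have := hgg x 0 fun y hy => by
      have h1 : ‖x - y‖ < 1 := (mem_ball_iff_norm'.1 hy).trans_le (min_le_right _ _)
      rw [h0, hg0 y (by linarith [norm_sub_norm_le x y]), dist_self]
    rwa [dist_le_zero, h0] at this
  have hgc' : HasCompactSupport g' := HasCompactSupport.intro (isCompact_closedBall 0 (R + 1)) fun x hx => hg'0 x (by simpa using hx)
  have hdist : ∀ z, ‖g z - g' z‖ ≤ η := fun z => by
    rw [← dist_eq_norm, dist_comm]
    exact hgg z η fun y hy => (hu (ball_subset_ball (min_le_left _ _) hy)).le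
  obtain ⟨Kg, hKg⟩ := (hg'.of_le (m := 1) (by norm_cast)).lipschitzWith_of_hasCompactSupport hgc' one_ne_zero
  have e1 := integral_comp_flow_of_lipschitz hV hF hKg hgc' s t
  have hz1 : ∀ z, R + 1 < ‖z‖ → g z - g' z = 0 := fun z hz => by rw [hg0 z (by linarith), hg'0 z hz, sub_zero]
  have b1 := hb _ η hdist fun z hz => hz1 z (hK' z hz).2
  have b2 := hb (fun z => g (flow V F s t z) - g' (flow V F s t z)) η (fun z => hdist _) fun z hz => hz1 _ (hfz z (hK' z hz).1)
  have hg'c := hg'.continuous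
  rw [integral_sub (hi _ hg fun z hz => hg0 z (by linarith [(hK' z hz).2])) (hi _ hg'c fun z hz => hg'0 z (hK' z hz).2)] at b1
  rw [integral_sub (f := fun z => g (flow V F s t z)) (g := fun z => g' (flow V F s t z)) (hi _ (hg.comp hfc) fun z hz => hg0 _ (by linarith [hfz z (hK' z hz).1]))
    (hi _ (hg'c.comp hfc) fun z hz => hg'0 _ (hfz z (hK' z hz).1)), e1] at b2
  have h4 : η * volume.real K ≤ e / 2 := by
    rw [hη, div_mul_eq_mul_div, div_le_div_iff₀ (by positivity) two_pos]
    nlinarith [measureReal_nonneg (μ := volume) (s := K)]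
  rw [Real.dist_eq]
  rw [Real.norm_eq_abs, abs_le] at b1 b2
  rw [abs_le]
  constructor <;> linarith [b1.1, b1.2, b2.1, b2.2]

def flowHomeo (s t : ℝ) : Phase d ≃ₜ Phase d where
  toFun := flow V F s t
  invFun := flow V F t s
  left_inv z := by rw [flow_inv hV hF]
  right_inv z := by rw [flow_inv hV hF]
  continuous_toFun := continuous_flow_snd hV hF s t
  continuous_invFun := continuous_flow_snd hV hF t s

/-- Liouville's theorem. -/
theorem measurePreserving_flow (s t : ℝ) : MeasurePreserving (flow V F s t) (volume : Measure (Phase d)) volume := by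
  have hc := continuous_flow_snd hV hF s t
  refine ⟨hc.measurable, ?_⟩
  have : (Measure.map (flow V F s t) (volume : Measure (Phase d))).Regular := Measure.Regular.map (μ := volume) (flowHomeo hV hF s t)
  refine Measure.ext_of_integral_eq_on_compactlySupported fun f => ?_
  refine (integral_map hc.measurable.aemeasurable f.continuous.aestronglyMeasurable).trans ?_
  exact integral_comp_flow hV hF f.continuous f.hasCompactSupport s t

theorem integral_comp_flow' {E : Type*} [NormedAddCommGroup E] [NormedSpace ℝ E] (g : Phase d → E) (s t : ℝ) : ∫ z, g (flow V F s t z) = ∫ z, g z :=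
  (measurePreserving_flow hV hF s t).integral_comp (flowHomeo hV hF s t).measurableEmbedding g

section
variable (f₀ : Density d) (t : ℝ)
include f₀ t

def transport : Density d := Lp.compMeasurePreserving (flow V F t 0) (measurePreserving_flow hV hF t 0) f₀

theorem transport_ae_eq : transport hV hF f₀ t =ᵐ[volume] fun z => f₀ (flow V F t 0 z) := Lp.coeFn_compMeasurePreserving _ _

theorem norm_transport : ‖transport hV hF f₀ t‖ = ‖f₀‖ := Lp.norm_compMeasurePreserving _ _

end

theorem transport_nonneg {f₀ : Density d} (h : 0 ≤ f₀) (t : ℝ) : 0 ≤ transport hV hF f₀ t := by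
  rw [← Lp.coeFn_nonneg] at h ⊢
  filter_upwards [transport_ae_eq hV hF f₀ t, (measurePreserving_flow hV hF t 0).quasiMeasurePreserving.ae h] with z h1 h2
  rw [h1]; exact h2

theorem integral_transport_mul (f₀ : Density d) (t : ℝ) {E : Type*} [NormedAddCommGroup E] [NormedSpace ℝ E] (g : Phase d → E) :
    ∫ z, transport hV hF f₀ t z • g z = ∫ z, f₀ z • g (flow V F 0 t z) := by
  rw [← integral_comp_flow' hV hF (fun z => f₀ z • g (flow V F 0 t z)) t 0]
  refine integral_congr_ae ?_
  filter_upwards [transport_ae_eq hV hF f₀ t] with z hz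
  rw [hz, flow_inv hV hF]

end

end Liouville

variable {V : Rd d → ℝ} {L M : ℝ → ℝ} {F : ℝ → Rd d → Rd d}

abbrev ForceLim (T : ℝ) (Fk : ℕ → ℝ → Rd d → Rd d) (F : ℝ → Rd d → Rd d) : Prop :=
  ∀ R, ∀ ε > 0, ∀ᶠ k in atTop, ∀ t, |t| ≤ T → ∀ x, ‖x‖ ≤ R → ‖Fk k t x - F t x‖ ≤ ε

theorem tendsto_transport (hV : IsExternalPotential V) {Fk : ℕ → ℝ → Rd d → Rd d} (hFk : ∀ k, IsForce (Fk k) M L) (hF : IsForce F M L) (T : ℝ)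
    (hlim : ForceLim T Fk F) {tk : ℕ → ℝ} {t : ℝ} (htk : ∀ k, |tk k| ≤ T)
    (ht : |t| ≤ T) (htlim : Tendsto tk atTop (𝓝 t)) {fk : ℕ → Density d} {f : Density d} (hf : Tendsto fk atTop (𝓝 f)) :
    Tendsto (fun k => transport hV (hFk k) (fk k) (tk k)) atTop (𝓝 (transport hV hF f t)) := by
  refine Filter.Tendsto.compMeasurePreservingLp hf
    (g := fun k => ⟨flow V (Fk k) (tk k) 0, continuous_flow_snd hV (hFk k) _ _⟩)
    (g₀ := ⟨flow V F t 0, continuous_flow_snd hV hF _ _⟩) ?_ (fun k => measurePreserving_flow hV (hFk k) _ _)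
    (measurePreserving_flow hV hF t 0) ENNReal.one_ne_top
  rw [ContinuousMap.tendsto_iff_forall_isCompact_tendstoUniformlyOn]
  intro K hK
  obtain ⟨R, hR⟩ := hK.isBounded.subset_closedBall 0
  have hT0 : 0 ≤ T := (abs_nonneg t).trans ht
  obtain ⟨R₁, hR₁, hbd⟩ := exists_flow_bound hV M L T R
  obtain ⟨K₁, R', hK₁, h⟩ := exists_flow_lipschitz hV M L T R
  obtain ⟨K₂, R'', hK₂, h'⟩ := exists_flow_lipschitz hV M L T (R₁ + 1)
  rw [Metric.tendstoUniformlyOn_iff]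
  intro ε hε
  -- the starting time is moved by comparing `z` with the flow at time `t`
  have e1 : ∀ᶠ k in atTop, ∀ z ∈ closedBall (0 : Phase d) R, ‖flow V F t (tk k) z - z‖ < min 1 (ε / (2 * (K₂ + 1))) := by
    have hc : Continuous fun p : ℝ × Phase d => ‖flow V F t (t + p.1) p.2 - p.2‖ :=
      (((continuous_flow hV hF t).comp ((continuous_const.add continuous_fst).prodMk continuous_snd)).sub continuous_snd).norm
    have := eventually_forall_of_continuous (isCompact_closedBall (0 : Phase d) R)
      (ε := min 1 (ε / (2 * (K₂ + 1)))) hc (fun y _ => by simp only [add_zero, flow_self hV hF, sub_self, norm_zero]; positivity)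
    have htl : Tendsto (fun k => tk k - t) atTop (𝓝 0) := by simpa using htlim.sub_const t
    filter_upwards [htl.eventually this] with k hk z hz
    simpa using hk z hz
  filter_upwards [hlim R' (ε / (2 * (K₁ + 1))) (by positivity), e1] with k hk1 hk2 z hz
  have hzR : ‖z‖ ≤ R := by simpa using hR hz
  have s1 := h (Fk k) F (hFk k) hF (ε / (2 * (K₁ + 1))) (by positivity) hk1 (tk k) 0 (htk k) (by simpa using hT0) z z hzR hzR
  have hR₁R : ‖z‖ ≤ R₁ := by
    have := hbd F hF t t ht ht z hzR
    rwa [flow_self hV hF] at this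
  have hk2' := hk2 z (by simpa using hzR)
  have s2 := h' F F hF hF 0 le_rfl (fun _ _ _ _ => by simp) (tk k) 0 (htk k) (by simpa using hT0) z (flow V F t (tk k) z) (by linarith)
    ((hbd F hF t (tk k) ht (htk k) z hzR).trans (by linarith))
  rw [flow_flow hV hF] at s2
  rw [norm_sub_rev] at hk2'
  have s3 : ‖flow V F (tk k) 0 z - flow V F t 0 z‖ ≤ K₂ * (ε / (2 * (K₂ + 1))) := by
    refine s2.trans ?_
    rw [add_zero]
    gcongr
    exact hk2'.le.trans (min_le_right _ _)
  rw [sub_self, norm_zero, zero_add] at s1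
  have a1 : K₁ * (ε / (2 * (K₁ + 1))) < ε / 2 := by rw [← mul_div_assoc, div_lt_div_iff₀ (by positivity) two_pos]; nlinarith
  have a2 : K₂ * (ε / (2 * (K₂ + 1))) < ε / 2 := by rw [← mul_div_assoc, div_lt_div_iff₀ (by positivity) two_pos]; nlinarith
  rw [dist_eq_norm, norm_sub_rev]
  calc ‖flow V (Fk k) (tk k) 0 z - flow V F t 0 z‖
      ≤ ‖flow V (Fk k) (tk k) 0 z - flow V F (tk k) 0 z‖ + ‖flow V F (tk k) 0 z - flow V F t 0 z‖ := norm_sub_le_norm_sub_add_norm_sub _ _ _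
    _ < ε := by linarith

theorem continuous_transport (hV : IsExternalPotential V) (hF : IsForce F M L) (f₀ : Density d) : Continuous (transport hV hF f₀) := by
  refine continuous_iff_seqContinuous.2 fun u t hu => ?_
  obtain ⟨T, hT⟩ := (hu.norm.bddAbove_range)
  exact tendsto_transport hV (fun _ => hF) hF (max T |t|) (fun R ε hε => .of_forall fun _ _ _ _ _ => by
    simpa using hε.le) (fun k => (hT ⟨k, rfl⟩).trans (le_max_left _ _)) (le_max_right _ _) hu tendsto_const_nhds

section Commutator

variable {X : Type*} [NormedAddCommGroup X] [NormedSpace ℝ X] [FiniteDimensional ℝ X]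
  [MeasureSpace X] [BorelSpace X] [(volume : Measure X).IsAddHaarMeasure]

variable {u φ : X → ℝ}

variable (X) in
theorem exists_mollifier : ∃ C : ℝ, 0 ≤ C ∧ ∀ ε : ℝ, 0 < ε → ∃ Θ : X → ℝ, IsTest Θ ∧ (∀ x, 0 ≤ Θ x) ∧
    ∫ x, Θ x = 1 ∧ Function.support Θ ⊆ ball 0 ε ∧ ∫ x, ‖fderiv ℝ Θ x‖ ≤ C / ε := by
  let bump : ContDiffBump (0 : X) := ⟨1 / 2, 1, by norm_num, by norm_num⟩
  set θ : X → ℝ := bump.normed volume with hθ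
  have hθs : ContDiff ℝ (⊤ : ℕ∞) θ := bump.contDiff_normed
  refine ⟨∫ x, ‖fderiv ℝ θ x‖, integral_nonneg fun _ => norm_nonneg _, fun ε hε => ?_⟩
  set N := Module.finrank ℝ X
  have hεi : ε⁻¹ ≠ 0 := inv_ne_zero hε.ne'
  set Θ : X → ℝ := fun x => (ε⁻¹) ^ N * θ (ε⁻¹ • x) with hΘ
  have hscale : ∀ f : X → ℝ, ∫ x, (ε⁻¹) ^ N * f (ε⁻¹ • x) = ∫ x, f x := fun f => by
    rw [integral_const_mul, Measure.integral_comp_smul, abs_of_pos (by positivity), smul_eq_mul, ← mul_assoc,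
      mul_inv_cancel₀ (by positivity), one_mul]
  have hsm : ContDiff ℝ (⊤ : ℕ∞) Θ := contDiff_const.mul (hθs.comp (contDiff_const_smul _))
  have hcs : HasCompactSupport Θ := (bump.hasCompactSupport_normed.comp_homeomorph (Homeomorph.smulOfNeZero ε⁻¹ hεi)).mul_left
  refine ⟨Θ, ⟨hsm, hcs⟩, fun x => mul_nonneg (by positivity) (bump.nonneg_normed _), ?_, ?_, ?_⟩
  · rw [hscale, hθ, bump.integral_normed]
  · intro x hx
    have h1 : ε⁻¹ • x ∈ Function.support θ := fun h => hx (by simp [hΘ, h])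
    rw [hθ, bump.support_normed_eq, mem_ball_zero_iff, norm_smul, norm_inv, Real.norm_of_nonneg hε.le] at h1
    rw [mem_ball_zero_iff]
    have : ε⁻¹ * ‖x‖ < 1 := h1
    rwa [inv_mul_lt_iff₀ hε, mul_one] at this
  · have hd : ∀ x, ‖fderiv ℝ Θ x‖ = ε⁻¹ ^ N * (ε⁻¹ * ‖fderiv ℝ θ (ε⁻¹ • x)‖) := fun x => by
      have h1 : HasFDerivAt (fun x : X => ε⁻¹ • x) (ε⁻¹ • ContinuousLinearMap.id ℝ X) x := (hasFDerivAt_id x).const_smul _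
      have h2 := (((hθs.differentiable (by simp)) (ε⁻¹ • x)).hasFDerivAt.comp x h1).const_mul (ε⁻¹ ^ N)
      rw [show Θ = fun y => ε⁻¹ ^ N * (θ ∘ fun x => ε⁻¹ • x) y from rfl, h2.fderiv, norm_smul,
        ContinuousLinearMap.comp_smul, norm_smul, ContinuousLinearMap.comp_id]
      rw [Real.norm_of_nonneg (by positivity), Real.norm_of_nonneg (by positivity)]
    simp only [hd]
    rw [hscale (fun x => ε⁻¹ * ‖fderiv ℝ θ x‖), integral_const_mul, div_eq_inv_mul]

section
variable (hφ : IsTest φ)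
include hφ

theorem IsTest.comp_sub_left (x : X) : IsTest (fun y => φ (x - y)) :=
  ⟨hφ.1.comp (contDiff_const.sub contDiff_id), hφ.2.comp_homeomorph (Homeomorph.subLeft x)⟩

theorem IsTest.fderiv_comp_sub_left (x y e : X) : fderiv ℝ (fun y => φ (x - y)) y e = -fderiv ℝ φ (x - y) e := by
  have := ((hφ.1.differentiable (by simp)) (x - y)).hasFDerivAt.comp y ((hasFDerivAt_const x y).sub (hasFDerivAt_id y))
  rw [show (fun y => φ (x - y)) = φ ∘ fun y => x - y from rfl, this.fderiv]
  simp

theorem IsTest.fderiv_convolution_apply (hu : LocallyIntegrable u) (x e : X) :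
    fderiv ℝ (φ ⋆[ContinuousLinearMap.lsmul ℝ ℝ, volume] u) x e = ∫ y, fderiv ℝ φ (x - y) e * u y := by
  have h1 := hφ.2.hasFDerivAt_convolution_left (ContinuousLinearMap.lsmul ℝ ℝ) (μ := volume) (hφ.1.of_le (by norm_cast)) hu x
  have hc : ConvolutionExists (fderiv ℝ φ) u ((ContinuousLinearMap.lsmul ℝ ℝ).precompL X) volume :=
    (hφ.2.fderiv ℝ).convolutionExists_left _ (hφ.1.continuous_fderiv (by simp)) hu
  rw [h1.fderiv, convolution, ContinuousLinearMap.integral_apply (hc x)]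
  simp only [ContinuousLinearMap.precompL_apply, ContinuousLinearMap.lsmul_apply, smul_eq_mul]
  rw [← integral_sub_left_eq_self (fun t => fderiv ℝ φ t e * u (x - t)) volume x]
  simp only [sub_sub_cancel]

theorem IsTest.integral_fderiv_sub (x e : X) : ∫ y, fderiv ℝ φ (x - y) e = 0 := by
  have h := hφ.fderiv_convolution_apply (u := fun _ => 1) (locallyIntegrable_const 1) x e
  have hc : (φ ⋆[ContinuousLinearMap.lsmul ℝ ℝ, volume] (fun _ => (1:ℝ))) = fun _ => ∫ t, φ t := by ext x; simp [convolution]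
  rw [hc] at h
  simpa using h.symm

end

/-- The commutator of a derivation `b · ∇` with a convolution. -/
theorem abs_fderiv_convolution_le {Θ : X → ℝ} {b : X → X} (hΘ : IsTest Θ) (hu : Continuous u) (hb : Continuous b) {ε a : ℝ}
    (hs : Function.support Θ ⊆ ball 0 ε) (p : X) (hid : ∀ ψ : X → ℝ, IsTest ψ → ∫ y, (u y - u p) * fderiv ℝ ψ y (b y) = 0)
    (ha : ∀ y, ‖y - p‖ ≤ ε → |u y - u p| * ‖b p - b y‖ ≤ a) :
    |fderiv ℝ (Θ ⋆[ContinuousLinearMap.lsmul ℝ ℝ, volume] u) p (b p)| ≤ a * ∫ x, ‖fderiv ℝ Θ x‖ := by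
  have hΘc : Continuous (fderiv ℝ Θ) := hΘ.1.continuous_fderiv (by simp)
  have hcs : HasCompactSupport (fun y => fderiv ℝ Θ (p - y)) := (hΘ.2.fderiv ℝ).comp_homeomorph (Homeomorph.subLeft p)
  have hi : ∀ (w : X → X) (v : X → ℝ), Continuous w → Continuous v → Integrable (fun y => fderiv ℝ Θ (p - y) (w y) * v y) := fun w v hw hv => by
    refine Continuous.integrable_of_hasCompactSupport ?_ ?_
    · exact ((hΘc.comp (continuous_const.sub continuous_id)).clm_apply hw).mul hv
    · refine hcs.mono fun y hy => ?_
      intro h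
      exact hy (by simp [show fderiv ℝ Θ (p - y) = 0 from h])
  have h1 := hΘ.fderiv_convolution_apply hu.locallyIntegrable p (b p)
  have h2 := hid _ (hΘ.comp_sub_left p)
  simp only [hΘ.fderiv_comp_sub_left, mul_neg, integral_neg, neg_eq_zero] at h2
  have h3 : ∫ y, fderiv ℝ Θ (p - y) (b p) * u p = 0 := by rw [integral_mul_const, hΘ.integral_fderiv_sub, zero_mul]
  have h4 : fderiv ℝ (Θ ⋆[ContinuousLinearMap.lsmul ℝ ℝ, volume] u) p (b p) = ∫ y, fderiv ℝ Θ (p - y) (b p - b y) * (u y - u p) := by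
    have e1 : ∫ y, fderiv ℝ Θ (p - y) (b p - b y) * (u y - u p) = ∫ y, ((fderiv ℝ Θ (p - y) (b p) * u y - fderiv ℝ Θ (p - y) (b p) * u p)
          - (u y - u p) * fderiv ℝ Θ (p - y) (b y)) := by
      refine integral_ext fun y => ?_
      simp only [map_sub]; ring
    rw [e1, integral_sub, integral_sub, h2, h3, h1, sub_zero, sub_zero]
    · exact hi _ _ continuous_const hu
    · exact hi _ _ continuous_const continuous_const
    · exact (hi _ _ continuous_const hu).sub (hi _ _ continuous_const continuous_const)
    · simpa only [mul_comm] using hi b (fun y => u y - u p) hb (hu.sub continuous_const)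
  have hin : Integrable (fun y => ‖fderiv ℝ Θ (p - y)‖) := ((hΘc.comp (continuous_const.sub continuous_id)).integrable_of_hasCompactSupport hcs).norm
  rw [h4, ← Real.norm_eq_abs]
  refine (norm_integral_le_of_norm_le (hin.const_mul a) (ae_of_all _ fun y => ?_)).trans ?_
  · by_cases hy : ‖y - p‖ ≤ ε
    · rw [norm_mul]
      calc _ ≤ (‖fderiv ℝ Θ (p - y)‖ * ‖b p - b y‖) * ‖u y - u p‖ := by
            gcongr; exact ContinuousLinearMap.le_opNorm _ _
        _ = (|u y - u p| * ‖b p - b y‖) * ‖fderiv ℝ Θ (p - y)‖ := by rw [Real.norm_eq_abs]; ring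
        _ ≤ _ := by gcongr; exact ha y hy
    · have : fderiv ℝ Θ (p - y) = 0 := by
        by_contra h
        have h5 : p - y ∈ tsupport Θ := support_fderiv_subset ℝ h
        have h6 := closure_mono hs h5
        have h7 := Metric.closure_ball_subset_closedBall h6
        rw [mem_closedBall_zero_iff, norm_sub_rev] at h7
        exact hy h7
      simp [this]
  · rw [integral_const_mul, integral_sub_left_eq_self (fun x => ‖fderiv ℝ Θ x‖) volume p]

end Commutator

variable {B : ℝ}

section
variable {X : Type*} [TopologicalSpace X] [SecondCountableTopology X] [MeasureSpace X] [BorelSpace X]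

section
variable (f : Lp ℝ 1 (volume : Measure X)) {w : X → ℝ}
include f

theorem integrable_mul_of_bounded (hw : Continuous w) (hB : ∀ x, |w x| ≤ B) : Integrable (fun x => f x * w x) :=
  (L1.integrable_coeFn f).mul_bdd (c := B) hw.aestronglyMeasurable (ae_of_all _ fun x => hB x)

theorem abs_integral_mul_le (hB : ∀ x, |w x| ≤ B) : |∫ x, f x * w x| ≤ B * ‖f‖ := by
  rw [L1.norm_eq_integral_norm, ← integral_const_mul, ← Real.norm_eq_abs]
  refine norm_integral_le_of_norm_le ((L1.integrable_coeFn f).norm.const_mul B) (ae_of_all _ fun x => ?_)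
  rw [norm_mul, mul_comm]
  exact mul_le_mul_of_nonneg_right (hB x) (norm_nonneg _)

end

theorem continuousOn_integral_mul {S : Set ℝ} {f : ℝ → Lp ℝ 1 (volume : Measure X)} (hf : ContinuousOn f S) {w : ℝ → X → ℝ}
    (hw : ∀ t, Continuous (w t)) (hwt : ∀ x, ContinuousOn (fun t => w t x) S) (hB : ∀ t ∈ S, ∀ x, |w t x| ≤ B) :
    ContinuousOn (fun t => ∫ x, f t x * w t x) S := by
  intro t ht
  have h1 : Tendsto (fun s => ∫ x, f t x * w s x) (𝓝[S] t) (𝓝 (∫ x, f t x * w t x)) := by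
    refine tendsto_integral_filter_of_dominated_convergence (fun x => B * ‖f t x‖) ?_ ?_ ((L1.integrable_coeFn (f t)).norm.const_mul B) ?_
    · filter_upwards [self_mem_nhdsWithin] with s hs using (integrable_mul_of_bounded _ (hw s) (hB s hs)).1
    · filter_upwards [self_mem_nhdsWithin] with s hs
      refine ae_of_all _ fun x => ?_
      rw [norm_mul, mul_comm]
      exact mul_le_mul_of_nonneg_right (hB s hs x) (norm_nonneg _)
    · exact ae_of_all _ fun x => (hwt x t ht).const_mul _
  have h2 : Tendsto (fun s => ∫ x, (f s - f t) x * w s x) (𝓝[S] t) (𝓝 0) := by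
    have h3 : Tendsto (fun s => B * ‖f s - f t‖) (𝓝[S] t) (𝓝 0) := by
      have := ((hf t ht).sub_const (f t)).norm.const_mul B
      simpa using this
    refine squeeze_zero_norm' ?_ h3
    filter_upwards [self_mem_nhdsWithin] with s hs
    exact abs_integral_mul_le _ (hB s hs)
  have h4 := h1.add h2
  rw [add_zero] at h4
  refine h4.congr' ?_
  filter_upwards [self_mem_nhdsWithin] with s hs
  rw [← integral_add (integrable_mul_of_bounded _ (hw s) (hB s hs)) (integrable_mul_of_bounded _ (hw s) (hB s hs))]
  refine integral_congr_ae ?_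
  filter_upwards [Lp.coeFn_sub (f s) (f t)] with x hx
  rw [hx, Pi.sub_apply]; ring

end

variable {d : ℕ} {V : Rd d → ℝ} {F : ℝ → Rd d → Rd d} {M L : ℝ → ℝ}

variable {φ : ℝ × Phase d → ℝ} {g : Phase d → ℝ} {T : ℝ} {Kg : NNReal}

instance {m n : ℕ} : (volume : Measure (ℝ × (Rd m × Rd n))).IsAddHaarMeasure := Measure.prod.instIsAddHaarMeasure _ _

instance {m n : ℕ} : (volume : Measure (ℝ × (Rd m × Rd n))).IsNegInvariant := Measure.IsAddHaarMeasure.isNegInvariant_of_regular _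

def along (V : Rd d → ℝ) (F : ℝ → Rd d → Rd d) (φ : ℝ × Phase d → ℝ) (p : ℝ × Phase d) : ℝ := fderiv ℝ φ p (1, vfield V F p.1 p.2)

theorem continuous_along (hV : IsExternalPotential V) (hF : IsForce F M L) (hφ : ContDiff ℝ 1 φ) : Continuous (along V F φ) :=
  (hφ.continuous_fderiv (by simp)).clm_apply (continuous_const.prodMk (continuous_vfield hV hF.continuous))

theorem along_eq_zero {p : ℝ × Phase d} (hp : p ∉ tsupport φ) : along V F φ p = 0 := by
  have : fderiv ℝ φ p = 0 := by by_contra h; exact hp (support_fderiv_subset ℝ h)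
  simp [along, this]

section
variable (hV : IsExternalPotential V) (hF : IsForce F M L)
include hV hF

theorem hasDerivAt_comp_flow (hφ : ContDiff ℝ 1 φ) (s t : ℝ) (z : Phase d) :
    HasDerivAt (fun t => φ (t, flow V F s t z)) (along V F φ (t, flow V F s t z)) t :=
  ((hφ.differentiable (by simp)) (t, flow V F s t z)).hasFDerivAt.comp_hasDerivAt t ((hasDerivAt_id t).prodMk (hasDerivAt_flow hV hF s t z))

theorem continuous_prodMk_flow (s : ℝ) : Continuous fun p : ℝ × Phase d => (p.1, flow V F s p.1 p.2) :=
  continuous_fst.prodMk (continuous_flow hV hF s)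

/-- Functions constant along the flow solve the transport equation. -/
theorem integral_along_comp_flow (hg : Continuous g) (hφ : IsTest φ) (huc : Continuous fun p : ℝ × Phase d => g (flow V F p.1 0 p.2)) :
    ∫ p : ℝ × Phase d, g (flow V F p.1 0 p.2) * along V F φ p = 0 := by
  have hφ1 : ContDiff ℝ 1 φ := hφ.1.of_le (by norm_cast)
  have hac := continuous_along hV hF hφ1
  have hcs : HasCompactSupport (along V F φ) := hφ.2.mono' fun p hp => by by_contra h; exact hp (along_eq_zero h)
  have hi1 : Integrable (fun p : ℝ × Phase d => g (flow V F p.1 0 p.2) * along V F φ p) := (huc.mul hac).integrable_of_hasCompactSupport hcs.mul_left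
  obtain ⟨R, hR⟩ := hφ.2.isCompact.isBounded.subset_closedBall 0
  obtain ⟨R', hR', hbd⟩ := exists_flow_bound hV M L (max R 0) R
  have hsupp : ∀ p : ℝ × Phase d, (p.1, flow V F 0 p.1 p.2) ∈ tsupport φ → p ∈ Icc (-R) R ×ˢ closedBall (0 : Phase d) R' := by
    intro p hp
    have h1 := hR hp
    rw [mem_closedBall_zero_iff, Prod.norm_mk, max_le_iff, Real.norm_eq_abs] at h1
    refine ⟨abs_le.1 h1.1, ?_⟩
    have := hbd F hF p.1 0 (h1.1.trans (le_max_left _ _)) (by simp) _ h1.2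
    rw [flow_inv hV hF] at this
    simpa using this
  have hK : IsCompact (Icc (-R) R ×ˢ closedBall (0 : Phase d) R') := isCompact_Icc.prod (isCompact_closedBall _ _)
  have hi2 : Integrable (fun p : ℝ × Phase d => g p.2 * along V F φ (p.1, flow V F 0 p.1 p.2)) := by
    refine ((hg.comp continuous_snd).mul (hac.comp (continuous_prodMk_flow hV hF 0))).integrable_of_hasCompactSupport ?_
    refine HasCompactSupport.intro hK fun p hp => ?_
    simp [along_eq_zero (fun h => hp (hsupp p h))]
  rw [Measure.volume_eq_prod, integral_prod _ hi1]
  have h1 : ∀ t : ℝ, ∫ z : Phase d, g (flow V F t 0 z) * along V F φ (t, z) = ∫ z : Phase d, g z * along V F φ (t, flow V F 0 t z) := fun t => by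
    rw [← integral_comp_flow' hV hF _ 0 t]
    simp only [flow_inv hV hF]
  simp only [h1]
  rw [integral_integral_swap hi2]
  have h2 : ∀ z : Phase d, ∫ t : ℝ, g z * along V F φ (t, flow V F 0 t z) = 0 := fun z => by
    rw [integral_const_mul]
    have hc1 : Continuous fun t => along V F φ (t, flow V F 0 t z) :=
      (hac.comp (continuous_prodMk_flow hV hF 0)).along_fst
    have hc2 : Continuous fun t => φ (t, flow V F 0 t z) :=
      (hφ1.continuous.comp (continuous_prodMk_flow hV hF 0)).along_fst
    rw [integral_eq_zero_of_hasDerivAt_of_integrable (fun t => hasDerivAt_comp_flow hV hF hφ1 0 t z), mul_zero]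
    · refine hc1.integrable_of_hasCompactSupport (HasCompactSupport.intro (isCompact_Icc (a := -R) (b := R)) fun t ht => ?_)
      exact along_eq_zero fun h => ht (hsupp (t, z) h).1
    · refine hc2.integrable_of_hasCompactSupport (HasCompactSupport.intro (isCompact_Icc (a := -R) (b := R)) fun t ht => ?_)
      exact image_eq_zero_of_notMem_tsupport fun h => ht (hsupp (t, z) h).1
  simp [h2]

theorem transport_weak (f₀ : Density d) (hT : 0 < T) (hφ : IsTest φ) (hs : tsupport φ ⊆ Iio T ×ˢ univ) :
    (∫ t in Icc 0 T, ∫ z, transport hV hF f₀ t z * along V F φ (t, z)) + ∫ z, f₀ z * φ (0, z) = 0 := by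
  have hφ1 : ContDiff ℝ 1 φ := hφ.1.of_le (by norm_cast)
  have hac := continuous_along hV hF hφ1
  have hcs : HasCompactSupport (along V F φ) := hφ.2.mono' fun p hp => by by_contra h; exact hp (along_eq_zero h)
  obtain ⟨B, hB⟩ := hac.bounded_above_of_compact_support hcs
  have hcf : Continuous fun p : ℝ × Phase d => along V F φ (p.1, flow V F 0 p.1 p.2) := hac.comp (continuous_prodMk_flow hV hF 0)
  have h1 : ∀ t, ∫ z, transport hV hF f₀ t z * along V F φ (t, z) = ∫ z, f₀ z * along V F φ (t, flow V F 0 t z) := fun t =>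
    integral_transport_mul hV hF f₀ t (fun z => along V F φ (t, z))
  simp only [h1]
  have hi : Integrable (fun p : ℝ × Phase d => f₀ p.2 * along V F φ (p.1, flow V F 0 p.1 p.2)) ((volume.restrict (Icc 0 T)).prod volume) := by
    have h0 : Integrable (fun p : ℝ × Phase d => f₀ p.2) ((volume.restrict (Icc 0 T)).prod volume) := by
      have := (integrable_const (μ := volume.restrict (Icc 0 T)) (1:ℝ)).mul_prod (L1.integrable_coeFn f₀)
      simpa using this
    exact h0.mul_bdd (c := B) hcf.aestronglyMeasurable (ae_of_all _ fun p => hB _)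
  rw [integral_integral_swap hi]
  have h2 : ∀ z, ∫ t in Icc 0 T, f₀ z * along V F φ (t, flow V F 0 t z) = -(f₀ z * φ (0, z)) := fun z => by
    rw [integral_const_mul, integral_Icc_eq_integral_Ioc, ← intervalIntegral.integral_of_le hT.le,
      intervalIntegral.integral_eq_sub_of_hasDerivAt (fun t _ => hasDerivAt_comp_flow hV hF hφ1 0 t z)
        (hcf.along_fst.intervalIntegrable _ _), flow_self hV hF,
      show φ (T, flow V F 0 T z) = 0 from image_eq_zero_of_notMem_tsupport (fun h => lt_irrefl T (hs h).1)]
    ring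
  simp only [h2, integral_neg]
  ring

theorem norm_vfield_le_of_compact (T R : ℝ) : ∃ B, 0 ≤ B ∧ ∀ t, |t| ≤ T → ∀ z, ‖z‖ ≤ R → ‖vfield V F t z‖ ≤ B := by
  obtain ⟨B, hB⟩ := ((isCompact_Icc (a := -T) (b := T)).prod (isCompact_closedBall (0 : Phase d) R)).exists_bound_of_continuousOn
    (continuous_vfield hV hF.continuous).continuousOn
  exact ⟨max B 0, le_max_right _ _, fun t ht z hz => (hB (t, z) ⟨abs_le.1 ht, by simpa using hz⟩).trans (le_max_left _ _)⟩

section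
variable (hg : LipschitzWith Kg g) (hgc : HasCompactSupport g)
include hg hgc

/-- Functions constant along the flow are Lipschitz if their initial values are. -/
theorem exists_lipschitz_comp_flow (T : ℝ) (hT : 0 ≤ T) : ∃ C R : ℝ, 0 ≤ C ∧ 0 ≤ R ∧
      (∀ s t y z, |s| ≤ T → |t| ≤ T → |g (flow V F s 0 y) - g (flow V F t 0 z)| ≤ C * ‖(s, y) - (t, z)‖) ∧
      (∀ t z, |t| ≤ T → g (flow V F t 0 z) ≠ 0 → ‖z‖ ≤ R) := by
  obtain ⟨B, hB⟩ := hg.continuous.bounded_above_of_compact_support hgc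
  have hB0 : 0 ≤ B := (norm_nonneg _).trans (hB 0)
  obtain ⟨R₀, hR₀⟩ := hgc.isCompact.isBounded.subset_closedBall 0
  obtain ⟨R, hR, hbd⟩ := exists_flow_bound hV M L T R₀
  have hsupp : ∀ t z, |t| ≤ T → g (flow V F t 0 z) ≠ 0 → ‖z‖ ≤ R := fun t z ht h => by
    have h1 : ‖flow V F t 0 z‖ ≤ R₀ := by simpa using hR₀ (subset_tsupport _ h)
    have := hbd F hF 0 t (by simpa using hT) ht _ h1
    rwa [flow_inv hV hF] at this
  obtain ⟨R₁, hR₁, hbd₁⟩ := exists_flow_bound hV M L T (R + 1)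
  obtain ⟨K, R₂, hK, hlip⟩ := exists_flow_lipschitz hV M L T (max R₁ (R + 1))
  obtain ⟨Bv, hBv, hv⟩ := norm_vfield_le_of_compact hV hF T R₁
  have main : ∀ s t y z, |s| ≤ T → |t| ≤ T → g (flow V F t 0 z) ≠ 0 →
      |g (flow V F s 0 y) - g (flow V F t 0 z)| ≤ (B + Kg * K * (1 + Bv)) * ‖(s, y) - (t, z)‖ := by
    intro s t y z hs ht hz
    have hzR := hsupp t z ht hz
    have hp1 : |s - t| ≤ ‖(s, y) - (t, z)‖ := by rw [Prod.mk_sub_mk, Prod.norm_mk, Real.norm_eq_abs]; exact le_max_left _ _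
    have hp2 : ‖y - z‖ ≤ ‖(s, y) - (t, z)‖ := by rw [Prod.mk_sub_mk, Prod.norm_mk]; exact le_max_right _ _
    by_cases hy : ‖y‖ ≤ R + 1
    · have h1 : |g (flow V F s 0 y) - g (flow V F t 0 z)| ≤ Kg * ‖flow V F s 0 y - flow V F t 0 z‖ := by
        simpa [dist_eq_norm, Real.dist_eq] using hg.dist_le_mul (flow V F s 0 y) (flow V F t 0 z)
      have h2 := hlip F F hF hF 0 le_rfl (fun _ _ _ _ => by simp) s 0 hs (by simpa using hT) y (flow V F t s z) (hy.trans (le_max_right _ _))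
        ((hbd₁ F hF t s ht hs z (by linarith)).trans (le_max_left _ _))
      rw [flow_flow hV hF, add_zero] at h2
      have h3 : ‖z - flow V F t s z‖ ≤ Bv * |s - t| := by
        have := (convex_uIcc t s).norm_image_sub_le_of_norm_hasDerivWithin_le (C := Bv)
          (fun τ _ => (hasDerivAt_flow hV hF t τ z).hasDerivWithinAt) (fun τ hτ => by
            have h4 : |τ| ≤ T := by
              rw [abs_le] at hs ht ⊢
              exact ⟨(le_min ht.1 hs.1).trans hτ.1, hτ.2.trans (max_le ht.2 hs.2)⟩
            exact hv τ h4 _ (hbd₁ F hF t τ ht h4 z (by linarith))) left_mem_uIcc right_mem_uIcc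
        rw [flow_self hV hF] at this
        rwa [norm_sub_rev]
      have h4 : ‖y - flow V F t s z‖ ≤ (1 + Bv) * ‖(s, y) - (t, z)‖ := by
        calc _ ≤ ‖y - z‖ + ‖z - flow V F t s z‖ := norm_sub_le_norm_sub_add_norm_sub _ _ _
          _ ≤ ‖(s, y) - (t, z)‖ + Bv * ‖(s, y) - (t, z)‖ := by gcongr; exact h3.trans (by gcongr)
          _ = _ := by ring
      calc _ ≤ Kg * (K * ((1 + Bv) * ‖(s, y) - (t, z)‖)) := h1.trans (by gcongr; exact h2.trans (by gcongr))
        _ ≤ B * ‖(s, y) - (t, z)‖ + Kg * (K * ((1 + Bv) * ‖(s, y) - (t, z)‖)) := le_add_of_nonneg_left (by positivity)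
        _ = _ := by ring
    · have h0 : g (flow V F s 0 y) = 0 := by
        by_contra h
        exact hy ((hsupp s y hs h).trans (by linarith))
      have h1 : 1 ≤ ‖(s, y) - (t, z)‖ := by
        have := norm_sub_norm_le y z
        linarith
      rw [h0, zero_sub, abs_neg]
      calc _ ≤ B * 1 := by rw [mul_one]; exact hB _
        _ ≤ (B + Kg * K * (1 + Bv)) * ‖(s, y) - (t, z)‖ := by
          gcongr
          exact le_add_of_nonneg_right (by positivity)
  refine ⟨B + Kg * K * (1 + Bv), R, by positivity, hR, fun s t y z hs ht => ?_, hsupp⟩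
  by_cases hz : g (flow V F t 0 z) = 0
  · by_cases hy : g (flow V F s 0 y) = 0
    · rw [hy, hz, sub_zero, abs_zero]; positivity
    · rw [abs_sub_comm, norm_sub_rev]
      exact main t s z y ht hs hy
  · exact main s t y z hs ht hz

theorem continuous_comp_flow : Continuous fun p : ℝ × Phase d => g (flow V F p.1 0 p.2) := by
  refine continuous_iff_continuousAt.2 fun p => ?_
  obtain ⟨C, R, hC, hR, h, -⟩ := exists_lipschitz_comp_flow hV hF hg hgc (|p.1| + 1) (by positivity)
  refine continuousAt_of_locally_lipschitz one_pos C fun q hq => ?_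
  rw [dist_eq_norm] at hq ⊢
  have h1 : |q.1 - p.1| ≤ ‖q - p‖ := norm_fst_le (q - p)
  exact h q.1 p.1 q.2 p.2 (by linarith [abs_sub_abs_le_abs_sub q.1 p.1]) (by linarith)

theorem exists_smooth_approx {A : ℝ} (hA : 0 ≤ A) {η : ℝ} (hη : 0 < η) :
    ∃ φ : ℝ × Phase d → ℝ, ContDiff ℝ (⊤ : ℕ∞) φ ∧ (∃ R, ∀ t z, |t| ≤ A → R < ‖z‖ → φ (t, z) = 0) ∧
      ∀ t z, |t| ≤ A → |φ (t, z) - g (flow V F t 0 z)| ≤ η ∧ |along V F φ (t, z)| ≤ η := by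
  obtain ⟨C, R, hC, hR, hlip, hsupp⟩ := exists_lipschitz_comp_flow hV hF hg hgc (A + 1) (by positivity)
  obtain ⟨CΘ, hCΘ, hmoll⟩ := exists_mollifier (ℝ × Phase d)
  set u : ℝ × Phase d → ℝ := fun p => g (flow V F p.1 0 p.2) with hu
  have huc : Continuous u := continuous_comp_flow hV hF hg hgc
  set b : ℝ × Phase d → ℝ × Phase d := fun p => (1, vfield V F p.1 p.2) with hb
  have hbc : Continuous b := continuous_const.prodMk (continuous_vfield hV hF.continuous)
  set ω := η / (C * CΘ + 1) with hω
  have hω0 : 0 < ω := by positivity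
  have hK : IsCompact (Icc (-(A + 1)) (A + 1) ×ˢ closedBall (0 : Phase d) (R + 1)) := isCompact_Icc.prod (isCompact_closedBall _ _)
  obtain ⟨δ, hδ, hunif⟩ := Metric.uniformContinuousOn_iff.1 (hK.uniformContinuousOn_of_continuous hbc.continuousOn) ω hω0
  set ε := min (min 1 (δ / 2)) (η / (C + 1)) with hε
  have hε0 : 0 < ε := by positivity
  have hε1 : ε ≤ 1 := (min_le_left _ _).trans (min_le_left _ _)
  have hεδ : ε < δ := ((min_le_left _ _).trans (min_le_right _ _)).trans_lt (by linarith)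
  have hεη : C * ε ≤ η := by
    calc C * ε ≤ C * (η / (C + 1)) := by gcongr; exact min_le_right _ _
      _ ≤ η := by rw [← mul_div_assoc, div_le_iff₀ (by positivity)]; nlinarith
  obtain ⟨Θ, hΘ, hΘ0, hΘ1, hΘs, hΘd⟩ := hmoll ε hε0
  have hnear : ∀ p y : ℝ × Phase d, |p.1| ≤ A → ‖y - p‖ ≤ ε → |y.1| ≤ A + 1 := fun p y hp hy => by
    have h1 : |y.1 - p.1| ≤ ε := (norm_fst_le (y - p)).trans hy
    have := abs_sub_abs_le_abs_sub y.1 p.1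
    linarith
  refine ⟨Θ ⋆[ContinuousLinearMap.lsmul ℝ ℝ, volume] u, hΘ.2.contDiff_convolution_left _ hΘ.1 huc.locallyIntegrable,
    ⟨R + 1, fun t z ht hz => ?_⟩, fun t z ht => ⟨?_, ?_⟩⟩
  · refine abs_eq_zero.1 (le_antisymm ?_ (abs_nonneg _))
    refine abs_convolution_le hΘ.1.continuous hΘ.2 hΘ0 hΘ1 hΘs (t, z) (ae_of_all _ fun y hy => ?_)
    rw [mem_ball_iff_norm] at hy
    have h1 : u y = 0 := by
      by_contra h
      have h2 := hsupp y.1 y.2 (hnear (t, z) y ht hy.le) h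
      have h3 : ‖y.2 - z‖ < ε := (norm_snd_le (y - (t, z))).trans_lt hy
      have h4 := norm_sub_norm_le z y.2
      rw [norm_sub_rev] at h4
      linarith
    rw [h1, abs_zero]
  · rw [← Real.dist_eq]
    refine dist_convolution_le hη.le hΘs hΘ0 hΘ1 huc.aestronglyMeasurable fun y hy => ?_
    rw [mem_ball_iff_norm] at hy
    rw [Real.dist_eq]
    refine (hlip y.1 t y.2 z (hnear (t, z) y ht hy.le) (by linarith)).trans (le_trans ?_ hεη)
    exact mul_le_mul_of_nonneg_left hy.le hC
  · refine (abs_fderiv_convolution_le (b := b) (ε := ε) (a := C * ε * ω) hΘ huc hbc hΘs (t, z) (fun ψ hψ => ?_) (fun y hy => ?_)).trans ?_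
    · exact integral_along_comp_flow hV hF (g := fun y => g y - u (t, z)) (hg.continuous.sub continuous_const) hψ (huc.sub continuous_const)
    · have hyA := hnear (t, z) y ht hy
      have h1 : |u y - u (t, z)| ≤ C * ε := (hlip y.1 t y.2 z hyA (by linarith)).trans (mul_le_mul_of_nonneg_left hy hC)
      by_cases h0 : u y = 0 ∧ u (t, z) = 0
      · rw [h0.1, h0.2, sub_zero, abs_zero, zero_mul]; positivity
      · have h2 : ‖y.2 - z‖ ≤ ε := (norm_snd_le (y - (t, z))).trans hy
        have h3 := norm_sub_norm_le z y.2
        have h4 := norm_sub_norm_le y.2 z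
        rw [norm_sub_rev] at h3
        have h5 : ‖y.2‖ ≤ R + 1 ∧ ‖z‖ ≤ R + 1 := by
          rw [not_and_or] at h0
          rcases h0 with h0 | h0
          · have := hsupp y.1 y.2 hyA h0
            exact ⟨by linarith, by linarith⟩
          · have := hsupp t z (by linarith) h0
            exact ⟨by linarith, by linarith⟩
        have h6 := hunif (t, z) ⟨abs_le.1 (by linarith : |t| ≤ A + 1), by simpa using h5.2⟩ y
          ⟨abs_le.1 hyA, by simpa using h5.1⟩ (by rw [dist_eq_norm, norm_sub_rev]; linarith)
        rw [dist_eq_norm] at h6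
        exact mul_le_mul h1 h6.le (norm_nonneg _) (by positivity)
    · calc C * ε * ω * ∫ x, ‖fderiv ℝ Θ x‖ ≤ C * ε * ω * (CΘ / ε) := by gcongr
        _ = (C * CΘ) * ω := by field_simp
        _ ≤ η := by rw [hω, ← mul_div_assoc, div_le_iff₀ (by positivity)]; nlinarith

end

theorem eq_transport_of_weak (hT : 0 < T) {f₀ : Density d} {f : ℝ → Density d} (hf : ContinuousOn f (Icc 0 T))
    (hw : ∀ φ : ℝ × Phase d → ℝ, IsTest φ → tsupport φ ⊆ Iio T ×ˢ univ → (∫ t in Icc 0 T, ∫ z, f t z * along V F φ (t, z)) + ∫ z, f₀ z * φ (0, z) = 0) :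
    ∀ t ∈ Icc 0 T, f t = transport hV hF f₀ t := by
  have key : ∀ g : Phase d → ℝ, IsTest g → ∀ t ∈ Icc 0 T, ∫ z, f t z * g (flow V F t 0 z) = ∫ z, f₀ z * g z := by
    intro g hg
    obtain ⟨Kg, hKg⟩ := (hg.1.of_le (m := 1) (by norm_cast)).lipschitzWith_of_hasCompactSupport hg.2 one_ne_zero
    have huc := continuous_comp_flow hV hF hKg hg.2
    obtain ⟨Bg, hBg⟩ := hg.1.continuous.bounded_above_of_compact_support hg.2
    have hm : ContinuousOn (fun t => ∫ z, f t z * g (flow V F t 0 z)) (Icc 0 T) := continuousOn_integral_mul hf (w := fun t z => g (flow V F t 0 z))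
        (fun t => huc.along_snd)
        (fun z => huc.along_fst.continuousOn) (B := Bg) (fun t _ x => hBg _)
    have := eq_add_integral_of_test hT (k := fun _ => 0) (m₀ := ∫ z, f₀ z * g z) hm continuousOn_const ?_
    · simpa using this
    intro χ hχ hχT
    obtain ⟨B₁, hB₁⟩ := hχ.1.continuous.bounded_above_of_compact_support hχ.2
    have hχ' : Continuous (deriv χ) := hχ.1.continuous_deriv (by norm_cast)
    obtain ⟨B₂, hB₂⟩ := hχ'.bounded_above_of_compact_support hχ.2.deriv
    obtain ⟨Bf, hBf⟩ := isCompact_Icc.exists_bound_of_continuousOn hf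
    obtain ⟨A, hA⟩ := (hχ.2.isCompact.isBounded).subset_closedBall 0
    have hB₁0 : 0 ≤ B₁ := (norm_nonneg _).trans (hB₁ 0)
    have hB₂0 : 0 ≤ B₂ := (norm_nonneg _).trans (hB₂ 0)
    have hBf0 : 0 ≤ Bf := (norm_nonneg _).trans (hBf 0 ⟨le_rfl, hT.le⟩)
    set A' := max A T with hA'
    have hA'0 : 0 ≤ A' := hT.le.trans (le_max_right _ _)
    have main : ∀ η > 0, |(∫ t in Icc 0 T, (deriv χ t * ∫ z, f t z * g (flow V F t 0 z))) + χ 0 * ∫ z, f₀ z * g z|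
        ≤ ((B₂ + B₁) * Bf * T + B₁ * ‖f₀‖) * η := by
      intro η hη
      obtain ⟨φ, hφ, ⟨R, hφR⟩, happ⟩ := exists_smooth_approx hV hF hKg hg.2 hA'0 hη
      set ψ : ℝ × Phase d → ℝ := fun p => χ p.1 * φ p with hψ
      have hψK : ∀ p, p ∉ tsupport χ ×ˢ closedBall (0 : Phase d) R → ψ p = 0 := by
        rintro ⟨t, z⟩ hp
        by_cases ht : t ∈ tsupport χ
        · have hz : R < ‖z‖ := by
            by_contra h
            exact hp ⟨ht, by simpa using not_lt.1 h⟩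
          have htA : |t| ≤ A' := by
            have := hA ht
            rw [mem_closedBall_zero_iff] at this
            exact this.trans (le_max_left _ _)
          simp [hψ, hφR t z htA hz]
        · simp [hψ, image_eq_zero_of_notMem_tsupport ht]
      have hKc : IsCompact (tsupport χ ×ˢ closedBall (0 : Phase d) R) := hχ.2.isCompact.prod (isCompact_closedBall _ _)
      have hψt : IsTest ψ := ⟨(hχ.1.comp contDiff_fst).mul hφ, HasCompactSupport.intro hKc fun p hp => hψK p hp⟩
      have hψs : tsupport ψ ⊆ Iio T ×ˢ univ := by
        refine (closure_minimal (fun p hp => ?_) hKc.isClosed).trans (prod_mono hχT (subset_univ _))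
        by_contra h
        exact hp (hψK p h)
      have hal : ∀ t z, along V F ψ (t, z) = deriv χ t * φ (t, z) + χ t * along V F φ (t, z) := by
        intro t z
        have h1 : HasFDerivAt (fun p : ℝ × Phase d => χ p.1)
            ((ContinuousLinearMap.toSpanSingleton ℝ (deriv χ t)).comp (ContinuousLinearMap.fst ℝ ℝ (Phase d))) (t, z) := by
          have := ((hχ.1.differentiable (by simp)) t).hasDerivAt.hasFDerivAt
          exact this.comp (t, z) hasFDerivAt_fst
        have h2 := h1.mul ((hφ.differentiable (by simp)) (t, z)).hasFDerivAt
        rw [along, show ψ = (fun p : ℝ × Phase d => χ p.1) * φ from rfl, h2.fderiv]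
        simp [along]
        ring
      have h0 := hw ψ hψt hψs
      have hacψ := continuous_along hV hF (hψt.1.of_le (m := 1) (by norm_cast))
      obtain ⟨Bψ, hBψ⟩ := hacψ.bounded_above_of_compact_support (hψt.2.mono' fun p hp => by by_contra h; exact hp (along_eq_zero h))
      have hc2 : ContinuousOn (fun t => ∫ z, f t z * along V F ψ (t, z)) (Icc 0 T) :=
        continuousOn_integral_mul hf (w := fun t z => along V F ψ (t, z)) (fun t => hacψ.along_snd)
          (fun z => hacψ.along_fst.continuousOn) (B := Bψ) (fun t _ x => hBψ _)
      have e1 : (∫ t in Icc 0 T, (deriv χ t * ∫ z, f t z * g (flow V F t 0 z))) + χ 0 * ∫ z, f₀ z * g z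
          = (∫ t in Icc 0 T, ∫ z, f t z * (deriv χ t * g (flow V F t 0 z) - along V F ψ (t, z))) + ∫ z, f₀ z * (χ 0 * (g z - φ (0, z))) := by
        have e2 : ∀ t, ∫ z, f t z * (deriv χ t * g (flow V F t 0 z) - along V F ψ (t, z))
            = (deriv χ t * ∫ z, f t z * g (flow V F t 0 z)) - ∫ z, f t z * along V F ψ (t, z) := fun t => by
          rw [← integral_const_mul, ← integral_sub]
          · refine integral_ext fun z => ?_
            ring
          · exact (integrable_mul_of_bounded (f t) huc.along_snd (fun x => hBg _)).const_mul _
          · exact integrable_mul_of_bounded (f t) hacψ.along_snd (fun x => hBψ _)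
        have e3 : ∫ z, f₀ z * (χ 0 * (g z - φ (0, z))) = χ 0 * (∫ z, f₀ z * g z) - ∫ z, f₀ z * ψ (0, z) := by
          obtain ⟨B, hB⟩ := hψt.1.continuous.bounded_above_of_compact_support hψt.2
          rw [← integral_const_mul, ← integral_sub]
          · refine integral_ext fun z => ?_
            simp only [hψ]; ring
          · exact (integrable_mul_of_bounded f₀ hg.1.continuous hBg).const_mul _
          · exact integrable_mul_of_bounded f₀ hψt.1.continuous.along_snd (fun x => hB _)
        simp only [e2]
        rw [integral_sub (f := fun t => deriv χ t * ∫ z, f t z * g (flow V F t 0 z)) ((hχ'.continuousOn.mul hm).integrableOn_compact isCompact_Icc)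
          (hc2.integrableOn_compact isCompact_Icc), e3]
        linarith
      rw [e1]
      have htA' : ∀ t ∈ Icc 0 T, |t| ≤ A' := fun t ht => by rw [abs_of_nonneg ht.1]; exact ht.2.trans (le_max_right _ _)
      have b1 : ‖∫ t in Icc 0 T, ∫ z, f t z * (deriv χ t * g (flow V F t 0 z) - along V F ψ (t, z))‖
          ≤ (B₂ + B₁) * η * Bf * volume.real (Icc 0 T) := by
        refine norm_setIntegral_le_of_norm_le_const isCompact_Icc.measure_lt_top fun t ht => ?_
        refine (abs_integral_mul_le (f t) (B := (B₂ + B₁) * η) fun z => ?_).trans (by gcongr; exact hBf t ht)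
        obtain ⟨a1, a2⟩ := happ t z (htA' t ht)
        rw [hal, show deriv χ t * g (flow V F t 0 z) - (deriv χ t * φ (t, z) + χ t * along V F φ (t, z))
          = -(deriv χ t * (φ (t, z) - g (flow V F t 0 z)) + χ t * along V F φ (t, z)) by ring, abs_neg, add_mul]
        refine (abs_add_le _ _).trans ?_
        rw [abs_mul, abs_mul]
        gcongr
        · exact hB₂ t
        · exact hB₁ t
      have b2 : |∫ z, f₀ z * (χ 0 * (g z - φ (0, z)))| ≤ B₁ * η * ‖f₀‖ := by
        refine abs_integral_mul_le f₀ fun z => ?_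
        rw [abs_mul]
        have := (happ 0 z (by simpa using hA'0)).1
        rw [flow_self hV hF, abs_sub_comm] at this
        gcongr
        exact hB₁ 0
      rw [Real.norm_eq_abs, Real.volume_real_Icc_of_le hT.le, sub_zero] at b1
      refine (abs_add_le _ _).trans ((add_le_add b1 b2).trans_eq (by ring))
    simp only [mul_zero, add_zero]
    set X := |(∫ t in Icc 0 T, (deriv χ t * ∫ z, f t z * g (flow V F t 0 z))) + χ 0 * ∫ z, f₀ z * g z| with hX
    set D := (B₂ + B₁) * Bf * T + B₁ * ‖f₀‖ with hD
    have hX0 : X ≤ 0 := by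
      refine le_of_forall_pos_le_add fun e he => ?_
      have hD0 : 0 ≤ D := by positivity
      calc X ≤ D * (e / (D + 1)) := main _ (by positivity)
        _ ≤ 0 + e := by rw [zero_add, ← mul_div_assoc, div_le_iff₀ (by positivity)]; nlinarith
    exact abs_eq_zero.1 (le_antisymm hX0 (abs_nonneg _))
  intro t ht
  have hmp := measurePreserving_flow hV hF 0 t
  have hi : Integrable (fun z => f t (flow V F 0 t z)) := hmp.integrable_comp_of_integrable (L1.integrable_coeFn (f t))
  have hae : ∀ᵐ z, f t (flow V F 0 t z) = f₀ z := by
    refine ae_eq_of_integral_contDiff_smul_eq hi.locallyIntegrable (L1.integrable_coeFn f₀).locallyIntegrable fun g hg hgc => ?_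
    have h1 := key g ⟨hg, hgc⟩ t ht
    rw [← integral_comp_flow' hV hF _ 0 t] at h1
    simp only [flow_inv hV hF] at h1
    simpa only [smul_eq_mul, mul_comm] using h1
  refine Lp.ext ?_
  filter_upwards [transport_ae_eq hV hF f₀ t, (measurePreserving_flow hV hF t 0).quasiMeasurePreserving.ae hae] with z h1 h2
  rw [h1, ← h2, flow_inv hV hF]

end

section LpCurves

variable {X : Type*} [MeasurableSpace X] {μ : Measure X} {G : Type*} [NormedAddCommGroup G]

variable {k : X → ℝ}

theorem tendsto_Lp_two_of_dominated {ι : Type*} {l : Filter ι} [l.IsCountablyGenerated] {u : ι → Lp G 2 μ} {v : Lp G 2 μ} {F : ι → X → G}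
    (hk : MemLp k 2 μ) (hu : ∀ᶠ i in l, u i =ᵐ[μ] F i) (hb : ∀ᶠ i in l, ∀ᵐ x ∂μ, ‖F i x - v x‖ ≤ k x)
    (hlim : ∀ᵐ x ∂μ, Tendsto (fun i => F i x) l (𝓝 (v x))) : Tendsto u l (𝓝 v) := by
  rw [Lp.tendsto_Lp_iff_tendsto_eLpNorm']
  have h2 : ((2 : ℝ≥0∞)).toReal = 2 := by simp
  have e : ∀ w : X → G, eLpNorm w 2 μ = (∫⁻ x, ‖w x‖ₑ ^ (2:ℝ) ∂μ) ^ (1 / 2 : ℝ) := fun w => by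
    rw [eLpNorm_eq_lintegral_rpow_enorm_toReal two_ne_zero ENNReal.ofNat_ne_top, h2]
  have h0 : Tendsto (fun i => ∫⁻ x, ‖(u i - v : X → G) x‖ₑ ^ (2:ℝ) ∂μ) l (𝓝 (∫⁻ _, 0 ∂μ)) := by
    have h1 : Tendsto (fun i => ∫⁻ x, ‖F i x - v x‖ₑ ^ (2:ℝ) ∂μ) l (𝓝 (∫⁻ _, 0 ∂μ)) := by
      refine tendsto_lintegral_filter_of_dominated_convergence' (fun x => ‖k x‖ₑ ^ (2:ℝ)) ?_ ?_ ?_ ?_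
      · filter_upwards [hu] with i hi
        exact (((Lp.aestronglyMeasurable (u i)).congr hi).sub (Lp.aestronglyMeasurable v)).enorm.pow_const _
      · filter_upwards [hb] with i hi
        filter_upwards [hi] with x hx
        refine ENNReal.rpow_le_rpow ?_ two_pos.le
        rw [enorm_le_iff_norm_le]
        exact hx.trans (le_abs_self _)
      · have := hk.2
        rw [eLpNorm_eq_lintegral_rpow_enorm_toReal two_ne_zero ENNReal.ofNat_ne_top, h2, ENNReal.rpow_lt_top_iff_of_pos (by norm_num)] at this
        exact this.ne
      · filter_upwards [hlim] with x hx
        have h3 : Tendsto (fun i => ‖F i x - v x‖ₑ) l (𝓝 0) := by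
          have := (hx.sub_const (v x)).enorm
          simpa using this
        have := (ENNReal.continuous_rpow_const (y := 2)).tendsto 0 |>.comp h3
        simpa [Function.comp_def] using this
    refine h1.congr' ?_
    filter_upwards [hu] with i hi
    refine lintegral_congr_ae ?_
    filter_upwards [hi] with x hx
    simp [hx]
  simp only [e]
  have := (ENNReal.continuous_rpow_const (y := 1 / 2)).tendsto _ |>.comp h0
  simpa [Function.comp_def] using this

theorem hasDerivAt_Lp_two [NormedSpace ℝ G] {u : ℝ → Lp G 2 μ} {u' : Lp G 2 μ} {F F' : ℝ → X → G} {t ε : ℝ} (hε : 0 < ε) (hk : MemLp k 2 μ)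
    (hu : ∀ τ ∈ ball t ε, u τ =ᵐ[μ] F τ) (hu' : u' =ᵐ[μ] F' t)
    (hd : ∀ᵐ x ∂μ, ∀ τ ∈ ball t ε, HasDerivAt (fun τ => F τ x) (F' τ x) τ ∧ ‖F' τ x‖ ≤ k x) : HasDerivAt u u' t := by
  rw [hasDerivAt_iff_tendsto_slope]
  have ht : t ∈ ball t ε := mem_ball_self hε
  have hnear : ∀ᶠ τ in 𝓝[≠] t, τ ∈ ball t ε := nhdsWithin_le_nhds (ball_mem_nhds t hε)
  refine tendsto_Lp_two_of_dominated (F := fun τ x => slope (fun τ => F τ x) t τ) (k := fun x => 2 * k x) (hk.const_mul 2) ?_ ?_ ?_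
  · filter_upwards [hnear] with τ hτ
    filter_upwards [hu τ hτ, hu t ht, Lp.coeFn_smul (τ - t)⁻¹ (u τ - u t), Lp.coeFn_sub (u τ) (u t)] with x h1 h2 h3 h4
    rw [slope_def_module, h3, Pi.smul_apply, h4, Pi.sub_apply, h1, h2, slope_def_module]
  · filter_upwards [hnear, self_mem_nhdsWithin] with τ hτ hne
    filter_upwards [hd, hu'] with x hx hx'
    have h1 : ‖F τ x - F t x‖ ≤ k x * ‖τ - t‖ := (convex_ball t ε).norm_image_sub_le_of_norm_hasDerivWithin_le
        (fun r hr => (hx r hr).1.hasDerivWithinAt) (fun r hr => (hx r hr).2) ht hτ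
    have h2 : ‖slope (fun τ => F τ x) t τ‖ ≤ k x := by
      rw [slope_def_module, norm_smul, norm_inv]
      have : 0 < ‖τ - t‖ := norm_pos_iff.2 (sub_ne_zero.2 hne)
      rwa [inv_mul_le_iff₀ this, mul_comm]
    rw [hx']
    linarith [norm_sub_le (slope (fun τ => F τ x) t τ) (F' t x), (hx t ht).2]
  · filter_upwards [hd, hu'] with x hx hx'
    rw [hx']
    exact hasDerivAt_iff_tendsto_slope.1 (hx t ht).1

end LpCurves

section Mult

variable {X : Type*} [MeasurableSpace X] {μ : Measure X}

variable {m : X → ℝ} {h : Lp ℂ 2 μ} {K t : ℝ}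

open Classical in
/-- Multiplication by a real function on `L²`, extended by zero outside of its domain. -/
def mult (m : X → ℝ) (h : Lp ℂ 2 μ) : Lp ℂ 2 μ :=
  if H : MemLp (fun x => m x • h x) 2 μ then H.toLp _ else 0

theorem mult_ae (H : MemLp (fun x => m x • h x) 2 μ) : mult m h =ᵐ[μ] fun x => m x • h x := by rw [mult, dif_pos H]; exact H.coeFn_toLp

section
variable (hm : Measurable m) (hK : ∀ x, |m x| ≤ K)
include hm hK

theorem memLp_mult (h : Lp ℂ 2 μ) : MemLp (fun x => m x • h x) 2 μ := by
  refine MemLp.of_le_mul (c := K) (Lp.memLp h) (hm.aestronglyMeasurable.smul (Lp.aestronglyMeasurable h)) (ae_of_all _ fun x => ?_)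
  rw [norm_smul]
  exact mul_le_mul_of_nonneg_right (hK x) (norm_nonneg _)

theorem mult_ae_of_bound (h : Lp ℂ 2 μ) : mult m h =ᵐ[μ] fun x => m x • h x := mult_ae (memLp_mult hm hK h)

theorem norm_mult_le (h : Lp ℂ 2 μ) : ‖mult m h‖ ≤ K * ‖h‖ := by
  refine Lp.norm_le_mul_norm_of_ae_le_mul ?_
  filter_upwards [mult_ae_of_bound hm hK h] with x hx
  rw [hx, norm_smul]
  exact mul_le_mul_of_nonneg_right (hK x) (norm_nonneg _)

theorem mult_add (g h : Lp ℂ 2 μ) : mult m (g + h) = mult m g + mult m h := by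
  refine Lp.ext ?_
  filter_upwards [mult_ae_of_bound hm hK g, mult_ae_of_bound hm hK h, mult_ae_of_bound hm hK (g + h),
    Lp.coeFn_add g h, Lp.coeFn_add (mult m g) (mult m h)] with x h1 h2 h3 h4 h5
  rw [h3, h5, Pi.add_apply, h1, h2, h4, Pi.add_apply, smul_add]

theorem mult_smul (a : ℝ) (h : Lp ℂ 2 μ) : mult m (a • h) = a • mult m h := by
  refine Lp.ext ?_
  filter_upwards [mult_ae_of_bound hm hK h, mult_ae_of_bound hm hK (a • h), Lp.coeFn_smul a h, Lp.coeFn_smul a (mult m h)] with x h2 h3 h4 h5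
  rw [h3, h5, Pi.smul_apply, h2, h4, Pi.smul_apply, smul_comm]

end

def multL (m : X → ℝ) (hm : Measurable m) (K : ℝ) (hK : ∀ x, |m x| ≤ K) : Lp ℂ 2 μ →L[ℝ] Lp ℂ 2 μ :=
  LinearMap.mkContinuous ⟨⟨mult m, mult_add hm hK⟩, mult_smul hm hK⟩ K (norm_mult_le hm hK)

@[simp] theorem multL_apply (m : X → ℝ) (hm : Measurable m) (K : ℝ) (hK : ∀ x, |m x| ≤ K) (h : Lp ℂ 2 μ) : multL m hm K hK h = mult m h := rfl

theorem mult_sub (hm : Measurable m) (hK : ∀ x, |m x| ≤ K) (g h : Lp ℂ 2 μ) : mult m (g - h) = mult m g - mult m h := by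
  simpa using map_sub (multL (μ := μ) m hm K hK) g h

theorem inner_mult {g : Lp ℂ 2 μ} (hg : MemLp (fun x => m x • g x) 2 μ) (hh : MemLp (fun x => m x • h x) 2 μ) :
    inner ℂ (mult m g) h = inner ℂ g (mult m h) := by
  rw [L2.inner_def, L2.inner_def]
  refine integral_congr_ae ?_
  filter_upwards [mult_ae hg, mult_ae hh] with x h1 h2
  rw [h1, h2, inner_smul_right_eq_smul, inner_smul_left_eq_smul]

/-- Families of multipliers that are continuous in time and locally bounded in time. -/
structure IsMultiplier (m : ℝ → X → ℝ) : Prop where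
  measurable : ∀ t, Measurable (m t)
  continuous : ∀ x, Continuous fun t => m t x
  bound : ∀ T, ∃ K, 0 ≤ K ∧ ∀ t, |t| ≤ T → ∀ x, |m t x| ≤ K

theorem IsMultiplier.exists_bound {m : ℝ → X → ℝ} (hm : IsMultiplier m) (t : ℝ) : ∃ K, 0 ≤ K ∧ ∀ x, |m t x| ≤ K := by
  obtain ⟨K, hK, h⟩ := hm.bound |t|
  exact ⟨K, hK, h t le_rfl⟩

theorem IsMultiplier.memLp {m : ℝ → X → ℝ} (hm : IsMultiplier m) (t : ℝ) (h : Lp ℂ 2 μ) : MemLp (fun x => m t x • h x) 2 μ :=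
  have ⟨_, _, hK⟩ := hm.exists_bound t
  memLp_mult (hm.measurable t) hK h

theorem IsMultiplier.ae {m : ℝ → X → ℝ} (hm : IsMultiplier m) (t : ℝ) (h : Lp ℂ 2 μ) :
    mult (m t) h =ᵐ[μ] fun x => m t x • h x := mult_ae (hm.memLp t h)

theorem IsMultiplier.tendsto {m : ℝ → X → ℝ} (hm : IsMultiplier m) (h : Lp ℂ 2 μ) (t : ℝ) :
    Tendsto (fun s => mult (m s) h) (𝓝 t) (𝓝 (mult (m t) h)) := by
  obtain ⟨K, hK, hb⟩ := hm.bound (|t| + 1)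
  refine tendsto_Lp_two_of_dominated (F := fun s x => m s x • h x) (k := fun x => 2 * K * ‖h x‖)
    ((Lp.memLp h).norm.const_mul _) (.of_forall fun s => hm.ae s h) ?_ ?_
  · filter_upwards [ball_mem_nhds t one_pos] with s hs
    filter_upwards [hm.ae t h] with x hx
    rw [mem_ball, Real.dist_eq] at hs
    have h1 : |s| ≤ |t| + 1 := by have := abs_sub_abs_le_abs_sub s t; linarith
    rw [hx, ← sub_smul, norm_smul]
    refine mul_le_mul_of_nonneg_right ?_ (norm_nonneg _)
    rw [Real.norm_eq_abs]
    linarith [abs_sub (m s x) (m t x), hb s h1 x, hb t (by linarith) x]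
  · filter_upwards [hm.ae t h] with x hx
    rw [hx]
    exact ((hm.continuous x).tendsto t).smul_const _

theorem IsMultiplier.tendsto_mult {m : ℝ → X → ℝ} (hm : IsMultiplier m) {h : ℝ → Lp ℂ 2 μ} {l : Filter ℝ} (hl : l ≤ 𝓝 t) {h₀ : Lp ℂ 2 μ}
    (hh : Tendsto h l (𝓝 h₀)) : Tendsto (fun s => mult (m s) (h s)) l (𝓝 (mult (m t) h₀)) := by
  obtain ⟨K, hK, hb⟩ := hm.bound (|t| + 1)
  have h1 := (hm.tendsto h₀ t).mono_left hl
  have h2 : Tendsto (fun s => mult (m s) (h s) - mult (m s) h₀) l (𝓝 0) := by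
    have h3 : Tendsto (fun s => K * ‖h s - h₀‖) l (𝓝 0) := by
      have := ((hh.sub_const h₀).norm).const_mul K
      simpa using this
    refine squeeze_zero_norm' ?_ h3
    filter_upwards [hl (ball_mem_nhds t one_pos)] with s hs
    rw [mem_ball, Real.dist_eq] at hs
    have h1 : |s| ≤ |t| + 1 := by have := abs_sub_abs_le_abs_sub s t; linarith
    rw [← mult_sub (hm.measurable s) (hb s h1)]
    exact norm_mult_le (hm.measurable s) (hb s h1) _
  simpa using h2.add h1

theorem IsMultiplier.continuous_mult {m : ℝ → X → ℝ} (hm : IsMultiplier m) {h : ℝ → Lp ℂ 2 μ} (hh : Continuous h) :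
    Continuous fun t => mult (m t) (h t) :=
  continuous_iff_continuousAt.2 fun t => hm.tendsto_mult le_rfl (hh.tendsto t)

theorem IsMultiplier.hasDerivAt_mult {m m' : ℝ → X → ℝ} (hm : IsMultiplier m) (hd : ∀ t x, HasDerivAt (fun t => m t x) (m' t x) t) {u : ℝ → Lp ℂ 2 μ}
    {u' w : Lp ℂ 2 μ} (hu : HasDerivAt u u' t) {k : X → ℝ} (hk : MemLp k 2 μ) (hb : ∀ᵐ x ∂μ, ∀ τ ∈ ball t 1, ‖m' τ x • u t x‖ ≤ k x)
    (hw : w =ᵐ[μ] fun x => m' t x • u t x) : HasDerivAt (fun s => mult (m s) (u s)) (mult (m t) u' + w) t := by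
  have h1 : HasDerivAt (fun s => mult (m s) (u t)) w t := by
    refine hasDerivAt_Lp_two (F := fun s x => m s x • u t x) (F' := fun s x => m' s x • u t x) one_pos hk (fun τ _ => hm.ae τ _) hw ?_
    filter_upwards [hb] with x hx τ hτ
    exact ⟨(hd τ x).smul_const _, hx τ hτ⟩
  have h2 : HasDerivAt (fun s => mult (m s) (u s - u t)) (mult (m t) u') t := by
    rw [hasDerivAt_iff_tendsto_slope] at hu ⊢
    refine (hm.tendsto_mult nhdsWithin_le_nhds hu).congr fun s => ?_
    obtain ⟨K, -, hK⟩ := hm.exists_bound s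
    obtain ⟨K', -, hK'⟩ := hm.exists_bound t
    have h0 : mult (m t) (u t - u t) = 0 := by rw [mult_sub (hm.measurable t) hK', sub_self]
    rw [slope_def_module, slope_def_module, h0, sub_zero, mult_smul (hm.measurable s) hK]
  refine (h2.add h1).congr_of_eventuallyEq (.of_forall fun s => ?_)
  obtain ⟨K, -, hK⟩ := hm.exists_bound s
  simp only [Pi.add_apply]
  rw [← mult_add (hm.measurable s) hK, sub_add_cancel]

end Mult

section Duhamel

variable {X : Type*} [MeasurableSpace X] {μ : Measure X} {ω : X → ℝ}

variable {g u : ℝ → Lp ℂ 2 μ} {q u' : Lp ℂ 2 μ} {t : ℝ}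

def cosM (ω : X → ℝ) (t : ℝ) (x : X) : ℝ := Real.cos (ω x * t)

def sinM (ω : X → ℝ) (t : ℝ) (x : X) : ℝ := t * Real.sinc (ω x * t)

def sinwM (ω : X → ℝ) (t : ℝ) (x : X) : ℝ := Real.sin (ω x * t)

theorem mul_sinM (ω : X → ℝ) (t : ℝ) (x : X) : ω x * sinM ω t x = sinwM ω t x := by
  unfold sinM sinwM
  by_cases h : ω x * t = 0
  · simp [h]
  · rw [Real.sinc_of_ne_zero h, ← mul_assoc, mul_div_cancel₀ _ h]

theorem abs_cosM_le (ω : X → ℝ) (t : ℝ) (x : X) : |cosM ω t x| ≤ 1 := Real.abs_cos_le_one _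

theorem abs_sinwM_le (ω : X → ℝ) (t : ℝ) (x : X) : |sinwM ω t x| ≤ 1 := Real.abs_sin_le_one _

theorem abs_sinM_le (ω : X → ℝ) (t : ℝ) (x : X) : |sinM ω t x| ≤ |t| := by
  rw [sinM, abs_mul]
  exact mul_le_of_le_one_right (abs_nonneg _) (Real.abs_sinc_le_one _)

theorem isMultiplier_cosM (hω : Measurable ω) : IsMultiplier (cosM ω) where
  measurable t := Real.measurable_cos.comp (hω.mul_const t)
  continuous x := by unfold cosM; fun_prop
  bound T := ⟨1, zero_le_one, fun t _ x => abs_cosM_le ω t x⟩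

theorem isMultiplier_sinwM (hω : Measurable ω) : IsMultiplier (sinwM ω) where
  measurable t := Real.measurable_sin.comp (hω.mul_const t)
  continuous x := by unfold sinwM; fun_prop
  bound T := ⟨1, zero_le_one, fun t _ x => abs_sinwM_le ω t x⟩

theorem isMultiplier_sinM (hω : Measurable ω) : IsMultiplier (sinM ω) where
  measurable t := (Real.continuous_sinc.measurable.comp (hω.mul_const t)).const_mul t
  continuous x := continuous_id.mul (Real.continuous_sinc.comp (continuous_const.mul continuous_id))
  bound T := ⟨|T|, abs_nonneg _, fun t ht x => (abs_sinM_le ω t x).trans (ht.trans (le_abs_self _))⟩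

theorem hasDerivAt_cosM (ω : X → ℝ) (t : ℝ) (x : X) : HasDerivAt (fun t => cosM ω t x) (-(ω x * sinwM ω t x)) t := by
  have := (Real.hasDerivAt_cos (ω x * t)).comp t ((hasDerivAt_id t).const_mul (ω x))
  simpa [cosM, sinwM, Function.comp_def, mul_comm] using this

theorem hasDerivAt_sinM (ω : X → ℝ) (t : ℝ) (x : X) : HasDerivAt (fun t => sinM ω t x) (cosM ω t x) t := by
  by_cases h : ω x = 0
  · simpa [sinM, cosM, h] using hasDerivAt_id' t
  · have h1 : (fun t => sinM ω t x) = fun t => (ω x)⁻¹ * Real.sin (ω x * t) := by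
      ext t; have := mul_sinM ω t x; rw [sinwM] at this; rw [← this, inv_mul_cancel_left₀ h]
    rw [h1]
    have := ((Real.hasDerivAt_sin (ω x * t)).comp t ((hasDerivAt_id t).const_mul (ω x))).const_mul (ω x)⁻¹
    simp only [mul_one] at this
    rw [mul_comm (Real.cos _), inv_mul_cancel_left₀ h] at this
    exact this

/-- The slowly varying cosine amplitude. -/
def duA (ω : X → ℝ) (a : Lp ℂ 2 μ) (g : ℝ → Lp ℂ 2 μ) (t : ℝ) : Lp ℂ 2 μ := a + ∫ s in 0..t, mult (sinM ω s) (g s)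

/-- The slowly varying sine amplitude. -/
def duB (ω : X → ℝ) (b : Lp ℂ 2 μ) (g : ℝ → Lp ℂ 2 μ) (t : ℝ) : Lp ℂ 2 μ := b - ∫ s in 0..t, mult (cosM ω s) (g s)

/-- The solution of `y'' + ω² y = -g`, `y(0) = a`, `y'(0) = b`. -/
def duY (ω : X → ℝ) (a b : Lp ℂ 2 μ) (g : ℝ → Lp ℂ 2 μ) (t : ℝ) : Lp ℂ 2 μ := mult (cosM ω t) (duA ω a g t) + mult (sinM ω t) (duB ω b g t)

section
variable (hω : Measurable ω)
include hω

theorem hasDerivAt_duA (a : Lp ℂ 2 μ) (hg : Continuous g) (t : ℝ) : HasDerivAt (duA ω a g) (mult (sinM ω t) (g t)) t := by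
  have hc := (isMultiplier_sinM hω).continuous_mult hg
  exact (intervalIntegral.integral_hasDerivAt_right (hc.intervalIntegrable _ _) (hc.stronglyMeasurableAtFilter _ _) hc.continuousAt).const_add a

theorem hasDerivAt_duB (b : Lp ℂ 2 μ) (hg : Continuous g) (t : ℝ) : HasDerivAt (duB ω b g) (-mult (cosM ω t) (g t)) t := by
  have hc := (isMultiplier_cosM hω).continuous_mult hg
  exact (intervalIntegral.integral_hasDerivAt_right (hc.intervalIntegrable _ _) (hc.stronglyMeasurableAtFilter _ _) hc.continuousAt).const_sub b

theorem continuous_duA (a : Lp ℂ 2 μ) (hg : Continuous g) :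
    Continuous (duA ω a g) := continuous_iff_continuousAt.2 fun t => (hasDerivAt_duA hω a hg t).continuousAt

theorem continuous_duB (b : Lp ℂ 2 μ) (hg : Continuous g) :
    Continuous (duB ω b g) := continuous_iff_continuousAt.2 fun t => (hasDerivAt_duB hω b hg t).continuousAt

theorem continuous_duY (a b : Lp ℂ 2 μ) (hg : Continuous g) : Continuous (duY ω a b g) :=
  ((isMultiplier_cosM hω).continuous_mult (continuous_duA hω a hg)).add ((isMultiplier_sinM hω).continuous_mult (continuous_duB hω b hg))

end

theorem duA_zero (a : Lp ℂ 2 μ) (g : ℝ → Lp ℂ 2 μ) : duA ω a g 0 = a := by simp [duA]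

theorem duB_zero (b : Lp ℂ 2 μ) (g : ℝ → Lp ℂ 2 μ) : duB ω b g 0 = b := by simp [duB]

theorem mult_cosM_zero (h : Lp ℂ 2 μ) (hω : Measurable ω) : mult (cosM ω 0) h = h := by
  refine Lp.ext ?_
  filter_upwards [(isMultiplier_cosM hω).ae 0 h] with x hx
  simp [hx, cosM]

theorem mult_sinM_zero (h : Lp ℂ 2 μ) (hω : Measurable ω) : mult (sinM ω 0) h = 0 := by
  refine Lp.ext ?_
  filter_upwards [(isMultiplier_sinM hω).ae 0 h, Lp.coeFn_zero ℂ 2 μ] with x hx h0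
  rw [hx, h0]; simp [sinM]

section
variable (hω : Measurable ω)
include hω

theorem inner_duY (a b : Lp ℂ 2 μ) (g : ℝ → Lp ℂ 2 μ) (t : ℝ) (h : Lp ℂ 2 μ) : inner ℂ (duY ω a b g t) h
      = inner ℂ (duA ω a g t) (mult (cosM ω t) h) + inner ℂ (duB ω b g t) (mult (sinM ω t) h) := by
  have hc := isMultiplier_cosM hω
  have hs := isMultiplier_sinM hω
  rw [duY, inner_add_left, inner_mult (hc.memLp t _) (hc.memLp t _), inner_mult (hs.memLp t _) (hs.memLp t _)]

theorem hasDerivAt_mult_sinM (hu : HasDerivAt u u' t) :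
    HasDerivAt (fun s => mult (sinM ω s) (u s)) (mult (sinM ω t) u' + mult (cosM ω t) (u t)) t := by
  refine (isMultiplier_sinM hω).hasDerivAt_mult (hasDerivAt_sinM ω) hu (k := fun x => ‖u t x‖)
    (Lp.memLp (u t)).norm (ae_of_all _ fun x τ _ => ?_) ((isMultiplier_cosM hω).ae t (u t))
  rw [norm_smul]
  exact mul_le_of_le_one_left (norm_nonneg _) (abs_cosM_le ω τ x)

theorem hasDerivAt_mult_cosM (hu : HasDerivAt u u' t) (hq : q =ᵐ[μ] fun x => ω x ^ 2 • u t x) :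
    HasDerivAt (fun s => mult (cosM ω s) (u s)) (mult (cosM ω t) u' + -mult (sinM ω t) q) t := by
  refine (isMultiplier_cosM hω).hasDerivAt_mult (hasDerivAt_cosM ω) hu (k := fun x => ‖u t x‖ + ‖q x‖)
    ((Lp.memLp (u t)).norm.add (Lp.memLp q).norm) ?_ ?_
  · filter_upwards [hq] with x hx τ _
    rw [hx, norm_smul, norm_smul, norm_neg, norm_mul, Real.norm_eq_abs, Real.norm_eq_abs, Real.norm_eq_abs, abs_pow, sq_abs, ← one_add_mul]
    refine mul_le_mul_of_nonneg_right ?_ (norm_nonneg _)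
    have h1 : |ω x| * |sinwM ω τ x| ≤ |ω x| * 1 := by gcongr; exact abs_sinwM_le ω τ x
    nlinarith [sq_nonneg (|ω x| - 1), sq_abs (ω x)]
  · filter_upwards [hq, (isMultiplier_sinM hω).ae t q, Lp.coeFn_neg (mult (sinM ω t) q)] with x h1 h2 h3
    rw [h3, Pi.neg_apply, h2, h1, ← mul_sinM, smul_smul, neg_smul]
    congr 2; ring

/-- The weak formulation of the equation satisfied by `duY`, differentiated in time. -/
theorem hasDerivAt_pairing (a b : Lp ℂ 2 μ) (hg : Continuous g) {p p₁ p₂ q q₁ : ℝ → Lp ℂ 2 μ} (hp : HasDerivAt p (p₁ t) t)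
    (hp₁ : HasDerivAt p₁ (p₂ t) t) (hq : HasDerivAt q (q₁ t) t) (hqp : q t =ᵐ[μ] fun x => ω x ^ 2 • p t x)
    (hqp₁ : q₁ t =ᵐ[μ] fun x => ω x ^ 2 • p₁ t x) : HasDerivAt (fun t => inner ℂ (duA ω a g t) (mult (cosM ω t) (p₁ t) + mult (sinM ω t) (q t))
        + inner ℂ (duB ω b g t) (mult (sinM ω t) (p₁ t) - mult (cosM ω t) (p t)))
      (inner ℂ (duY ω a b g t) (p₂ t + q t) + inner ℂ (g t) (p t)) t := by
  have hc := isMultiplier_cosM hω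
  have hs := isMultiplier_sinM hω
  obtain ⟨Kc, -, hKc⟩ := hc.exists_bound t
  obtain ⟨Ks, -, hKs⟩ := hs.exists_bound t
  have hP : HasDerivAt (fun t => mult (cosM ω t) (p₁ t) + mult (sinM ω t) (q t)) (mult (cosM ω t) (p₂ t + q t)) t := by
    refine ((hasDerivAt_mult_cosM hω hp₁ hqp₁).add (hasDerivAt_mult_sinM hω hq)).congr_deriv ?_
    rw [mult_add (hc.measurable t) hKc]; abel
  have hQ : HasDerivAt (fun t => mult (sinM ω t) (p₁ t) - mult (cosM ω t) (p t)) (mult (sinM ω t) (p₂ t + q t)) t := by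
    refine ((hasDerivAt_mult_sinM hω hp₁).sub (hasDerivAt_mult_cosM hω hp hqp)).congr_deriv ?_
    rw [mult_add (hs.measurable t) hKs]; abel
  refine (((hasDerivAt_duA hω a hg t).inner ℂ hP).add ((hasDerivAt_duB hω b hg t).inner ℂ hQ)).congr_deriv ?_
  rw [inner_duY hω, inner_neg_left, inner_mult (hs.memLp t _) (hs.memLp t _), inner_mult (hc.memLp t _) (hc.memLp t _)]
  have h1 : mult (sinM ω t) (mult (cosM ω t) (p₁ t) + mult (sinM ω t) (q t))
      - mult (cosM ω t) (mult (sinM ω t) (p₁ t) - mult (cosM ω t) (p t)) = p t := by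
    rw [mult_add (hs.measurable t) hKs, mult_sub (hc.measurable t) hKc]
    refine Lp.ext ?_
    set c1 := mult (cosM ω t) (p₁ t)
    set s1 := mult (sinM ω t) (q t)
    set s2 := mult (sinM ω t) (p₁ t)
    set c2 := mult (cosM ω t) (p t)
    filter_upwards [Lp.coeFn_sub (mult (sinM ω t) c1 + mult (sinM ω t) s1) (mult (cosM ω t) s2 - mult (cosM ω t) c2),
      Lp.coeFn_add (mult (sinM ω t) c1) (mult (sinM ω t) s1), Lp.coeFn_sub (mult (cosM ω t) s2) (mult (cosM ω t) c2),
      hs.ae t c1, hs.ae t s1, hc.ae t s2, hc.ae t c2, hc.ae t (p₁ t), hs.ae t (q t), hs.ae t (p₁ t), hc.ae t (p t), hqp]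
      with x e1 e2 e3 e4 e5 e6 e7 e8 e9 e10 e11 e12
    rw [e1, Pi.sub_apply, e2, e3, Pi.add_apply, Pi.sub_apply, e4, e5, e6, e7, e8, e9, e10, e11, e12]
    simp only [smul_smul]
    rw [mul_comm (sinM ω t x) (cosM ω t x), add_sub_sub_cancel, ← add_smul]
    have : sinM ω t x * (sinM ω t x * ω x ^ 2) + cosM ω t x * cosM ω t x = 1 := by
      rw [show sinM ω t x * (sinM ω t x * ω x ^ 2) = (ω x * sinM ω t x) ^ 2 by ring, mul_sinM, ← pow_two]
      exact Real.sin_sq_add_cos_sq _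
    rw [this, one_smul]
  have h2 := congrArg (fun w => (inner ℂ (g t) w : ℂ)) h1
  simp only [inner_sub_right] at h2
  rw [← h2]
  ring

/-- The pairing of `duY` with a regular element is differentiable. -/
theorem hasDerivAt_inner_duY (a b : Lp ℂ 2 μ) (hg : Continuous g) {h : Lp ℂ 2 μ} (hq : q =ᵐ[μ] fun x => ω x ^ 2 • h x) (t : ℝ) :
    HasDerivAt (fun t => inner ℂ (duY ω a b g t) h) (-inner ℂ (duA ω a g t) (mult (sinM ω t) q) + inner ℂ (duB ω b g t) (mult (cosM ω t) h)) t := by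
  have hc := isMultiplier_cosM hω
  have hs := isMultiplier_sinM hω
  obtain ⟨Kc, -, hKc⟩ := hc.exists_bound t
  obtain ⟨Ks, -, hKs⟩ := hs.exists_bound t
  have hz : ∀ m : ℝ → X → ℝ, IsMultiplier m → mult (m t) (0 : Lp ℂ 2 μ) = 0 := fun m hm => by
    obtain ⟨K, -, hK⟩ := hm.exists_bound t
    simpa using map_zero (multL (μ := μ) (m t) (hm.measurable t) K hK)
  have h1 := hasDerivAt_mult_cosM hω (hasDerivAt_const t h) hq
  have h2 := hasDerivAt_mult_sinM hω (hasDerivAt_const t h)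
  have h3 := ((hasDerivAt_duA hω a hg t).inner ℂ h1).add ((hasDerivAt_duB hω b hg t).inner ℂ h2)
  simp only [inner_duY hω]
  refine h3.congr_deriv ?_
  rw [hz _ hc, hz _ hs, zero_add, zero_add, inner_neg_right, inner_neg_left, inner_mult (hs.memLp t _) (hs.memLp t _),
    inner_mult (hc.memLp t _) (hc.memLp t _)]
  have h4 : mult (sinM ω t) (mult (cosM ω t) h) = mult (cosM ω t) (mult (sinM ω t) h) := by
    refine Lp.ext ?_
    filter_upwards [hs.ae t (mult (cosM ω t) h), hc.ae t (mult (sinM ω t) h), hs.ae t h, hc.ae t h] with x e1 e2 e3 e4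
    rw [e1, e2, e3, e4, smul_comm]
  rw [h4]
  ring

end

end Duhamel

abbrev Freq (d n : ℕ) := WithLp 2 (Rd d × Rd n)

abbrev Spec (d n : ℕ) := Lp ℂ 2 (volume : Measure (Freq d n))

variable {d n : ℕ}

variable {a : Rd d × Rd n → ℝ}

theorem measurePreserving_ofLp : MeasurePreserving (fun ζ : Freq d n => ζ.ofLp) volume volume := WithLp.volume_preserving_ofLp (Rd d) (Rd n)

theorem measurePreserving_toLp : MeasurePreserving (fun q : Rd d × Rd n => WithLp.toLp 2 q) volume volume :=
  WithLp.volume_preserving_toLp (Rd d) (Rd n)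

theorem integral_freq {G : Type*} [NormedAddCommGroup G] [NormedSpace ℝ G] (g : Rd d × Rd n → G) : ∫ ζ : Freq d n, g ζ.ofLp = ∫ q, g q :=
  measurePreserving_ofLp.integral_comp (MeasurableEquiv.toLp 2 (Rd d × Rd n)).symm.measurableEmbedding g

def complexify : WaveField d n →ₗᵢ[ℝ] Spec d n where
  toLinearMap := (Complex.ofRealCLM.compLpL 2 (volume : Measure (Freq d n))).toLinearMap ∘ₗ
    (Lp.compMeasurePreservingₗᵢ ℝ _ (measurePreserving_ofLp (d := d) (n := n))).toLinearMap
  norm_map' Ψ := by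
    have h1 : ‖Lp.compMeasurePreservingₗᵢ ℝ _ (measurePreserving_ofLp (d := d) (n := n)) Ψ‖ = ‖Ψ‖ := LinearIsometry.norm_map _ _
    rw [← h1]
    rw [Lp.norm_def, Lp.norm_def]
    refine congrArg _ (eLpNorm_congr_norm_ae (μ := volume) ?_)
    filter_upwards [ContinuousLinearMap.coeFn_compLp Complex.ofRealCLM
      (Lp.compMeasurePreservingₗᵢ ℝ _ (measurePreserving_ofLp (d := d) (n := n)) Ψ)] with x hx
    exact (congrArg norm hx).trans (by simp)

theorem complexify_ae (Ψ : WaveField d n) : complexify Ψ =ᵐ[volume] fun ζ => ((Ψ ζ.ofLp : ℝ) : ℂ) := by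
  filter_upwards [ContinuousLinearMap.coeFn_compLp Complex.ofRealCLM (Lp.compMeasurePreservingₗᵢ ℝ _ (measurePreserving_ofLp (d := d) (n := n)) Ψ),
      Lp.coeFn_compMeasurePreserving Ψ (measurePreserving_ofLp (d := d) (n := n))] with x h1 h2
  refine h1.trans ?_
  rw [Complex.ofRealCLM_apply]
  exact congrArg _ h2

def fourierField : WaveField d n →ₗᵢ[ℝ] Spec d n where
  toFun Ψ := 𝓕 (complexify Ψ)
  map_add' a b := by rw [map_add]; exact FourierAdd.fourier_add _ _
  map_smul' r a := by
    rw [map_smul]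
    exact map_smul ((Lp.fourierTransformₗᵢ (Freq d n) ℂ).toLinearEquiv.toLinearMap.restrictScalars ℝ) r _
  norm_map' Ψ := by
    change ‖𝓕 (complexify Ψ)‖ = _
    rw [Lp.norm_fourier_eq]; exact complexify.norm_map Ψ

theorem fourierField_apply (Ψ : WaveField d n) : fourierField Ψ = 𝓕 (complexify Ψ) := rfl

theorem inner_complexify (a b : WaveField d n) : inner ℂ (complexify a) (complexify b) = ((∫ q, a q * b q : ℝ) : ℂ) := by
  rw [L2.inner_def, ← integral_freq (fun q => a q * b q), ← integral_complex_ofReal]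
  refine integral_congr_ae ?_
  filter_upwards [complexify_ae a, complexify_ae b] with x h1 h2
  rw [h1, h2]
  simp [mul_comm]

theorem inner_fourierField (a b : WaveField d n) : inner ℂ (fourierField a) (fourierField b) = ((inner ℝ a b : ℝ) : ℂ) := by
  rw [fourierField_apply, fourierField_apply, Lp.inner_fourier_eq, inner_complexify, L2.inner_def]
  congr 1
  exact integral_congr_ae (ae_of_all _ fun x => by simp [mul_comm])

def reField : Spec d n →L[ℝ] WaveField d n :=
  (Lp.compMeasurePreservingₗᵢ ℝ _ (measurePreserving_toLp (d := d) (n := n))).toContinuousLinearMap ∘L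
    (Complex.reCLM.compLpL 2 (volume : Measure (Freq d n))) ∘L
      ((Lp.fourierTransformₗᵢ (Freq d n) ℂ).symm.toContinuousLinearEquiv.toContinuousLinearMap.restrictScalars ℝ)

def imField : Spec d n →L[ℝ] WaveField d n :=
  (Lp.compMeasurePreservingₗᵢ ℝ _ (measurePreserving_toLp (d := d) (n := n))).toContinuousLinearMap ∘L
    (Complex.imCLM.compLpL 2 (volume : Measure (Freq d n))) ∘L
      ((Lp.fourierTransformₗᵢ (Freq d n) ℂ).symm.toContinuousLinearEquiv.toContinuousLinearMap.restrictScalars ℝ)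

theorem reField_ae (y : Spec d n) : ∀ᵐ ζ : Freq d n, reField y ζ.ofLp = ((𝓕⁻ y : Spec d n) ζ).re := by
  have h1 := Lp.coeFn_compMeasurePreserving (Complex.reCLM.compLp (𝓕⁻ y : Spec d n)) (measurePreserving_toLp (d := d) (n := n))
  filter_upwards [measurePreserving_ofLp.quasiMeasurePreserving.ae h1, ContinuousLinearMap.coeFn_compLp Complex.reCLM (𝓕⁻ y : Spec d n)] with ζ h1 h2
  exact h1.trans h2

theorem imField_ae (y : Spec d n) : ∀ᵐ ζ : Freq d n, imField y ζ.ofLp = ((𝓕⁻ y : Spec d n) ζ).im := by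
  have h1 := Lp.coeFn_compMeasurePreserving (Complex.imCLM.compLp (𝓕⁻ y : Spec d n)) (measurePreserving_toLp (d := d) (n := n))
  filter_upwards [measurePreserving_ofLp.quasiMeasurePreserving.ae h1, ContinuousLinearMap.coeFn_compLp Complex.imCLM (𝓕⁻ y : Spec d n)] with ζ h1 h2
  exact h1.trans h2

theorem eq_fourierField_reField {y : Spec d n} (h : imField y = 0) : y = fourierField (reField y) := by
  have h1 : complexify (reField y) = 𝓕⁻ y := by
    refine Lp.ext ?_
    have h0 := measurePreserving_ofLp.quasiMeasurePreserving.ae (Lp.coeFn_zero ℝ 2 (volume : Measure (Rd d × Rd n)))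
    filter_upwards [complexify_ae (reField y), reField_ae y, imField_ae y, h0] with ζ e1 e2 e3 e4
    rw [e1, e2]
    apply Complex.ext
    · simp
    · rw [← e3, h]
      simp only [Complex.ofReal_im]
      exact e4.symm
  rw [fourierField_apply, h1]
  exact (FourierInvPair.fourier_fourierInv_eq y).symm

theorem inner_fourierField_right (y : Spec d n) (b : WaveField d n) :
    inner ℂ y (fourierField b) = ((inner ℝ (reField y) b : ℝ) : ℂ) - (inner ℝ (imField y) b : ℝ) * Complex.I := by
  have hy : y = 𝓕 (𝓕⁻ y : Spec d n) := (FourierInvPair.fourier_fourierInv_eq y).symm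
  conv_lhs => rw [hy]
  rw [fourierField_apply, Lp.inner_fourier_eq, L2.inner_def, L2.inner_def, L2.inner_def,
    ← integral_freq (fun q => inner ℝ (reField y q) (b q)), ← integral_freq (fun q => inner ℝ (imField y q) (b q)),
    ← integral_complex_ofReal, ← integral_complex_ofReal, ← integral_mul_const, ← integral_sub]
  · refine integral_congr_ae ?_
    filter_upwards [complexify_ae b, reField_ae y, imField_ae y] with ζ e1 e2 e3
    rw [e1, e2, e3]
    apply Complex.ext <;> simp [mul_comm]
  · exact ((measurePreserving_ofLp.integrable_comp_of_integrable (L2.integrable_inner (𝕜 := ℝ) (reField y) b))).ofReal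
  · exact ((measurePreserving_ofLp.integrable_comp_of_integrable (L2.integrable_inner (𝕜 := ℝ) (imField y) b))).ofReal.mul_const _

theorem reField_fourierField (Ψ : WaveField d n) : reField (fourierField Ψ) = Ψ := by
  refine ext_inner_right ℝ fun b => ?_
  have h := inner_fourierField_right (fourierField Ψ) b
  rw [inner_fourierField] at h
  have := congrArg Complex.re h
  simpa using this.symm

theorem IsTest.memLp {X : Type*} [NormedAddCommGroup X] [NormedSpace ℝ X] [MeasureSpace X] [BorelSpace X]
    [IsFiniteMeasureOnCompacts (volume : Measure X)] [SecondCountableTopology X] {a : X → ℝ} (ha : IsTest a) {p : ℝ≥0∞} : MemLp a p volume :=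
  ha.1.continuous.memLp_of_hasCompactSupport ha.2

section
variable (ha : IsTest a)
include ha

def IsTest.wave : WaveField d n := (ha.memLp (p := 2)).toLp a

theorem IsTest.wave_ae : ha.wave =ᵐ[volume] a := MemLp.coeFn_toLp _

theorem IsTest.inner_wave (Ψ : WaveField d n) : inner ℝ Ψ ha.wave = ∫ q, Ψ q * a q := by
  rw [L2.inner_def]
  refine integral_congr_ae ?_
  filter_upwards [ha.wave_ae] with q hq
  rw [hq]; simp [mul_comm]

def IsTest.schwartz : 𝓢(Freq d n, ℂ) := HasCompactSupport.toSchwartzMap (f := fun ζ : Freq d n => ((a ζ.ofLp : ℝ) : ℂ))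
    ((ha.2.comp_homeomorph (WithLp.homeomorphProd 2 (Rd d) (Rd n))).comp_left (g := fun r : ℝ => (r : ℂ)) (by simp))
    (Complex.ofRealCLM.contDiff.comp (ha.1.comp (WithLp.prodContinuousLinearEquiv 2 ℝ (Rd d) (Rd n)).contDiff))

theorem IsTest.schwartz_apply (ζ : Freq d n) : ha.schwartz ζ = ((a ζ.ofLp : ℝ) : ℂ) := rfl

theorem IsTest.complexify_wave : complexify ha.wave = ha.schwartz.toLp 2 := by
  refine Lp.ext ?_
  filter_upwards [complexify_ae ha.wave, ha.schwartz.coeFn_toLp 2 volume, measurePreserving_ofLp.quasiMeasurePreserving.ae ha.wave_ae] with ζ e1 e2 e3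
  rw [e1, e2, e3, ha.schwartz_apply]

theorem IsTest.lineDeriv_schwartz (m : Freq d n) : ∂_{m} ha.schwartz = (ha.fderiv_apply (WithLp.ofLp m)).schwartz := by
  ext ζ
  rw [SchwartzMap.lineDerivOp_apply, IsTest.schwartz_apply]
  refine HasLineDerivAt.lineDeriv ?_
  have h1 : HasDerivAt (fun t : ℝ => ζ.ofLp + t • WithLp.ofLp m) (WithLp.ofLp m) 0 := by
    simpa using ((hasDerivAt_id (0:ℝ)).smul_const (WithLp.ofLp m)).const_add ζ.ofLp
  have h2 : HasFDerivAt a (fderiv ℝ a ζ.ofLp) (ζ.ofLp + (0:ℝ) • WithLp.ofLp m) := by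
    rw [zero_smul, add_zero]
    exact ((ha.1.differentiable (by simp)) ζ.ofLp).hasFDerivAt
  exact (h2.comp_hasDerivAt 0 h1).ofReal_comp

end

/-- The orthonormal basis of the transverse directions, in the space of all variables. -/
def dirSnd (d : ℕ) {n : ℕ} (i : Fin n) : Rd d × Rd n := (0, EuclideanSpace.basisFun (Fin n) ℝ i)

def lapSnd (a : Rd d × Rd n → ℝ) (q : Rd d × Rd n) : ℝ := ∑ i, fderiv ℝ (fun p => fderiv ℝ a p (dirSnd d i)) q (dirSnd d i)

theorem laplacian_slice (ha : ContDiff ℝ 2 a) (q : Rd d × Rd n) : (Δ (fun y => a (q.1, y))) q.2 = lapSnd a q := by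
  have hs : ∀ y : Rd n, HasFDerivAt (fun y : Rd n => (q.1, y)) (ContinuousLinearMap.inr ℝ (Rd d) (Rd n)) y := fun y => hasFDerivAt_prodMk_right q.1 y
  have h1 : ∀ e : Rd n, (fun y => fderiv ℝ (fun y => a (q.1, y)) y e) = fun y => fderiv ℝ a (q.1, y) (0, e) := fun e => by
    ext y
    have := ((ha.differentiable (by simp)) (q.1, y)).hasFDerivAt.comp y (hs y)
    rw [show (fun y => a (q.1, y)) = a ∘ fun y => (q.1, y) from rfl, this.fderiv]
    rfl
  have hsl : ContDiff ℝ 2 (fun y => a (q.1, y)) := ha.comp (contDiff_const.prodMk contDiff_id)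
  rw [InnerProductSpace.laplacian_eq_iteratedFDeriv_orthonormalBasis _ (EuclideanSpace.basisFun (Fin n) ℝ), lapSnd]
  refine Finset.sum_congr rfl fun i _ => ?_
  rw [iteratedFDeriv_two_apply]
  set e := EuclideanSpace.basisFun (Fin n) ℝ i
  have h2 : DifferentiableAt ℝ (fderiv ℝ (fun y => a (q.1, y))) q.2 := ((hsl.fderiv_right (m := 1) (by norm_num)).differentiable (by simp)) q.2
  have h3 : fderiv ℝ (fun y => fderiv ℝ (fun y => a (q.1, y)) y e) q.2 = (ContinuousLinearMap.apply ℝ ℝ e).comp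
      (fderiv ℝ (fderiv ℝ (fun y => a (q.1, y))) q.2) :=
    ((ContinuousLinearMap.apply ℝ ℝ e).hasFDerivAt.comp q.2 h2.hasFDerivAt).fderiv
  have h4 := congrArg (fun L : Rd n →L[ℝ] ℝ => L e) h3
  simp only [ContinuousLinearMap.comp_apply, ContinuousLinearMap.apply_apply] at h4
  simp only [Matrix.cons_val_zero, Matrix.cons_val_one]
  rw [← h4, h1 e]
  have h5 : DifferentiableAt ℝ (fun p => fderiv ℝ a p (0, e)) q :=
    (((ha.fderiv_right (m := 1) (by norm_num)).clm_apply contDiff_const).differentiable (by simp)) q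
  have h6 := h5.hasFDerivAt.comp q.2 (hs q.2)
  rw [show (fun y => fderiv ℝ a (q.1, y) (0, e)) = (fun p => fderiv ℝ a p (0, e)) ∘ fun y => (q.1, y) from rfl, h6.fderiv]
  rfl

theorem IsTest.add {X : Type*} [NormedAddCommGroup X] [NormedSpace ℝ X] {a b : X → ℝ} (ha : IsTest a) (hb : IsTest b) :
    IsTest (fun x => a x + b x) := ⟨ha.1.add hb.1, ha.2.add hb.2⟩

theorem IsTest.sum {X ι : Type*} [NormedAddCommGroup X] [NormedSpace ℝ X] {s : Finset ι} {a : ι → X → ℝ} (ha : ∀ i, IsTest (a i)) :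
    IsTest (fun x => ∑ i ∈ s, a i x) := by
  classical
  induction s using Finset.induction_on with
  | empty => exact ⟨by simpa using contDiff_const, HasCompactSupport.intro isCompact_empty (by simp)⟩
  | insert i s hi ih =>
    simp only [Finset.sum_insert hi]
    exact (ha i).add ih

theorem IsTest.const_mul {X : Type*} [NormedAddCommGroup X] [NormedSpace ℝ X] {a : X → ℝ} (ha : IsTest a) (r : ℝ) :
    IsTest (fun x => r * a x) := ⟨contDiff_const.mul ha.1, ha.2.mul_left⟩

theorem IsTest.lapSnd (ha : IsTest a) : IsTest (lapSnd a) := IsTest.sum fun i => (ha.fderiv_apply (dirSnd d i)).fderiv_apply (dirSnd d i)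

def lapS (b : 𝓢(Freq d n, ℂ)) : 𝓢(Freq d n, ℂ) := ∑ i : Fin n, ∂_{WithLp.toLp 2 (dirSnd d i)} (∂_{WithLp.toLp 2 (dirSnd d i)} b)

theorem IsTest.schwartz_lapSnd (ha : IsTest a) : ha.lapSnd.schwartz = lapS ha.schwartz := by
  ext ζ
  rw [IsTest.schwartz_apply, lapS, SchwartzMap.sum_apply]
  simp only [ha.lineDeriv_schwartz, IsTest.lineDeriv_schwartz, IsTest.schwartz_apply]
  simp [VlasovWave.lapSnd]

theorem fourier_lapS (b : 𝓢(Freq d n, ℂ)) (ζ : Freq d n) : (𝓕 (lapS b)) ζ = (-(2 * Real.pi * ‖ζ.ofLp.2‖) ^ 2 : ℝ) • (𝓕 b) ζ := by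
  have h1 : 𝓕 (lapS b) = ∑ i : Fin n, 𝓕 (∂_{WithLp.toLp 2 (dirSnd d i)} (∂_{WithLp.toLp 2 (dirSnd d i)} b)) :=
    map_sum (FourierTransform.fourierCLM ℂ 𝓢(Freq d n, ℂ)) _ _
  have hg : ∀ m : Freq d n, (fun x : Freq d n => inner ℝ x m).HasTemperateGrowth := fun m => ((innerSL ℝ).flip m).hasTemperateGrowth
  rw [h1, SchwartzMap.sum_apply]
  have h2 : ∀ i : Fin n, (𝓕 (∂_{WithLp.toLp 2 (dirSnd d i)} (∂_{WithLp.toLp 2 (dirSnd d i)} b))) ζ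
      = (-(2 * Real.pi) ^ 2 * (ζ.ofLp.2 i) ^ 2 : ℝ) • (𝓕 b) ζ := fun i => by
    rw [SchwartzMap.fourier_lineDerivOp_eq, SchwartzMap.smul_apply, SchwartzMap.smulLeftCLM_apply_apply (hg _),
      SchwartzMap.fourier_lineDerivOp_eq, SchwartzMap.smul_apply, SchwartzMap.smulLeftCLM_apply_apply (hg _)]
    have h3 : inner ℝ ζ (WithLp.toLp 2 (dirSnd d i)) = ζ.ofLp.2 i := by
      simp [WithLp.prod_inner_apply, dirSnd, EuclideanSpace.inner_single_right]
    rw [h3]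
    simp only [smul_eq_mul, Complex.real_smul]
    push_cast
    ring_nf
    rw [Complex.I_sq]; ring
  simp only [h2]
  have hn := EuclideanSpace.norm_sq_eq ζ.ofLp.2
  simp only [Real.norm_eq_abs, sq_abs] at hn
  rw [← Finset.sum_smul, ← Finset.mul_sum, ← hn]
  congr 1
  ring

/-- The dispersion relation `ω = c |ξ|`, `ξ = 2 π η`. -/
def freq (c : ℝ) (ζ : Freq d n) : ℝ := 2 * Real.pi * c * ‖ζ.ofLp.2‖

theorem continuous_freq (c : ℝ) : Continuous (freq c : Freq d n → ℝ) :=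
  continuous_const.mul (continuous_snd.comp (WithLp.prod_continuous_ofLp 2 (Rd d) (Rd n))).norm

theorem IsTest.fourierField_wave_ae (ha : IsTest a) : fourierField ha.wave =ᵐ[volume] (𝓕 ha.schwartz : 𝓢(Freq d n, ℂ)) := by
  rw [fourierField_apply, ha.complexify_wave, SchwartzMap.toLp_fourier_eq]
  exact SchwartzMap.coeFn_toLp _ 2 volume

theorem IsTest.fourierField_lapSnd (ha : IsTest a) (c : ℝ) :
    -(c ^ 2) • fourierField ha.lapSnd.wave =ᵐ[volume] fun ζ => freq c ζ ^ 2 • fourierField ha.wave ζ := by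
  filter_upwards [ha.fourierField_wave_ae, ha.lapSnd.fourierField_wave_ae, Lp.coeFn_smul (-(c ^ 2)) (fourierField ha.lapSnd.wave)] with ζ h1 h2 h3
  rw [h3, Pi.smul_apply, h1, h2, ha.schwartz_lapSnd, fourier_lapS, smul_smul]
  congr 1
  rw [freq]; ring

variable {d n : ℕ}

variable {D I : WaveField d n}

theorem IsTest.exists_bound {X : Type*} [NormedAddCommGroup X] [NormedSpace ℝ X] {θ : X → ℝ} (hθ : IsTest θ) : ∃ B, 0 ≤ B ∧ ∀ x, |θ x| ≤ B := by
  obtain ⟨B, hB⟩ := hθ.1.continuous.bounded_above_of_compact_support hθ.2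
  exact ⟨B, (norm_nonneg _).trans (hB 0), hB⟩

theorem ae_eq_zero_of_fourier_eq_zero {h : Freq d n → ℂ} (hi : Integrable h) (h0 : ∀ w, 𝓕 h w = 0) : ∀ᵐ ζ, h ζ = 0 := by
  refine ae_eq_zero_of_integral_contDiff_smul_eq_zero hi.locallyIntegrable fun g hg hgc => ?_
  let G : 𝓢(Freq d n, ℂ) := HasCompactSupport.toSchwartzMap (f := fun ζ => ((g ζ : ℝ) : ℂ))
    (hgc.comp_left (g := fun r : ℝ => (r : ℂ)) (by simp)) (Complex.ofRealCLM.contDiff.comp hg)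
  have h1 := VectorFourier.integral_fourierIntegral_smul_eq_flip (μ := volume) (ν := volume) (L := innerₗ (Freq d n))
    Real.continuous_fourierChar continuous_inner (𝓕⁻ G).integrable hi
  have h2 : ∀ ζ, VectorFourier.fourierIntegral Real.fourierChar volume (innerₗ (Freq d n)) (𝓕⁻ G : 𝓢(Freq d n, ℂ)) ζ = G ζ := fun ζ => by
    have := congrArg (fun b : 𝓢(Freq d n, ℂ) => b ζ) (FourierInvPair.fourier_fourierInv_eq (F := 𝓢(Freq d n, ℂ)) G)
    rwa [SchwartzMap.fourier_coe] at this
  rw [flip_innerₗ] at h1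
  simp only [h2] at h1
  refine Eq.trans ?_ (h1.trans ?_)
  · exact integral_congr_ae (ae_of_all _ fun ζ => (Complex.real_smul (x := g ζ)))
  · exact integral_eq_zero_of_ae (ae_of_all _ fun ζ => by
      change (𝓕⁻ G) ζ • 𝓕 h ζ = 0
      rw [h0, smul_zero])

theorem IsTest.comp_ofLp {θ : Freq d n → ℝ} (hθ : IsTest θ) : IsTest fun q : Rd d × Rd n => θ (WithLp.toLp 2 q) :=
  ⟨hθ.1.comp (WithLp.prodContinuousLinearEquiv 2 ℝ (Rd d) (Rd n)).symm.contDiff, hθ.2.comp_homeomorph (WithLp.homeomorphProd 2 (Rd d) (Rd n)).symm⟩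

theorem ae_eq_zero_of_fourier_test {v : Freq d n → ℂ} (hi : ∀ (a : Rd d × Rd n → ℝ) (ha : IsTest a), Integrable fun ζ => 𝓕 ha.schwartz ζ * v ζ)
    (h0 : ∀ (a : Rd d × Rd n → ℝ) (ha : IsTest a), ∫ ζ, 𝓕 ha.schwartz ζ * v ζ = 0) : ∀ᵐ ζ, v ζ = 0 := by
  let φ : ℕ → ContDiffBump (0 : Freq d n) := fun k =>
    ⟨1 / ((k : ℝ) + 1), 2 * (1 / ((k : ℝ) + 1)), by positivity, by linarith [show (0 : ℝ) < 1 / ((k : ℝ) + 1) by positivity]⟩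
  have hφ : ∀ k, IsTest ((φ k).normed volume) := fun k => ⟨(φ k).contDiff_normed, (φ k).hasCompactSupport_normed⟩
  have key : ∀ k, ∀ᵐ ζ, 𝓕 (hφ k).comp_ofLp.schwartz ζ * v ζ = 0 := fun k => by
    refine ae_eq_zero_of_fourier_eq_zero (hi _ _) fun w => ?_
    have ht : IsTest fun ζ => (φ k).normed volume (ζ + -w) :=
      ⟨(hφ k).1.comp (contDiff_id.add contDiff_const), (hφ k).2.comp_homeomorph (Homeomorph.addRight (-w))⟩
    rw [← h0 _ ht.comp_ofLp]
    refine integral_ext fun ζ => ?_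
    have e := congrFun (VectorFourier.fourierIntegral_comp_add_right Real.fourierChar volume (innerₗ (Freq d n)) (hφ k).comp_ofLp.schwartz (-w)) ζ
    have e' : 𝓕 ht.comp_ofLp.schwartz ζ = Real.fourierChar (inner ℝ (-w) ζ) • 𝓕 (hφ k).comp_ofLp.schwartz ζ := e
    beta_reduce
    rw [e', inner_neg_left, real_inner_comm, smul_mul_assoc]
    rfl
  filter_upwards [ae_all_iff.2 key] with ζ hζ
  have hl : Tendsto (fun k => 𝓕 (hφ k).comp_ofLp.schwartz ζ) atTop (𝓝 1) := by
    have h1 := ContDiffBump.convolution_tendsto_right_of_continuous (μ := volume) (φ := φ) (l := atTop)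
      (by simpa [φ] using tendsto_one_div_add_atTop_nhds_zero_nat.const_mul (2 : ℝ))
      (g := fun x : Freq d n => (Real.fourierChar (inner ℝ x ζ) : ℂ)) (by fun_prop) 0
    simp only [inner_zero_left, AddChar.map_zero_eq_one, Circle.coe_one] at h1
    refine h1.congr fun k => integral_ext fun x => ?_
    simp only [zero_sub, inner_neg_left]
    exact (mul_comm _ _)
  obtain ⟨k, hk⟩ := (hl.eventually_ne one_ne_zero).exists
  exact (mul_eq_zero.1 (hζ k)).resolve_left hk

/-- An identity `D = P* I`, tested against test functions, for a Fourier multiplier `P` with symbol `m`. -/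
theorem fourierField_ae_of_multiplier {m : Freq d n → ℂ} (P : ∀ a : Rd d × Rd n → ℝ, IsTest a → WaveField d n)
    (hP : ∀ a ha, fourierField (P a ha) =ᵐ[volume] fun ζ => m ζ * fourierField ha.wave ζ)
    (h : ∀ a (ha : IsTest a), inner ℝ D ha.wave = inner ℝ I (P a ha)) :
    ∀ᵐ ζ, fourierField D ζ = (starRingEnd ℂ) (m ζ) * fourierField I ζ := by
  have hae : ∀ a (ha : IsTest a), (fun ζ => inner ℂ (fourierField D ζ) (fourierField ha.wave ζ)
      - inner ℂ (fourierField I ζ) (fourierField (P a ha) ζ)) =ᵐ[volume] fun ζ => 𝓕 ha.schwartz ζ *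
        ((starRingEnd ℂ) (fourierField D ζ) - m ζ * (starRingEnd ℂ) (fourierField I ζ)) := fun a ha => by
    filter_upwards [hP a ha, ha.fourierField_wave_ae] with ζ h1 h2
    rw [h1, h2, RCLike.inner_apply, RCLike.inner_apply]
    ring
  have hi := fun A B : WaveField d n => L2.integrable_inner (𝕜 := ℂ) (fourierField A) (fourierField B)
  filter_upwards [ae_eq_zero_of_fourier_test (fun a ha => ((hi D ha.wave).sub (hi I (P a ha))).congr (hae a ha)) fun a ha => by
    rw [← integral_congr_ae (hae a ha), integral_sub (hi _ _) (hi _ _), ← L2.inner_def, ← L2.inner_def, inner_fourierField,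
      inner_fourierField, h a ha, sub_self]] with ζ hζ
  simpa using congrArg (starRingEnd ℂ) (sub_eq_zero.1 hζ)

theorem fourierField_ae_of_test (c : ℝ) (h : ∀ a : Rd d × Rd n → ℝ, IsTest a → ∫ q, D q * a q = ∫ q, I q * (c ^ 2 * lapSnd a q)) :
    ∀ᵐ ζ : Freq d n, fourierField D ζ = -(freq c ζ ^ 2) • fourierField I ζ := by
  have hP : ∀ (a : Rd d × Rd n → ℝ) (ha : IsTest a), fourierField (ha.lapSnd.const_mul (c ^ 2)).wave =ᵐ[volume]
      fun ζ => ((-(freq c ζ ^ 2) : ℝ) : ℂ) * fourierField ha.wave ζ := fun a ha => by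
    have e : (ha.lapSnd.const_mul (c ^ 2)).wave = c ^ 2 • ha.lapSnd.wave := Lp.ext (by
      filter_upwards [(ha.lapSnd.const_mul (c ^ 2)).wave_ae, Lp.coeFn_smul (c ^ 2) ha.lapSnd.wave, ha.lapSnd.wave_ae] with q h1 h2 h3
      rw [h1, h2, Pi.smul_apply, h3, smul_eq_mul])
    rw [e, map_smul]
    filter_upwards [ha.fourierField_lapSnd c, Lp.coeFn_smul (-(c ^ 2)) (fourierField ha.lapSnd.wave),
      Lp.coeFn_smul (c ^ 2) (fourierField ha.lapSnd.wave)] with ζ h1 h2 h3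
    rw [h2, Pi.smul_apply, neg_smul] at h1
    rw [h3, Pi.smul_apply, ← Complex.real_smul, neg_smul, ← h1, neg_neg]
  filter_upwards [fourierField_ae_of_multiplier (D := D) (I := I) _ hP fun a ha => by rw [IsTest.inner_wave, IsTest.inner_wave, h a ha]] with ζ hζ
  rw [hζ, Complex.conj_ofReal, Complex.real_smul]

section Slices

variable {d n : ℕ}

variable {φ : ℝ × (Rd d × Rd n) → ℝ} {T c : ℝ} {D Ψ : ℝ → WaveField d n} {χ : ℝ → ℝ} {a : Rd d × Rd n → ℝ} {N : ℕ}

section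
variable (hφ : IsTest φ)
include hφ

theorem IsTest.slice (t : ℝ) : IsTest (fun q => φ (t, q)) := by
  refine ⟨hφ.1.comp (contDiff_const.prodMk contDiff_id), ?_⟩
  refine hφ.2.comp_isClosedEmbedding (g := fun q : Rd d × Rd n => (t, q)) ?_
  exact Topology.IsClosedEmbedding.of_continuous_injective_isClosedMap (by fun_prop) (fun a b h => (Prod.mk.inj h).2) (fun s hs => by
      have : (fun q : Rd d × Rd n => (t, q)) '' s = {t} ×ˢ s := singleton_prod.symm
      rw [this]; exact isClosed_singleton.prod hs)

theorem IsTest.hasDerivAt_slice (t : ℝ) (q : Rd d × Rd n) : HasDerivAt (fun s => φ (s, q)) (fderiv ℝ φ (t, q) (1, 0)) t := by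
  have h1 : HasFDerivAt φ (fderiv ℝ φ (t, q)) (t, q) := (hφ.1.differentiable (by simp) _).hasFDerivAt
  exact HasFDerivAt.comp_hasDerivAt t h1 ((hasDerivAt_id t).prodMk (hasDerivAt_const t q))

theorem IsTest.exists_slice_dominated : ∃ k : Rd d × Rd n → ℝ, MemLp k 2 ∧ ∀ t q, ‖φ (t, q)‖ ≤ k q := by
  obtain ⟨B, hB⟩ := hφ.2.exists_bound_of_continuous hφ.1.continuous
  have hK : IsCompact (Prod.snd '' tsupport φ) := hφ.2.isCompact.image continuous_snd
  refine ⟨(Prod.snd '' tsupport φ).indicator fun _ => B, memLp_indicator_const 2 hK.measurableSet B (Or.inr hK.measure_lt_top.ne), fun t q => ?_⟩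
  by_cases h : q ∈ Prod.snd '' tsupport φ
  · rw [indicator_of_mem h]; exact hB _
  · rw [indicator_of_notMem h]
    have : (t, q) ∉ tsupport φ := fun h' => h ⟨_, h', rfl⟩
    rw [image_eq_zero_of_notMem_tsupport this, norm_zero]

theorem IsTest.hasDerivAt_wave (t : ℝ) : HasDerivAt (fun s => (hφ.slice s).wave) ((hφ.fderiv_apply (1, 0)).slice t).wave t := by
  obtain ⟨k, hk, hb⟩ := (hφ.fderiv_apply (1, 0)).exists_slice_dominated
  exact hasDerivAt_Lp_two (F := fun s q => φ (s, q)) (F' := fun s q => fderiv ℝ φ (s, q) (1, 0)) one_pos hk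
    (fun τ _ => (hφ.slice τ).wave_ae) ((hφ.fderiv_apply (1, 0)).slice t).wave_ae
    (ae_of_all _ fun q τ _ => ⟨hφ.hasDerivAt_slice τ q, hb τ q⟩)

theorem IsTest.continuous_wave : Continuous fun s => (hφ.slice s).wave := continuous_iff_continuousAt.2 fun t => (hφ.hasDerivAt_wave t).continuousAt

end

def lapTr (φ : ℝ × (Rd d × Rd n) → ℝ) (p : ℝ × (Rd d × Rd n)) : ℝ := ∑ i : Fin n, fderiv ℝ (fun p => fderiv ℝ φ p (0, dirSnd d i)) p (0, dirSnd d i)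

theorem IsTest.lapTr (hφ : IsTest φ) : IsTest (lapTr φ) := IsTest.sum fun i => (hφ.fderiv_apply (0, dirSnd d i)).fderiv_apply (0, dirSnd d i)

theorem IsTest.fderiv_slice (hφ : IsTest φ) (t : ℝ) (q e : Rd d × Rd n) : fderiv ℝ (fun q => φ (t, q)) q e = fderiv ℝ φ (t, q) (0, e) := by
  have h1 : HasFDerivAt φ (fderiv ℝ φ (t, q)) (t, q) := (hφ.1.differentiable (by simp) _).hasFDerivAt
  have h2 : HasFDerivAt (fun q : Rd d × Rd n => (t, q)) (ContinuousLinearMap.inr ℝ ℝ (Rd d × Rd n)) q := hasFDerivAt_prodMk_right t q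
  exact congrArg (fun L : (Rd d × Rd n) →L[ℝ] ℝ => L e) (h1.comp q h2).fderiv

theorem IsTest.lapSnd_slice (hφ : IsTest φ) (t : ℝ) : VlasovWave.lapSnd (fun q => φ (t, q)) = fun q => VlasovWave.lapTr φ (t, q) := by
  ext q
  refine Finset.sum_congr rfl fun i _ => ?_
  have e : (fun q => fderiv ℝ (fun q => φ (t, q)) q (dirSnd d i)) = fun q => fderiv ℝ φ (t, q) (0, dirSnd d i) :=
    funext fun q => hφ.fderiv_slice t q _
  rw [e]
  exact (hφ.fderiv_apply (0, dirSnd d i)).fderiv_slice t q _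

def dAlembert (c : ℝ) (φ : ℝ × (Rd d × Rd n) → ℝ) (p : ℝ × (Rd d × Rd n)) : ℝ :=
  fderiv ℝ (fun p => fderiv ℝ φ p (1, 0)) p (1, 0) + -(c ^ 2) * lapTr φ p

theorem IsTest.dAlembert (hφ : IsTest φ) (c : ℝ) : IsTest (dAlembert c φ) := ((hφ.fderiv_apply (1, 0)).fderiv_apply (1, 0)).add (hφ.lapTr.const_mul _)

theorem IsTest.dAlembert_eq (hφ : IsTest φ) (c t : ℝ) (q : Rd d × Rd n) :
    iteratedDeriv 2 (fun s => φ (s, q)) t - c ^ 2 * (Δ (fun y => φ (t, (q.1, y)))) q.2 = VlasovWave.dAlembert c φ (t, q) := by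
  have h1 : deriv (fun s => φ (s, q)) = fun s => fderiv ℝ φ (s, q) (1, 0) := funext fun s => (hφ.hasDerivAt_slice s q).deriv
  rw [iteratedDeriv_succ, iteratedDeriv_one, h1, ((hφ.fderiv_apply (1, 0)).hasDerivAt_slice t q).deriv,
    laplacian_slice (a := fun q => φ (t, q)) ((hφ.slice t).1.of_le (by norm_cast)) q, hφ.lapSnd_slice]
  simp only [VlasovWave.dAlembert]
  ring

theorem IsTest.dAlembert_wave (hφ : IsTest φ) (c t : ℝ) :
    ((hφ.dAlembert c).slice t).wave = (((hφ.fderiv_apply (1, 0)).fderiv_apply (1, 0)).slice t).wave - c ^ 2 • (hφ.slice t).lapSnd.wave := by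
  refine Lp.ext ?_
  filter_upwards [((hφ.dAlembert c).slice t).wave_ae, (((hφ.fderiv_apply (1, 0)).fderiv_apply (1, 0)).slice t).wave_ae,
    (hφ.slice t).lapSnd.wave_ae, Lp.coeFn_sub (((hφ.fderiv_apply (1, 0)).fderiv_apply (1, 0)).slice t).wave
      (c ^ 2 • (hφ.slice t).lapSnd.wave), Lp.coeFn_smul (c ^ 2) (hφ.slice t).lapSnd.wave] with q h1 h2 h3 h4 h5
  rw [h1, h4, Pi.sub_apply, h2, h5, Pi.smul_apply, h3, hφ.lapSnd_slice]
  simp only [VlasovWave.dAlembert, smul_eq_mul]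
  ring

/-- Weak solutions of `∂ₜₜΨ - c² Δ_y Ψ = g` on `[0,T)`, with initial data `(Ψ₀, Ψ₁)`. -/
def WeakWave (T c : ℝ) (g : ℝ → WaveField d n) (Ψ₀ Ψ₁ : WaveField d n) (Ψ : ℝ → WaveField d n) : Prop :=
  ∀ (φ : ℝ × (Rd d × Rd n) → ℝ) (hφ : IsTest φ), tsupport φ ⊆ Iio T ×ˢ univ → ∫ t in Icc 0 T, inner ℝ (Ψ t) ((hφ.dAlembert c).slice t).wave
      = (∫ t in Icc 0 T, inner ℝ (g t) (hφ.slice t).wave) + inner ℝ Ψ₁ (hφ.slice 0).wave - inner ℝ Ψ₀ ((hφ.fderiv_apply (1, 0)).slice 0).wave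

theorem integrableOn_inner_wave (hΨ : ContinuousOn Ψ (Icc 0 T)) (hφ : IsTest φ) : IntegrableOn (fun t => inner ℝ (Ψ t) (hφ.slice t).wave) (Icc 0 T) :=
  (hΨ.inner hφ.continuous_wave.continuousOn).integrableOn_Icc

theorem WeakWave.sub {g : ℝ → WaveField d n} {Ψ₀ Ψ₁ : WaveField d n} {Ψ' : ℝ → WaveField d n} (h : WeakWave T c g Ψ₀ Ψ₁ Ψ)
    (h' : WeakWave T c g Ψ₀ Ψ₁ Ψ') (hΨ : ContinuousOn Ψ (Icc 0 T)) (hΨ' : ContinuousOn Ψ' (Icc 0 T)) : WeakWave T c 0 0 0 (fun t => Ψ t - Ψ' t) := by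
  intro φ hφ hs
  simp only [inner_sub_left, Pi.zero_apply, inner_zero_left, integral_zero]
  rw [integral_sub (integrableOn_inner_wave hΨ (hφ.dAlembert c)) (integrableOn_inner_wave hΨ' (hφ.dAlembert c)), h φ hφ hs, h' φ hφ hs]
  ring

theorem IsTest.prod (hχ : IsTest χ) (ha : IsTest a) : IsTest (fun p : ℝ × (Rd d × Rd n) => χ p.1 * a p.2) := by
  refine ⟨(hχ.1.comp contDiff_fst).mul (ha.1.comp contDiff_snd), ?_⟩
  refine HasCompactSupport.intro (hχ.2.isCompact.prod ha.2.isCompact) fun p hp => ?_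
  by_cases h1 : p.1 ∈ tsupport χ
  · have h2 : p.2 ∉ tsupport a := fun h2 => hp ⟨h1, h2⟩
    rw [image_eq_zero_of_notMem_tsupport h2, mul_zero]
  · rw [image_eq_zero_of_notMem_tsupport h1, zero_mul]

theorem IsTest.dt_prod (hχ : IsTest χ) (ha : IsTest a) : (fun p : ℝ × (Rd d × Rd n) => fderiv ℝ (fun p : ℝ × (Rd d × Rd n) => χ p.1 * a p.2) p (1, 0))
      = fun p => deriv χ p.1 * a p.2 := by
  ext ⟨t, q⟩
  refine ((hχ.prod ha).hasDerivAt_slice t q).unique ?_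
  exact ((hχ.1.differentiable (by simp) t).hasDerivAt).mul_const (a q)

theorem IsTest.test_deriv (hχ : IsTest χ) : IsTest (deriv χ) := by
  have := hχ.fderiv_apply 1
  simpa only [fderiv_apply_one_eq_deriv] using this

theorem WeakWave.eq_of_test (hT : 0 < T) (hD : ContinuousOn D (Icc 0 T)) (h : WeakWave T c 0 0 0 D) (ha : IsTest a) :
    ∀ t ∈ Icc 0 T, ∫ q, D t q * a q = ∫ s in 0..t, ∫ r in 0..s, ∫ q, D r q * (c ^ 2 * lapSnd a q) := by
  have hm : ∀ {b : Rd d × Rd n → ℝ} (hb : IsTest b), ContinuousOn (fun t => ∫ q, D t q * b q) (Icc 0 T) := fun hb => by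
    simp only [← hb.inner_wave]
    exact hD.inner continuousOn_const
  have := eq_add_integral_integral_of_test hT (m := fun t => ∫ q, D t q * a q)
    (k := fun t => ∫ q, D t q * (c ^ 2 * lapSnd a q)) (m₀ := 0) (m₁ := 0) (hm ha) (hm (ha.lapSnd.const_mul (c ^ 2)))
    fun χ hχ hs => ?_
  · simpa using this
  · have h1 := h _ (hχ.prod ha) ?_
    · simp only [Pi.zero_apply, inner_zero_left, integral_zero, add_zero, sub_zero] at h1
      rw [mul_zero, mul_zero, sub_zero]
      refine (integral_ext fun t => ?_).trans h1
      have e1 : (fun q => VlasovWave.dAlembert c (fun p : ℝ × (Rd d × Rd n) => χ p.1 * a p.2) (t, q))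
          = fun q => deriv (deriv χ) t * a q + -(χ t) * (c ^ 2 * lapSnd a q) := by
        ext q
        have e2 := congrFun ((hχ.prod ha).lapSnd_slice t) q
        have e3 : lapSnd (fun q => χ t * a q) q = χ t * lapSnd a q := by
          simp only [lapSnd, Finset.mul_sum]
          refine Finset.sum_congr rfl fun i _ => ?_
          have e4 : (fun q => fderiv ℝ (fun q => χ t * a q) q (dirSnd d i)) = fun q => χ t * fderiv ℝ a q (dirSnd d i) := by
            ext q
            rw [fderiv_const_mul ((ha.1.differentiable (by simp)) q)]; rfl
          rw [e4, fderiv_const_mul (((ha.fderiv_apply _).1.differentiable (by simp)) q)]; rfl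
        rw [VlasovWave.dAlembert, hχ.dt_prod ha, congrFun (hχ.test_deriv.dt_prod ha) (t, q), ← e2]
        simp only
        rw [e3]; ring
      rw [IsTest.inner_wave]
      have i1 : Integrable (fun q => D t q * a q) := by
        have := L2.integrable_inner (𝕜 := ℝ) (D t) ha.wave
        refine this.congr ?_
        filter_upwards [ha.wave_ae] with q hq
        rw [hq]; simp [mul_comm]
      have hb := ha.lapSnd.const_mul (c ^ 2)
      have i2 : Integrable (fun q => D t q * (c ^ 2 * lapSnd a q)) := by
        have := L2.integrable_inner (𝕜 := ℝ) (D t) hb.wave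
        refine this.congr ?_
        filter_upwards [hb.wave_ae] with q hq
        rw [hq]; simp [mul_comm]
      rw [← integral_const_mul, ← integral_const_mul, ← integral_sub (i1.const_mul _) (i2.const_mul _)]
      exact integral_ext (fun q => by rw [congrFun e1 q]; ring)
    · refine (closure_minimal (fun p hp => ?_) ((isClosed_tsupport χ).preimage continuous_fst)).trans fun p hp => ⟨hs hp, mem_univ _⟩
      exact subset_tsupport χ (left_ne_zero_of_mul hp)

theorem inner_intervalIntegral {H : Type*} [NormedAddCommGroup H] [InnerProductSpace ℝ H] [CompleteSpace H] {J : ℝ → H} {a b : ℝ}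
    (hJ : IntervalIntegrable J volume a b) (h : H) : inner ℝ (∫ s in a..b, J s) h = ∫ s in a..b, inner ℝ (J s) h := by
  have e := ContinuousLinearMap.intervalIntegral_comp_comm (innerSL ℝ h) hJ
  simp only [innerSL_apply_apply] at e
  rw [real_inner_comm, ← e]
  exact intervalIntegral.integral_congr fun s _ => real_inner_comm _ _

theorem eq_zero_of_norm_le_iterated_integral {W S : Type*} [NormedAddCommGroup W] [NormedSpace ℝ W] [CompleteSpace W] [NormedAddCommGroup S]
    [NormedSpace ℝ S] {K : ℝ} (hK : 0 ≤ K) {E : ℝ → W} (hE : Continuous E) (P : W →L[ℝ] S)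
    (h : ∀ t ∈ Icc 0 T, ‖P (E t)‖ ≤ K * ‖P (∫ s in 0..t, ∫ r in 0..s, E r)‖) : ∀ t ∈ Icc 0 T, P (E t) = 0 := by
  set I1 : ℝ → W := fun s => ∫ r in 0..s, E r
  have hI1c : Continuous I1 := intervalIntegral.continuous_primitive (fun a b => hE.intervalIntegrable a b) 0
  set I : ℝ → W := fun t => ∫ s in 0..t, I1 s
  have hG := norm_le_integral_mul_exp_of_monotone (f := fun t => (P (I t), P (I1 t)))
    (f' := fun t => (P (I1 t), P (E t))) (k := fun _ => K + 1) (α := fun _ => 0) (b := T) ?_ ?_ ?_ monotone_const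
    (fun _ => by positivity) continuous_const (fun _ => le_rfl) ?_
  · intro t ht
    have h1 := hG t ht
    simp only [intervalIntegral.integral_zero, zero_mul] at h1
    have h2 : P (I t) = 0 := (Prod.mk.inj (norm_le_zero_iff.1 h1)).1
    have h3 : ‖P (E t)‖ ≤ K * ‖P (I t)‖ := h t ht
    rw [h2, norm_zero, mul_zero] at h3
    exact norm_le_zero_iff.1 h3
  · refine Continuous.continuousOn ?_
    exact (P.continuous.comp (intervalIntegral.continuous_primitive (fun a b => hI1c.intervalIntegrable a b) 0)).prodMk (P.continuous.comp hI1c)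
  · intro t _
    have d1 : HasDerivAt (fun t => P (I t)) (P (I1 t)) t :=
      P.hasFDerivAt.comp_hasDerivAt t (intervalIntegral.integral_hasDerivAt_right (hI1c.intervalIntegrable 0 t)
        hI1c.aestronglyMeasurable.stronglyMeasurableAtFilter hI1c.continuousAt)
    have d2 : HasDerivAt (fun t => P (I1 t)) (P (E t)) t :=
      P.hasFDerivAt.comp_hasDerivAt t (intervalIntegral.integral_hasDerivAt_right (hE.intervalIntegrable 0 t)
        hE.aestronglyMeasurable.stronglyMeasurableAtFilter hE.continuousAt)
    exact (d1.prodMk d2).hasDerivWithinAt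
  · simp [I, I1]
  · intro t ht
    simp only [Prod.norm_mk, add_zero]
    have h1 : ‖P (E t)‖ ≤ K * ‖P (I t)‖ := h t ⟨ht.1, ht.2.le⟩
    have h2 := le_max_left ‖P (I t)‖ ‖P (I1 t)‖
    have h3 := le_max_right ‖P (I t)‖ ‖P (I1 t)‖
    have h4 := norm_nonneg (P (I1 t))
    refine max_le ?_ ?_
    · nlinarith
    · nlinarith [norm_nonneg (P (I t))]

section
variable {X : Type*}

def lowFreq (ω : X → ℝ) (N : ℕ) : X → ℝ := (ω ⁻¹' Icc (-N) N).indicator fun _ => 1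

theorem measurable_lowFreq [MeasurableSpace X] {ω : X → ℝ} (hω : Measurable ω) (N : ℕ) : Measurable (lowFreq ω N) :=
  measurable_const.indicator (hω measurableSet_Icc)

theorem lowFreq_of_le {ω : X → ℝ} {x : X} (h : |ω x| ≤ N) : lowFreq ω N x = 1 := indicator_of_mem (show x ∈ ω ⁻¹' Icc (-(N:ℝ)) N from abs_le.1 h) _

theorem lowFreq_of_not_le {ω : X → ℝ} {x : X} (h : ¬|ω x| ≤ N) : lowFreq ω N x = 0 :=
  indicator_of_notMem (fun h' : x ∈ ω ⁻¹' Icc (-(N:ℝ)) N => h (abs_le.2 h')) _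

theorem abs_lowFreq_le (ω : X → ℝ) (N : ℕ) (x : X) : |lowFreq ω N x| ≤ 1 := by
  by_cases h : |ω x| ≤ N
  · simp [lowFreq_of_le h]
  · simp [lowFreq_of_not_le h]

section
variable [MeasurableSpace X] {μ : Measure X} {ω : X → ℝ} (hω : Measurable ω)
include hω

theorem eq_zero_of_mult_lowFreq {h : Lp ℂ 2 μ} (h0 : ∀ N : ℕ, mult (lowFreq ω N) h = 0) : h = 0 := by
  refine Lp.ext ?_
  have hall : ∀ᵐ x ∂μ, ∀ N : ℕ, lowFreq ω N x • h x = 0 := by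
    refine ae_all_iff.2 fun N => ?_
    have h1 := mult_ae_of_bound (measurable_lowFreq hω N) (abs_lowFreq_le ω N) h
    rw [h0 N] at h1
    filter_upwards [h1, Lp.coeFn_zero ℂ 2 μ] with x h2 h3
    rw [← h2, h3]; rfl
  filter_upwards [hall, Lp.coeFn_zero ℂ 2 μ] with x h1 h2
  rw [h2, Pi.zero_apply]
  obtain ⟨N, hN⟩ := exists_nat_ge |ω x|
  have h3 := h1 N
  rwa [lowFreq_of_le hN, one_smul] at h3

theorem norm_mult_lowFreq_le {g h : Lp ℂ 2 μ} (hgh : ∀ᵐ x ∂μ, g x = -(ω x ^ 2) • h x) (N : ℕ) :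
    ‖mult (lowFreq ω N) g‖ ≤ N ^ 2 * ‖mult (lowFreq ω N) h‖ := by
  refine Lp.norm_le_mul_norm_of_ae_le_mul ?_
  filter_upwards [hgh, mult_ae_of_bound (measurable_lowFreq hω N) (abs_lowFreq_le ω N) g,
    mult_ae_of_bound (measurable_lowFreq hω N) (abs_lowFreq_le ω N) h] with x h1 h2 h3
  rw [h2, h3, h1, norm_smul, norm_smul, norm_smul]
  by_cases hx : |ω x| ≤ N
  · simp only [lowFreq_of_le hx, norm_one, one_mul, norm_neg, norm_pow, Real.norm_eq_abs]
    gcongr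
  · simp [lowFreq_of_not_le hx]

end

end

theorem WeakWave.eq_zero (hT : 0 < T) (hD : ContinuousOn D (Icc 0 T)) (h : WeakWave T c 0 0 0 D) : ∀ t ∈ Icc 0 T, D t = 0 := by
  set E : ℝ → WaveField d n := fun t => D (projIcc 0 T hT.le t) with hE
  have hEc : Continuous E := (continuousOn_iff_continuous_restrict.1 hD).comp continuous_projIcc
  have hED : ∀ t ∈ Icc 0 T, E t = D t := fun t ht => by rw [hE]; simp only; rw [projIcc_of_mem hT.le ht]
  have hI1c : Continuous fun s => ∫ r in 0..s, E r := intervalIntegral.continuous_primitive (fun a b => hEc.intervalIntegrable a b) 0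
  have hker : ∀ t ∈ Icc 0 T, ∀ᵐ ζ : Freq d n, fourierField (E t) ζ
      = -(freq c ζ ^ 2) • fourierField (∫ s in 0..t, ∫ r in 0..s, E r) ζ := by
    intro t ht
    refine fourierField_ae_of_test c fun a ha => ?_
    have hb := ha.lapSnd.const_mul (c ^ 2)
    rw [hED t ht, h.eq_of_test hT hD ha t ht, ← hb.inner_wave, inner_intervalIntegral (hI1c.intervalIntegrable _ _)]
    refine intervalIntegral.integral_congr fun s hs => ?_
    rw [uIcc_of_le ht.1] at hs
    rw [inner_intervalIntegral (hEc.intervalIntegrable _ _)]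
    refine intervalIntegral.integral_congr fun r hr => ?_
    rw [uIcc_of_le hs.1] at hr
    rw [hED r ⟨hr.1, hr.2.trans (hs.2.trans ht.2)⟩, hb.inner_wave]
  have hfm : Measurable (freq c : Freq d n → ℝ) := (continuous_freq c).measurable
  intro t ht
  rw [← hED t ht]
  refine fourierField.injective ?_
  rw [map_zero]
  refine eq_zero_of_mult_lowFreq hfm fun N => ?_
  exact eq_zero_of_norm_le_iterated_integral (T := T) (K := (N:ℝ) ^ 2) (by positivity) hEc
    ((multL (lowFreq (freq c) N) (measurable_lowFreq hfm N) 1 (abs_lowFreq_le _ N)).comp fourierField.toContinuousLinearMap)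
    (fun t ht => norm_mult_lowFreq_le hfm (hker t ht) N) t ht

end Slices

section WaveSolution

variable {d n : ℕ}

variable {φ : ℝ × (Rd d × Rd n) → ℝ} {T c : ℝ} {g Ψ : ℝ → WaveField d n} {Ψ₀ Ψ₁ : WaveField d n}

theorem IsTest.fderiv_comm {X : Type*} [NormedAddCommGroup X] [NormedSpace ℝ X] {φ : X → ℝ} (hφ : IsTest φ) (a b : X) :
    (fun p => fderiv ℝ (fun p => fderiv ℝ φ p a) p b) = fun p => fderiv ℝ (fun p => fderiv ℝ φ p b) p a := by
  have hd : Differentiable ℝ (fderiv ℝ φ) := (hφ.1.fderiv_right (m := ((⊤ : ℕ∞) : WithTop ℕ∞)) (by simp)).differentiable (by simp)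
  have h1 : ∀ (p a b : X), fderiv ℝ (fun p => fderiv ℝ φ p a) p b = fderiv ℝ (fderiv ℝ φ) p b a := fun p a b => by
    rw [fderiv_clm_apply (hd p) (differentiableAt_const a)]
    simp
  ext p
  rw [h1, h1]
  exact (hφ.1.contDiffAt.isSymmSndFDerivAt (by simp only [minSmoothness_of_isRCLikeNormedField]; norm_cast)).eq b a

theorem IsTest.dt_lapTr (hφ : IsTest φ) : (fun p => fderiv ℝ (VlasovWave.lapTr φ) p (1, 0)) = VlasovWave.lapTr fun p => fderiv ℝ φ p (1, 0) := by
  ext p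
  unfold VlasovWave.lapTr
  rw [fderiv_fun_sum fun i _ => (((hφ.fderiv_apply (0, dirSnd d i)).fderiv_apply (0, dirSnd d i)).1.differentiable (by simp)) p]
  rw [ContinuousLinearMap.sum_apply]
  refine Finset.sum_congr rfl fun i _ => ?_
  rw [congrFun ((hφ.fderiv_apply (0, dirSnd d i)).fderiv_comm (0, dirSnd d i) (1, 0)) p, hφ.fderiv_comm (0, dirSnd d i) (1, 0)]

theorem IsTest.wave_congr {a b : Rd d × Rd n → ℝ} (ha : IsTest a) (hb : IsTest b) (h : a = b) : ha.wave = hb.wave := by subst h; rfl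

theorem IsTest.lapSnd_wave_slice (hφ : IsTest φ) (t : ℝ) : (hφ.slice t).lapSnd.wave = (hφ.lapTr.slice t).wave :=
  IsTest.wave_congr _ _ (hφ.lapSnd_slice t)

theorem IsTest.hasDerivAt_lapSnd_wave (hφ : IsTest φ) (t : ℝ) :
    HasDerivAt (fun s => (hφ.slice s).lapSnd.wave) ((hφ.fderiv_apply (1, 0)).slice t).lapSnd.wave t := by
  rw [show (fun s => (hφ.slice s).lapSnd.wave) = fun s => (hφ.lapTr.slice s).wave from funext fun s => hφ.lapSnd_wave_slice s,
    IsTest.lapSnd_wave_slice (hφ.fderiv_apply (1, 0)), IsTest.wave_congr _ ((hφ.lapTr.fderiv_apply (1, 0)).slice t) (funext fun q => congrFun hφ.dt_lapTr.symm (t, q))]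
  exact hφ.lapTr.hasDerivAt_wave t

theorem IsTest.wave_eq_zero (hφ : IsTest φ) (hs : tsupport φ ⊆ Iio T ×ˢ univ) : (hφ.slice T).wave = 0 := by
  refine Lp.ext ?_
  filter_upwards [(hφ.slice T).wave_ae, Lp.coeFn_zero ℝ 2 (volume : Measure (Rd d × Rd n))] with q h1 h2
  rw [h1, h2, Pi.zero_apply]
  exact image_eq_zero_of_notMem_tsupport fun h => lt_irrefl T (hs h).1

theorem integral_inner_duY {X : Type*} [MeasurableSpace X] {μ : Measure X} {ω : X → ℝ} (hω : Measurable ω) (hT : 0 < T) (a b : Lp ℂ 2 μ)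
    {g : ℝ → Lp ℂ 2 μ} (hg : Continuous g) {p p₁ p₂ q q₁ : ℝ → Lp ℂ 2 μ} (hp : ∀ t, HasDerivAt p (p₁ t) t) (hp₁ : ∀ t, HasDerivAt p₁ (p₂ t) t)
    (hq : ∀ t, HasDerivAt q (q₁ t) t) (hqp : ∀ t, q t =ᵐ[μ] fun x => ω x ^ 2 • p t x) (hqp₁ : ∀ t, q₁ t =ᵐ[μ] fun x => ω x ^ 2 • p₁ t x)
    (hp₂ : Continuous p₂) (z0 : p T = 0) (z1 : p₁ T = 0) (z2 : q T = 0) : ∫ t in Icc 0 T, inner ℂ (duY ω a b g t) (p₂ t + q t)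
      = -(∫ t in Icc 0 T, inner ℂ (g t) (p t)) + inner ℂ b (p 0) - inner ℂ a (p₁ 0) := by
  have hqc : Continuous q := continuous_iff_continuousAt.2 fun t => (hq t).continuousAt
  have hpc : Continuous p := continuous_iff_continuousAt.2 fun t => (hp t).continuousAt
  have key := fun t => hasDerivAt_pairing hω a b hg (hp t) (hp₁ t) (hq t) (hqp t) (hqp₁ t)
  have c1 : Continuous fun t => (inner ℂ (duY ω a b g t) (p₂ t + q t) : ℂ) := (continuous_duY hω a b hg).inner (hp₂.add hqc)
  have c2 : Continuous fun t => (inner ℂ (g t) (p t) : ℂ) := hg.inner hpc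
  have hF := intervalIntegral.integral_eq_sub_of_hasDerivAt (a := 0) (b := T) (fun t _ => key t) ((c1.add c2).intervalIntegrable _ _)
  rw [intervalIntegral.integral_add (c1.intervalIntegrable _ _) (c2.intervalIntegrable _ _)] at hF
  have mz : ∀ (m : ℝ → X → ℝ), IsMultiplier m → ∀ t, mult (m t) (0 : Lp ℂ 2 μ) = 0 := fun m hm t => by
    obtain ⟨K, -, hK⟩ := hm.exists_bound t
    exact map_zero (multL (μ := μ) (m t) (hm.measurable t) K hK)
  rw [z1, z2, z0, mz _ (isMultiplier_cosM hω), mz _ (isMultiplier_sinM hω), duA_zero, duB_zero,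
    mult_cosM_zero _ hω, mult_cosM_zero _ hω, mult_sinM_zero _ hω, mult_sinM_zero _ hω, add_zero, sub_zero, inner_zero_right,
    inner_zero_right, add_zero, add_zero, zero_sub, zero_sub, inner_neg_right] at hF
  rw [integral_Icc_eq_integral_Ioc, integral_Icc_eq_integral_Ioc, ← intervalIntegral.integral_of_le hT.le, ← intervalIntegral.integral_of_le hT.le]
  exact (eq_sub_of_add_eq hF).trans (by ring)

theorem IsTest.lapSnd_wave_eq_zero (hφ : IsTest φ) (hs : tsupport φ ⊆ Iio T ×ˢ univ) : (hφ.slice T).lapSnd.wave = 0 := by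
  rw [hφ.lapSnd_wave_slice]
  refine hφ.lapTr.wave_eq_zero (Subset.trans (closure_minimal (fun p hp => ?_) (isClosed_tsupport φ)) hs)
  obtain ⟨i, -, hi⟩ := Finset.exists_ne_zero_of_sum_ne_zero hp
  exact tsupport_fderiv_apply_subset ℝ (0, dirSnd d i) (tsupport_fderiv_apply_subset ℝ (0, dirSnd d i) (subset_tsupport _ hi))

theorem duhamel_weak (c : ℝ) (hT : 0 < T) (Ψ₀ Ψ₁ : WaveField d n) (hg : Continuous g) (hφ : IsTest φ) (hs : tsupport φ ⊆ Iio T ×ˢ univ) :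
    ∫ t in Icc 0 T, inner ℂ (duY (freq c) (fourierField Ψ₀) (fourierField Ψ₁) (fun s => fourierField (g s)) t)
        (fourierField ((hφ.dAlembert c).slice t).wave)
      = -(∫ t in Icc 0 T, ((inner ℝ (g t) (hφ.slice t).wave : ℝ) : ℂ)) + (inner ℝ Ψ₁ (hφ.slice 0).wave : ℝ)
        - (inner ℝ Ψ₀ ((hφ.fderiv_apply (1, 0)).slice 0).wave : ℝ) := by
  have hφ₁ := hφ.fderiv_apply (1, 0)
  have hφ₂ := hφ₁.fderiv_apply (1, 0)
  have hUd : ∀ {u : ℝ → WaveField d n} {u' : WaveField d n} {t : ℝ}, HasDerivAt u u' t →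
      HasDerivAt (fun t => fourierField (u t)) (fourierField u') t :=
    fun h => fourierField.toContinuousLinearMap.hasFDerivAt.comp_hasDerivAt _ h
  have h1 := integral_inner_duY (continuous_freq c).measurable hT (fourierField Ψ₀) (fourierField Ψ₁)
    (g := fun s => fourierField (g s)) (fourierField.continuous.comp hg)
    (p := fun t => fourierField (hφ.slice t).wave) (p₁ := fun t => fourierField (hφ₁.slice t).wave)
    (p₂ := fun t => fourierField (hφ₂.slice t).wave) (q := fun t => -(c ^ 2) • fourierField (hφ.slice t).lapSnd.wave)
    (q₁ := fun t => -(c ^ 2) • fourierField (hφ₁.slice t).lapSnd.wave)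
    (fun t => hUd (hφ.hasDerivAt_wave t)) (fun t => hUd (hφ₁.hasDerivAt_wave t))
    (fun t => (hUd (hφ.hasDerivAt_lapSnd_wave t)).fun_const_smul _) (fun t => (hφ.slice t).fourierField_lapSnd c)
    (fun t => (hφ₁.slice t).fourierField_lapSnd c) (fourierField.continuous.comp hφ₂.continuous_wave)
    ?_ ?_ ?_
  · simp only [inner_fourierField] at h1
    rw [← h1]
    refine integral_ext fun t => ?_
    rw [hφ.dAlembert_wave, map_sub, map_smul, neg_smul, ← sub_eq_add_neg]
  · simp only [hφ.wave_eq_zero hs, map_zero]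
  · simp only [hφ₁.wave_eq_zero (fun p hp => hs (tsupport_fderiv_apply_subset ℝ (1, 0) hp)), map_zero]
  · simp only [hφ.lapSnd_wave_eq_zero hs, map_zero, smul_zero]

/-- The solution of `∂ₜₜΨ - c² Δ_y Ψ = -g` given by Duhamel's formula. -/
def waveSol (c : ℝ) (Ψ₀ Ψ₁ : WaveField d n) (g : ℝ → WaveField d n) (t : ℝ) : WaveField d n :=
  reField (duY (freq c) (fourierField Ψ₀) (fourierField Ψ₁) (fun s => fourierField (g s)) t)

theorem continuous_duhamel (c : ℝ) (Ψ₀ Ψ₁ : WaveField d n) (hg : Continuous g) :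
    Continuous (duY (freq c) (fourierField Ψ₀) (fourierField Ψ₁) fun s => fourierField (g s)) :=
  continuous_duY (continuous_freq c).measurable _ _ (fourierField.continuous.comp hg)

theorem continuous_waveSol (c : ℝ) (Ψ₀ Ψ₁ : WaveField d n) (hg : Continuous g) : Continuous (waveSol c Ψ₀ Ψ₁ g) :=
  reField.continuous.comp (continuous_duhamel c Ψ₀ Ψ₁ hg)

theorem duhamel_weak_re_im (c : ℝ) (hT : 0 < T) (Ψ₀ Ψ₁ : WaveField d n) (hg : Continuous g) :
    WeakWave T c (fun t => -g t) Ψ₀ Ψ₁ (waveSol c Ψ₀ Ψ₁ g) ∧ WeakWave T c 0 0 0 fun t =>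
      imField (duY (freq c) (fourierField Ψ₀) (fourierField Ψ₁) (fun s => fourierField (g s)) t) := by
  have hY := continuous_duhamel c Ψ₀ Ψ₁ hg
  have key : ∀ (φ : ℝ × (Rd d × Rd n) → ℝ) (hφ : IsTest φ), tsupport φ ⊆ Iio T ×ˢ univ →
      ((∫ t in Icc 0 T, inner ℝ (waveSol c Ψ₀ Ψ₁ g t) ((hφ.dAlembert c).slice t).wave : ℝ) : ℂ)
        - (∫ t in Icc 0 T, inner ℝ (imField (duY (freq c) (fourierField Ψ₀) (fourierField Ψ₁)
          (fun s => fourierField (g s)) t)) ((hφ.dAlembert c).slice t).wave : ℝ) * Complex.I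
      = ((-(∫ t in Icc 0 T, inner ℝ (g t) (hφ.slice t).wave) + inner ℝ Ψ₁ (hφ.slice 0).wave
        - inner ℝ Ψ₀ ((hφ.fderiv_apply (1, 0)).slice 0).wave : ℝ) : ℂ) := by
    intro φ hφ hs
    have h1 := duhamel_weak c hT Ψ₀ Ψ₁ hg hφ hs
    simp only [inner_fourierField_right] at h1
    have i1 : IntegrableOn (fun t => inner ℝ (waveSol c Ψ₀ Ψ₁ g t) ((hφ.dAlembert c).slice t).wave) (Icc 0 T) :=
      integrableOn_inner_wave (continuous_waveSol c Ψ₀ Ψ₁ hg).continuousOn (hφ.dAlembert c)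
    have i2 := integrableOn_inner_wave (T := T) (imField.continuous.comp hY).continuousOn (hφ.dAlembert c)
    have h2 := integral_sub i1.ofReal (i2.ofReal.mul_const Complex.I)
    have h3 := h2.symm.trans h1
    rw [integral_mul_const, integral_ofReal, integral_ofReal, integral_complex_ofReal] at h3
    push_cast
    exact h3
  constructor
  · intro φ hφ hs
    have := congrArg Complex.re (key φ hφ hs)
    simp only [Complex.sub_re, Complex.ofReal_re, Complex.mul_re, Complex.I_re, Complex.I_im, Complex.ofReal_im, mul_zero, zero_mul, sub_zero] at this
    simp only [inner_neg_left, integral_neg]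
    exact this
  · intro φ hφ hs
    have := congrArg Complex.im (key φ hφ hs)
    simp only [Complex.sub_im, Complex.ofReal_re, Complex.mul_im, Complex.I_re, Complex.I_im, Complex.ofReal_im, mul_zero,
      mul_one, add_zero, zero_sub, neg_eq_zero] at this
    simp only [Pi.zero_apply, inner_zero_left, integral_zero, add_zero, sub_zero]
    exact this

theorem weakWave_waveSol (c : ℝ) (hT : 0 < T) (Ψ₀ Ψ₁ : WaveField d n) (hg : Continuous g) :
    WeakWave T c (fun t => -g t) Ψ₀ Ψ₁ (waveSol c Ψ₀ Ψ₁ g) := (duhamel_weak_re_im c hT Ψ₀ Ψ₁ hg).1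

theorem fourierField_waveSol (c : ℝ) (Ψ₀ Ψ₁ : WaveField d n) (hg : Continuous g) {t : ℝ} (ht : 0 ≤ t) : fourierField (waveSol c Ψ₀ Ψ₁ g t)
      = duY (freq c) (fourierField Ψ₀) (fourierField Ψ₁) (fun s => fourierField (g s)) t := by
  refine (eq_fourierField_reField ?_).symm
  exact (duhamel_weak_re_im c (T := t + 1) (by linarith) Ψ₀ Ψ₁ hg).2.eq_zero (by linarith)
    (imField.continuous.comp (continuous_duhamel c Ψ₀ Ψ₁ hg)).continuousOn t ⟨ht, by linarith⟩

theorem WeakWave.congr_source {g' : ℝ → WaveField d n} (h : WeakWave T c g Ψ₀ Ψ₁ Ψ) (hg : EqOn g g' (Icc 0 T)) : WeakWave T c g' Ψ₀ Ψ₁ Ψ := by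
  intro φ hφ hs
  rw [h φ hφ hs]
  congr 2
  exact setIntegral_congr_fun measurableSet_Icc fun t ht => by simp only [hg ht]

theorem WeakWave.eq_waveSol (hT : 0 < T) (hg : Continuous g) (h : WeakWave T c (fun t => -g t) Ψ₀ Ψ₁ Ψ) (hΨ : ContinuousOn Ψ (Icc 0 T)) :
    EqOn Ψ (waveSol c Ψ₀ Ψ₁ g) (Icc 0 T) := by
  intro t ht
  have hc := (continuous_waveSol c Ψ₀ Ψ₁ hg).continuousOn (s := Icc 0 T)
  exact sub_eq_zero.1 ((h.sub (weakWave_waveSol c hT Ψ₀ Ψ₁ hg) hΨ hc).eq_zero hT (hΨ.sub hc) t ht)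

end WaveSolution

section Coupling

variable {d n : ℕ}

variable {k m : ℕ} {a a' σ₁ : Rd d → ℝ} {b b' σ₂ : Rd n → ℝ} {f : Rd d × Rd n → ℝ}

def sobN (k : ℕ) (a : Rd m → ℝ) : ℝ := (eLpNorm (iteratedFDeriv ℝ k a) 2 volume).toReal

theorem sobN_nonneg (k : ℕ) (a : Rd m → ℝ) : 0 ≤ sobN k a := ENNReal.toReal_nonneg

theorem sobN_mul_nonneg {j : ℕ} {a : Rd d → ℝ} {b : Rd n → ℝ} : 0 ≤ sobN j a * sobN k b := mul_nonneg (sobN_nonneg _ _) (sobN_nonneg _ _)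

theorem sobN_const_zero (m k : ℕ) : sobN k (fun _ : Rd m => (0:ℝ)) = 0 := by
  unfold sobN
  rw [show iteratedFDeriv ℝ k (fun _ : Rd m => (0:ℝ)) = 0 from iteratedFDeriv_zero_fun]
  simp

theorem IsTest.sub {X : Type*} [NormedAddCommGroup X] [NormedSpace ℝ X] {a b : X → ℝ} (ha : IsTest a) (hb : IsTest b) :
    IsTest fun x => a x - b x := by
  have := ha.add (hb.const_mul (-1))
  simpa only [neg_one_mul, ← sub_eq_add_neg] using this

theorem IsTest.memLp_iteratedFDeriv {a : Rd m → ℝ} (ha : IsTest a) (k : ℕ) : MemLp (iteratedFDeriv ℝ k a) 2 :=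
  (ha.1.continuous_iteratedFDeriv (by norm_cast; exact le_top)).memLp_of_hasCompactSupport (ha.2.iteratedFDeriv k)

theorem IsTest.sobN_zero {a : Rd m → ℝ} (ha : IsTest a) : sobN 0 a ^ 2 = ∫ x, a x ^ 2 := by
  have h : eLpNorm (iteratedFDeriv ℝ 0 a) 2 volume = eLpNorm a 2 volume := eLpNorm_congr_norm_ae (ae_of_all _ fun x => norm_iteratedFDeriv_zero)
  have h2 := (ha.memLp (p := 2)).eLpNorm_eq_integral_rpow_norm (by norm_num) (by norm_num)
  rw [sobN, h, h2, ENNReal.toReal_ofReal (by positivity), ← Real.rpow_natCast, ← Real.rpow_mul (by positivity)]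
  simp

theorem IsTest.sobN_fderiv_apply_le {a : Rd m → ℝ} (ha : IsTest a) (k : ℕ) (e : Rd m) : sobN k (fun p => fderiv ℝ a p e) ≤ ‖e‖ * sobN (k + 1) a := by
  have hf : MemLp (iteratedFDeriv ℝ (k + 1) a) 2 := ha.memLp_iteratedFDeriv (k + 1)
  have h : eLpNorm (iteratedFDeriv ℝ k fun p => fderiv ℝ a p e) 2 volume ≤ ENNReal.ofReal ‖e‖ * eLpNorm (iteratedFDeriv ℝ (k + 1) a) 2 volume := by
    refine eLpNorm_le_mul_eLpNorm_of_ae_le_mul (ae_of_all _ fun x => ?_) 2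
    rw [← norm_iteratedFDeriv_fderiv]
    exact norm_iteratedFDeriv_clm_apply_const (N := ((⊤ : ℕ∞) : WithTop ℕ∞))
      ((ha.1.fderiv_right (m := ((⊤ : ℕ∞) : WithTop ℕ∞)) (by simp)).contDiffAt) (by norm_cast; exact le_top)
  refine (ENNReal.toReal_mono (ENNReal.mul_ne_top ENNReal.ofReal_ne_top hf.2.ne) h).trans ?_
  rw [ENNReal.toReal_mul, ENNReal.toReal_ofReal (norm_nonneg _)]
  rfl

section
variable (ha : IsTest a) (hb : IsTest b) (x : Rd d)
include ha hb x

theorem IsTest.prod_sub : IsTest (fun q : Rd d × Rd n => a (x - q.1) * b q.2) := by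
  have ha' := ha.comp_sub_left x
  refine ⟨(ha'.1.comp contDiff_fst).mul (hb.1.comp contDiff_snd), ?_⟩
  refine HasCompactSupport.intro (ha'.2.isCompact.prod hb.2.isCompact) fun p hp => ?_
  by_cases h1 : p.1 ∈ tsupport fun y => a (x - y)
  · have h2 : p.2 ∉ tsupport b := fun h2 => hp ⟨h1, h2⟩
    rw [image_eq_zero_of_notMem_tsupport h2, mul_zero]
  · have : a (x - p.1) = 0 := image_eq_zero_of_notMem_tsupport (f := fun y => a (x - y)) h1
    rw [this, zero_mul]

def elem : WaveField d n := (ha.prod_sub hb x).wave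

theorem elem_ae : elem ha hb x =ᵐ[volume] fun q => a (x - q.1) * b q.2 := (ha.prod_sub hb x).wave_ae

end

theorem norm_wave_sq (hf : IsTest f) : ‖hf.wave‖ ^ 2 = ∫ q, f q * f q := by
  rw [← real_inner_self_eq_norm_sq, hf.inner_wave]
  refine integral_congr_ae ?_
  filter_upwards [hf.wave_ae] with q hq
  rw [hq]

section
variable (ha : IsTest a) (hb : IsTest b)
include ha hb

theorem norm_elem (x : Rd d) : ‖elem ha hb x‖ = sobN 0 a * sobN 0 b := by
  rw [← sq_eq_sq₀ (norm_nonneg _) sobN_mul_nonneg, elem, norm_wave_sq, mul_pow,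
    ha.sobN_zero, hb.sobN_zero, ← integral_sub_left_eq_self (fun z => a z ^ 2) volume x, Measure.volume_eq_prod,
    ← integral_prod_mul (fun z => a (x - z) ^ 2) fun y => b y ^ 2]
  exact integral_ext fun q => by ring

theorem potential_eq_inner (Ψ : WaveField d n) (x : Rd d) : potential a b Ψ x = inner ℝ Ψ (elem ha hb x) := by
  rw [elem, IsTest.inner_wave, potential]
  exact integral_ext fun q => by ring

theorem abs_potential_le (Ψ : WaveField d n) (x : Rd d) : |potential a b Ψ x| ≤ ‖Ψ‖ * (sobN 0 a * sobN 0 b) := by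
  rw [potential_eq_inner ha hb, ← norm_elem ha hb x]
  exact abs_real_inner_le_norm _ _

end

/-- The transverse average of a field against a form function. -/
def sndAverage (b : Rd n → ℝ) (Ψ : WaveField d n) (z : Rd d) : ℝ := ∫ y, Ψ (z, y) * b y

theorem integrable_field_mul (Ψ : WaveField d n) (hf : MemLp f 2) : Integrable (fun q => Ψ q * f q) := (Lp.memLp Ψ).integrable_mul hf

section
variable {X Y : Type*} [MeasureSpace X] [MeasureSpace Y] [SFinite (volume : Measure X)] [SFinite (volume : Measure Y)]

theorem integral_prod_volume {E : Type*} [NormedAddCommGroup E] [NormedSpace ℝ E] {h : X × Y → E} (hi : Integrable h) :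
    Integrable (fun x => ∫ y, h (x, y)) ∧ ∫ x, ∫ y, h (x, y) = ∫ q, h q :=
  ⟨Integrable.integral_prod_left hi, (integral_prod h hi).symm⟩

theorem memLp_mul_prod {f : X → ℝ} {g : Y → ℝ} (hf : MemLp f 2) (hg : MemLp g 2) : MemLp (fun q : X × Y => f q.1 * g q.2) 2 := by
  refine (memLp_two_iff_integrable_sq (hf.1.comp_fst.mul hg.1.comp_snd)).2 ?_
  exact (hf.integrable_sq.mul_prod hg.integrable_sq).congr (ae_of_all _ fun q => (mul_pow (f q.1) (g q.2) 2).symm)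

end

theorem integral_mul_sndAverage (hb : IsTest b) (Ψ : WaveField d n) {w : Rd d → ℝ} (hw : MemLp w 2) : Integrable (fun z => w z * sndAverage b Ψ z) ∧
      ∫ z, w z * sndAverage b Ψ z = ∫ q : Rd d × Rd n, Ψ q * (w q.1 * b q.2) := by
  have hf : MemLp (fun q : Rd d × Rd n => w q.1 * b q.2) 2 := memLp_mul_prod hw hb.memLp
  have hi := integrable_field_mul Ψ hf
  have e : ∀ z, w z * sndAverage b Ψ z = ∫ y, Ψ (z, y) * (w z * b y) := fun z => by
    rw [sndAverage, ← integral_const_mul]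
    exact integral_ext fun y => by ring
  simp only [e]
  exact integral_prod_volume hi

theorem locallyIntegrable_sndAverage (hb : IsTest b) (Ψ : WaveField d n) : LocallyIntegrable (sndAverage b Ψ) := by
  refine (locallyIntegrable_iff).2 fun K hK => ?_
  have h := (integral_mul_sndAverage hb Ψ (memLp_indicator_const 2 hK.measurableSet (1:ℝ) (Or.inr hK.measure_lt_top.ne))).1
  rw [← integrable_indicator_iff hK.measurableSet]
  refine h.congr (ae_of_all _ fun z => ?_)
  by_cases hz : z ∈ K
  · simp [hz]
  · simp [hz]

section
variable (ha : IsTest a) (hb : IsTest b) (Ψ : WaveField d n)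
include ha hb Ψ

theorem potential_eq_integral (x : Rd d) : potential a b Ψ x = ∫ z, a (x - z) * sndAverage b Ψ z := by
  rw [(integral_mul_sndAverage hb Ψ ((ha.comp_sub_left x).memLp (p := 2))).2, potential]
  exact integral_ext fun q => by ring

theorem potential_eq_convolution : potential a b Ψ = a ⋆[ContinuousLinearMap.lsmul ℝ ℝ, volume] sndAverage b Ψ := by
  ext x
  rw [potential_eq_integral ha hb, convolution, ← integral_sub_left_eq_self _ volume x]
  simp

theorem differentiable_potential : Differentiable ℝ (potential a b Ψ) := by
  rw [potential_eq_convolution ha hb]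
  exact ha.differentiable_convolution (locallyIntegrable_sndAverage hb Ψ)

theorem fderiv_potential (x e : Rd d) : fderiv ℝ (potential a b Ψ) x e = potential (fun p => fderiv ℝ a p e) b Ψ x := by
  rw [potential_eq_integral (ha.fderiv_apply e) hb, potential_eq_convolution ha hb, ha.fderiv_convolution_apply (locallyIntegrable_sndAverage hb Ψ)]

theorem inner_elem_fderiv_le (x e : Rd d) : |inner ℝ Ψ (elem (ha.fderiv_apply e) hb x)| ≤ ‖Ψ‖ * (sobN 1 a * sobN 0 b) * ‖e‖ := by
  refine (abs_real_inner_le_norm _ _).trans ?_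
  rw [norm_elem, mul_assoc, mul_right_comm, mul_comm (sobN 1 a)]
  exact mul_le_mul_of_nonneg_left (mul_le_mul_of_nonneg_right (ha.sobN_fderiv_apply_le 0 e) (sobN_nonneg _ _)) (norm_nonneg _)

theorem potential_sub_le (x y : Rd d) : |potential a b Ψ x - potential a b Ψ y| ≤ ‖Ψ‖ * (sobN 1 a * sobN 0 b) * ‖x - y‖ := by
  refine Convex.norm_image_sub_le_of_norm_fderiv_le (𝕜 := ℝ) (s := univ) (fun z _ => differentiable_potential ha hb Ψ z)
    (fun z _ => ?_) convex_univ (mem_univ _) (mem_univ _)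
  refine ContinuousLinearMap.opNorm_le_bound _ (mul_nonneg (norm_nonneg _) sobN_mul_nonneg) fun e => ?_
  rw [fderiv_potential ha hb, potential_eq_inner (ha.fderiv_apply e) hb]
  exact inner_elem_fderiv_le ha hb Ψ z e

end

theorem norm_elem_sub_le (ha : IsTest a) (hb : IsTest b) (x y : Rd d) : ‖elem ha hb x - elem ha hb y‖ ≤ sobN 1 a * sobN 0 b * ‖x - y‖ := by
  set D := elem ha hb x - elem ha hb y with hD
  have h := potential_sub_le ha hb D x y
  rw [potential_eq_inner ha hb, potential_eq_inner ha hb, ← inner_sub_right, ← hD, real_inner_self_eq_norm_sq, abs_of_nonneg (sq_nonneg _)] at h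
  by_cases h0 : ‖D‖ = 0
  · rw [h0]; exact mul_nonneg sobN_mul_nonneg (norm_nonneg _)
  · have h1 : 0 < ‖D‖ := lt_of_le_of_ne (norm_nonneg _) (Ne.symm h0)
    refine le_of_mul_le_mul_left ?_ h1
    calc _ = ‖D‖ ^ 2 := by ring
      _ ≤ _ := h
      _ = _ := by ring

theorem continuous_elem (ha : IsTest a) (hb : IsTest b) : Continuous (elem ha hb) :=
  (LipschitzWith.of_dist_le_mul (K := NNReal.mk (sobN 1 a * sobN 0 b) sobN_mul_nonneg) fun x y => by
    rw [dist_eq_norm, dist_eq_norm]; exact norm_elem_sub_le ha hb x y).continuous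

theorem inner_gradient {f : Rd d → ℝ} {x : Rd d} (hf : DifferentiableAt ℝ f x) (e : Rd d) : inner ℝ (gradient f x) e = fderiv ℝ f x e := by
  have h1 := hf.hasGradientAt.hasFDerivAt.fderiv
  rw [h1]; rfl

/-- The force `-∇Φ` created by the field `Ψ`. -/
def force (a : Rd d → ℝ) (b : Rd n → ℝ) (Ψ : WaveField d n) (x : Rd d) : Rd d := -gradient (potential a b Ψ) x

theorem inner_force (ha : IsTest a) (hb : IsTest b) (Ψ : WaveField d n) (x e : Rd d) :
    inner ℝ (force a b Ψ x) e = -inner ℝ Ψ (elem (ha.fderiv_apply e) hb x) := by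
  rw [force, inner_neg_left, inner_gradient (differentiable_potential ha hb Ψ x), fderiv_potential ha hb, potential_eq_inner]

theorem norm_le_of_inner_le {v : Rd d} {K : ℝ} (hK : 0 ≤ K) (h : ∀ e, inner ℝ v e ≤ K * ‖e‖) : ‖v‖ ≤ K := by
  have h1 := h v
  rw [real_inner_self_eq_norm_sq] at h1
  by_contra h2
  push Not at h2
  nlinarith [norm_nonneg v]

section
variable (ha : IsTest a) (hb : IsTest b)
include ha hb

theorem elem_sub (ha' : IsTest a') (hb' : IsTest b') {w : Rd d → ℝ} {u : Rd n → ℝ} (hw : IsTest w) (hu : IsTest u) (h : ∀ x, a x - a' x = w x)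
    (h' : ∀ y, b y - b' y = u y) (x : Rd d) : elem ha hb x - elem ha' hb' x = elem hw hb x + elem ha' hu x := by
  refine Lp.ext ?_
  filter_upwards [Lp.coeFn_sub (elem ha hb x) (elem ha' hb' x), Lp.coeFn_add (elem hw hb x) (elem ha' hu x), elem_ae ha hb x,
    elem_ae ha' hb' x, elem_ae hw hb x, elem_ae ha' hu x] with q h1 h2 h3 h4 h5 h6
  rw [h1, h2, Pi.sub_apply, Pi.add_apply, h3, h4, h5, h6, ← h, ← h']
  ring

theorem norm_force_sub_le (ha' : IsTest a') (hb' : IsTest b') (Ψ Ψ' : WaveField d n) (x : Rd d) :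
    ‖force a b Ψ x - force a' b' Ψ' x‖ ≤ ‖Ψ - Ψ'‖ * (sobN 1 a * sobN 0 b) + ‖Ψ'‖ * (sobN 1 (fun x => a x - a' x) * sobN 0 b
      + sobN 1 a' * sobN 0 (fun x => b x - b' x)) := by
  refine norm_le_of_inner_le (add_nonneg (mul_nonneg (norm_nonneg _) sobN_mul_nonneg)
    (mul_nonneg (norm_nonneg _) (add_nonneg sobN_mul_nonneg sobN_mul_nonneg))) fun e => ?_
  have e1 := elem_sub (ha.fderiv_apply e) hb (ha'.fderiv_apply e) hb' ((ha.sub ha').fderiv_apply e) (hb.sub hb')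
    (fun p => by rw [fderiv_fun_sub ((ha.1.differentiable (by simp)) _) ((ha'.1.differentiable (by simp)) _)]; rfl) (fun _ => rfl) x
  have e2 : inner ℝ (force a b Ψ x - force a' b' Ψ' x) e = -(inner ℝ (Ψ - Ψ') (elem (ha.fderiv_apply e) hb x)
      + (inner ℝ Ψ' (elem ((ha.sub ha').fderiv_apply e) hb x) + inner ℝ Ψ' (elem (ha'.fderiv_apply e) (hb.sub hb') x))) := by
    rw [← inner_add_right, ← e1, inner_sub_left, inner_force ha hb, inner_force ha' hb', inner_sub_left, inner_sub_right]
    ring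
  rw [e2]
  have h1 := (abs_le.1 (inner_elem_fderiv_le ha hb (Ψ - Ψ') x e)).1
  have h2 := (abs_le.1 (inner_elem_fderiv_le (ha.sub ha') hb Ψ' x e)).1
  have h3 := (abs_le.1 (inner_elem_fderiv_le ha' (hb.sub hb') Ψ' x e)).1
  linarith

theorem norm_force_sub_le' (Ψ Ψ' : WaveField d n) (x : Rd d) : ‖force a b Ψ x - force a b Ψ' x‖ ≤ ‖Ψ - Ψ'‖ * (sobN 1 a * sobN 0 b) := by
  have := norm_force_sub_le ha hb ha hb Ψ Ψ' x
  simpa only [sub_self, sobN_const_zero, zero_mul, mul_zero, add_zero] using this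

theorem norm_force_le (Ψ : WaveField d n) (x : Rd d) : ‖force a b Ψ x‖ ≤ ‖Ψ‖ * (sobN 1 a * sobN 0 b) := by
  refine norm_le_of_inner_le (mul_nonneg (norm_nonneg _) sobN_mul_nonneg) fun e => ?_
  rw [inner_force ha hb]
  linarith [(abs_le.1 (inner_elem_fderiv_le ha hb Ψ x e)).1]

theorem norm_force_sub_force_le (Ψ : WaveField d n) (x y : Rd d) : ‖force a b Ψ x - force a b Ψ y‖ ≤ ‖Ψ‖ * (sobN 2 a * sobN 0 b) * ‖x - y‖ := by
  have n1 := sobN_nonneg 2 a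
  have n2 := sobN_nonneg 0 b
  refine norm_le_of_inner_le (by positivity) fun e => ?_
  rw [inner_sub_left, inner_force ha hb, inner_force ha hb, ← potential_eq_inner, ← potential_eq_inner]
  have h0 := (abs_le.1 (potential_sub_le (ha.fderiv_apply e) hb Ψ x y)).1
  have h1 := ha.sobN_fderiv_apply_le 1 e
  have h2 : sobN 1 (fun p => fderiv ℝ a p e) * sobN 0 b ≤ ‖e‖ * sobN 2 a * sobN 0 b := mul_le_mul_of_nonneg_right h1 n2
  have h3 := mul_le_mul_of_nonneg_right (mul_le_mul_of_nonneg_left h2 (norm_nonneg Ψ)) (norm_nonneg (x - y))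
  linarith

theorem isForce_force {Ψ : ℝ → WaveField d n} (hΨ : Continuous Ψ) {K : ℝ → ℝ} (hK : ∀ T t, |t| ≤ T → ‖Ψ t‖ ≤ K T) :
    IsForce (fun t => force a b (Ψ t)) (fun T => K T * (sobN 1 a * sobN 0 b)) (fun T => K T * (sobN 2 a * sobN 0 b)) where
  continuous := by
    rw [continuous_iff_continuousAt]
    rintro ⟨t, x⟩
    have c : Continuous fun p : ℝ × Rd d => ‖Ψ p.1 - Ψ t‖ * (sobN 1 a * sobN 0 b) + ‖Ψ t‖ * (sobN 2 a * sobN 0 b) * ‖p.2 - x‖ := by fun_prop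
    exact tendsto_iff_norm_sub_tendsto_zero.2 (squeeze_zero (fun _ => norm_nonneg _) (fun p => (norm_sub_le_norm_sub_add_norm_sub _
      (force a b (Ψ t) p.2) _).trans (add_le_add (norm_force_sub_le' ha hb _ _ _) (norm_force_sub_force_le ha hb _ _ _)))
      (by simpa using c.tendsto (t, x)))
  bound T t x h := (norm_force_le ha hb _ _).trans (mul_le_mul_of_nonneg_right (hK T t h) sobN_mul_nonneg)
  lipschitz T t x y h := (norm_force_sub_force_le ha hb _ _ _).trans (mul_le_mul_of_nonneg_right (mul_le_mul_of_nonneg_right (hK T t h)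
    sobN_mul_nonneg) (norm_nonneg _))

end

section
variable (ha : IsTest a) (hb : IsTest b)
include ha hb

theorem integrable_smul_elem (f : Density d) : Integrable fun z : Rd d × Rd d => f z • elem ha hb z.1 := by
  refine ((L1.integrable_coeFn f).norm.mul_const (sobN 0 a * sobN 0 b)).mono'
    ((L1.integrable_coeFn f).1.smul ((continuous_elem ha hb).comp continuous_fst).aestronglyMeasurable)
    (ae_of_all _ fun z => ?_)
  rw [norm_smul, norm_elem]

/-- The source `σ₂(y) ∫ σ₁(x - z) ρ(z) dz` of the wave equation. -/
def source (f : Density d) : WaveField d n := ∫ z : Rd d × Rd d, f z • elem ha hb z.1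

theorem inner_source (f : Density d) (Ψ : WaveField d n) : inner ℝ Ψ (source ha hb f) = ∫ z : Rd d × Rd d, f z * potential a b Ψ z.1 := by
  rw [source, ← integral_inner (integrable_smul_elem ha hb f)]
  exact integral_ext (fun z => by rw [inner_smul_right, potential_eq_inner])

theorem norm_source_le (f : Density d) : ‖source ha hb f‖ ≤ sobN 0 a * sobN 0 b * ‖f‖ := by
  rw [L1.norm_eq_integral_norm, ← integral_const_mul]
  refine norm_integral_le_of_norm_le ((L1.integrable_coeFn f).norm.const_mul _) (ae_of_all _ fun z => ?_)
  rw [norm_smul, norm_elem, mul_comm]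

theorem source_sub (f g : Density d) : source ha hb (f - g) = source ha hb f - source ha hb g := by
  rw [source, source, source, ← integral_sub (integrable_smul_elem ha hb f) (integrable_smul_elem ha hb g)]
  refine integral_congr_ae ?_
  filter_upwards [Lp.coeFn_sub f g] with z hz
  rw [hz, Pi.sub_apply, sub_smul]

theorem norm_source_sub_le (ha' : IsTest a') (hb' : IsTest b') (f : Density d) :
    ‖source ha hb f - source ha' hb' f‖ ≤ (sobN 0 (fun x => a x - a' x) * sobN 0 b + sobN 0 a' * sobN 0 (fun x => b x - b' x)) * ‖f‖ := by
  rw [source, source, ← integral_sub (integrable_smul_elem ha hb f) (integrable_smul_elem ha' hb' f), L1.norm_eq_integral_norm, ← integral_const_mul]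
  refine norm_integral_le_of_norm_le ((L1.integrable_coeFn f).norm.const_mul _) (ae_of_all _ fun z => ?_)
  rw [← smul_sub, elem_sub ha hb ha' hb' (ha.sub ha') (hb.sub hb') (fun _ => rfl) (fun _ => rfl), norm_smul, mul_comm]
  refine mul_le_mul_of_nonneg_right ((norm_add_le _ _).trans ?_) (norm_nonneg _)
  rw [norm_elem, norm_elem]

theorem continuous_source : Continuous (source ha hb) :=
  (LipschitzWith.of_dist_le_mul (K := NNReal.mk (sobN 0 a * sobN 0 b) sobN_mul_nonneg) fun x y => by
    rw [dist_eq_norm, dist_eq_norm, ← source_sub]; exact norm_source_le ha hb _).continuous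

end

theorem IsFormFunction.isTest {σ : Rd k → ℝ} (h : IsFormFunction σ) : IsTest σ := ⟨h.smooth, h.compactSupport⟩

theorem IsFormFunction.symm {σ : Rd k → ℝ} (h : IsFormFunction σ) (x y : Rd k) : σ (x - y) = σ (y - x) := h.radial _ _ (norm_sub_rev x y)

/-- The source of the weak wave equation in the form used in its definition. -/
theorem integral_source_mul (h₁ : IsFormFunction σ₁) (h₂ : IsFormFunction σ₂) (f : Density d) {φ : Rd d × Rd n → ℝ} (hφ : IsTest φ) :
    ∫ q : Rd d × Rd n, σ₂ q.2 * (∫ z, σ₁ (q.1 - z) * macroDensity f z) * φ q = inner ℝ (source h₁.isTest h₂.isTest f) hφ.wave := by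
  obtain ⟨B, hB0, hB⟩ := h₁.isTest.exists_bound
  rw [real_inner_comm, inner_source]
  have e1 : ∀ x, ∫ z, σ₁ (x - z) * macroDensity f z = ∫ p : Rd d × Rd d, f p * σ₁ (x - p.1) := by
    intro x
    have hi : Integrable (fun p : Rd d × Rd d => f p * σ₁ (x - p.1)) :=
      integrable_mul_of_bounded f (h₁.smooth.continuous.comp (continuous_const.sub continuous_fst)) fun p => hB _
    rw [← (integral_prod_volume hi).2]
    refine integral_ext fun z => ?_
    simp only
    rw [macroDensity, ← integral_const_mul]
    exact integral_ext fun v => by ring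
  have e2 : ∀ p : Rd d × Rd d, f p * potential σ₁ σ₂ hφ.wave p.1 = ∫ q : Rd d × Rd n, f p * (φ q * (σ₁ (q.1 - p.1) * σ₂ q.2)) := by
    intro p
    rw [potential, ← integral_const_mul]
    refine integral_congr_ae ?_
    filter_upwards [hφ.wave_ae] with q hq
    rw [hq, h₁.symm p.1 q.1]; ring
  simp only [e1, e2]
  have e3 : ∀ q : Rd d × Rd n, σ₂ q.2 * (∫ p : Rd d × Rd d, f p * σ₁ (q.1 - p.1)) * φ q
      = ∫ p : Rd d × Rd d, f p * (φ q * (σ₁ (q.1 - p.1) * σ₂ q.2)) := by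
    intro q
    rw [mul_comm, ← mul_assoc, ← integral_const_mul]
    exact integral_ext fun p => by ring
  simp only [e3]
  rw [integral_integral_swap]
  have hφσ : Integrable (fun q : Rd d × Rd n => φ q * σ₂ q.2) :=
    (hφ.1.continuous.mul (h₂.smooth.continuous.comp continuous_snd)).integrable_of_hasCompactSupport hφ.2.mul_right
  have h3 := (hφσ.mul_prod (L1.integrable_coeFn f)).mul_bdd (c := B)
    (g := fun r : (Rd d × Rd n) × (Rd d × Rd d) => (σ₁ (r.1.1 - r.2.1)))
    ((h₁.smooth.continuous.comp ((continuous_fst.comp continuous_fst).sub (continuous_fst.comp continuous_snd))).aestronglyMeasurable) (ae_of_all _ fun r => hB _)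
  refine h3.congr (ae_of_all _ fun r => ?_)
  simp only [Function.uncurry]
  ring

theorem isWeakWave_iff {T c : ℝ} (h₁ : IsFormFunction σ₁) (h₂ : IsFormFunction σ₂) (Ψ₀ Ψ₁ : WaveField d n) (f : ℝ → Density d) (Ψ : ℝ → WaveField d n) :
    IsWeakWave T c σ₁ σ₂ Ψ₀ Ψ₁ f Ψ ↔ WeakWave T c (fun t => -source h₁.isTest h₂.isTest (f t)) Ψ₀ Ψ₁ Ψ := by
  refine forall_congr' fun φ => forall_congr' fun hφ => forall_congr' fun hs => ?_
  have e1 : ∀ t, ∫ q : Rd d × Rd n, Ψ t q * (iteratedDeriv 2 (fun s => φ (s, q)) t - c ^ 2 * (Δ (fun y => φ (t, (q.1, y)))) q.2)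
      = inner ℝ (Ψ t) ((hφ.dAlembert c).slice t).wave := fun t => by
    rw [IsTest.inner_wave]
    exact integral_ext (fun q => by rw [hφ.dAlembert_eq])
  have e2 : ∀ t, ∫ q : Rd d × Rd n, σ₂ q.2 * (∫ z, σ₁ (q.1 - z) * macroDensity (f t) z) * φ (t, q)
      = inner ℝ (source h₁.isTest h₂.isTest (f t)) (hφ.slice t).wave := fun t => integral_source_mul h₁ h₂ (f t) (hφ.slice t)
  have e3 : ∫ q : Rd d × Rd n, Ψ₀ q * deriv (fun s => φ (s, q)) 0 = inner ℝ Ψ₀ ((hφ.fderiv_apply (1, 0)).slice 0).wave := by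
    rw [IsTest.inner_wave]
    exact integral_ext (fun q => by rw [(hφ.hasDerivAt_slice 0 q).deriv])
  simp only [e1, e2, e3]
  rw [← IsTest.inner_wave (hφ.slice 0)]
  simp only [inner_neg_left, integral_neg]

end Coupling

section DuhamelEstimates

variable {X : Type*} [MeasurableSpace X] {μ : Measure X} {ω : X → ℝ}

variable {g g' : ℝ → Lp ℂ 2 μ} {K t : ℝ} {a w : Lp ℂ 2 μ}

/-- The amplitude `ω · duA`, defined without unbounded multipliers. -/
def duW (ω : X → ℝ) (w : Lp ℂ 2 μ) (g : ℝ → Lp ℂ 2 μ) (t : ℝ) : Lp ℂ 2 μ := w + ∫ s in 0..t, mult (sinwM ω s) (g s)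

theorem hasDerivAt_duW (hω : Measurable ω) (w : Lp ℂ 2 μ) (hg : Continuous g) (t : ℝ) : HasDerivAt (duW ω w g) (mult (sinwM ω t) (g t)) t := by
  have hc := (isMultiplier_sinwM hω).continuous_mult hg
  exact (intervalIntegral.integral_hasDerivAt_right (hc.intervalIntegrable _ _) (hc.stronglyMeasurableAtFilter _ _) hc.continuousAt).const_add w

theorem duW_zero (w : Lp ℂ 2 μ) (g : ℝ → Lp ℂ 2 μ) : duW ω w g 0 = w := by simp [duW]

theorem mult_congr_of_mul {m₁ m₂ n₁ n₂ : X → ℝ} (hm₁ : Measurable m₁) (hm₂ : Measurable m₂) (hn₁ : Measurable n₁) (hn₂ : Measurable n₂)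
    (b₁ : ∀ x, |m₁ x| ≤ K) (b₂ : ∀ x, |m₂ x| ≤ K) (b₃ : ∀ x, |n₁ x| ≤ K) (b₄ : ∀ x, |n₂ x| ≤ K) (h : ∀ x, m₁ x * n₁ x = m₂ x * n₂ x) (g : Lp ℂ 2 μ) :
    mult m₁ (mult n₁ g) = mult m₂ (mult n₂ g) := by
  refine Lp.ext ?_
  filter_upwards [mult_ae_of_bound hm₁ b₁ (mult n₁ g), mult_ae_of_bound hm₂ b₂ (mult n₂ g), mult_ae_of_bound hn₁ b₃ g,
    mult_ae_of_bound hn₂ b₄ g] with x h1 h2 h3 h4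
  rw [h1, h2, h3, h4, smul_smul, smul_smul, h]

theorem duW_ae (hω : Measurable ω) (hw : w =ᵐ[μ] fun x => ω x • a x) (hg : Continuous g) (t : ℝ) :
    duW ω w g t =ᵐ[μ] fun x => ω x • duA ω a g t x := by
  have hp : ∀ x, 0 < 1 + |ω x| := fun x => by positivity
  set ρ : X → ℝ := fun x => (1 + |ω x|)⁻¹ with hρ
  have hρm : Measurable ρ := ((measurable_const.add hω.abs).inv)
  have hρp : ∀ x, 0 < ρ x := fun x => inv_pos.2 (hp x)
  have hρb : ∀ x, |ρ x| ≤ 1 := fun x => by rw [abs_of_pos (hρp x)]; exact inv_le_one_of_one_le₀ (by linarith [abs_nonneg (ω x)])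
  have hσm : Measurable fun x => ρ x * ω x := hρm.mul hω
  have hσb : ∀ x, |ρ x * ω x| ≤ 1 := fun x => by rw [abs_mul, abs_of_pos (hρp x), hρ, inv_mul_le_iff₀ (hp x)]; linarith
  have key : mult ρ (duW ω w g t) = mult (fun x => ρ x * ω x) (duA ω a g t) := by
    have c1 := (isMultiplier_sinwM hω).continuous_mult hg
    have c2 := (isMultiplier_sinM hω).continuous_mult hg
    rw [duW, duA, mult_add hρm hρb, mult_add hσm hσb]
    congr 1
    · refine Lp.ext ?_
      filter_upwards [mult_ae_of_bound hρm hρb w, mult_ae_of_bound hσm hσb a, hw] with x h1 h2 h3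
      rw [h1, h2, h3, smul_smul]
    · rw [← multL_apply ρ hρm 1 hρb, ← multL_apply (fun x => ρ x * ω x) hσm 1 hσb,
        ← ContinuousLinearMap.intervalIntegral_comp_comm _ (c1.intervalIntegrable _ _),
        ← ContinuousLinearMap.intervalIntegral_comp_comm _ (c2.intervalIntegrable _ _)]
      refine intervalIntegral.integral_congr fun s _ => ?_
      simp only [multL_apply]
      refine mult_congr_of_mul (K := max 1 |s|) hρm hσm ((isMultiplier_sinwM hω).measurable s) ((isMultiplier_sinM hω).measurable s)
        (fun x => (hρb x).trans (le_max_left _ _)) (fun x => (hσb x).trans (le_max_left _ _))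
        (fun x => (abs_sinwM_le ω s x).trans (le_max_left _ _)) (fun x => (abs_sinM_le ω s x).trans (le_max_right _ _)) (fun x => ?_) _
      rw [mul_assoc, mul_sinM]
  filter_upwards [mult_ae_of_bound hρm hρb (duW ω w g t), mult_ae_of_bound hσm hσb (duA ω a g t)] with x h1 h2
  rw [← key, h1, mul_smul] at h2
  exact smul_right_injective ℂ (hρp x).ne' h2

def duZ (ω : X → ℝ) (w b : Lp ℂ 2 μ) (g : ℝ → Lp ℂ 2 μ) (t : ℝ) : Lp ℂ 2 μ := mult (cosM ω t) (duB ω b g t) - mult (sinwM ω t) (duW ω w g t)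

theorem continuous_duW (hω : Measurable ω) (w : Lp ℂ 2 μ) (hg : Continuous g) :
    Continuous (duW ω w g) := continuous_iff_continuousAt.2 fun t => (hasDerivAt_duW hω w hg t).continuousAt

theorem continuous_duZ (hω : Measurable ω) (w b : Lp ℂ 2 μ) (hg : Continuous g) : Continuous (duZ ω w b g) :=
  ((isMultiplier_cosM hω).continuous_mult (continuous_duB hω b hg)).sub ((isMultiplier_sinwM hω).continuous_mult (continuous_duW hω w hg))

theorem hasDerivAt_duY (hω : Measurable ω) (hw : w =ᵐ[μ] fun x => ω x • a x) (b : Lp ℂ 2 μ) (hg : Continuous g) (t : ℝ) :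
    HasDerivAt (duY ω a b g) (duZ ω w b g t) t := by
  have h1 : HasDerivAt (fun s => mult (cosM ω s) (duA ω a g s)) (mult (cosM ω t) (mult (sinM ω t) (g t)) + -mult (sinwM ω t) (duW ω w g t)) t := by
    refine (isMultiplier_cosM hω).hasDerivAt_mult (hasDerivAt_cosM ω) (hasDerivAt_duA hω a hg t) (k := fun x => ‖duW ω w g t x‖)
      (Lp.memLp _).norm ?_ ?_
    · filter_upwards [duW_ae hω hw hg t] with x hx τ _
      rw [hx, norm_smul, norm_smul, norm_neg, norm_mul]
      refine mul_le_mul_of_nonneg_right ?_ (norm_nonneg _)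
      exact mul_le_of_le_one_right (norm_nonneg _) (abs_sinwM_le ω τ x)
    · filter_upwards [duW_ae hω hw hg t, (isMultiplier_sinwM hω).ae t (duW ω w g t), Lp.coeFn_neg (mult (sinwM ω t) (duW ω w g t))] with x h1 h2 h3
      rw [h3, Pi.neg_apply, h2, h1, smul_smul, neg_smul, mul_comm]
  have h2 := hasDerivAt_mult_sinM hω (hasDerivAt_duB hω b hg t)
  refine (h1.add h2).congr_deriv ?_
  obtain ⟨K, -, hK⟩ := (isMultiplier_sinM hω).exists_bound t
  have hn : mult (sinM ω t) (-mult (cosM ω t) (g t)) = -mult (sinM ω t) (mult (cosM ω t) (g t)) :=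
    map_neg (multL (μ := μ) (sinM ω t) ((isMultiplier_sinM hω).measurable t) K hK) _
  have hc : mult (cosM ω t) (mult (sinM ω t) (g t)) = mult (sinM ω t) (mult (cosM ω t) (g t)) :=
    mult_congr_of_mul (K := max 1 |t|) ((isMultiplier_cosM hω).measurable t) ((isMultiplier_sinM hω).measurable t)
      ((isMultiplier_sinM hω).measurable t) ((isMultiplier_cosM hω).measurable t)
      (fun x => (abs_cosM_le ω t x).trans (le_max_left _ _)) (fun x => (abs_sinM_le ω t x).trans (le_max_right _ _))
      (fun x => (abs_sinM_le ω t x).trans (le_max_right _ _)) (fun x => (abs_cosM_le ω t x).trans (le_max_left _ _))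
      (fun x => mul_comm _ _) _
  rw [hn, hc, duZ]
  abel

theorem norm_integral_mult_le {m : ℝ → X → ℝ} (hm : IsMultiplier m) (ht : 0 ≤ t) (hK : ∀ s ∈ Icc 0 t, ∀ x, |m s x| ≤ K) (hg : Continuous g) :
    ‖∫ s in 0..t, mult (m s) (g s)‖ ≤ K * ∫ s in 0..t, ‖g s‖ := by
  rw [← intervalIntegral.integral_const_mul]
  refine intervalIntegral.norm_integral_le_of_norm_le ht (ae_of_all _ fun s hs => ?_) ((hg.norm.const_mul K).intervalIntegrable _ _)
  exact norm_mult_le (hm.measurable s) (hK s ⟨hs.1.le, hs.2⟩) (g s)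

theorem norm_duY_le (hω : Measurable ω) (a b : Lp ℂ 2 μ) (hg : Continuous g) (ht : 0 ≤ t) :
    ‖duY ω a b g t‖ ≤ ‖a‖ + t * ‖b‖ + 2 * t * ∫ s in 0..t, ‖g s‖ := by
  have hA : ‖duA ω a g t‖ ≤ ‖a‖ + t * ∫ s in 0..t, ‖g s‖ := (norm_add_le _ _).trans (add_le_add_right
    (norm_integral_mult_le (isMultiplier_sinM hω) ht (fun s hs x => (abs_sinM_le ω s x).trans (by rw [abs_of_nonneg hs.1]; exact hs.2)) hg) _)
  have hB : ‖duB ω b g t‖ ≤ ‖b‖ + 1 * ∫ s in 0..t, ‖g s‖ := (norm_sub_le _ _).trans (add_le_add_right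
    (norm_integral_mult_le (isMultiplier_cosM hω) ht (fun s hs x => abs_cosM_le ω s x) hg) _)
  have h1 := norm_mult_le ((isMultiplier_cosM hω).measurable t) (abs_cosM_le ω t) (duA ω a g t)
  have h2 := norm_mult_le ((isMultiplier_sinM hω).measurable t) (abs_sinM_le ω t) (duB ω b g t)
  rw [abs_of_nonneg ht] at h2
  have h3 := mul_le_mul_of_nonneg_left hB ht
  have h4 : ‖duY ω a b g t‖ ≤ _ := norm_add_le _ _
  linarith

theorem norm_duZ_le (hω : Measurable ω) (w b : Lp ℂ 2 μ) (hg : Continuous g) (ht : 0 ≤ t) :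
    ‖duZ ω w b g t‖ ≤ ‖w‖ + ‖b‖ + 2 * ∫ s in 0..t, ‖g s‖ := by
  have hW : ‖duW ω w g t‖ ≤ ‖w‖ + 1 * ∫ s in 0..t, ‖g s‖ := (norm_add_le _ _).trans (add_le_add_right
    (norm_integral_mult_le (isMultiplier_sinwM hω) ht (fun s hs x => abs_sinwM_le ω s x) hg) _)
  have hB : ‖duB ω b g t‖ ≤ ‖b‖ + 1 * ∫ s in 0..t, ‖g s‖ := (norm_sub_le _ _).trans (add_le_add_right
    (norm_integral_mult_le (isMultiplier_cosM hω) ht (fun s hs x => abs_cosM_le ω s x) hg) _)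
  have h1 := norm_mult_le ((isMultiplier_sinwM hω).measurable t) (abs_sinwM_le ω t) (duW ω w g t)
  have h2 := norm_mult_le ((isMultiplier_cosM hω).measurable t) (abs_cosM_le ω t) (duB ω b g t)
  have h4 : ‖duZ ω w b g t‖ ≤ _ := norm_sub_le _ _
  linarith

theorem duY_sub (hω : Measurable ω) (a b a' b' : Lp ℂ 2 μ) (hg : Continuous g) (hg' : Continuous g') (t : ℝ) :
    duY ω a b g t - duY ω a' b' g' t = duY ω (a - a') (b - b') (fun s => g s - g' s) t := by
  have hc := isMultiplier_cosM hω
  have hs := isMultiplier_sinM hω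
  have i : ∀ {m : ℝ → X → ℝ}, IsMultiplier m → ∫ s in 0..t, mult (m s) (g s - g' s)
      = (∫ s in 0..t, mult (m s) (g s)) - ∫ s in 0..t, mult (m s) (g' s) := fun {m} hm => by
    rw [← intervalIntegral.integral_sub ((hm.continuous_mult hg).intervalIntegrable _ _) ((hm.continuous_mult hg').intervalIntegrable _ _)]
    refine intervalIntegral.integral_congr fun s _ => ?_
    obtain ⟨K, -, hK⟩ := hm.exists_bound s
    exact mult_sub (hm.measurable s) hK _ _
  obtain ⟨K, -, hK⟩ := hc.exists_bound t
  obtain ⟨K', -, hK'⟩ := hs.exists_bound t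
  have eA : duA ω (a - a') (fun s => g s - g' s) t = duA ω a g t - duA ω a' g' t := by rw [duA, duA, duA, i hs]; abel
  have eB : duB ω (b - b') (fun s => g s - g' s) t = duB ω b g t - duB ω b' g' t := by rw [duB, duB, duB, i hc]; abel
  rw [duY, duY, duY, eA, eB, mult_sub (hc.measurable t) hK, mult_sub (hs.measurable t) hK']
  abel

theorem duY_congr {b : Lp ℂ 2 μ} (ht : 0 ≤ t) (h : EqOn g g' (Icc 0 t)) : duY ω a b g t = duY ω a b g' t := by
  have i : ∀ m : ℝ → X → ℝ, ∫ s in 0..t, mult (m s) (g s) = ∫ s in 0..t, mult (m s) (g' s) := fun m =>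
    intervalIntegral.integral_congr fun s hs => by
      rw [uIcc_of_le ht] at hs
      simp only [h hs]
  rw [duY, duY, duA, duA, duB, duB, i, i]

end DuhamelEstimates

section WaveEstimates

variable {d n : ℕ}

variable {g g' : ℝ → WaveField d n} {t : ℝ}

theorem waveSol_congr {c : ℝ} {Ψ₀ Ψ₁ : WaveField d n} (ht : 0 ≤ t) (h : EqOn g g' (Icc 0 t)) : waveSol c Ψ₀ Ψ₁ g t = waveSol c Ψ₀ Ψ₁ g' t := by
  exact congrArg reField (duY_congr ht fun s hs => congrArg fourierField (h hs))

theorem waveSol_sub (c : ℝ) (Ψ₀ Ψ₁ Ψ₀' Ψ₁' : WaveField d n) (hg : Continuous g) (hg' : Continuous g') (t : ℝ) :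
    waveSol c Ψ₀ Ψ₁ g t - waveSol c Ψ₀' Ψ₁' g' t = waveSol c (Ψ₀ - Ψ₀') (Ψ₁ - Ψ₁') (fun s => g s - g' s) t := by
  rw [waveSol, waveSol, waveSol, ← map_sub, duY_sub (continuous_freq c).measurable _ _ _ _ (g := fun s => fourierField (g s))
    (g' := fun s => fourierField (g' s)) (fourierField.continuous.comp hg) (fourierField.continuous.comp hg')]
  simp only [map_sub]

section
variable (c : ℝ) (Ψ₀ Ψ₁ : WaveField d n)
include c Ψ₀ Ψ₁

theorem norm_waveSol_le (hg : Continuous g) (ht : 0 ≤ t) : ‖waveSol c Ψ₀ Ψ₁ g t‖ ≤ ‖Ψ₀‖ + t * ‖Ψ₁‖ + 2 * t * ∫ s in 0..t, ‖g s‖ := by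
  rw [← fourierField.norm_map, fourierField_waveSol c Ψ₀ Ψ₁ hg ht]
  refine (norm_duY_le (continuous_freq c).measurable _ _ (fourierField.continuous.comp hg) ht).trans_eq ?_
  simp only [LinearIsometry.norm_map, Function.comp_apply]

theorem norm_waveSol_le_of_bound {T C : ℝ} (hg : Continuous g) (hgC : ∀ s, ‖g s‖ ≤ C) (ht : t ∈ Icc 0 T) :
    ‖waveSol c Ψ₀ Ψ₁ g t‖ ≤ ‖Ψ₀‖ + T * ‖Ψ₁‖ + 2 * T * (T * C) := by
  refine (norm_waveSol_le c Ψ₀ Ψ₁ hg ht.1).trans ?_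
  have hi := intervalIntegral.integral_mono_on (μ := volume) ht.1 (hg.norm.intervalIntegrable _ _) intervalIntegrable_const fun s _ => hgC s
  rw [intervalIntegral.integral_const, smul_eq_mul, sub_zero] at hi
  have hi0 : 0 ≤ ∫ s in 0..t, ‖g s‖ := intervalIntegral.integral_nonneg ht.1 fun _ _ => norm_nonneg _
  have h2 := hi.trans (mul_le_mul_of_nonneg_right ht.2 ((norm_nonneg _).trans (hgC 0)))
  have ht2 := ht.2
  have hT := ht.1.trans ht2
  gcongr

theorem waveSol_zero (g : ℝ → WaveField d n) : waveSol c Ψ₀ Ψ₁ g 0 = Ψ₀ := by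
  have hω : Measurable (freq c : Freq d n → ℝ) := (continuous_freq c).measurable
  rw [waveSol, duY, duA_zero, duB_zero, mult_cosM_zero _ hω, mult_sinM_zero _ hω, add_zero, reField_fourierField]

theorem waveSol_add (hg : Continuous g) (t : ℝ) : waveSol c Ψ₀ Ψ₁ g t = waveSol c Ψ₀ Ψ₁ (fun _ => 0) t + waveSol c 0 0 g t := by
  have h := waveSol_sub c Ψ₀ Ψ₁ 0 0 (g := g) (g' := g) hg hg t
  simp only [sub_zero, sub_self] at h
  rw [← h, sub_add_cancel]

end

theorem norm_waveSol_sub_le (c : ℝ) (hg : Continuous g) {T K : ℝ} (hK : ∀ s ∈ Icc 0 T, ‖g s‖ ≤ K) {s : ℝ} (hs : s ∈ Icc 0 T) (ht : t ∈ Icc 0 T) :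
    ‖waveSol c 0 0 g t - waveSol c 0 0 g s‖ ≤ 2 * (T * K) * |t - s| := by
  have hω : Measurable (freq c : Freq d n → ℝ) := (continuous_freq c).measurable
  have hgU : Continuous fun s => fourierField (g s) := fourierField.continuous.comp hg
  have h0 : (0 : Spec d n) =ᵐ[volume] fun x => freq c x • (fourierField 0 : Spec d n) x := by
    rw [map_zero]
    filter_upwards [Lp.coeFn_zero ℂ 2 (volume : Measure (Freq d n))] with x hx
    rw [hx]; simp
  rw [← fourierField.norm_map, map_sub, fourierField_waveSol c 0 0 hg ht.1, fourierField_waveSol c 0 0 hg hs.1]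
  refine Convex.norm_image_sub_le_of_norm_hasDerivWithin_le (s := Icc 0 T)
    (fun r _ => (hasDerivAt_duY hω h0 (fourierField 0) hgU r).hasDerivWithinAt) (fun r hr => ?_) (convex_Icc 0 T) hs ht
  refine (norm_duZ_le hω _ _ hgU hr.1).trans ?_
  rw [map_zero, norm_zero, zero_add, zero_add]
  refine mul_le_mul_of_nonneg_left ?_ zero_le_two
  have h1 : ∫ s in 0..r, ‖fourierField (g s)‖ ≤ ∫ s in 0..r, K :=
    intervalIntegral.integral_mono_on hr.1 (hgU.norm.intervalIntegrable _ _) (by simp) fun s hs => by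
      rw [LinearIsometry.norm_map]; exact hK s ⟨hs.1, hs.2.trans hr.2⟩
  rw [intervalIntegral.integral_const, smul_eq_mul, sub_zero] at h1
  refine h1.trans (mul_le_mul_of_nonneg_right hr.2 ?_)
  exact (norm_nonneg _).trans (hK 0 ⟨le_rfl, hr.1.trans hr.2⟩)

end WaveEstimates

section Ascoli

theorem exists_subseq_tendsto_locally_uniformly {P Y : Type*} [NormedAddCommGroup P] [ProperSpace P] [NormedAddCommGroup Y] [ProperSpace Y]
    {u : ℕ → P → Y} (h : ∀ R : ℝ, ∃ C : ℝ, 0 ≤ C ∧ ∀ k p q, ‖p‖ ≤ R → ‖q‖ ≤ R → ‖u k p‖ ≤ C ∧ ‖u k p - u k q‖ ≤ C * ‖p - q‖) :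
    ∃ (φ : ℕ → ℕ) (v : P → Y), StrictMono φ ∧ ∀ R : ℝ, ∀ ε > 0, ∀ᶠ k in atTop, ∀ p, ‖p‖ ≤ R → ‖u (φ k) p - v p‖ ≤ ε := by
  let F : Filter ℕ := ((hyperfilter ℕ : Ultrafilter ℕ) : Filter ℕ)
  have hlim : ∀ p, ∃ y, Tendsto (fun k => u k p) F (𝓝 y) := fun p => by
    obtain ⟨C, -, hC⟩ := h ‖p‖
    have hmem : (closedBall (0 : Y) C) ∈ Ultrafilter.map (fun k => u k p) (hyperfilter ℕ) :=
      Ultrafilter.mem_map.2 (Filter.mem_of_superset univ_mem fun k _ => by simpa using (hC k p p le_rfl le_rfl).1)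
    obtain ⟨y, -, hy⟩ := (isCompact_closedBall (0 : Y) C).ultrafilter_le_nhds _ (le_principal_iff.2 hmem)
    exact ⟨y, hy⟩
  choose v hv using hlim
  have hunif : ∀ R : ℝ, ∀ ε > 0, ∀ᶠ k in F, ∀ p, ‖p‖ ≤ R → ‖u k p - v p‖ ≤ ε := by
    intro R ε hε
    obtain ⟨C, hC0, hC⟩ := h R
    have hvC : ∀ p q, ‖p‖ ≤ R → ‖q‖ ≤ R → ‖v p - v q‖ ≤ C * ‖p - q‖ := fun p q hp hq =>
      le_of_tendsto ((hv p).sub (hv q)).norm (.of_forall fun k => (hC k p q hp hq).2)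
    set δ := ε / (3 * (C + 1)) with hδ
    have hδ0 : 0 < δ := by positivity
    obtain ⟨s, hs, hsf, hcov⟩ := (isCompact_closedBall (0 : P) R).finite_cover_balls hδ0
    have hfin : ∀ᶠ k in F, ∀ p ∈ s, ‖u k p - v p‖ ≤ ε / 3 := by
      rw [eventually_all_finite hsf]
      intro p _
      have := (tendsto_iff_norm_sub_tendsto_zero.1 (hv p)).eventually (gt_mem_nhds (show (0:ℝ) < ε / 3 by positivity))
      exact this.mono fun k hk => hk.le
    filter_upwards [hfin] with k hk p hp
    obtain ⟨q, hq⟩ := mem_iUnion.1 (hcov (show p ∈ closedBall 0 R by simpa using hp))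
    obtain ⟨hqs, hpq⟩ := mem_iUnion.1 hq
    have hqR : ‖q‖ ≤ R := by simpa using hs hqs
    rw [mem_ball, dist_eq_norm] at hpq
    have h1 := (hC k p q hp hqR).2
    have h2 := hk q hqs
    have h3 := hvC q p hqR hp
    rw [norm_sub_rev q p] at h3
    have h4 : C * ‖p - q‖ ≤ ε / 3 := by
      have : C * ‖p - q‖ ≤ (C + 1) * δ := mul_le_mul (by linarith) hpq.le (norm_nonneg _) (by linarith)
      refine this.trans_eq ?_
      rw [hδ]; field_simp
    calc ‖u k p - v p‖ = ‖(u k p - u k q) + (u k q - v q) + (v q - v p)‖ := by congr 1; abel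
      _ ≤ ‖u k p - u k q‖ + ‖u k q - v q‖ + ‖v q - v p‖ := norm_add₃_le
      _ ≤ ε := by linarith
  obtain ⟨φ, hφ, hP⟩ := extraction_forall_of_frequently (P := fun m k => ∀ p, ‖p‖ ≤ m → ‖u k p - v p‖ ≤ 1 / ((m:ℝ) + 1)) fun m => by
    have h1 : ∀ᶠ k in F, ∀ p, ‖p‖ ≤ m → ‖u k p - v p‖ ≤ 1 / ((m:ℝ) + 1) := hunif m _ (by positivity)
    have h2 : F ≤ atTop := by rw [← Nat.cofinite_eq_atTop]; exact hyperfilter_le_cofinite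
    exact (h1.frequently).filter_mono h2
  refine ⟨φ, v, hφ, fun R ε hε => ?_⟩
  obtain ⟨N, hN⟩ := exists_nat_ge R
  have h0 : Tendsto (fun m : ℕ => 1 / ((m:ℝ) + 1)) atTop (𝓝 0) := tendsto_one_div_add_atTop_nhds_zero_nat
  filter_upwards [eventually_ge_atTop N, h0.eventually (gt_mem_nhds hε)] with m hm1 hm2 p hp
  exact (hP m p (hp.trans (hN.trans (by exact_mod_cast hm1)))).trans hm2.le

end Ascoli

section FixedPoint

variable {d n : ℕ} {V : Rd d → ℝ} {F F' : ℝ → Rd d → Rd d} {M L M' L' : ℝ → ℝ}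

variable {a σ₁ : Rd d → ℝ} {T c t : ℝ} {b σ₂ : Rd n → ℝ} {Ψ : ℝ → WaveField d n} {Ψ₀ Ψ₁ : WaveField d n} {f₀ : Density d}

theorem IsForce.mono (hF : IsForce F M L) (hM : ∀ t, M t ≤ M' t) (hL : ∀ t, L t ≤ L' t) : IsForce F M' L' where
  continuous := hF.continuous
  bound T t x h := (hF.bound T t x h).trans (hM T)
  lipschitz T t x y h := (hF.lipschitz T t x y h).trans (mul_le_mul_of_nonneg_right (hL T) (norm_nonneg _))

theorem IsForce.add (hF : IsForce F M L) (hF' : IsForce F' M' L') :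
    IsForce (fun t x => F t x + F' t x) (fun t => M t + M' t) (fun t => L t + L' t) where
  continuous := hF.continuous.add hF'.continuous
  bound T t x h := (norm_add_le _ _).trans (add_le_add (hF.bound T t x h) (hF'.bound T t x h))
  lipschitz T t x y h := by
    rw [add_sub_add_comm, add_mul]
    exact (norm_add_le _ _).trans (add_le_add (hF.lipschitz T t x y h) (hF'.lipschitz T t x y h))

section
variable (hV : IsExternalPotential V) (hF : IsForce F M L) (hF' : IsForce F' M' L')
include hV hF hF'

theorem flow_congr {a : ℝ} (h : EqOn F F' (Icc a c)) {s : ℝ} (hs : s ∈ Icc a c) (ht : t ∈ Icc a c) (z : Phase d) :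
    flow V F s t z = flow V F' s t z := by
  have := eq_flow hV hF' (γ := fun r => flow V F s r z) (a := a) (c := c) (fun r hr => ?_) hs ht
  · simpa only [flow_self hV hF] using this
  · have h1 := hasDerivAt_flow hV hF s r z
    rwa [vfield, h hr, ← vfield] at h1

theorem transport_congr (ht : 0 ≤ t) (h : EqOn F F' (Icc 0 t)) (f₀ : Density d) : transport hV hF f₀ t = transport hV hF' f₀ t := by
  refine Lp.ext ?_
  filter_upwards [transport_ae_eq hV hF f₀ t, transport_ae_eq hV hF' f₀ t] with z h1 h2
  rw [h1, h2, flow_congr hV hF hF' h ⟨ht, le_rfl⟩ ⟨le_rfl, ht⟩]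

end

def clamp (T t : ℝ) : ℝ := max 0 (min t T)

theorem continuous_clamp (T : ℝ) : Continuous (clamp T) := continuous_const.max (continuous_id.min continuous_const)

theorem clamp_mem (hT : 0 ≤ T) (t : ℝ) : clamp T t ∈ Icc 0 T := ⟨le_max_left _ _, max_le hT (min_le_right _ _)⟩

theorem clamp_of_mem (ht : t ∈ Icc 0 T) : clamp T t = t := by rw [clamp, min_eq_left ht.2, max_eq_right ht.1]

theorem continuous_comp_clamp (hT : 0 ≤ T) {E : Type*} [TopologicalSpace E] {f : ℝ → E} (hf : ContinuousOn f (Icc 0 T)) :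
    Continuous fun t => f (clamp T t) :=
  hf.comp_continuous (continuous_clamp T) fun t => clamp_mem hT t

section
variable {E : Type*} [NormedAddCommGroup E]

def curveSup (Ψ : ℝ → E) (T : ℝ) : ℝ := sSup ((fun t => ‖Ψ t‖) '' Icc (-T) T)

theorem le_curveSup {Ψ : ℝ → E} (hΨ : Continuous Ψ) (T t : ℝ) (h : |t| ≤ T) : ‖Ψ t‖ ≤ curveSup Ψ T :=
  le_csSup ((isCompact_Icc.image hΨ.norm).bddAbove) ⟨t, abs_le.1 h, rfl⟩

end

theorem isForce_of_continuous (ha : IsTest a) (hb : IsTest b) (hΨ : Continuous Ψ) :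
    IsForce (fun t => force a b (Ψ t)) (fun T => curveSup Ψ T * (sobN 1 a * sobN 0 b)) (fun T => curveSup Ψ T * (sobN 2 a * sobN 0 b)) :=
  isForce_force ha hb hΨ (le_curveSup hΨ)

section
variable (hV : IsExternalPotential V)
include hV

theorem along_eq (ha : IsTest a) (hb : IsTest b) {Ψ : WaveField d n} (hF : F t = force a b Ψ) (φ : ℝ × (Rd d × Rd d) → ℝ) (z : Rd d × Rd d) :
    fderiv ℝ φ (t, z) (1, (z.2, -gradient (fun x => V x + potential a b Ψ x) z.1)) = along V F φ (t, z) := by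
  have h : gradient (fun x => V x + potential a b Ψ x) z.1 = gradient V z.1 + gradient (potential a b Ψ) z.1 := by
    have h1 := (hV.differentiable z.1).hasGradientAt
    have h2 := (differentiable_potential ha hb Ψ z.1).hasGradientAt
    have h3 : HasGradientAt (fun x => V x + potential a b Ψ x) (gradient V z.1 + gradient (potential a b Ψ) z.1) z.1 := by
      rw [hasGradientAt_iff_hasFDerivAt] at h1 h2 ⊢
      rw [map_add]; exact h1.add h2
    exact h3.gradient
  rw [along, vfield, h, hF, force, neg_add]

theorem isWeakVlasov_iff (ha : IsTest a) (hb : IsTest b) (hF : ∀ t ∈ Icc 0 T, F t = force a b (Ψ t)) (f₀ : Density d) (f : ℝ → Density d) :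
    IsWeakVlasov T V (fun t => potential a b (Ψ t)) f₀ f ↔ ∀ φ : ℝ × Phase d → ℝ, IsTest φ → tsupport φ ⊆ Iio T ×ˢ univ →
      (∫ t in Icc 0 T, ∫ z, f t z * along V F φ (t, z)) + ∫ z, f₀ z * φ (0, z) = 0 := by
  refine forall_congr' fun φ => forall_congr' fun hφ => forall_congr' fun hs => ?_
  have : ∫ t in Icc 0 T, ∫ z : Rd d × Rd d, f t z * fderiv ℝ φ (t, z) (1, (z.2, -gradient (fun x => V x + potential a b (Ψ t) x) z.1))
      = ∫ t in Icc 0 T, ∫ z, f t z * along V F φ (t, z) :=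
    setIntegral_congr_fun measurableSet_Icc fun t ht => by simp only [along_eq hV ha hb (hF t ht)]
  rw [this]

section
variable (h₁ : IsFormFunction σ₁) (h₂ : IsFormFunction σ₂) (hT : 0 < T)
include h₁ h₂ hT

/-- Weak solutions are given by the characteristics and by Duhamel's formula. -/
theorem IsWeakSolution.eq_transport_waveSol {f : ℝ → Density d} (h : IsWeakSolution T c V σ₁ σ₂ Ψ₀ Ψ₁ f₀ f Ψ) (hF : IsForce F M L)
    (hFΨ : ∀ t ∈ Icc 0 T, F t = force σ₁ σ₂ (Ψ t)) : EqOn f (transport hV hF f₀) (Icc 0 T) ∧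
      EqOn Ψ (waveSol c Ψ₀ Ψ₁ fun t => source h₁.isTest h₂.isTest (transport hV hF f₀ t)) (Icc 0 T) := by
  have h1 : EqOn f (transport hV hF f₀) (Icc 0 T) := eq_transport_of_weak hV hF hT h.continuous_density
    ((isWeakVlasov_iff hV h₁.isTest h₂.isTest hFΨ f₀ f).1 h.vlasov)
  refine ⟨h1, ?_⟩
  refine WeakWave.eq_waveSol hT ((continuous_source _ _).comp (continuous_transport hV hF f₀)) ?_ h.continuous_field
  refine (((isWeakWave_iff h₁ h₂ Ψ₀ Ψ₁ f Ψ)).1 h.wave).congr_source fun t ht => ?_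
  simp only [h1 ht, Function.comp]

theorem isWeakSolution_of_eq (hF : IsForce F M L)
    (hFΨ : ∀ t ∈ Icc 0 T, F t = force σ₁ σ₂ (waveSol c Ψ₀ Ψ₁ (fun t => source h₁.isTest h₂.isTest (transport hV hF f₀ t)) t)) :
    IsWeakSolution T c V σ₁ σ₂ Ψ₀ Ψ₁ f₀ (transport hV hF f₀) (waveSol c Ψ₀ Ψ₁ fun t => source h₁.isTest h₂.isTest (transport hV hF f₀ t)) := by
  have hs : Continuous fun t => source h₁.isTest h₂.isTest (transport hV hF f₀ t) := (continuous_source _ _).comp (continuous_transport hV hF f₀)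
  exact ⟨(continuous_transport hV hF f₀).continuousOn, (continuous_waveSol c Ψ₀ Ψ₁ hs).continuousOn,
    (isWeakVlasov_iff hV h₁.isTest h₂.isTest hFΨ f₀ _).2 fun φ hφ hsu => transport_weak hV hF f₀ hT hφ hsu,
    (isWeakWave_iff h₁ h₂ Ψ₀ Ψ₁ _ _).2 (weakWave_waveSol c hT Ψ₀ Ψ₁ hs)⟩

end

end

end FixedPoint

section Limit

variable {d n : ℕ}

variable {V a : Rd d → ℝ} {b : Rd n → ℝ} {F : ℝ → Rd d → Rd d} {L M : ℝ → ℝ} {m : ℕ}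

theorem force_add (ha : IsTest a) (hb : IsTest b) (Ψ Ψ' : WaveField d n) (x : Rd d) : force a b (Ψ + Ψ') x = force a b Ψ x + force a b Ψ' x := by
  refine ext_inner_right ℝ fun e => ?_
  rw [inner_add_left, inner_force ha hb, inner_force ha hb, inner_force ha hb, inner_add_left]
  ring

theorem exists_subseq_force (ha : IsTest a) (hb : IsTest b) {D : ℕ → ℝ → WaveField d n}
    (hD : ∀ T : ℝ, ∃ K : ℝ, 0 ≤ K ∧ ∀ k t s, |t| ≤ T → |s| ≤ T → ‖D k t‖ ≤ K ∧ ‖D k t - D k s‖ ≤ K * |t - s|) :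
    ∃ (φ : ℕ → ℕ) (G : ℝ → Rd d → Rd d) (M L : ℝ → ℝ), StrictMono φ ∧ IsForce G M L ∧
      ∀ R : ℝ, ∀ ε > 0, ∀ᶠ k in atTop, ∀ t x, |t| ≤ R → ‖x‖ ≤ R → ‖force a b (D (φ k) t) x - G t x‖ ≤ ε := by
  choose K hK0 hK using hD
  have n1 := sobN_nonneg 1 a
  have n2 := sobN_nonneg 2 a
  have n0 := sobN_nonneg 0 b
  set s := sobN 1 a * sobN 0 b + sobN 2 a * sobN 0 b with hs
  have hs0 : 0 ≤ s := by positivity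
  have hlip : ∀ T k (p q : ℝ × Rd d), |p.1| ≤ T → |q.1| ≤ T →
      ‖force a b (D k p.1) p.2‖ ≤ K T * s ∧ ‖force a b (D k p.1) p.2 - force a b (D k q.1) q.2‖ ≤ K T * s * ‖p - q‖ := by
    intro T k p q hp hq
    obtain ⟨h1, h2⟩ := hK T k p.1 q.1 hp hq
    have hKT := hK0 T
    constructor
    · exact (norm_force_le ha hb _ _).trans (mul_le_mul h1 (by rw [hs]; linarith [mul_nonneg n2 n0]) (by positivity) hKT)
    · refine (norm_sub_le_norm_sub_add_norm_sub _ (force a b (D k q.1) p.2) _).trans ?_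
      have e1 := norm_force_sub_le' ha hb (D k p.1) (D k q.1) p.2
      have e2 := norm_force_sub_force_le ha hb (D k q.1) p.2 q.2
      have e3 : |p.1 - q.1| ≤ ‖p - q‖ := norm_fst_le (p - q)
      have e4 : ‖p.2 - q.2‖ ≤ ‖p - q‖ := norm_snd_le (p - q)
      have e5 := (hK T k q.1 q.1 hq hq).1
      have e6 : ‖D k p.1 - D k q.1‖ * (sobN 1 a * sobN 0 b) ≤ K T * ‖p - q‖ * (sobN 1 a * sobN 0 b) :=
        mul_le_mul_of_nonneg_right (h2.trans (mul_le_mul_of_nonneg_left e3 hKT)) (by positivity)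
      have e7 : ‖D k q.1‖ * (sobN 2 a * sobN 0 b) * ‖p.2 - q.2‖ ≤ K T * (sobN 2 a * sobN 0 b) * ‖p - q‖ := by gcongr
      have e8 : K T * s * ‖p - q‖ = K T * ‖p - q‖ * (sobN 1 a * sobN 0 b) + K T * (sobN 2 a * sobN 0 b) * ‖p - q‖ := by rw [hs]; ring
      linarith
  obtain ⟨φ, v, hφ, hv⟩ := exists_subseq_tendsto_locally_uniformly (u := fun k (p : ℝ × Rd d) => force a b (D k p.1) p.2) fun R =>
    ⟨K R * s, mul_nonneg (hK0 R) hs0, fun k p q hp hq => hlip R k p q ((norm_fst_le p).trans hp) ((norm_fst_le q).trans hq)⟩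
  have hpt : ∀ p : ℝ × Rd d, Tendsto (fun k => force a b (D (φ k) p.1) p.2) atTop (𝓝 (v p)) := fun p => by
    rw [tendsto_iff_norm_sub_tendsto_zero]
    refine tendsto_order.2 ⟨fun r hr => .of_forall fun k => hr.trans_le (norm_nonneg _), fun r hr => ?_⟩
    filter_upwards [hv ‖p‖ (r / 2) (by positivity)] with k hk
    exact (hk p le_rfl).trans_lt (by linarith)
  have hvl : ∀ T (p q : ℝ × Rd d), |p.1| ≤ T → |q.1| ≤ T → ‖v p - v q‖ ≤ K T * s * ‖p - q‖ := fun T p q hp hq =>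
    le_of_tendsto ((hpt p).sub (hpt q)).norm (.of_forall fun k => (hlip T (φ k) p q hp hq).2)
  refine ⟨φ, fun t x => v (t, x), fun T => K T * s, fun T => K T * s, hφ, ⟨?_, fun T t x ht => ?_, fun T t x y ht => ?_⟩, fun R ε hε => ?_⟩
  · refine continuous_iff_continuousAt.2 fun p => continuousAt_of_locally_lipschitz one_pos (K (|p.1| + 1) * s) fun q hq => ?_
    rw [dist_eq_norm] at hq ⊢
    rw [dist_eq_norm]
    have h1 : |q.1 - p.1| ≤ ‖q - p‖ := norm_fst_le (q - p)
    exact hvl (|p.1| + 1) q p (by linarith [abs_sub_abs_le_abs_sub q.1 p.1]) (by linarith)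
  · exact le_of_tendsto (hpt (t, x)).norm (.of_forall fun k => (hlip T (φ k) (t, x) (t, x) ht ht).1)
  · refine (hvl T (t, x) (t, y) ht ht).trans_eq ?_
    simp
  · filter_upwards [hv R ε hε] with k hk t x ht hx
    exact hk (t, x) (by simpa [Prod.norm_def] using ⟨ht, hx⟩)

/-- The source of the wave equation created by the density transported by the force `F`. -/
abbrev drive {V : Rd d → ℝ} {F : ℝ → Rd d → Rd d} {M L : ℝ → ℝ} (hV : IsExternalPotential V) {a : Rd d → ℝ} {b : Rd n → ℝ}
    (ha : IsTest a) (hb : IsTest b) (hF : IsForce F M L) (f₀ : Density d) (t : ℝ) : WaveField d n :=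
  source ha hb (transport hV hF f₀ t)

section
variable (hV : IsExternalPotential V) (ha : IsTest a) (hb : IsTest b) (hF : IsForce F M L) (f₀ : Density d)
include hV ha hb hF f₀

theorem continuous_drive : Continuous (drive hV ha hb hF f₀) := (continuous_source _ _).comp (continuous_transport hV hF f₀)

theorem norm_drive_le (t : ℝ) : ‖drive hV ha hb hF f₀ t‖ ≤ sobN 0 a * sobN 0 b * ‖f₀‖ := by
  rw [← norm_transport hV hF f₀ t]; exact norm_source_le _ _ _

end

theorem sobN_le_add {a a' : Rd m → ℝ} (ha : IsTest a) (ha' : IsTest a') (k : ℕ) : sobN k a' ≤ sobN k a + sobN k (fun x => a' x - a x) := by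
  have h1 := ha.memLp_iteratedFDeriv k
  have h2 := (ha'.sub ha).memLp_iteratedFDeriv k
  have e : iteratedFDeriv ℝ k a' = iteratedFDeriv ℝ k a + iteratedFDeriv ℝ k fun x => a' x - a x := by
    have := iteratedFDeriv_add (i := k) (ha.1.of_le (m := (k : WithTop ℕ∞)) (by norm_cast; exact le_top))
      ((ha'.sub ha).1.of_le (m := (k : WithTop ℕ∞)) (by norm_cast; exact le_top))
    rw [← this]
    congr 1
    ext x
    simp
  rw [sobN, sobN, sobN, e, ← ENNReal.toReal_add h1.2.ne h2.2.ne]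
  exact ENNReal.toReal_mono (ENNReal.add_ne_top.2 ⟨h1.2.ne, h2.2.ne⟩) (eLpNorm_add_le h1.1 h2.1 (by norm_num))

end Limit

/-- Convergence of form functions and initial data. -/
structure DataLim {d n : ℕ} (ak : ℕ → Rd d → ℝ) (a : Rd d → ℝ) (bk : ℕ → Rd n → ℝ) (b : Rd n → ℝ) (f₀k : ℕ → Density d) (f₀ : Density d)
    (Ψ₀k : ℕ → WaveField d n) (Ψ₀ : WaveField d n) (Ψ₁k : ℕ → WaveField d n) (Ψ₁ : WaveField d n) : Prop where
  test₁ : IsTest a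
  test₂ : IsTest b
  test₁k : ∀ k, IsTest (ak k)
  test₂k : ∀ k, IsTest (bk k)
  sob₁ : ∀ j < 3, Tendsto (fun k => sobN j (fun x => ak k x - a x)) atTop (𝓝 0)
  sob₂ : Tendsto (fun k => sobN 0 (fun x => bk k x - b x)) atTop (𝓝 0)
  density : Tendsto f₀k atTop (𝓝 f₀)
  field : Tendsto Ψ₀k atTop (𝓝 Ψ₀)
  speed : Tendsto Ψ₁k atTop (𝓝 Ψ₁)

namespace DataLim

variable {d n : ℕ} {V a : Rd d → ℝ} {b : Rd n → ℝ} {ak : ℕ → Rd d → ℝ} {bk : ℕ → Rd n → ℝ} {M L : ℝ → ℝ} {Fk : ℕ → ℝ → Rd d → Rd d}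
  {F : ℝ → Rd d → Rd d} {f₀k : ℕ → Density d} {f₀ : Density d} {Ψ₀ Ψ₁ : WaveField d n} {Ψ₀k Ψ₁k : ℕ → WaveField d n} {T ε : ℝ}
  (H : DataLim ak a bk b f₀k f₀ Ψ₀k Ψ₀ Ψ₁k Ψ₁) (hV : IsExternalPotential V) (hFk : ∀ k, IsForce (Fk k) M L) (hF : IsForce F M L)

section
include H

theorem comp {φ : ℕ → ℕ} (hφ : StrictMono φ) : DataLim (fun k => ak (φ k)) a (fun k => bk (φ k)) b (fun k => f₀k (φ k)) f₀
    (fun k => Ψ₀k (φ k)) Ψ₀ (fun k => Ψ₁k (φ k)) Ψ₁ :=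
  have h := hφ.tendsto_atTop
  ⟨H.test₁, H.test₂, fun k => H.test₁k _, fun k => H.test₂k _, fun j hj => (H.sob₁ j hj).comp h, H.sob₂.comp h, H.density.comp h,
    H.field.comp h, H.speed.comp h⟩

theorem exists_sobN_bound {j : ℕ} (hj : j < 3) : ∃ S : ℝ, 0 ≤ S ∧ ∀ k, sobN j (ak k) * sobN 0 (bk k) ≤ S := by
  obtain ⟨A, hA⟩ := (H.sob₁ j hj).bddAbove_range
  obtain ⟨B, hB⟩ := H.sob₂.bddAbove_range
  have h1 : ∀ k, sobN j (ak k) ≤ sobN j a + |A| := fun k =>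
    (sobN_le_add H.test₁ (H.test₁k k) j).trans (add_le_add_right ((hA ⟨k, rfl⟩).trans (le_abs_self A)) _)
  have h2 : ∀ k, sobN 0 (bk k) ≤ sobN 0 b + |B| := fun k =>
    (sobN_le_add H.test₂ (H.test₂k k) 0).trans (add_le_add_right ((hB ⟨k, rfl⟩).trans (le_abs_self B)) _)
  have h3 := (sobN_nonneg j _).trans (h1 0)
  exact ⟨_, mul_nonneg h3 ((sobN_nonneg 0 _).trans (h2 0)), fun k => mul_le_mul (h1 k) (h2 k) (sobN_nonneg _ _) h3⟩

theorem exists_drive_bound : ∃ C : ℝ, 0 ≤ C ∧ ∀ k, sobN 0 (ak k) * sobN 0 (bk k) * ‖f₀k k‖ ≤ C := by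
  obtain ⟨S, hS0, hS⟩ := H.exists_sobN_bound (j := 0) (by norm_num)
  obtain ⟨B, hB⟩ := H.density.norm.bddAbove_range
  exact ⟨S * |B|, by positivity, fun k => mul_le_mul (hS k) ((hB ⟨k, rfl⟩).trans (le_abs_self B)) (norm_nonneg _) hS0⟩

theorem tendsto_sobN_mul {j : ℕ} (hj : j < 3) : Tendsto (fun k => sobN j (fun x => ak k x - a x) * sobN 0 (bk k)
    + sobN j a * sobN 0 (fun x => bk k x - b x)) atTop (𝓝 0) := by
  have h := ((H.sob₁ j hj).mul (H.sob₂.const_add (sobN 0 b))).add (H.sob₂.const_mul (sobN j a))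
  rw [zero_mul, mul_zero, add_zero] at h
  exact squeeze_zero (fun k => add_nonneg sobN_mul_nonneg sobN_mul_nonneg) (fun k => add_le_add_left (mul_le_mul_of_nonneg_left
    (sobN_le_add H.test₂ (H.test₂k k) 0) (sobN_nonneg _ _)) _) h

end

theorem tendsto_drive (hlim : ForceLim T Fk F) {s : ℝ} (hs : |s| ≤ T) :
    Tendsto (fun k => drive hV (H.test₁k k) (H.test₂k k) (hFk k) (f₀k k) s) atTop (𝓝 (drive hV H.test₁ H.test₂ hF f₀ s)) := by
  have h1 : Tendsto (fun k => transport hV (hFk k) (f₀k k) s) atTop (𝓝 (transport hV hF f₀ s)) :=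
    tendsto_transport hV hFk hF T hlim (tk := fun _ => s) (fun _ => hs) hs tendsto_const_nhds H.density
  have h3 : Tendsto (fun k => drive hV (H.test₁k k) (H.test₂k k) (hFk k) (f₀k k) s - source H.test₁ H.test₂ (transport hV (hFk k) (f₀k k) s)) atTop (𝓝 0) :=
    squeeze_zero_norm (fun k => (norm_source_sub_le (H.test₁k k) (H.test₂k k) H.test₁ H.test₂ _).trans_eq (by rw [norm_transport]))
      (by simpa using (H.tendsto_sobN_mul (j := 0) (by norm_num)).mul H.density.norm)
  simpa using h3.add (((continuous_source H.test₁ H.test₂).tendsto _).comp h1)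

abbrev sol (c : ℝ) (k : ℕ) : ℝ → WaveField d n := waveSol c (Ψ₀k k) (Ψ₁k k) (drive hV (H.test₁k k) (H.test₂k k) (hFk k) (f₀k k))

abbrev limSol (c : ℝ) : ℝ → WaveField d n := waveSol c Ψ₀ Ψ₁ (drive hV H.test₁ H.test₂ hF f₀)

theorem eventually_norm_sol_sub_le (c : ℝ) (hT : 0 < T) (hlim : ForceLim T Fk F) (hε : 0 < ε) :
    ∀ᶠ k in atTop, ∀ t ∈ Icc 0 T, ‖H.sol hV hFk c k t - H.limSol hV hF c t‖ ≤ ε := by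
  obtain ⟨C, hC0, hC⟩ := H.exists_drive_bound
  set gk := fun k => drive hV (H.test₁k k) (H.test₂k k) (hFk k) (f₀k k)
  set g := drive hV H.test₁ H.test₂ hF f₀
  have hck : ∀ k, Continuous (gk k) := fun k => continuous_drive hV _ _ _ _
  have hc : Continuous g := continuous_drive hV _ _ _ _
  have hint : Tendsto (fun k => ∫ s in 0..T, ‖gk k s - g s‖) atTop (𝓝 0) := by
    have := intervalIntegral.tendsto_integral_filter_of_dominated_convergence (μ := volume) (a := 0) (b := T) (l := atTop)
      (F := fun k s => ‖gk k s - g s‖) (f := fun _ => (0:ℝ)) (fun _ => C + sobN 0 a * sobN 0 b * ‖f₀‖)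
      (.of_forall fun k => ((hck k).sub hc).norm.aestronglyMeasurable)
      (.of_forall fun k => ae_of_all _ fun s _ => ?_) (by simp) (ae_of_all _ fun s hs => ?_)
    · simpa using this
    · rw [norm_norm]
      exact (norm_sub_le _ _).trans (add_le_add ((norm_drive_le hV _ _ _ _ s).trans (hC k)) (norm_drive_le hV _ _ _ _ s))
    · rw [uIoc_of_le hT.le] at hs
      exact tendsto_iff_norm_sub_tendsto_zero.1 (H.tendsto_drive hV hFk hF hlim (by rw [abs_of_pos hs.1]; exact hs.2))
  have hsum := ((tendsto_iff_norm_sub_tendsto_zero.1 H.field).add ((tendsto_iff_norm_sub_tendsto_zero.1 H.speed).const_mul T)).add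
    (hint.const_mul (2 * T))
  rw [mul_zero, mul_zero, add_zero, add_zero] at hsum
  filter_upwards [hsum.eventually (gt_mem_nhds hε)] with k hk t ht
  rw [waveSol_sub c _ _ _ _ (hck k) hc]
  refine (norm_waveSol_le c _ _ ((hck k).sub hc) ht.1).trans (le_trans ?_ hk.le)
  have h1 : ∫ s in 0..t, ‖gk k s - g s‖ ≤ ∫ s in 0..T, ‖gk k s - g s‖ :=
    intervalIntegral.integral_mono_interval le_rfl ht.1 ht.2 (ae_of_all _ fun _ => norm_nonneg _) (((hck k).sub hc).norm.intervalIntegrable _ _)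
  have h3 : 0 ≤ ∫ s in 0..t, ‖gk k s - g s‖ := intervalIntegral.integral_nonneg ht.1 fun _ _ => norm_nonneg _
  have := ht.2
  gcongr
  exact h1

include H in
theorem tendsto_force {K : ℝ} {ι : Type*} {Θ Ξ : ℕ → ι → WaveField d n} {S : Set ι} (hK : ∀ k, ∀ i ∈ S, ‖Ξ k i‖ ≤ K)
    (hΘ : ∀ ε > 0, ∀ᶠ k in atTop, ∀ i ∈ S, ‖Θ k i - Ξ k i‖ ≤ ε) (hε : 0 < ε) :
    ∀ᶠ k in atTop, ∀ i ∈ S, ∀ x, ‖force (ak k) (bk k) (Θ k i) x - force a b (Ξ k i) x‖ ≤ ε := by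
  obtain ⟨S, hS0, hS⟩ := H.exists_sobN_bound (j := 1) (by norm_num)
  have e1 := (H.tendsto_sobN_mul (j := 1) (by norm_num)).const_mul |K|
  rw [mul_zero] at e1
  filter_upwards [hΘ (ε / 2 / (S + 1)) (by positivity), e1.eventually (gt_mem_nhds (half_pos hε))] with k hk1 hk2 i hi x
  refine (norm_force_sub_le (H.test₁k k) (H.test₂k k) H.test₁ H.test₂ _ _ x).trans ?_
  have e5 := mul_le_mul (hk1 i hi) (hS k) sobN_mul_nonneg (by positivity)
  have e6 : ε / 2 / (S + 1) * S ≤ ε / 2 := by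
    rw [div_mul_eq_mul_div, div_le_iff₀ (by positivity)]
    nlinarith
  have e7 := mul_le_mul_of_nonneg_right ((hK k i hi).trans (le_abs_self K)) (add_nonneg (sobN_mul_nonneg (j := 1) (k := 0)
    (a := fun x => ak k x - a x) (b := bk k)) (sobN_mul_nonneg (j := 1) (k := 0) (a := a) (b := fun x => bk k x - b x)))
  linarith

end DataLim

section Compactness

variable {d n : ℕ} {δ : ℝ}

theorem norm_waveSol_clamped_le (c : ℝ) {g : ℝ → WaveField d n} (hg : Continuous g) {C : ℝ} (hC : 0 ≤ C) (hgC : ∀ s, ‖g s‖ ≤ C) (T : ℝ) :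
    ∀ t s, |t| ≤ T → |s| ≤ T → ‖waveSol c 0 0 g (max t 0)‖ ≤ 2 * (|T| * C) * (|T| + 1) ∧
      ‖waveSol c 0 0 g (max t 0) - waveSol c 0 0 g (max s 0)‖ ≤ 2 * (|T| * C) * (|T| + 1) * |t - s| := by
  have hmem : ∀ t, |t| ≤ T → max t 0 ∈ Icc 0 |T| := fun t ht => ⟨le_max_right _ _, max_le ((le_abs_self t).trans (ht.trans (le_abs_self T))) (abs_nonneg T)⟩
  have hl : ∀ t s, |t| ≤ T → |s| ≤ T → ‖waveSol c 0 0 g (max t 0) - waveSol c 0 0 g (max s 0)‖ ≤ 2 * (|T| * C) * |max t 0 - max s 0| :=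
    fun t s ht hs => norm_waveSol_sub_le c hg (fun s _ => hgC s) (hmem s hs) (hmem t ht)
  intro t s ht hs
  constructor
  · have hT : 0 ≤ T := (abs_nonneg t).trans ht
    have := hl t 0 ht (by simpa using hT)
    rw [max_self, waveSol_zero, sub_zero, sub_zero, abs_of_nonneg (hmem t ht).1] at this
    refine this.trans (mul_le_mul_of_nonneg_left ?_ (by positivity))
    linarith [(hmem t ht).2]
  · refine (hl t s ht hs).trans ?_
    have h1 : |max t 0 - max s 0| ≤ |t - s| := abs_max_sub_max_le_abs t s 0
    calc _ ≤ 2 * (|T| * C) * |t - s| := by gcongr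
      _ ≤ 2 * (|T| * C) * (|T| + 1) * |t - s| := by
        refine mul_le_mul_of_nonneg_right ?_ (abs_nonneg _)
        exact le_mul_of_one_le_right (by positivity) (by linarith [abs_nonneg T])

theorem norm_free_sub_le (c : ℝ) (Ψ₀ Ψ₁ Ψ₀' Ψ₁' : WaveField d n) {t : ℝ} (ht : 0 ≤ t) :
    ‖waveSol c Ψ₀ Ψ₁ (fun _ => 0) t - waveSol c Ψ₀' Ψ₁' (fun _ => 0) t‖ ≤ ‖Ψ₀ - Ψ₀'‖ + t * ‖Ψ₁ - Ψ₁'‖ := by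
  have h0 : Continuous fun _ : ℝ => (0 : WaveField d n) := continuous_const
  have e := waveSol_sub c Ψ₀ Ψ₁ Ψ₀' Ψ₁' h0 h0 t
  have h1 : (fun s : ℝ => (0 : WaveField d n) - 0) = fun _ => 0 := funext fun _ => sub_zero 0
  rw [h1] at e
  rw [e]
  have h2 := norm_waveSol_le c (Ψ₀ - Ψ₀') (Ψ₁ - Ψ₁') h0 ht
  rwa [norm_zero, intervalIntegral.integral_zero, mul_zero, add_zero] at h2

section
variable {E : Type*} [NormedAddCommGroup E]

theorem norm_sub_le_of_split {x y p q r : E} (h : y = p + q) (h1 : ‖x - y‖ ≤ δ / 2) (h2 : ‖p - r‖ ≤ δ / 2) : ‖x - (r + q)‖ ≤ δ := by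
  have : x - (r + q) = (x - y) + (p - r) := by rw [h]; abel
  rw [this]
  linarith [norm_add_le (x - y) (p - r)]

theorem norm_sub_le_of_split' {x p q r : E} (h1 : ‖x - (p + q)‖ ≤ δ / 2) (h2 : ‖q - r‖ ≤ δ / 2) : ‖x - (p + r)‖ ≤ δ :=
  by rw [add_comm p r]; exact norm_sub_le_of_split (add_comm p q) h1 h2

end

variable {V a : Rd d → ℝ} (hV : IsExternalPotential V) {b : Rd n → ℝ} {ak : ℕ → Rd d → ℝ} {bk : ℕ → Rd n → ℝ} {f₀k : ℕ → Density d} {f₀ : Density d}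
  {Ψ₀ Ψ₁ : WaveField d n} {Ψ₀k Ψ₁k : ℕ → WaveField d n} {Θ : ℕ → ℝ → WaveField d n} (H : DataLim ak a bk b f₀k f₀ Ψ₀k Ψ₀ Ψ₁k Ψ₁)
  (hΘ : ∀ k, Continuous (Θ k)) (hΘb : ∀ T : ℝ, ∃ K : ℝ, ∀ k t, |t| ≤ T → ‖Θ k t‖ ≤ K)
include H hΘ hΘb

theorem DataLim.exists_force_bound : ∃ M L : ℝ → ℝ, ∀ k, IsForce (fun t => force (ak k) (bk k) (Θ k t)) M L := by
  choose K hK using hΘb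
  obtain ⟨S1, -, h1⟩ := H.exists_sobN_bound (j := 1) (by norm_num)
  obtain ⟨S2, -, h2⟩ := H.exists_sobN_bound (j := 2) (by norm_num)
  exact ⟨fun T => |K T| * S1, fun T => |K T| * S2, fun k => (isForce_force (H.test₁k k) (H.test₂k k) (hΘ k) (K := fun T => |K T|)
    fun T t ht => (hK T k t ht).trans (le_abs_self _)).mono (fun T => mul_le_mul_of_nonneg_left (h1 k) (abs_nonneg _))
    fun T => mul_le_mul_of_nonneg_left (h2 k) (abs_nonneg _)⟩

theorem DataLim.exists_limit_force (c : ℝ) (hΘ0 : ∀ k t, t ≤ 0 → Θ k t = Θ k 0) :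
    ∃ (M L : ℝ → ℝ) (hFk : ∀ k, IsForce (fun t => force (ak k) (bk k) (Θ k t)) M L) (φ : ℕ → ℕ) (F : ℝ → Rd d → Rd d)
      (hF : IsForce F M L), StrictMono φ ∧ ∀ T > 0, (∀ ε > 0, ∀ᶠ k in atTop, ∀ t ∈ Icc 0 T, ‖Θ k t - H.sol hV hFk c k t‖ ≤ ε) →
        ForceLim T (fun k t => force (ak (φ k)) (bk (φ k)) (Θ (φ k) t)) F ∧ ∀ t ∈ Icc 0 T, F t = force a b (H.limSol hV hF c t) := by
  have ha := H.test₁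
  have hb := H.test₂
  obtain ⟨M₁, L₁, hF₁⟩ := H.exists_force_bound hΘ hΘb
  obtain ⟨C, hC0, hC⟩ := H.exists_drive_bound
  set g : ℕ → ℝ → WaveField d n := fun k => drive hV (H.test₁k k) (H.test₂k k) (hF₁ k) (f₀k k) with hg
  have hgc : ∀ k, Continuous (g k) := fun k => continuous_drive hV _ _ _ _
  have hgC : ∀ k s, ‖g k s‖ ≤ C := fun k s => (norm_drive_le hV _ _ _ _ s).trans (hC k)
  set D : ℕ → ℝ → WaveField d n := fun k t => waveSol c 0 0 (g k) (max t 0) with hD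
  obtain ⟨φ, G, M₂, L₂, hφ, hG, hGlim⟩ := exists_subseq_force ha hb (D := D) fun T =>
    ⟨2 * (|T| * C) * (|T| + 1), by positivity, fun k t s ht hs => norm_waveSol_clamped_le c (hgc k) hC0 (hgC k) T t s ht hs⟩
  set P : ℝ → WaveField d n := fun t => waveSol c Ψ₀ Ψ₁ (fun _ => 0) (max t 0) with hP
  have hPc : Continuous P := (continuous_waveSol c Ψ₀ Ψ₁ continuous_const).comp (continuous_id.max continuous_const)
  set F : ℝ → Rd d → Rd d := fun t x => force a b (P t) x + G t x with hFdef
  have hF : IsForce F _ _ := ((isForce_of_continuous ha hb hPc).add hG).mono (fun t => le_max_right (M₁ t) _) fun t => le_max_right (L₁ t) _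
  have hFk := fun k => (hF₁ k).mono (fun t => le_max_left (M₁ t) (curveSup P t * (sobN 1 a * sobN 0 b) + M₂ t))
    fun t => le_max_left (L₁ t) (curveSup P t * (sobN 2 a * sobN 0 b) + L₂ t)
  refine ⟨_, _, hFk, φ, F, hF, hφ, fun T hT hcl => ?_⟩
  have H' := H.comp hφ
  have hclφ : ∀ ε > 0, ∀ᶠ k in atTop, ∀ t ∈ Icc 0 T, ‖Θ (φ k) t - waveSol c (Ψ₀k (φ k)) (Ψ₁k (φ k)) (g (φ k)) t‖ ≤ ε :=
    fun ε hε => hφ.tendsto_atTop.eventually (hcl ε hε)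
  have hlim : ForceLim T (fun k t => force (ak (φ k)) (bk (φ k)) (Θ (φ k) t)) F := by
    intro R ε hε
    have hΞ : ∀ ε > 0, ∀ᶠ k in atTop, ∀ t ∈ Icc (-T) T, ‖Θ (φ k) t - (P t + D (φ k) t)‖ ≤ ε := by
      intro ε hε
      have hsum := (tendsto_iff_norm_sub_tendsto_zero.1 H'.field).add ((tendsto_iff_norm_sub_tendsto_zero.1 H'.speed).const_mul T)
      rw [mul_zero, add_zero] at hsum
      filter_upwards [hclφ _ (half_pos hε), hsum.eventually (gt_mem_nhds (half_pos hε))] with k hk1 hk2 t ht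
      have ht' : max t 0 ∈ Icc 0 T := ⟨le_max_right _ _, max_le ht.2 hT.le⟩
      have e1 : Θ (φ k) t = Θ (φ k) (max t 0) := by
        rcases le_total t 0 with h | h
        · rw [max_eq_right h, hΘ0 _ t h]
        · rw [max_eq_left h]
      have e4 : ‖waveSol c (Ψ₀k (φ k)) (Ψ₁k (φ k)) (fun _ => 0) (max t 0) - P t‖ ≤ ε / 2 := by
        have := mul_le_mul_of_nonneg_right ht'.2 (norm_nonneg (Ψ₁k (φ k) - Ψ₁))
        linarith [norm_free_sub_le c (Ψ₀k (φ k)) (Ψ₁k (φ k)) Ψ₀ Ψ₁ ht'.1]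
      rw [e1]
      exact norm_sub_le_of_split (waveSol_add c _ _ (hgc (φ k)) _) (hk1 _ ht') e4
    have hK : ∀ k, ∀ t ∈ Icc (-T) T, ‖P t + D (φ k) t‖ ≤ curveSup P T + 2 * (|T| * C) * (|T| + 1) := fun k t ht =>
      (norm_add_le _ _).trans (add_le_add (le_curveSup hPc T t (abs_le.2 ht))
        (norm_waveSol_clamped_le c (hgc _) hC0 (hgC _) T t t (abs_le.2 ht) (abs_le.2 ht)).1)
    filter_upwards [H'.tendsto_force hK hΞ (half_pos hε), hGlim (max R T) _ (half_pos hε)] with k hk1 hk2 t ht x hx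
    have e1 := hk1 t (abs_le.1 ht) x
    rw [force_add ha hb] at e1
    exact norm_sub_le_of_split' e1 (hk2 t x (ht.trans (le_max_right _ _)) (hx.trans (le_max_left _ _)))
  refine ⟨hlim, fun t ht => funext fun x => eq_of_forall_dist_le fun ε hε => ?_⟩
  have habs : ∀ {t}, t ∈ Icc 0 T → |t| ≤ T := fun ht => by rw [abs_of_nonneg ht.1]; exact ht.2
  have hconv : ∀ ε > 0, ∀ᶠ k in atTop, ∀ t ∈ Icc 0 T, ‖Θ (φ k) t - H.limSol hV hF c t‖ ≤ ε := fun ε hε => by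
    filter_upwards [hclφ _ (half_pos hε), H'.eventually_norm_sol_sub_le hV (fun k => hFk (φ k)) hF c hT hlim (half_pos hε)] with k hk1 hk2 t ht
    exact (norm_sub_le_norm_sub_add_norm_sub _ _ _).trans ((add_le_add (hk1 t ht) (hk2 t ht)).trans_eq (add_halves ε))
  obtain ⟨k, k1, k2⟩ := ((hlim ‖x‖ _ (half_pos hε)).and (H'.tendsto_force (Ξ := fun _ t => H.limSol hV hF c t) (S := Icc 0 T)
    (fun k t ht => le_curveSup (continuous_waveSol c Ψ₀ Ψ₁ (continuous_drive hV ha hb hF f₀)) T t (habs ht)) hconv (half_pos hε))).exists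
  refine (dist_triangle_left _ _ (force (ak (φ k)) (bk (φ k)) (Θ (φ k) t) x)).trans ((add_le_add ?_ ?_).trans_eq (add_halves ε))
  · rw [dist_eq_norm]; exact k1 t (habs ht) x le_rfl
  · rw [dist_eq_norm]; exact k2 t ht x

end Compactness

section Existence

variable {d n : ℕ} {V : Rd d → ℝ} (hV : IsExternalPotential V) {a : Rd d → ℝ} {b : Rd n → ℝ} (ha : IsTest a) (hb : IsTest b)
  (c : ℝ) (Ψ₀ Ψ₁ : WaveField d n) (f₀ : Density d) (h : ℝ)

/-- One Picard step for the system with delay `h`, acting on the delayed field. -/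
def delayStep (Θ : {Θ : ℝ → WaveField d n // Continuous Θ}) : {Θ : ℝ → WaveField d n // Continuous Θ} :=
  ⟨fun t => waveSol c Ψ₀ Ψ₁ (drive hV ha hb (isForce_of_continuous ha hb Θ.2) f₀) (max (t - h) 0),
    (continuous_waveSol c Ψ₀ Ψ₁ (continuous_drive hV ha hb _ f₀)).comp ((continuous_id.sub continuous_const).max continuous_const)⟩

/-- The Picard iterates for the system with delay `h`. -/
def delayIter (N : ℕ) : {Θ : ℝ → WaveField d n // Continuous Θ} := (delayStep hV ha hb c Ψ₀ Ψ₁ f₀ h)^[N] ⟨fun _ => Ψ₀, continuous_const⟩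

theorem delayIter_succ (N : ℕ) : delayIter hV ha hb c Ψ₀ Ψ₁ f₀ h (N + 1) = delayStep hV ha hb c Ψ₀ Ψ₁ f₀ h (delayIter hV ha hb c Ψ₀ Ψ₁ f₀ h N) :=
  Function.iterate_succ_apply' _ _ _

variable {h}

theorem delayStep_eqOn {Θ Θ' : {Θ : ℝ → WaveField d n // Continuous Θ}} {τ : ℝ} (hΘ : ∀ t ≤ τ, Θ.1 t = Θ'.1 t) {t : ℝ} (ht : t ≤ τ + h) :
    (delayStep hV ha hb c Ψ₀ Ψ₁ f₀ h Θ).1 t = (delayStep hV ha hb c Ψ₀ Ψ₁ f₀ h Θ').1 t := by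
  rcases le_total (t - h) 0 with h0 | h0
  · simp only [delayStep, max_eq_right h0, waveSol_zero]
  · simp only [delayStep, max_eq_left h0]
    refine waveSol_congr h0 fun s hs => ?_
    refine congrArg (source ha hb) (transport_congr hV _ _ hs.1 (fun r hr => ?_) f₀)
    simp only [hΘ r (by linarith [hr.2, hs.2])]

theorem delayIter_eq (N : ℕ) : ∀ t ≤ (N + 1) * h, (delayIter hV ha hb c Ψ₀ Ψ₁ f₀ h N).1 t = (delayIter hV ha hb c Ψ₀ Ψ₁ f₀ h (N + 1)).1 t := by
  induction N with
  | zero =>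
    intro t ht
    rw [delayIter_succ]
    simp only [delayIter, delayStep, Function.iterate_zero, id]
    rw [max_eq_right (by push_cast at ht; linarith), waveSol_zero]
  | succ N ih =>
    intro t ht
    rw [delayIter_succ _ _ _ _ _ _ _ _ (N + 1)]
    conv_lhs => rw [delayIter_succ]
    exact delayStep_eqOn hV ha hb c Ψ₀ Ψ₁ f₀ ih (by push_cast at ht ⊢; linarith)

theorem delayIter_of_nonpos (hh : 0 ≤ h) (N : ℕ) (t : ℝ) (ht : t ≤ 0) : (delayIter hV ha hb c Ψ₀ Ψ₁ f₀ h N).1 t = Ψ₀ := by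
  cases N with
  | zero => rfl
  | succ N =>
    rw [delayIter_succ]
    simp only [delayStep]
    rw [max_eq_right (by linarith), waveSol_zero]

theorem norm_delayIter_le (hh : 0 ≤ h) (N : ℕ) (T t : ℝ) (ht : |t| ≤ T) : ‖(delayIter hV ha hb c Ψ₀ Ψ₁ f₀ h N).1 t‖
    ≤ ‖Ψ₀‖ + T * ‖Ψ₁‖ + 2 * T * (T * (sobN 0 a * sobN 0 b * ‖f₀‖)) := by
  have hT : 0 ≤ T := (abs_nonneg t).trans ht
  cases N with
  | zero =>
    have : 0 ≤ sobN 0 a * sobN 0 b := sobN_mul_nonneg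
    have : 0 ≤ T * ‖Ψ₁‖ + 2 * T * (T * (sobN 0 a * sobN 0 b * ‖f₀‖)) := by positivity
    simp only [delayIter, Function.iterate_zero, id]
    linarith
  | succ N =>
    rw [delayIter_succ]
    exact norm_waveSol_le_of_bound c _ _ (continuous_drive hV ha hb _ f₀) (norm_drive_le hV ha hb _ f₀)
      ⟨le_max_right _ _, max_le (by linarith [le_abs_self t]) hT⟩

theorem eventually_norm_free_sub_le {T : ℝ} {ε : ℝ} (hε : 0 < ε) : ∃ δ > 0, ∀ s ∈ Icc 0 T, ∀ t ∈ Icc 0 T, |t - s| < δ →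
    ‖waveSol c Ψ₀ Ψ₁ (fun _ => 0) s - waveSol c Ψ₀ Ψ₁ (fun _ => 0) t‖ ≤ ε := by
  have h0 : Continuous fun _ : ℝ => (0 : WaveField d n) := continuous_const
  have := (isCompact_Icc (a := (0:ℝ)) (b := T)).uniformContinuousOn_of_continuous (continuous_waveSol c Ψ₀ Ψ₁ h0).continuousOn
  obtain ⟨δ, hδ, h⟩ := Metric.uniformContinuousOn_iff.1 this ε hε
  refine ⟨δ, hδ, fun s hs t ht hst => ?_⟩
  have := h s hs t ht (by rwa [dist_comm, Real.dist_eq])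
  rw [dist_eq_norm] at this
  exact this.le

theorem exists_force_eq : ∃ (F : ℝ → Rd d → Rd d) (M L : ℝ → ℝ) (hF : IsForce F M L),
    ∀ t, 0 ≤ t → F t = force a b (waveSol c Ψ₀ Ψ₁ (drive hV ha hb hF f₀) t) := by
  set h : ℕ → ℝ := fun k => 1 / ((k : ℝ) + 1) with hh
  have hh0 : ∀ k, 0 < h k := fun k => by positivity
  set Θ : ℕ → ℝ → WaveField d n := fun k => (delayIter hV ha hb c Ψ₀ Ψ₁ f₀ (h k) ((k + 1) ^ 2)).1 with hΘ
  have hΘc : ∀ k, Continuous (Θ k) := fun k => (delayIter hV ha hb c Ψ₀ Ψ₁ f₀ (h k) ((k + 1) ^ 2)).2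
  have hz : ∀ (m j : ℕ) (a : Rd m → ℝ), Tendsto (fun _ : ℕ => sobN j (fun x => a x - a x)) atTop (𝓝 0) := fun m j a => by
    simp only [sub_self, sobN_const_zero]; exact tendsto_const_nhds
  have H₀ : DataLim (fun _ => a) a (fun _ => b) b (fun _ => f₀) f₀ (fun _ => Ψ₀) Ψ₀ (fun _ => Ψ₁) Ψ₁ :=
    ⟨ha, hb, fun _ => ha, fun _ => hb, fun j _ => hz d j a, hz n 0 b, tendsto_const_nhds, tendsto_const_nhds, tendsto_const_nhds⟩
  obtain ⟨M, L, hFk, φ, F, hF, hφ, H⟩ := H₀.exists_limit_force hV hΘc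
    (fun T => ⟨_, fun k t ht => norm_delayIter_le hV ha hb c Ψ₀ Ψ₁ f₀ (hh0 k).le _ T t ht⟩) c
    fun k t ht => by rw [hΘ]; simp only; rw [delayIter_of_nonpos _ _ _ _ _ _ _ (hh0 k).le _ t ht, delayIter_of_nonpos _ _ _ _ _ _ _ (hh0 k).le _ 0 le_rfl]
  refine ⟨F, M, L, hF, fun t ht => ?_⟩
  refine (H (t + 1) (by linarith) fun ε hε => ?_).2 t ⟨ht, by linarith⟩
  obtain ⟨δ, hδ, hfree⟩ := eventually_norm_free_sub_le c Ψ₀ Ψ₁ (T := t + 1) (half_pos hε)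
  set C : ℝ := 2 * ((t + 1) * (sobN 0 a * sobN 0 b * ‖f₀‖)) with hC
  have hC0 : 0 ≤ C := by have := sobN_mul_nonneg (j := 0) (k := 0) (a := a) (b := b); positivity
  have hlim : Tendsto h atTop (𝓝 0) := tendsto_one_div_add_atTop_nhds_zero_nat
  have hlim' : Tendsto (fun k => C * h k) atTop (𝓝 0) := by simpa using hlim.const_mul C
  obtain ⟨K, hK⟩ := exists_nat_ge (t + 1)
  filter_upwards [hlim.eventually (gt_mem_nhds hδ), hlim'.eventually (gt_mem_nhds (half_pos hε)), eventually_ge_atTop K] with k k1 k2 k3 s hs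
  have hsk : s ≤ (((k + 1) ^ 2 : ℕ) + 1 : ℝ) * h k := by
    have : (((k + 1) ^ 2 : ℕ) : ℝ) * h k = k + 1 := by rw [hh]; push_cast; field_simp
    have hkK : (K : ℝ) ≤ k := by exact_mod_cast k3
    rw [add_mul, this]
    linarith [hs.2, (hh0 k).le]
  have e1 : Θ k s = waveSol c Ψ₀ Ψ₁ (drive hV ha hb (hFk k) f₀) (max (s - h k) 0) := by
    refine (delayIter_eq hV ha hb c Ψ₀ Ψ₁ f₀ _ s hsk).trans ?_
    rw [delayIter_succ]
    rfl
  have hs' : max (s - h k) 0 ∈ Icc 0 (t + 1) := ⟨le_max_right _ _, max_le (by linarith [hs.2, hh0 k]) (hs.1.trans hs.2)⟩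
  have hd : |max (s - h k) 0 - s| ≤ h k := by
    rw [abs_le]
    exact ⟨by linarith [le_max_left (s - h k) 0], by linarith [max_le (show s - h k ≤ s + h k by linarith [hh0 k]) (show 0 ≤ s + h k by linarith [hh0 k, hs.1])]⟩
  have hg := continuous_drive hV ha hb (hFk k) f₀
  have e2 := hfree _ hs' _ hs (by rw [abs_sub_comm]; exact hd.trans_lt k1)
  have e3 := norm_waveSol_sub_le c hg (T := t + 1) (fun s _ => norm_drive_le hV ha hb (hFk k) f₀ s) hs hs'
  have e4 : C * |max (s - h k) 0 - s| ≤ C * h k := mul_le_mul_of_nonneg_left hd hC0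
  change ‖_ - waveSol c Ψ₀ Ψ₁ (drive hV ha hb (hFk k) f₀) s‖ ≤ ε
  rw [e1, waveSol_add c Ψ₀ Ψ₁ hg (max (s - h k) 0), waveSol_add c Ψ₀ Ψ₁ hg s, ← dist_eq_norm]
  refine (dist_add_add_le _ _ _ _).trans ?_
  rw [dist_eq_norm, dist_eq_norm]
  linarith

theorem exists_global_solution (hV : IsExternalPotential V) {σ₁ : Rd d → ℝ} {σ₂ : Rd n → ℝ} (h₁ : IsFormFunction σ₁) (h₂ : IsFormFunction σ₂)
    (hf₀ : 0 ≤ f₀) : ∃ (f : ℝ → Density d) (Ψ : ℝ → WaveField d n), Continuous f ∧ Continuous Ψ ∧ (∀ t, 0 ≤ f t) ∧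
      ∀ T : ℝ, 0 < T → IsWeakSolution T c V σ₁ σ₂ Ψ₀ Ψ₁ f₀ f Ψ := by
  obtain ⟨F, M, L, hF, H⟩ := exists_force_eq hV h₁.isTest h₂.isTest c Ψ₀ Ψ₁ f₀
  exact ⟨_, _, continuous_transport hV hF f₀, continuous_waveSol c Ψ₀ Ψ₁ (continuous_drive hV h₁.isTest h₂.isTest hF f₀),
    transport_nonneg hV hF hf₀, fun T hT => isWeakSolution_of_eq hV h₁ h₂ hT hF fun t ht => H t ht.1⟩

end Existence

section Stability

variable {d n : ℕ} {V : Rd d → ℝ} {T c : ℝ}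

variable {m : ℕ} {σ₁ : Rd d → ℝ} {σ₂ : Rd n → ℝ} {Ψ₀ Ψ₁ : WaveField d n} {f₀ : Density d} {f : ℝ → Density d} {Ψ : ℝ → WaveField d n} {ε : ℝ}

theorem sobN_zero_eq (a : Rd m → ℝ) : sobN 0 a = (eLpNorm a 2 volume).toReal := by
  rw [sobN]
  exact congrArg _ (eLpNorm_congr_norm_ae (ae_of_all _ fun x => norm_iteratedFDeriv_zero))

theorem sobN_le_of_w32Norm_lt {a : Rd m → ℝ} {δ : ℝ} (hδ : 0 < δ) (h : w32Norm a < ENNReal.ofReal δ) {j : ℕ} (hj : j < 4) : sobN j a ≤ δ := by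
  refine ENNReal.toReal_le_of_le_ofReal hδ.le (le_trans ?_ h.le)
  exact Finset.single_le_sum (f := fun k => eLpNorm (iteratedFDeriv ℝ k a) 2 volume) (fun _ _ => zero_le) (Finset.mem_range.2 hj)

section
variable (hV : IsExternalPotential V) (h₁ : IsFormFunction σ₁) (h₂ : IsFormFunction σ₂) (hT : 0 < T)
include hV h₁ h₂ hT

theorem IsWeakSolution.norm_field_le (h : IsWeakSolution T c V σ₁ σ₂ Ψ₀ Ψ₁ f₀ f Ψ) {t : ℝ} (ht : t ∈ Icc 0 T) :
    ‖Ψ t‖ ≤ ‖Ψ₀‖ + T * ‖Ψ₁‖ + 2 * T * (T * (sobN 0 σ₁ * sobN 0 σ₂ * ‖f₀‖)) := by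
  have hF := isForce_of_continuous h₁.isTest h₂.isTest (continuous_comp_clamp hT.le h.continuous_field)
  rw [(h.eq_transport_waveSol hV h₁ h₂ hT hF fun t ht => by simp only [clamp_of_mem ht]).2 ht]
  exact norm_waveSol_le_of_bound c Ψ₀ Ψ₁ (continuous_drive hV h₁.isTest h₂.isTest hF f₀) (norm_drive_le hV h₁.isTest h₂.isTest hF f₀) ht

section
variable (huniq : ∀ f' Ψ', IsWeakSolution T c V σ₁ σ₂ Ψ₀ Ψ₁ f₀ f' Ψ' → EqOn f' f (Icc 0 T) ∧ EqOn Ψ' Ψ (Icc 0 T))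
include huniq

/-- Convergence of weak solutions under convergence of the data, when the limit problem has at most one solution. -/
theorem tendsto_of_unique {ak : ℕ → Rd d → ℝ} {bk : ℕ → Rd n → ℝ} (hak : ∀ k, IsFormFunction (ak k)) (hbk : ∀ k, IsFormFunction (bk k))
    {f₀k : ℕ → Density d} {Ψ₀k Ψ₁k : ℕ → WaveField d n} {fk : ℕ → ℝ → Density d} {Ψk : ℕ → ℝ → WaveField d n}
    (H : DataLim ak σ₁ bk σ₂ f₀k f₀ Ψ₀k Ψ₀ Ψ₁k Ψ₁) (hs : ∀ k, IsWeakSolution T c V (ak k) (bk k) (Ψ₀k k) (Ψ₁k k) (f₀k k) (fk k) (Ψk k))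
    {tk : ℕ → ℝ} (htk : ∀ k, tk k ∈ Icc 0 T) (hε : 0 < ε) : ∃ k, ‖fk k (tk k) - f (tk k)‖ < ε ∧ ‖Ψk k (tk k) - Ψ (tk k)‖ < ε := by
  have hbd : ∃ K : ℝ, ∀ k, ∀ t ∈ Icc 0 T, ‖Ψk k t‖ ≤ K := by
    obtain ⟨C, hC0, hC⟩ := H.exists_drive_bound
    obtain ⟨B₀, hB₀⟩ := H.field.norm.bddAbove_range
    obtain ⟨B₁, hB₁⟩ := H.speed.norm.bddAbove_range
    refine ⟨B₀ + T * B₁ + 2 * T * (T * C), fun k t ht => ((hs k).norm_field_le hV (hak k) (hbk k) hT ht).trans ?_⟩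
    have e3 := hC k
    have e4 : ‖Ψ₀k k‖ ≤ B₀ := hB₀ ⟨k, rfl⟩
    have e5 : ‖Ψ₁k k‖ ≤ B₁ := hB₁ ⟨k, rfl⟩
    gcongr
  obtain ⟨K, hK⟩ := hbd
  obtain ⟨M, L, hFk, φ, F, hF, hφ, H'⟩ := H.exists_limit_force hV (Θ := fun k t => Ψk k (clamp T t))
    (fun k => continuous_comp_clamp hT.le (hs k).continuous_field) (fun S => ⟨K, fun k t _ => hK k _ (clamp_mem hT.le t)⟩) c
    fun k t ht => by simp only [clamp, max_eq_left ((min_le_left t T).trans ht), max_eq_left (min_le_left 0 T)]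
  have hsk : ∀ k, EqOn (fk k) (transport hV (hFk k) (f₀k k)) (Icc 0 T) ∧ EqOn (Ψk k) (H.sol hV hFk c k) (Icc 0 T) := fun k =>
    (hs k).eq_transport_waveSol hV (hak k) (hbk k) hT (hFk k) fun t ht => by simp only [clamp_of_mem ht]
  obtain ⟨hlim, hFeq⟩ := H' T hT fun ε hε => .of_forall fun k t ht => by
    simp only [clamp_of_mem ht]
    rw [(hsk k).2 ht, sub_self, norm_zero]
    exact hε.le
  obtain ⟨uf, uΨ⟩ := huniq _ _ (isWeakSolution_of_eq hV h₁ h₂ hT hF hFeq)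
  obtain ⟨t, ht, ψ, hψ, htlim⟩ := isCompact_Icc.tendsto_subseq fun k => htk (φ k)
  have habs : ∀ {t : ℝ}, t ∈ Icc 0 T → |t| ≤ T := fun ht => by rw [abs_of_nonneg ht.1]; exact ht.2
  have hψt := hψ.tendsto_atTop
  have c1 := tendsto_transport hV (fun k => hFk (φ (ψ k))) hF T (fun R ε hε => hψt.eventually (hlim R ε hε))
    (tk := fun k => tk (φ (ψ k))) (fun k => habs (htk _)) (habs ht) htlim (H.comp (hφ.comp hψ)).density
  have c3 := (c1.sub (((continuous_transport hV hF f₀).tendsto t).comp htlim)).norm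
  rw [sub_self, norm_zero] at c3
  obtain ⟨k, k1, k2⟩ := ((c3.eventually (gt_mem_nhds hε)).and (hψt.eventually
    ((H.comp hφ).eventually_norm_sol_sub_le hV (fun k => hFk (φ k)) hF c hT hlim (half_pos hε)))).exists
  refine ⟨φ (ψ k), ?_, ?_⟩
  · rw [(hsk _).1 (htk _), ← uf (htk _)]
    exact k1
  · rw [(hsk _).2 (htk _), ← uΨ (htk _)]
    exact (k2 _ (htk _)).trans_lt (half_lt_self hε)

theorem continuous_dependence (hε : 0 < ε) : ∃ δ : ℝ, 0 < δ ∧ ∀ (σ₁' : Rd d → ℝ) (σ₂' : Rd n → ℝ) (Ψ₀' Ψ₁' : WaveField d n) (f₀' : Density d),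
      IsFormFunction σ₁' → IsFormFunction σ₂' → 0 ≤ f₀' → w32Norm (fun x => σ₁' x - σ₁ x) < ENNReal.ofReal δ →
      eLpNorm (fun y => σ₂' y - σ₂ y) 2 volume < ENNReal.ofReal δ → ‖Ψ₀' - Ψ₀‖ < δ → ‖Ψ₁' - Ψ₁‖ < δ → ‖f₀' - f₀‖ < δ →
      ∀ (f' : ℝ → Density d) (Ψ' : ℝ → WaveField d n), IsWeakSolution T c V σ₁' σ₂' Ψ₀' Ψ₁' f₀' f' Ψ' →
        ∀ t ∈ Icc 0 T, ‖f' t - f t‖ < ε ∧ ‖Ψ' t - Ψ t‖ < ε := by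
  by_contra hcon
  push Not at hcon
  have hδ : ∀ k : ℕ, (0:ℝ) < 1 / ((k : ℝ) + 1) := fun k => by positivity
  have hδl : Tendsto (fun k : ℕ => 1 / ((k : ℝ) + 1)) atTop (𝓝 0) := tendsto_one_div_add_atTop_nhds_zero_nat
  choose a b Ψ₀k Ψ₁k f₀k ha hb _ hw he hΨ₀ hΨ₁ hf fk Ψk hs t ht hbad using fun k : ℕ => hcon _ (hδ k)
  have H : DataLim a σ₁ b σ₂ f₀k f₀ Ψ₀k Ψ₀ Ψ₁k Ψ₁ := ⟨h₁.isTest, h₂.isTest, fun k => (ha k).isTest, fun k => (hb k).isTest,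
    fun j hj => squeeze_zero (fun _ => sobN_nonneg _ _) (fun k => sobN_le_of_w32Norm_lt (hδ k) (hw k) (hj.trans (by norm_num))) hδl,
    squeeze_zero (fun _ => sobN_nonneg _ _) (fun k => by rw [sobN_zero_eq]; exact ENNReal.toReal_le_of_le_ofReal (hδ k).le (he k).le) hδl,
    tendsto_iff_norm_sub_tendsto_zero.2 (squeeze_zero (fun _ => norm_nonneg _) (fun k => (hf k).le) hδl),
    tendsto_iff_norm_sub_tendsto_zero.2 (squeeze_zero (fun _ => norm_nonneg _) (fun k => (hΨ₀ k).le) hδl),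
    tendsto_iff_norm_sub_tendsto_zero.2 (squeeze_zero (fun _ => norm_nonneg _) (fun k => (hΨ₁ k).le) hδl)⟩
  obtain ⟨k, k1, k2⟩ := tendsto_of_unique hV h₁ h₂ hT huniq ha hb H hs ht hε
  exact absurd k2 (not_lt.2 (hbad k k1))

end

end

end Stability

section WeakDerivatives

theorem isWeakDerivAlong_of_contDiff {X : Type*} [NormedAddCommGroup X] [NormedSpace ℝ X] [FiniteDimensional ℝ X] [MeasureSpace X] [BorelSpace X]
    [(volume : Measure X).IsAddHaarMeasure] {u : X → ℝ} (hu : ContDiff ℝ 1 u) (e : X) : IsWeakDerivAlong u e fun x => fderiv ℝ u x e := by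
  have hd : Continuous fun x => fderiv ℝ u x e := (hu.continuous_fderiv (by simp)).clm_apply continuous_const
  refine ⟨hu.continuous.locallyIntegrable, hd.locallyIntegrable, fun φ hφ => ?_⟩
  exact integral_mul_fderiv_eq_neg_fderiv_mul_of_integrable (hφ.integrable_mul hd.locallyIntegrable)
    ((hφ.fderiv_apply e).integrable_mul hu.continuous.locallyIntegrable) (hφ.integrable_mul hu.continuous.locallyIntegrable)
    (fun x _ => hu.differentiable (by simp) x) fun x _ => hφ.1.differentiable (by simp) x

theorem eLpNorm_top_le {X E : Type*} [MeasureSpace X] [SeminormedAddCommGroup E] {u : X → E} {C : ℝ} (h : ∀ x, ‖u x‖ ≤ C) :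
    eLpNorm u ∞ volume ≤ ENNReal.ofReal C := by
  rw [eLpNorm_exponent_top]
  refine eLpNormEssSup_le_of_ae_enorm_bound (ae_of_all _ fun x => ?_)
  rw [← ofReal_norm]
  exact ENNReal.ofReal_le_ofReal (h x)

variable {d n : ℕ} {a : Rd d → ℝ} {b : Rd n → ℝ}

variable {u : Rd d → ℝ}

theorem contDiff_potential (ha : IsTest a) (hb : IsTest b) (Ψ : WaveField d n) : ContDiff ℝ 2 (potential a b Ψ) := by
  rw [potential_eq_convolution ha hb]
  exact ha.2.contDiff_convolution_left (n := 2) _ (ha.1.of_le (by exact_mod_cast le_top)) (locallyIntegrable_sndAverage hb Ψ)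

theorem w2infNorm_le {G : Rd d → Rd d} {H : Rd d → Rd d →L[ℝ] Rd d →L[ℝ] ℝ} (hG : HasWeakGradient u G) (hH : HasWeakJacobian G H) :
    w2infNorm u ≤ eLpNorm u ∞ volume + eLpNorm G ∞ volume + eLpNorm H ∞ volume :=
  iInf₂_le_of_le G H (iInf₂_le hG hH)

theorem fderiv_fderiv_apply (h : Differentiable ℝ (fderiv ℝ u)) (x e e' : Rd d) :
    fderiv ℝ (fderiv ℝ u) x e e' = fderiv ℝ (fun x => fderiv ℝ u x e') x e := by
  rw [((h x).hasFDerivAt.clm_apply (hasFDerivAt_const e' x)).fderiv]; simp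

section
variable {E : Type*} [NormedAddCommGroup E]

theorem tendsto_ofReal_norm_sub_mul {v : ℝ → E} (hv : Continuous v) (C t : ℝ) : Tendsto (fun s => ENNReal.ofReal (‖v s - v t‖ * C)) (𝓝 t) (𝓝 0) := by
  have := ENNReal.tendsto_ofReal ((((hv.tendsto t).sub_const (v t)).norm).mul_const C)
  simpa using this

theorem abs_re_inner_sub_le [InnerProductSpace ℂ E] (S S' C C' q h : E) :
    |(-inner ℂ S q + inner ℂ C h : ℂ).re - (-inner ℂ S' q + inner ℂ C' h : ℂ).re| ≤ ‖(S, C) - (S', C')‖ * (‖q‖ + ‖h‖) := by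
  have e : (-inner ℂ S q + inner ℂ C h : ℂ).re - (-inner ℂ S' q + inner ℂ C' h : ℂ).re = (-inner ℂ (S - S') q + inner ℂ (C - C') h : ℂ).re := by
    rw [inner_sub_left, inner_sub_left, ← Complex.sub_re]; congr 1; ring
  rw [e, mul_add]
  refine (Complex.abs_re_le_norm _).trans ((norm_add_le _ _).trans ?_)
  rw [norm_neg]
  exact add_le_add ((norm_inner_le_norm _ _).trans (mul_le_mul_of_nonneg_right (norm_fst_le ((S, C) - (S', C'))) (norm_nonneg _)))
    ((norm_inner_le_norm _ _).trans (mul_le_mul_of_nonneg_right (norm_snd_le ((S, C) - (S', C'))) (norm_nonneg _)))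

end

section
variable (ha : IsTest a)
include ha

theorem fderiv_elem_snd {θ : Rd n → ℝ} (hθ : IsTest θ) (x : Rd d) (q : Rd d × Rd n) (e : Rd n) :
    fderiv ℝ (fun q : Rd d × Rd n => a (x - q.1) * θ q.2) q (0, e) = a (x - q.1) * fderiv ℝ θ q.2 e := by
  have h1 : HasFDerivAt (fun q : Rd d × Rd n => a (x - q.1)) _ q :=
    (((ha.comp_sub_left x).1.differentiable (by simp) q.1).hasFDerivAt).comp q hasFDerivAt_fst
  have h2 : HasFDerivAt (fun q : Rd d × Rd n => θ q.2) _ q := ((hθ.1.differentiable (by simp) q.2).hasFDerivAt).comp q hasFDerivAt_snd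
  rw [(h1.fun_mul h2).fderiv]
  simp

section
variable (hb : IsTest b)
include hb

theorem norm_fderiv_fderiv_potential_le (Ψ : WaveField d n) (x : Rd d) : ‖fderiv ℝ (fderiv ℝ (potential a b Ψ)) x‖ ≤ ‖Ψ‖ * (sobN 2 a * sobN 0 b) := by
  have hd : Differentiable ℝ (fderiv ℝ (potential a b Ψ)) :=
    ((contDiff_potential ha hb Ψ).fderiv_right (m := 1) (by norm_num)).differentiable (by simp)
  have n2 := sobN_nonneg 2 a
  have n0 := sobN_nonneg 0 b
  refine ContinuousLinearMap.opNorm_le_bound₂ _ (by positivity) fun e e' => ?_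
  rw [fderiv_fderiv_apply hd, show (fun x => fderiv ℝ (potential a b Ψ) x e') = potential (fun p => fderiv ℝ a p e') b Ψ from
    funext fun x => fderiv_potential ha hb Ψ x e', fderiv_potential (ha.fderiv_apply e') hb]
  refine (abs_potential_le ((ha.fderiv_apply e').fderiv_apply e) hb Ψ x).trans ?_
  have h1 := (ha.fderiv_apply e').sobN_fderiv_apply_le 0 e
  have h2 := ha.sobN_fderiv_apply_le 1 e'
  have h3 : sobN 0 (fun p => fderiv ℝ (fun q => fderiv ℝ a q e') p e) ≤ ‖e‖ * (‖e'‖ * sobN 2 a) :=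
    h1.trans (mul_le_mul_of_nonneg_left h2 (norm_nonneg e))
  have h4 := mul_le_mul_of_nonneg_left (mul_le_mul_of_nonneg_right h3 n0) (norm_nonneg Ψ)
  linarith

theorem w2infNorm_potential_le (Ψ : WaveField d n) : w2infNorm (potential a b Ψ)
    ≤ ENNReal.ofReal (‖Ψ‖ * (sobN 0 a * sobN 0 b)) + ENNReal.ofReal (‖Ψ‖ * (sobN 1 a * sobN 0 b)) + ENNReal.ofReal (‖Ψ‖ * (sobN 2 a * sobN 0 b)) := by
  have hΦ := contDiff_potential ha hb Ψ
  have hΦ' : ContDiff ℝ 1 (fderiv ℝ (potential a b Ψ)) := hΦ.fderiv_right (by norm_num)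
  have hg : ∀ x e, inner ℝ (gradient (potential a b Ψ) x) e = fderiv ℝ (potential a b Ψ) x e := fun x e =>
    inner_gradient (differentiable_potential ha hb Ψ x) e
  have hG : HasWeakGradient (potential a b Ψ) (gradient (potential a b Ψ)) := fun e => by
    simp only [hg]; exact isWeakDerivAlong_of_contDiff (hΦ.of_le (by norm_num)) e
  have hJ : HasWeakJacobian (gradient (potential a b Ψ)) (fderiv ℝ (fderiv ℝ (potential a b Ψ))) := fun e e' => by
    simp only [hg, fderiv_fderiv_apply (hΦ'.differentiable (by simp))]
    exact isWeakDerivAlong_of_contDiff (hΦ'.clm_apply contDiff_const) e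
  have e1 : eLpNorm (potential a b Ψ) ∞ volume ≤ ENNReal.ofReal (‖Ψ‖ * (sobN 0 a * sobN 0 b)) :=
    eLpNorm_top_le fun x => (Real.norm_eq_abs _).trans_le (abs_potential_le ha hb Ψ x)
  have e2 : eLpNorm (gradient (potential a b Ψ)) ∞ volume ≤ ENNReal.ofReal (‖Ψ‖ * (sobN 1 a * sobN 0 b)) := eLpNorm_top_le fun x => by
      have := norm_force_le ha hb Ψ x
      rwa [force, norm_neg] at this
  have e3 : eLpNorm (fderiv ℝ (fderiv ℝ (potential a b Ψ))) ∞ volume ≤ ENNReal.ofReal (‖Ψ‖ * (sobN 2 a * sobN 0 b)) :=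
    eLpNorm_top_le fun x => norm_fderiv_fderiv_potential_le ha hb Ψ x
  exact (w2infNorm_le hG hJ).trans (add_le_add (add_le_add e1 e2) e3)

theorem potential_sub (Ψ Ψ' : WaveField d n) (x : Rd d) : potential a b (Ψ - Ψ') x = potential a b Ψ x - potential a b Ψ' x := by
  simp only [potential_eq_inner ha hb, inner_sub_left]

theorem potential_add (Ψ Ψ' : WaveField d n) (x : Rd d) : potential a b (Ψ + Ψ') x = potential a b Ψ x + potential a b Ψ' x := by
  simp only [potential_eq_inner ha hb, inner_add_left]

end

end

theorem timeDeriv_eq {Φ : ℝ → Rd d → ℝ} {t : ℝ} (ht : 0 ≤ t) {x : Rd d} {y : ℝ} (h : HasDerivAt (fun s => Φ s x) y t) : timeDeriv Φ t x = y :=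
  h.hasDerivWithinAt.derivWithin (uniqueDiffOn_Ici 0 t ht)

theorem isRegularPotential_potential (ha : IsTest a) (hb : IsTest b) {Ψ : ℝ → WaveField d n} (hΨ : Continuous Ψ) {D : ℝ → Rd d → ℝ}
    (hD : ∀ t x, HasDerivAt (fun s => potential a b (Ψ s) x) (D t x) t) {E : Type*} [NormedAddCommGroup E] {u : ℝ → E} (hu : Continuous u)
    (hDu : ∀ s t x, |D s x - D t x| ≤ ‖u s - u t‖) : IsRegularPotential fun t => potential a b (Ψ t) := by
  have ht' : ∀ t, 0 ≤ t → ∀ x, timeDeriv (fun t => potential a b (Ψ t)) t x = D t x := fun t ht x => timeDeriv_eq ht (hD t x)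
  refine ⟨fun t _ => (differentiable_potential ha hb _).continuous, fun t _ => (w2infNorm_potential_le ha hb _).trans_lt (by
    simp only [ENNReal.add_lt_top, ENNReal.ofReal_lt_top, and_self]),
    fun t _ => ?_, fun t ht => ?_, fun t ht => ?_⟩
  · have h := ((tendsto_ofReal_norm_sub_mul hΨ (sobN 0 a * sobN 0 b) t).add (tendsto_ofReal_norm_sub_mul hΨ (sobN 1 a * sobN 0 b) t)).add (tendsto_ofReal_norm_sub_mul hΨ (sobN 2 a * sobN 0 b) t)
    simp only [add_zero] at h
    refine tendsto_of_tendsto_of_tendsto_of_le_of_le tendsto_const_nhds (h.mono_left nhdsWithin_le_nhds) (fun _ => zero_le) fun s => ?_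
    simp only [← potential_sub ha hb]
    exact w2infNorm_potential_le ha hb _
  · rw [ENNReal.tendsto_nhds_zero]
    intro ε hε
    obtain ⟨r, hr, hrε⟩ : ∃ r : ℝ, 0 < r ∧ ENNReal.ofReal r ≤ ε := by
      rcases eq_or_ne ε ∞ with rfl | h
      · exact ⟨1, one_pos, le_top⟩
      · exact ⟨ε.toReal, ENNReal.toReal_pos hε.ne' h, ENNReal.ofReal_toReal_le⟩
    obtain ⟨δ, hδ, hball⟩ := Metric.tendsto_nhds_nhds.1 (hu.tendsto t) r hr
    filter_upwards [mem_nhdsWithin_of_mem_nhds (ball_mem_nhds t hδ), self_mem_nhdsWithin] with s hs hs'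
    refine (eLpNorm_top_le (C := r) fun x => ?_).trans hrε
    rw [ht' t ht, Real.norm_eq_abs]
    have hst : s - t ≠ 0 := sub_ne_zero.2 hs'.2
    have hm : ∀ p ∈ ball t δ, HasDerivWithinAt (fun s => potential a b (Ψ s) x - s * D t x) (D p x - D t x) (ball t δ) p :=
      fun p _ => ((hD p x).sub (by simpa using (hasDerivAt_id p).mul_const (D t x))).hasDerivWithinAt
    have := (convex_ball t δ).norm_image_sub_le_of_norm_hasDerivWithin_le (C := r) hm
      (fun p hp => (hDu p t x).trans (by have := hball hp; rw [dist_eq_norm] at this; exact this.le)) (mem_ball_self hδ) hs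
    rw [show (s - t)⁻¹ * (potential a b (Ψ s) x - potential a b (Ψ t) x) - D t x
      = (s - t)⁻¹ * (potential a b (Ψ s) x - s * D t x - (potential a b (Ψ t) x - t * D t x)) by field_simp; ring, abs_mul, abs_inv]
    rw [Real.norm_eq_abs, Real.norm_eq_abs] at this
    rw [inv_mul_le_iff₀ (abs_pos.2 hst)]
    linarith
  · have h := tendsto_ofReal_norm_sub_mul hu 1 t
    refine tendsto_of_tendsto_of_tendsto_of_le_of_le' tendsto_const_nhds (h.mono_left nhdsWithin_le_nhds) (.of_forall fun _ => zero_le) ?_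
    filter_upwards [self_mem_nhdsWithin] with s hs
    refine eLpNorm_top_le fun x => ?_
    rw [ht' t ht, ht' s hs, Real.norm_eq_abs, mul_one]
    exact hDu s t x

theorem re_inner_fourierField (y : Spec d n) (e : WaveField d n) : (inner ℂ y (fourierField e)).re = inner ℝ (reField y) e := by
  rw [inner_fourierField_right]; simp

set_option maxHeartbeats 1000000 in
theorem exists_hasDerivAt_potential (ha : IsTest a) (hb : IsTest b) (c : ℝ) (Ψ₀ Ψ₁ : WaveField d n) {g : ℝ → WaveField d n} (hg : Continuous g) :
    ∃ (D : ℝ → Rd d → ℝ) (u : ℝ → Spec d n × Spec d n), Continuous u ∧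
      (∀ t x, HasDerivAt (fun s => potential a b (waveSol c Ψ₀ Ψ₁ g s) x) (D t x) t) ∧ ∀ s t x, |D s x - D t x| ≤ ‖u s - u t‖ := by
  have hω : Measurable (freq c : Freq d n → ℝ) := (continuous_freq c).measurable
  have hgU : Continuous fun s => fourierField (g s) := fourierField.continuous.comp hg
  have hs := isMultiplier_sinM hω
  have hc := isMultiplier_cosM hω
  set lb : Rd n → ℝ := fun y => ∑ i, fderiv ℝ (fun p => fderiv ℝ b p (EuclideanSpace.basisFun (Fin n) ℝ i)) y (EuclideanSpace.basisFun (Fin n) ℝ i)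
  have hlb : IsTest lb := IsTest.sum fun i => (hb.fderiv_apply _).fderiv_apply _
  have hlap : ∀ x, lapSnd (fun q : Rd d × Rd n => a (x - q.1) * b q.2) = fun q => a (x - q.1) * lb q.2 := fun x => by
    funext q
    simp only [lapSnd, dirSnd, fderiv_elem_snd ha hb, lb, Finset.mul_sum]
    exact Finset.sum_congr rfl fun i _ => fderiv_elem_snd ha (hb.fderiv_apply _) x q _
  set h : Rd d → Spec d n := fun x => fourierField (elem ha hb x)
  set q : Rd d → Spec d n := fun x => -(c ^ 2) • fourierField (elem ha hlb x)
  have hq : ∀ x, q x =ᵐ[volume] fun ζ => freq c ζ ^ 2 • h x ζ := fun x => by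
    have := (ha.prod_sub hb x).fourierField_lapSnd c
    rwa [show (ha.prod_sub hb x).lapSnd.wave = elem ha hlb x from IsTest.wave_congr _ (ha.prod_sub hlb x) (hlap x)] at this
  set A := duA (freq c) (fourierField Ψ₀) fun s => fourierField (g s)
  set B := duB (freq c) (fourierField Ψ₁) fun s => fourierField (g s)
  set S : ℝ → Spec d n := fun t => mult (sinM (freq c) t) (A t)
  set C : ℝ → Spec d n := fun t => mult (cosM (freq c) t) (B t)
  set K : ℝ := |c ^ 2| * (sobN 0 a * sobN 0 lb) + sobN 0 a * sobN 0 b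
  have hK : 0 ≤ K := by have := sobN_nonneg 0 a; have := sobN_nonneg 0 b; have := sobN_nonneg 0 lb; positivity
  refine ⟨fun t x => (-inner ℂ (S t) (q x) + inner ℂ (C t) (h x) : ℂ).re, fun t => K • (S t, C t), ?_, fun t x => ?_, fun s t x => ?_⟩
  · exact ((hs.continuous_mult (continuous_duA hω _ hgU)).prodMk (hc.continuous_mult (continuous_duB hω _ hgU))).const_smul K
  · have h1 := Complex.reCLM.hasFDerivAt.comp_hasDerivAt t (hasDerivAt_inner_duY hω (fourierField Ψ₀) (fourierField Ψ₁) hgU (hq x) t)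
    rw [← inner_mult (hs.memLp t _) (hs.memLp t _), ← inner_mult (hc.memLp t _) (hc.memLp t _)] at h1
    refine h1.congr_of_eventuallyEq (.of_forall fun s => ?_)
    simp only [Function.comp_apply, h]
    rw [potential_eq_inner ha hb]
    exact (re_inner_fourierField _ _).symm
  · have nq : ‖q x‖ = |c ^ 2| * (sobN 0 a * sobN 0 lb) := by
      simp only [q]; rw [norm_smul, LinearIsometry.norm_map, norm_elem, Real.norm_eq_abs, abs_neg]
    have nh : ‖h x‖ = sobN 0 a * sobN 0 b := by simp only [h]; rw [LinearIsometry.norm_map, norm_elem]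
    rw [← smul_sub, norm_smul, Real.norm_eq_abs, abs_of_nonneg hK, mul_comm]
    have := abs_re_inner_sub_le (S s) (S t) (C s) (C t) (q x) (h x)
    rwa [nq, nh] at this

end WeakDerivatives

section Tensor

variable {d n m : ℕ}

variable {a : Rd d → ℝ} {b : Rd n → ℝ}

abbrev L2C (m : ℕ) := Lp ℂ 2 (volume : Measure (Rd m))

section
variable (α : L2C d) (κ : L2C n)
include α κ

theorem memLp_tensor : MemLp (fun ζ : Freq d n => α ζ.ofLp.1 * κ ζ.ofLp.2) 2 volume := by
  have h : MemLp (fun q : Rd d × Rd n => α q.1 * κ q.2) 2 volume :=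
    (memLp_mul_prod (Lp.memLp α).norm (Lp.memLp κ).norm).of_le ((Lp.aestronglyMeasurable α).comp_fst.mul (Lp.aestronglyMeasurable κ).comp_snd)
      (ae_of_all _ fun q => by simp)
  exact h.comp_measurePreserving measurePreserving_ofLp

def tensor : Spec d n := (memLp_tensor α κ).toLp _

theorem tensor_ae : tensor α κ =ᵐ[volume] fun ζ => α ζ.ofLp.1 * κ ζ.ofLp.2 := MemLp.coeFn_toLp _

end

theorem ae_fst {p : Rd d → Prop} (h : ∀ᵐ x, p x) : ∀ᵐ ζ : Freq d n, p ζ.ofLp.1 :=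
  (Measure.quasiMeasurePreserving_fst.comp measurePreserving_ofLp.quasiMeasurePreserving).ae h

theorem ae_snd {p : Rd n → Prop} (h : ∀ᵐ y, p y) : ∀ᵐ ζ : Freq d n, p ζ.ofLp.2 :=
  (Measure.quasiMeasurePreserving_snd.comp measurePreserving_ofLp.quasiMeasurePreserving).ae h

theorem inner_tensor (α α' : L2C d) (κ κ' : L2C n) : inner ℂ (tensor α κ) (tensor α' κ') = inner ℂ α α' * inner ℂ κ κ' := by
  rw [L2.inner_def, L2.inner_def, L2.inner_def, ← integral_prod_mul (μ := volume) (ν := volume), ← Measure.volume_eq_prod, ← integral_freq]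
  refine integral_congr_ae ?_
  filter_upwards [tensor_ae α κ, tensor_ae α' κ'] with ζ h1 h2
  rw [h1, h2]
  simp only [RCLike.inner_apply, map_mul]
  ring

def tensorL (α : L2C d) : L2C n →L[ℂ] Spec d n := LinearMap.mkContinuous
    { toFun := tensor α
      map_add' := fun κ κ' => Lp.ext (by
        filter_upwards [tensor_ae α κ, tensor_ae α κ', tensor_ae α (κ + κ'), Lp.coeFn_add (tensor α κ) (tensor α κ'),
          ae_snd (Lp.coeFn_add κ κ')] with ζ h1 h2 h3 h4 h5
        rw [h3, h4, Pi.add_apply, h1, h2, h5, Pi.add_apply, mul_add])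
      map_smul' := fun z κ => Lp.ext (by
        filter_upwards [tensor_ae α κ, tensor_ae α (z • κ), Lp.coeFn_smul z (tensor α κ), ae_snd (Lp.coeFn_smul z κ)] with ζ h1 h2 h3 h4
        rw [RingHom.id_apply, h2, h3, Pi.smul_apply, h1, h4, Pi.smul_apply, smul_eq_mul, smul_eq_mul]
        ring) }
    ‖α‖ fun κ => by
      have h : ‖tensor α κ‖ ^ 2 = (‖α‖ * ‖κ‖) ^ 2 := by
        have := inner_tensor α α κ κ
        rw [inner_self_eq_norm_sq_to_K, inner_self_eq_norm_sq_to_K, inner_self_eq_norm_sq_to_K] at this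
        rw [mul_pow]
        exact_mod_cast this
      exact ((sq_eq_sq₀ (norm_nonneg _) (by positivity)).1 h).le

theorem ext_of_test {H : Type*} [NormedAddCommGroup H] [InnerProductSpace ℂ H] [CompleteSpace H] {S T : L2C m →L[ℂ] H}
    (h : ∀ (b : Rd m → ℝ) (hb : MemLp (fun y => ((b y : ℝ) : ℂ)) 2 volume), IsTest b → S (hb.toLp _) = T (hb.toLp _)) : S = T := by
  have key : ∀ y : H, ContinuousLinearMap.adjoint (S - T) y = 0 := fun y => by
    set w := ContinuousLinearMap.adjoint (S - T) y
    have hw : ∀ᵐ x, (starRingEnd ℂ) (w x) = 0 := by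
      refine ae_eq_zero_of_integral_contDiff_smul_eq_zero ?_ fun b hb hbc => ?_
      · exact (((Lp.memLp w).star).locallyIntegrable (by norm_num))
      · have hbt : IsTest b := ⟨hb, hbc⟩
        have hm : MemLp (fun y => ((b y : ℝ) : ℂ)) 2 volume := hbt.memLp.ofReal
        have h1 : inner ℂ w (hm.toLp _) = 0 := by
          rw [ContinuousLinearMap.adjoint_inner_left, ContinuousLinearMap.sub_apply, h b hm hbt, sub_self, inner_zero_right]
        rw [L2.inner_def] at h1
        rw [← h1]
        refine integral_congr_ae ?_
        filter_upwards [hm.coeFn_toLp] with x hx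
        rw [hx, RCLike.inner_apply, Complex.real_smul]
    refine Lp.ext ?_
    filter_upwards [hw, Lp.coeFn_zero ℂ 2 (volume : Measure (Rd m))] with x h1 h2
    rw [h2, Pi.zero_apply]
    simpa using h1
  refine sub_eq_zero.1 (ContinuousLinearMap.ext fun κ => ?_)
  have := ContinuousLinearMap.adjoint_inner_left (S - T) κ ((S - T) κ)
  rw [key, inner_zero_left] at this
  exact inner_self_eq_zero.1 this.symm

def IsTest.cplx {a : Rd m → ℝ} (ha : IsTest a) : L2C m := (ha.memLp (p := 2)).ofReal.toLp fun x => ((a x : ℝ) : ℂ)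

theorem IsTest.cplx_ae {a : Rd m → ℝ} (ha : IsTest a) : ha.cplx =ᵐ[volume] fun x => ((a x : ℝ) : ℂ) := MemLp.coeFn_toLp _

theorem IsTest.fourier_cplx_ae {a : Rd m → ℝ} (ha : IsTest a) : (𝓕 ha.cplx : L2C m) =ᵐ[volume] fourierForm a := by
  let S : 𝓢(Rd m, ℂ) := HasCompactSupport.toSchwartzMap (f := fun x : Rd m => ((a x : ℝ) : ℂ))
    (ha.2.comp_left (g := fun r : ℝ => (r : ℂ)) (by simp)) (Complex.ofRealCLM.contDiff.comp ha.1)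
  have h1 : ha.cplx = S.toLp 2 := Lp.ext (by
    filter_upwards [ha.cplx_ae, S.coeFn_toLp 2 volume] with x e1 e2
    rw [e1, e2]; rfl)
  rw [h1, SchwartzMap.toLp_fourier_eq]
  filter_upwards [(𝓕 S).coeFn_toLp 2 volume] with x hx
  rw [hx, SchwartzMap.fourier_coe]
  rfl

theorem fourier_tensor_test (ha : IsTest a) (hb : IsTest b) (hab : IsTest fun q : Rd d × Rd n => a q.1 * b q.2) :
    (𝓕 (tensor ha.cplx hb.cplx) : Spec d n) = tensor (𝓕 ha.cplx) (𝓕 hb.cplx) := by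
  have h1 : tensor ha.cplx hb.cplx = complexify hab.wave := Lp.ext (by
    filter_upwards [tensor_ae ha.cplx hb.cplx, complexify_ae hab.wave, measurePreserving_ofLp.quasiMeasurePreserving.ae hab.wave_ae,
      ae_fst ha.cplx_ae, ae_snd hb.cplx_ae] with ζ e1 e2 e3 e4 e5
    rw [e1, e2, e3, e4, e5]
    push_cast; rfl)
  rw [h1, ← fourierField_apply]
  refine Lp.ext ?_
  filter_upwards [hab.fourierField_wave_ae, tensor_ae (𝓕 ha.cplx) (𝓕 hb.cplx), ae_fst ha.fourier_cplx_ae, ae_snd hb.fourier_cplx_ae]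
    with ζ e1 e2 e3 e4
  rw [e1, e2, e3, e4, SchwartzMap.fourier_coe, fourierForm, fourierForm, Real.fourier_eq, Real.fourier_eq, Real.fourier_eq,
    ← integral_prod_mul (μ := volume) (ν := volume), ← Measure.volume_eq_prod, ← integral_freq]
  refine integral_ext fun v => ?_
  simp only [IsTest.schwartz_apply, Circle.smul_def, smul_eq_mul]
  rw [WithLp.prod_inner_apply, neg_add, AddChar.map_add_eq_mul, Circle.coe_mul]
  push_cast
  ring

theorem IsTest.prod_mul (ha : IsTest a) (hb : IsTest b) : IsTest fun q : Rd d × Rd n => a q.1 * b q.2 := by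
  have h0 : IsTest fun x => a (0 - x) := ha.comp_sub_left 0
  simpa using h0.prod_sub hb 0

theorem fourier_tensor (ha : IsTest a) (κ : L2C n) : (𝓕 (tensor ha.cplx κ) : Spec d n) = tensor (𝓕 ha.cplx) (𝓕 κ) := by
  have h := ext_of_test (S := (Lp.fourierTransformₗᵢ (Freq d n) ℂ).toContinuousLinearEquiv.toContinuousLinearMap ∘L tensorL ha.cplx)
    (T := tensorL (𝓕 ha.cplx) ∘L (Lp.fourierTransformₗᵢ (Rd n) ℂ).toContinuousLinearEquiv.toContinuousLinearMap)
    fun b hb hbt => fourier_tensor_test ha hbt (ha.prod_mul hbt)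
  exact congrArg (fun L : L2C n →L[ℂ] Spec d n => L κ) h

theorem mult_tensor {μ : Rd n → ℝ} (hμ : Measurable μ) {K : ℝ} (hK : ∀ y, |μ y| ≤ K) (α : L2C d) (κ : L2C n) :
    mult (fun ζ : Freq d n => μ ζ.ofLp.2) (tensor α κ) = tensor α (mult μ κ) := by
  have hm : Measurable fun ζ : Freq d n => μ ζ.ofLp.2 := hμ.comp (measurable_snd.comp measurePreserving_ofLp.measurable)
  refine Lp.ext ?_
  filter_upwards [mult_ae_of_bound hm (fun ζ => hK _) (tensor α κ), tensor_ae α κ, tensor_ae α (mult μ κ),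
    ae_snd (mult_ae_of_bound hμ hK κ)] with ζ h1 h2 h3 h4
  rw [h1, h2, h3, h4, Complex.real_smul, Complex.real_smul]
  ring

theorem fourierField_elem (ha : IsTest a) (hb : IsTest b) (x : Rd d) :
    fourierField (elem ha hb x) = tensor (𝓕 (ha.comp_sub_left x).cplx) (𝓕 hb.cplx) := by
  rw [← fourier_tensor, fourierField_apply]
  congr 1
  refine Lp.ext ?_
  filter_upwards [tensor_ae (ha.comp_sub_left x).cplx hb.cplx, complexify_ae (elem ha hb x),
    measurePreserving_ofLp.quasiMeasurePreserving.ae (elem_ae ha hb x), ae_fst (ha.comp_sub_left x).cplx_ae, ae_snd hb.cplx_ae]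
    with ζ e1 e2 e3 e4 e5
  rw [e1, e2, e3, e4, e5]
  push_cast; rfl

end Tensor

section Formulas

variable {d n : ℕ} {a : Rd d → ℝ} {b : Rd n → ℝ}

variable {c : ℝ}

theorem conj_fourierForm (hb : ∀ y, b (-y) = b y) (η : Rd n) : (starRingEnd ℂ) (fourierForm b η) = fourierForm b η := by
  rw [fourierForm, Real.fourier_eq, ← integral_conj, ← integral_neg_eq_self]
  refine integral_ext fun v => ?_
  simp only [Circle.smul_def, smul_eq_mul, map_mul, inner_neg_left, neg_neg, hb, Complex.conj_ofReal]
  rw [← Circle.coe_inv_eq_conj, ← AddChar.map_neg_eq_inv] <;> rfl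

theorem selfConv_eq (ha : ∀ y, a (-y) = a y) (x z : Rd d) : ∫ y, a (z - y) * a (x - y) = selfConv a (x - z) := by
  rw [selfConv, ← integral_sub_right_eq_self (fun w => a (x - z - w) * a w) z]
  refine integral_ext fun y => ?_
  rw [sub_sub_sub_cancel_right, ← ha (y - z), neg_sub, mul_comm]

theorem sinM_freq_eq (c t : ℝ) : (sinM (freq c) t : Freq d n → ℝ) = fun ζ => sinM (fun η : Rd n => 2 * Real.pi * c * ‖η‖) t ζ.ofLp.2 := rfl

theorem ae_sinM_eq (hn : 1 ≤ n) (hc : c ≠ 0) (t : ℝ) : ∀ᵐ η : Rd n, sinM (fun η : Rd n => 2 * Real.pi * c * ‖η‖) t η = sinMultiplier c t η := by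
  have : Nonempty (Fin n) := ⟨⟨0, hn⟩⟩
  filter_upwards [Measure.ae_ne volume (0 : Rd n)] with η hη
  have h0 : 2 * Real.pi * c * ‖η‖ ≠ 0 := mul_ne_zero (mul_ne_zero (by positivity) hc) (norm_ne_zero_iff.2 hη)
  rw [sinMultiplier, eq_div_iff h0, mul_comm]
  exact mul_sinM (fun η : Rd n => 2 * Real.pi * c * ‖η‖) t η

theorem measurable_abs (c : ℝ) : Measurable fun η : Rd n => 2 * Real.pi * c * ‖η‖ := measurable_norm.const_mul _

theorem inner_sinM_elem (hn : 1 ≤ n) (hc : c ≠ 0) (ha : IsTest a) (hb : IsTest b) (ha' : ∀ y, a (-y) = a y) (t : ℝ) (x z : Rd d) :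
    inner ℂ (mult (sinM (freq c) t) (fourierField (elem ha hb z))) (fourierField (elem ha hb x))
      = ((memoryKernel c b t * selfConv a (x - z) : ℝ) : ℂ) := by
  rw [fourierField_elem, fourierField_elem, sinM_freq_eq, mult_tensor ((isMultiplier_sinM (measurable_abs c)).measurable t)
    (fun η => abs_sinM_le _ t η), inner_tensor, Lp.inner_fourier_eq, mul_comm, Complex.ofReal_mul]
  congr 1
  · rw [memoryKernel, L2.inner_def, ← integral_complex_ofReal]
    refine integral_congr_ae ?_
    filter_upwards [(isMultiplier_sinM (measurable_abs c)).ae t (𝓕 hb.cplx : L2C n), hb.fourier_cplx_ae, ae_sinM_eq hn hc t] with η h1 h2 h3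
    rw [h1, h2, h3, RCLike.inner_apply, Complex.real_smul, map_mul, Complex.conj_ofReal]
    push_cast
    rw [mul_left_comm, Complex.mul_conj, Complex.normSq_eq_norm_sq]
    push_cast; rfl
  · rw [← selfConv_eq ha', L2.inner_def, ← integral_complex_ofReal]
    refine integral_congr_ae ?_
    filter_upwards [(ha.comp_sub_left x).cplx_ae, (ha.comp_sub_left z).cplx_ae] with y h1 h2
    rw [h1, h2, RCLike.inner_apply, Complex.conj_ofReal]
    push_cast
    ring

theorem memLp_fourierSnd (Ψ : WaveField d n) (z : Rd d) : MemLp (fourierSnd Ψ z) 2 volume := by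
  rw [fourierSnd]
  split_ifs with h
  · exact Lp.memLp _
  · exact MemLp.zero

theorem ae_memLp_slice (Ψ : WaveField d n) : ∀ᵐ z : Rd d, MemLp (fun y => ((Ψ (z, y) : ℝ) : ℂ)) 2 (volume : Measure (Rd n)) := by
  have h1 : AEStronglyMeasurable Ψ ((volume : Measure (Rd d)).prod (volume : Measure (Rd n))) := Lp.aestronglyMeasurable Ψ
  have h2 : Integrable (fun q => Ψ q ^ 2) ((volume : Measure (Rd d)).prod (volume : Measure (Rd n))) := (Lp.memLp Ψ).integrable_sq
  filter_upwards [h1.prodMk_left, h2.prod_right_ae] with z e1 e2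
  exact ((memLp_two_iff_integrable_sq e1).2 e2).ofReal

theorem re_inner_mult_elem (ha : IsTest a) (hb : IsTest b) (hb' : ∀ y, b (-y) = b y) {μ : Rd n → ℝ} (hμ : Measurable μ) {K : ℝ} (hK : ∀ y, |μ y| ≤ K)
    (Ψ : WaveField d n) (x : Rd d) : (∀ z, Integrable fun η => fourierSnd Ψ z η * μ η * fourierForm b η) ∧
      Integrable (fun z => (a (x - z) : ℂ) * ∫ η, fourierSnd Ψ z η * μ η * fourierForm b η) ∧
      (inner ℂ (fourierField Ψ) (mult (fun ζ : Freq d n => μ ζ.ofLp.2) (fourierField (elem ha hb x)))).re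
        = (∫ z, (a (x - z) : ℂ) * ∫ η, fourierSnd Ψ z η * μ η * fourierForm b η).re := by
  set κ : L2C n := 𝓕⁻ (mult μ (𝓕 hb.cplx : L2C n))
  have hκ : (𝓕 κ : L2C n) = mult μ (𝓕 hb.cplx : L2C n) := FourierInvPair.fourier_fourierInv_eq _
  have hκae : (𝓕 κ : L2C n) =ᵐ[volume] fun η => μ η * fourierForm b η := by
    rw [hκ]
    filter_upwards [mult_ae_of_bound hμ hK (𝓕 hb.cplx : L2C n), hb.fourier_cplx_ae] with η h1 h2
    rw [h1, h2, Complex.real_smul]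
  have hint : ∀ z, Integrable fun η => fourierSnd Ψ z η * μ η * fourierForm b η := fun z => by
    have h := (memLp_fourierSnd Ψ z).integrable_mul (Lp.memLp (𝓕 κ : L2C n))
    refine h.congr ?_
    filter_upwards [hκae] with η h1
    rw [Pi.mul_apply, h1, mul_assoc]
  have e1 : inner ℂ (fourierField Ψ) (mult (fun ζ : Freq d n => μ ζ.ofLp.2) (fourierField (elem ha hb x)))
      = ∫ q : Rd d × Rd n, (Ψ q : ℂ) * (a (x - q.1) * κ q.2) := by
    rw [fourierField_elem, mult_tensor hμ hK, ← hκ, ← fourier_tensor, fourierField_apply, Lp.inner_fourier_eq, L2.inner_def, ← integral_freq]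
    refine integral_congr_ae ?_
    filter_upwards [complexify_ae Ψ, tensor_ae (ha.comp_sub_left x).cplx κ, ae_fst (ha.comp_sub_left x).cplx_ae] with ζ h1 h2 h3
    rw [h1, h2, h3, RCLike.inner_apply, Complex.conj_ofReal, mul_comm]
  have hi : Integrable fun q : Rd d × Rd n => (Ψ q : ℂ) * (a (x - q.1) * κ q.2) := by
    have hm : MemLp (fun q : Rd d × Rd n => (a (x - q.1) : ℂ) * κ q.2) 2 volume :=
      (memLp_mul_prod (ha.comp_sub_left x).memLp.norm (Lp.memLp κ).norm).of_le
        ((Complex.continuous_ofReal.comp (ha.comp_sub_left x).1.continuous).aestronglyMeasurable.comp_fst.mul (Lp.aestronglyMeasurable κ).comp_snd)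
        (ae_of_all _ fun q => by simp)
    exact (Lp.memLp Ψ).ofReal.integrable_mul hm
  have e2 : ∀ᵐ z : Rd d, ∫ y, (Ψ (z, y) : ℂ) * (a (x - z) * κ y)
      = (starRingEnd ℂ) ((a (x - z) : ℂ) * ∫ η, fourierSnd Ψ z η * μ η * fourierForm b η) := by
    filter_upwards [ae_memLp_slice Ψ] with z hz
    have h1 : inner ℂ (hz.toLp _) κ = ∫ y, (Ψ (z, y) : ℂ) * κ y := by
      rw [L2.inner_def]
      refine integral_congr_ae ?_
      filter_upwards [hz.coeFn_toLp] with y hy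
      rw [hy, RCLike.inner_apply, Complex.conj_ofReal, mul_comm]
    have h2 : fourierSnd Ψ z = (𝓕 (hz.toLp _) : L2C n) := by rw [fourierSnd, dif_pos hz]
    have h3 : inner ℂ (𝓕 (hz.toLp _) : L2C n) (𝓕 κ : L2C n) = (starRingEnd ℂ) (∫ η, fourierSnd Ψ z η * μ η * fourierForm b η) := by
      rw [← integral_conj, L2.inner_def]
      refine integral_congr_ae ?_
      filter_upwards [hκae] with η h4
      rw [h4, h2, RCLike.inner_apply, map_mul, map_mul, Complex.conj_ofReal, conj_fourierForm hb']
      ring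
    rw [map_mul, Complex.conj_ofReal, ← h3, Lp.inner_fourier_eq, h1, ← integral_const_mul]
    exact integral_ext fun y => by ring
  obtain ⟨i1, i2⟩ := integral_prod_volume hi
  have i3 := i1.congr e2
  refine ⟨hint, ?_, ?_⟩
  · have := (Complex.conjCLE : ℂ ≃L[ℝ] ℂ).toContinuousLinearMap.integrable_comp i3
    exact this.congr (ae_of_all _ fun z => Complex.conj_conj _)
  · rw [e1, ← i2, integral_congr_ae e2, integral_conj, Complex.conj_re]

theorem freePotential_eq (hn : 1 ≤ n) (hc : c ≠ 0) (ha : IsTest a) (hb : IsTest b) (hb' : ∀ y, b (-y) = b y) (Ψ₀ Ψ₁ : WaveField d n) (t : ℝ)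
    (x : Rd d) : freePotential c a b Ψ₀ Ψ₁ t x = potential a b (waveSol c Ψ₀ Ψ₁ (fun _ => 0) t) x := by
  have hω : Measurable (freq c : Freq d n → ℝ) := (continuous_freq c).measurable
  have hm := measurable_abs (n := n) c
  obtain ⟨c1, c2, c3⟩ := re_inner_mult_elem ha hb hb' ((isMultiplier_cosM hm).measurable t) (fun η => abs_cosM_le _ t η) Ψ₀ x
  obtain ⟨s1, s2, s3⟩ := re_inner_mult_elem ha hb hb' ((isMultiplier_sinM hm).measurable t) (fun η => abs_sinM_le _ t η) Ψ₁ x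
  have h0 : ∀ m : ℝ → Freq d n → ℝ, IsMultiplier m → ∫ s in 0..t, mult (m s) (fourierField (0 : WaveField d n)) = 0 := fun m hm => by
    have : ∀ s, mult (m s) (fourierField (0 : WaveField d n)) = 0 := fun s => by
      obtain ⟨K, -, hK⟩ := hm.exists_bound s
      rw [map_zero]
      exact map_zero (multL (m s) (hm.measurable s) K hK)
    simp only [this, intervalIntegral.integral_zero]
  rw [potential_eq_inner ha hb, waveSol, ← re_inner_fourierField, inner_duY hω, duA, duB, h0 _ (isMultiplier_sinM hω), h0 _ (isMultiplier_cosM hω),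
    add_zero, sub_zero, Complex.add_re]
  refine Eq.trans ?_ (congrArg₂ (· + ·) c3 s3).symm
  rw [← Complex.add_re, ← integral_add c2 s2, freePotential]
  congr 1
  refine integral_ext fun z => ?_
  rw [← mul_add, ← integral_add (c1 z) (s1 z)]
  congr 1
  refine integral_congr_ae ?_
  filter_upwards [ae_sinM_eq hn hc t] with η hη
  rw [hη, add_mul]
  rfl

theorem sinM_sub {X : Type*} [MeasurableSpace X] (ω : X → ℝ) (t s : ℝ) (x : X) :
    cosM ω t x * sinM ω s x - sinM ω t x * cosM ω s x = -sinM ω (t - s) x := by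
  by_cases h : ω x = 0
  · simp [sinM, cosM, h]
  · refine mul_left_cancel₀ h ?_
    have e := fun r => mul_sinM ω r x
    rw [mul_sub, mul_neg, e, mul_left_comm, e, ← mul_assoc, e, sinwM, sinwM, sinwM, mul_sub, Real.sin_sub, cosM, cosM]
    ring

theorem duY_zero_eq {X : Type*} [MeasurableSpace X] {ν : Measure X} {ω : X → ℝ} (hω : Measurable ω) {g : ℝ → Lp ℂ 2 ν} (hg : Continuous g) (t : ℝ) :
    duY ω 0 0 g t = -∫ s in 0..t, mult (sinM ω (t - s)) (g s) := by
  have hs := isMultiplier_sinM hω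
  have hc := isMultiplier_cosM hω
  obtain ⟨Kc, -, hKc⟩ := hc.exists_bound t
  obtain ⟨Ks, -, hKs⟩ := hs.exists_bound t
  have e1 := (multL (μ := ν) (cosM ω t) (hc.measurable t) Kc hKc).intervalIntegral_comp_comm ((hs.continuous_mult hg).intervalIntegrable (μ := volume) 0 t)
  have e2 := (multL (μ := ν) (sinM ω t) (hs.measurable t) Ks hKs).intervalIntegral_comp_comm ((hc.continuous_mult hg).intervalIntegrable (μ := volume) 0 t)
  simp only [multL_apply] at e1 e2
  have i1 : Continuous fun s => mult (cosM ω t) (mult (sinM ω s) (g s)) := (multL _ (hc.measurable t) Kc hKc).continuous.comp (hs.continuous_mult hg)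
  have i2 : Continuous fun s => mult (sinM ω t) (mult (cosM ω s) (g s)) := (multL _ (hs.measurable t) Ks hKs).continuous.comp (hc.continuous_mult hg)
  rw [duY, duA, duB, zero_add, zero_sub, ← neg_one_smul ℝ (∫ s in 0..t, mult (cosM ω s) (g s)), mult_smul (hs.measurable t) hKs, ← e1, ← e2,
    neg_one_smul, ← sub_eq_add_neg, ← intervalIntegral.integral_sub (i1.intervalIntegrable _ _) (i2.intervalIntegrable _ _),
    ← intervalIntegral.integral_neg]
  refine intervalIntegral.integral_congr fun s _ => Lp.ext ?_
  filter_upwards [Lp.coeFn_sub (mult (cosM ω t) (mult (sinM ω s) (g s))) (mult (sinM ω t) (mult (cosM ω s) (g s))),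
    Lp.coeFn_neg (mult (sinM ω (t - s)) (g s)), hc.ae t (mult (sinM ω s) (g s)), hs.ae t (mult (cosM ω s) (g s)), hs.ae s (g s), hc.ae s (g s),
    hs.ae (t - s) (g s)] with x h1 h2 h3 h4 h5 h6 h7
  rw [h1, h2, Pi.sub_apply, Pi.neg_apply, h3, h4, h5, h6, h7, smul_smul, smul_smul, ← sub_smul, sinM_sub, neg_smul]

theorem potential_waveSol_source (hn : 1 ≤ n) (hc : c ≠ 0) (ha : IsTest a) (hb : IsTest b) (ha' : ∀ y, a (-y) = a y) {f : ℝ → Density d}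
    (hf : Continuous f) (t : ℝ) (x : Rd d) : potential a b (waveSol c 0 0 (fun s => source ha hb (f s)) t) x
      = -∫ s in 0..t, memoryKernel c b (t - s) * ∫ z, f s z * selfConv a (x - z.1) := by
  have hω : Measurable (freq c : Freq d n → ℝ) := (continuous_freq c).measurable
  have hs := isMultiplier_sinM hω
  have hg : Continuous fun s => fourierField (source ha hb (f s)) := fourierField.continuous.comp ((continuous_source ha hb).comp hf)
  set L : Spec d n →L[ℝ] ℝ := (innerSL ℝ (elem ha hb x)).comp reField
  have hL : ∀ y, L y = (inner ℂ y (fourierField (elem ha hb x))).re := fun y => by rw [re_inner_fourierField, real_inner_comm]; rfl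
  have hc' : Continuous fun s => mult (sinM (freq c) (t - s)) (fourierField (source ha hb (f s))) := by
    have := (hs.continuous_mult (hg.comp (continuous_sub_left t))).comp (continuous_sub_left t)
    simpa only [Function.comp_def, sub_sub_cancel] using this
  rw [potential_eq_inner ha hb, real_inner_comm]
  change L (duY _ _ _ _ t) = _
  rw [map_zero, duY_zero_eq hω hg, map_neg, ← L.intervalIntegral_comp_comm (hc'.intervalIntegrable _ _)]
  congr 1
  refine intervalIntegral.integral_congr fun s _ => ?_
  obtain ⟨K, -, hK⟩ := hs.exists_bound (t - s)
  set L' : WaveField d n →L[ℝ] ℝ := L.comp ((multL _ (hs.measurable (t - s)) K hK).comp fourierField.toContinuousLinearMap)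
  change L' (source ha hb (f s)) = _
  rw [source, ← L'.integral_comp_comm (integrable_smul_elem ha hb (f s)), ← integral_const_mul]
  refine integral_ext fun z => ?_
  simp only [map_smul, smul_eq_mul]
  have : L' (elem ha hb z.1) = memoryKernel c b (t - s) * selfConv a (x - z.1) := by
    refine (hL _).trans ((congrArg Complex.re (inner_sinM_elem hn hc ha hb ha' (t - s) x z.1)).trans (Complex.ofReal_re _))
  rw [this]
  ring

end Formulas

section Duality

variable {d n : ℕ} {a : Rd d → ℝ} {b : Rd n → ℝ}

theorem exists_W1inf {g : Rd d × Rd d → ℝ} (hg : ContDiff ℝ 1 g) {C C' : ℝ} (h : ∀ z, ‖g z‖ ≤ C) (h' : ∀ z, ‖fderiv ℝ g z‖ ≤ C') :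
    ∃ w : W1inf d, (w.1.1 : Rd d × Rd d → ℝ) =ᵐ[volume] g := by
  let κ := (WithLp.prodContinuousLinearEquiv 2 ℝ (Rd d) (Rd d)).toContinuousLinearMap
  let G : Rd d × Rd d → WithLp 2 (Rd d × Rd d) := fun z => (InnerProductSpace.toDual ℝ (WithLp 2 (Rd d × Rd d))).symm ((fderiv ℝ g z).comp κ)
  have hG : Continuous G := (LinearIsometryEquiv.continuous _).comp ((hg.continuous_fderiv (by simp)).clm_comp continuous_const)
  have hGm : MemLp G ∞ volume := memLp_top_of_bound hG.aestronglyMeasurable (C' * ‖κ‖) (ae_of_all _ fun z => by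
    simp only [G, LinearIsometryEquiv.norm_map]
    exact (ContinuousLinearMap.opNorm_comp_le _ _).trans (mul_le_mul_of_nonneg_right (h' z) (norm_nonneg _)))
  have hgm : MemLp g ∞ volume := memLp_top_of_bound hg.continuous.aestronglyMeasurable C (ae_of_all _ h)
  refine ⟨⟨(hgm.toLp g, hGm.toLp G), fun e => ?_⟩, hgm.coeFn_toLp⟩
  refine (isWeakDerivAlong_of_contDiff hg e).congr hgm.coeFn_toLp.symm ?_
  filter_upwards [hGm.coeFn_toLp] with z hz
  rw [hz]
  simp only [G, InnerProductSpace.toDual_symm_apply]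
  rfl

def dualOf : Density d →L[ℝ] W1infDual d :=
  (ContinuousLinearMap.precomp ℝ ((ContinuousLinearMap.fst ℝ _ _).comp (W1inf d).subtypeL)).comp ((ContinuousLinearMap.mul ℝ ℝ).lpPairing volume 1 ∞)

theorem dualOf_apply (f : Density d) (w : W1inf d) : dualOf f w = ∫ z, f z * (w.1.1 : Rd d × Rd d → ℝ) z :=
  ContinuousLinearMap.lpPairing_eq_integral _ _ _

theorem norm_dualOf_le (f : Density d) : ‖dualOf f‖ ≤ ‖f‖ := by
  refine ContinuousLinearMap.opNorm_le_bound _ (norm_nonneg f) fun w => ?_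
  rw [dualOf_apply]
  have hw : ∀ᵐ z, ‖(w.1.1 : Rd d × Rd d → ℝ) z‖ ≤ ‖w.1.1‖ := by
    filter_upwards [ae_le_eLpNormEssSup (f := (w.1.1 : Rd d × Rd d → ℝ)) (μ := volume)] with z hz
    rw [← eLpNorm_exponent_top, ← Lp.enorm_def] at hz
    exact enorm_le_iff_norm_le.1 hz
  have hi : Integrable f volume := L1.integrable_coeFn f
  refine (norm_integral_le_of_norm_le (hi.norm.mul_const ‖w.1.1‖) (by
    filter_upwards [hw] with z hz; rw [norm_mul]; exact mul_le_mul_of_nonneg_left hz (norm_nonneg _))).trans ?_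
  rw [integral_mul_const, ← L1.norm_eq_integral_norm]
  exact mul_le_mul_of_nonneg_left ((norm_fst_le w.1).trans le_rfl) (norm_nonneg _)

theorem isTest_selfConv (ha : IsTest a) : IsTest (selfConv a) := by
  have : selfConv a = convolution a a (ContinuousLinearMap.mul ℝ ℝ) volume := by
    funext x; simp only [selfConv, convolution, ContinuousLinearMap.mul_apply', mul_comm]
  rw [this]
  exact ⟨ha.2.contDiff_convolution_left _ ha.1 ha.1.continuous.locallyIntegrable, ha.2.convolution _ ha.2⟩

theorem pairing_smul_dualOf (ha : IsTest a) (r : ℝ) (f : Density d) (x : Rd d) :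
    pairing (dualOf (r • f)) (fun z => selfConv a (x - z.1)) = r * ∫ z, f z * selfConv a (x - z.1) := by
  have hT := (isTest_selfConv ha).comp_sub_left x
  obtain ⟨C, -, hC⟩ := hT.exists_bound
  obtain ⟨C', hC'⟩ := (hT.1.continuous_fderiv (by simp)).bounded_above_of_compact_support (hT.2.fderiv ℝ)
  have hd : ∀ z : Rd d × Rd d, fderiv ℝ (fun z : Rd d × Rd d => selfConv a (x - z.1)) z
      = (fderiv ℝ (fun y => selfConv a (x - y)) z.1).comp (ContinuousLinearMap.fst ℝ _ _) := fun z =>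
    (((hT.1.differentiable (by simp) z.1).hasFDerivAt).comp z hasFDerivAt_fst).fderiv
  have h := exists_W1inf (g := fun z : Rd d × Rd d => selfConv a (x - z.1)) ((hT.1.of_le (by exact_mod_cast le_top)).comp contDiff_fst) (fun z => hC z.1) (C' := C' * 1)
    (fun z => by
      rw [hd]
      exact (ContinuousLinearMap.opNorm_comp_le _ _).trans
        (mul_le_mul (hC' z.1) (ContinuousLinearMap.norm_fst_le _ _ _) (norm_nonneg _) ((norm_nonneg _).trans (hC' z.1))))
  rw [pairing, dif_pos h, dualOf_apply, ← integral_const_mul]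
  refine integral_congr_ae ?_
  filter_upwards [h.choose_spec, Lp.coeFn_smul r f] with z hz h'
  rw [hz, h', Pi.smul_apply, smul_eq_mul, mul_assoc]

end Duality

section Radius

variable {d n : ℕ} {a : Rd d → ℝ} {b : Rd n → ℝ}

variable {Φ : ℝ → Rd d → ℝ}

theorem IsFormFunction.neg_eq {m : ℕ} {σ : Rd m → ℝ} (h : IsFormFunction σ) (y : Rd m) : σ (-y) = σ y := h.radial _ _ (norm_neg y)

theorem c1Norm_const_mul (r : ℝ) (Φ : ℝ → Rd d → ℝ) (t : ℝ) : c1Norm (fun s x => r * Φ s x) t = ‖r‖ₑ * c1Norm Φ t := by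
  have h1 : ∀ u : Rd d → ℝ, eLpNorm (fun x => r * u x) ∞ volume = ‖r‖ₑ * eLpNorm u ∞ volume := fun u => eLpNorm_const_smul r u ∞ volume
  have h2 : ∀ s, timeDeriv (fun s x => r * Φ s x) s = fun x => r * timeDeriv Φ s x := fun s => funext fun x => derivWithin_const_mul_field r
  simp only [c1Norm, h1, h2, ENNReal.mul_iSup, mul_add]

theorem measurable_of_hasDerivAt {D : ℝ → Rd d → ℝ} (hc : ∀ t, Continuous (Φ t)) (h : ∀ t x, HasDerivAt (fun s => Φ s x) (D t x) t) (t : ℝ) :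
    Measurable (D t) := by
  refine measurable_of_tendsto_metrizable (f := fun (k : ℕ) x => (1 / ((k : ℝ) + 1))⁻¹ • (Φ (t + 1 / ((k : ℝ) + 1)) x - Φ t x))
    (fun k => (((hc (t + 1 / ((k : ℝ) + 1))).sub (hc t)).const_smul ((1 / ((k : ℝ) + 1))⁻¹)).measurable) (tendsto_pi_nhds.2 fun x => ?_)
  refine (h t x).tendsto_slope_zero.comp (tendsto_nhdsWithin_iff.2 ⟨tendsto_one_div_add_atTop_nhds_zero_nat, .of_forall fun k => ?_⟩)
  exact (one_div_pos.2 (by positivity)).ne'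

theorem c1Norm_le_of_hasDerivAt {Φ₁ Φ₂ D₁ D₂ : ℝ → Rd d → ℝ} (h : ∀ t x, Φ t x = Φ₁ t x + Φ₂ t x)
    (h₁ : ∀ t x, HasDerivAt (fun s => Φ₁ s x) (D₁ t x) t) (h₂ : ∀ t x, HasDerivAt (fun s => Φ₂ s x) (D₂ t x) t) (hc : ∀ t, Continuous (Φ₁ t))
    (hc' : ∀ t, Continuous (Φ₂ t)) (t : ℝ) : c1Norm Φ t ≤ c1Norm Φ₁ t + c1Norm Φ₂ t := by
  have hΦ : Φ = fun t x => Φ₁ t x + Φ₂ t x := by funext t x; exact h t x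
  subst hΦ
  have key : ∀ u v w : ℝ → Rd d → ℝ, (∀ s ∈ Icc 0 t, eLpNorm (u s) ∞ volume ≤ eLpNorm (v s) ∞ volume + eLpNorm (w s) ∞ volume) →
      (⨆ s ∈ Icc 0 t, eLpNorm (u s) ∞ volume) ≤ (⨆ s ∈ Icc 0 t, eLpNorm (v s) ∞ volume) + ⨆ s ∈ Icc 0 t, eLpNorm (w s) ∞ volume :=
    fun u v w h => iSup₂_le fun s hs => (h s hs).trans (add_le_add (le_iSup₂_of_le s hs le_rfl) (le_iSup₂_of_le s hs le_rfl))
  refine (add_le_add (key _ Φ₁ Φ₂ fun s _ => eLpNorm_add_le (hc s).aestronglyMeasurable (hc' s).aestronglyMeasurable le_top)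
    (key _ (timeDeriv Φ₁) (timeDeriv Φ₂) fun s hs => ?_)).trans (add_add_add_comm _ _ _ _).le
  have e1 : timeDeriv Φ₁ s = D₁ s := funext fun x => timeDeriv_eq hs.1 (h₁ s x)
  have e2 : timeDeriv Φ₂ s = D₂ s := funext fun x => timeDeriv_eq hs.1 (h₂ s x)
  have e3 : timeDeriv (fun t x => Φ₁ t x + Φ₂ t x) s = fun x => D₁ s x + D₂ s x := funext fun x => timeDeriv_eq hs.1 ((h₁ s x).add (h₂ s x))
  rw [e1, e2, e3]
  exact eLpNorm_add_le (measurable_of_hasDerivAt hc h₁ s).aestronglyMeasurable (measurable_of_hasDerivAt hc' h₂ s).aestronglyMeasurable le_top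

variable {σ₁ : Rd d → ℝ} {σ₂ : Rd n → ℝ}

variable {R₀ c s : ℝ} {f : ℝ → Density d} {V : Rd d → ℝ} {F : ℝ → Rd d → Rd d} {L M : ℝ → ℝ}

/-- The field created by a density of mass `R₀` obeys the bound that defines the radius. -/
theorem c1Norm_potential_le (hn : 1 ≤ n) (hc : 0 < c) (h₁ : IsFormFunction σ₁) (h₂ : IsFormFunction σ₂) (Ψ₀ Ψ₁ : WaveField d n) (hf : Continuous f)
    (hR : 0 < R₀) (hfR : ∀ t, ‖f t‖ ≤ R₀) (t : ℝ) :
    c1Norm (fun t => potential σ₁ σ₂ (waveSol c Ψ₀ Ψ₁ (fun s => source h₁.isTest h₂.isTest (f s)) t)) t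
      ≤ c1Norm (freePotential c σ₁ σ₂ Ψ₀ Ψ₁) t + interactionNorm c σ₁ σ₂ t * ENNReal.ofReal R₀ := by
  have ha := h₁.isTest
  have hb := h₂.isTest
  set g : ℝ → WaveField d n := fun s => source ha hb (f s)
  have hg : Continuous g := (continuous_source ha hb).comp hf
  obtain ⟨D₁, -, -, hD₁, -⟩ := exists_hasDerivAt_potential ha hb c Ψ₀ Ψ₁ (continuous_const (y := (0 : WaveField d n)))
  obtain ⟨D₂, -, -, hD₂, -⟩ := exists_hasDerivAt_potential ha hb c 0 0 hg
  have hfree : freePotential c σ₁ σ₂ Ψ₀ Ψ₁ = fun t => potential σ₁ σ₂ (waveSol c Ψ₀ Ψ₁ (fun _ => 0) t) := by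
    funext t x; exact freePotential_eq hn hc.ne' ha hb h₂.neg_eq Ψ₀ Ψ₁ t x
  have hint : (fun t => potential σ₁ σ₂ (waveSol c 0 0 g t)) = fun t x => -R₀ * interaction c σ₁ σ₂ (fun s => dualOf (R₀⁻¹ • f s)) t x := by
    funext t x
    rw [potential_waveSol_source hn hc.ne' ha hb h₁.neg_eq hf, interaction, ← intervalIntegral.integral_neg, ← intervalIntegral.integral_const_mul]
    refine intervalIntegral.integral_congr fun s _ => ?_
    simp only [pairing_smul_dualOf ha]
    field_simp
  refine (c1Norm_le_of_hasDerivAt (fun t x => ?_) hD₁ hD₂ (fun t => (differentiable_potential ha hb _).continuous)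
    (fun t => (differentiable_potential ha hb _).continuous) t).trans ?_
  · rw [waveSol_add c Ψ₀ Ψ₁ hg, potential_add ha hb]
  · rw [← hfree, hint, c1Norm_const_mul, enorm_neg, Real.enorm_of_nonneg hR.le, mul_comm]
    refine add_le_add le_rfl (mul_le_mul_left ?_ _)
    refine le_iSup₂_of_le (⟨fun s => dualOf (R₀⁻¹ • f s), dualOf.continuous.comp (hf.const_smul R₀⁻¹)⟩ : C(ℝ, W1infDual d)) (fun s _ => ?_) le_rfl
    simp only [ContinuousMap.coe_mk]
    refine (norm_dualOf_le _).trans ?_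
    rw [norm_smul, norm_inv, Real.norm_of_nonneg hR.le, inv_mul_le_iff₀ hR, mul_one]
    exact hfR s

theorem hessianBound_mono (V : Rd d → ℝ) : Monotone (hessianBound V) := fun _ _ h => iInf_mono fun _ => iInf_mono fun _ => iInf₂_mono fun _ _ =>
    eLpNorm_mono_measure _ (Measure.restrict_mono (fun _ hx => lt_of_lt_of_le hx h) le_rfl)

theorem c1Norm_mono (Φ : ℝ → Rd d → ℝ) : Monotone (c1Norm Φ) := fun _ _ h =>
  add_le_add (biSup_mono fun _ hs => ⟨hs.1, hs.2.trans h⟩) (biSup_mono fun _ hs => ⟨hs.1, hs.2.trans h⟩)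

theorem isCharacteristic_flow (hV : IsExternalPotential V) (hF : IsForce F M L) {Φ : ℝ → Rd d → ℝ} (h : ∀ t ∈ Icc 0 s, ∀ x, F t x = -gradient (Φ t) x)
    (z : Phase d) : IsCharacteristic V Φ s z.1 z.2 (fun t => (flow V F 0 t z).1) fun t => (flow V F 0 t z).2 := by
  refine ⟨congrArg Prod.fst (flow_self hV hF 0 z), congrArg Prod.snd (flow_self hV hF 0 z), fun t _ => ?_, fun t ht => ?_⟩
  · exact (hasFDerivAt_fst.comp_hasDerivAt t (hasDerivAt_flow hV hF 0 t z)).hasDerivWithinAt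
  · have := (hasFDerivAt_snd.comp_hasDerivAt t (hasDerivAt_flow hV hF 0 t z)).hasDerivWithinAt (s := Icc 0 s)
    rwa [vfield, h t ht, ← sub_eq_add_neg] at this

theorem enorm_flow_le_radius (hn : 1 ≤ n) (hc : 0 < c) (h₁ : IsFormFunction σ₁) (h₂ : IsFormFunction σ₂) (Ψ₀ Ψ₁ : WaveField d n)
    (hV : IsExternalPotential V) (hF : IsForce F M L) (hf : Continuous f) {T : ℝ} (hR : 0 < R₀) (hfR : ∀ t, ‖f t‖ ≤ R₀)
    (h : ∀ t ∈ Icc 0 T, F t = force σ₁ σ₂ (waveSol c Ψ₀ Ψ₁ (fun s => source h₁.isTest h₂.isTest (f s)) t)) {t : ℝ} (hs : s ∈ Icc 0 t) (ht : t ≤ T)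
    (z : Phase d) : ‖(flow V F 0 s z).1‖ₑ ≤ radius c V σ₁ σ₂ Ψ₀ Ψ₁ R₀ t z.1 z.2 := by
  have hg : Continuous fun s => source h₁.isTest h₂.isTest (f s) := (continuous_source h₁.isTest h₂.isTest).comp hf
  obtain ⟨D, u, hu, hD, hDu⟩ := exists_hasDerivAt_potential h₁.isTest h₂.isTest c Ψ₀ Ψ₁ hg
  have hreg := isRegularPotential_potential h₁.isTest h₂.isTest (continuous_waveSol c Ψ₀ Ψ₁ hg) hD hu hDu
  have hN := c1Norm_potential_le hn hc h₁ h₂ Ψ₀ Ψ₁ hf hR hfR t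
  have hchar := isCharacteristic_flow hV hF (s := s) (fun r hr x => congrFun (h r ⟨hr.1, hr.2.trans (hs.2.trans ht)⟩) x) z
  refine le_trans ?_ (le_iSup₂_of_le _ hreg (le_iSup₂_of_le s hs (le_iSup₂_of_le ((c1Norm_mono _ hs.2).trans hN) _ (le_iSup₂_of_le _ hchar le_rfl))))
  rw [← ofReal_norm]
  exact ENNReal.ofReal_le_ofReal (Real.le_sqrt_of_sq_le (le_add_of_nonneg_right (sq_nonneg _)))

end Radius

section Uniqueness

variable {d n : ℕ} {V : Rd d → ℝ} {F F' : ℝ → Rd d → Rd d} {M L M' L' : ℝ → ℝ}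

theorem MemW2infLoc.hessianBound_ne_top (hV : MemW2infLoc V) {r : ℝ≥0∞} (hr : r ≠ ∞) : hessianBound V r ≠ ∞ := by
  obtain ⟨-, G, H, hG, hH, hb⟩ := hV
  refine ((iInf₂_le_of_le G H (iInf₂_le hG hH)).trans_lt ((eLpNorm_mono_measure _ (Measure.restrict_mono (fun x hx => ?_) le_rfl)).trans_lt
    (hb r.toReal).2)).ne
  rw [mem_ball_zero_iff, ← toReal_enorm]
  exact (ENNReal.toReal_lt_toReal enorm_ne_top hr).2 hx

/-- Two flows in close force fields stay close, with a rate given by the Hessian of `V` where they travel. -/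
theorem enorm_flow_sub_le (hV : IsExternalPotential V) (hF : IsForce F M L) (hF' : IsForce F' M' L') {T : ℝ} {α : ℝ → ℝ} (hα : Continuous α)
    (hα0 : ∀ t, 0 ≤ α t) (h : ∀ t ∈ Icc 0 T, ∀ x, ‖F t x - F' t x‖ ≤ α t) {ρ : ℝ → ℝ≥0∞} (z : Phase d)
    (hρ : ∀ t ∈ Icc 0 T, ∀ s ∈ Icc 0 t, ‖(flow V F 0 s z).1‖ₑ ≤ ρ t ∧ ‖(flow V F' 0 s z).1‖ₑ ≤ ρ t) {t : ℝ} (ht : t ∈ Icc 0 T) :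
    ‖flow V F 0 t z - flow V F' 0 t z‖ₑ ≤ ENNReal.ofReal ((∫ s in 0..t, α s) * Real.exp (T * (1 + |L T|)))
      * EReal.exp ((∫⁻ s in Icc 0 T, hessianBound V (ρ s) : ℝ≥0∞) : EReal) := by
  have dX := fun t => hasDerivAt_flow hV hF 0 t z
  have dY := fun t => hasDerivAt_flow hV hF' 0 t z
  have cX : Continuous fun t => flow V F 0 t z := continuous_iff_continuousAt.2 fun t => (dX t).continuousAt
  have cY : Continuous fun t => flow V F' 0 t z := continuous_iff_continuousAt.2 fun t => (dY t).continuousAt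
  set X := fun t => flow V F 0 t z
  set Y := fun t => flow V F' 0 t z
  have hT : 0 ≤ T := ht.1.trans ht.2
  set ρ₀ : ℝ → ℝ≥0∞ := fun t => ⨆ s ∈ Icc 0 t, max ‖(X s).1‖ₑ ‖(Y s).1‖ₑ
  have hρm : Monotone ρ₀ := fun s t hst => biSup_mono fun r hr => ⟨hr.1, hr.2.trans hst⟩
  have hρt : ∀ t, ρ₀ t ≠ ∞ := fun t => by
    obtain ⟨C, hC⟩ := isCompact_Icc.exists_bound_of_continuousOn (s := Icc 0 t) (cX.prodMk cY).continuousOn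
    refine ((iSup₂_le fun s hs => max_le ?_ ?_).trans_lt (ENNReal.ofReal_lt_top (r := C))).ne <;> rw [← ofReal_norm]
    · exact ENNReal.ofReal_le_ofReal ((norm_fst_le (X s)).trans ((norm_fst_le (X s, Y s)).trans (hC s hs)))
    · exact ENNReal.ofReal_le_ofReal ((norm_fst_le (Y s)).trans ((norm_snd_le (X s, Y s)).trans (hC s hs)))
  have hk := fun t => hV.regular.hessianBound_ne_top (hρt t)
  set k₀ : ℝ → ℝ := fun t => (hessianBound V (ρ₀ t)).toReal
  have hk₀ : Monotone k₀ := fun s t hst => ENNReal.toReal_mono (hk t) (hessianBound_mono V (hρm hst))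
  have key := norm_le_integral_mul_exp_of_monotone (f := fun t => X t - Y t) (k := fun t => k₀ t + (1 + |L T|)) (α := α) (b := T)
    (cX.sub cY).continuousOn (fun t _ => ((dX t).sub (dY t)).hasDerivWithinAt) (by simp [X, Y, flow_self hV hF, flow_self hV hF'])
    (hk₀.add_const _) (fun t => by positivity) hα hα0 (fun s hs => ?_) t ht
  · have hi : IntervalIntegrable k₀ volume 0 t := hk₀.intervalIntegrable
    have e1 : ∫ s in 0..t, k₀ s + (1 + |L T|) = (∫ s in 0..t, k₀ s) + t * (1 + |L T|) := by
      rw [intervalIntegral.integral_add hi intervalIntegrable_const]; simp; ring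
    have e2 : ENNReal.ofReal (∫ s in 0..t, k₀ s) ≤ ∫⁻ s in Icc 0 T, hessianBound V (ρ s) := by
      rw [intervalIntegral.integral_of_le ht.1, ofReal_integral_eq_lintegral_ofReal ((intervalIntegrable_iff_integrableOn_Ioc_of_le ht.1).1 hi)
        (ae_of_all _ fun s => ENNReal.toReal_nonneg)]
      refine le_trans (setLIntegral_mono' measurableSet_Ioc fun s hs => ?_) (lintegral_mono_set fun s hs => ⟨hs.1.le, hs.2.trans ht.2⟩)
      rw [ENNReal.ofReal_toReal (hk s)]
      exact hessianBound_mono V (iSup₂_le fun r hr => max_le (hρ s ⟨hs.1.le, hs.2.trans ht.2⟩ r hr).1 (hρ s ⟨hs.1.le, hs.2.trans ht.2⟩ r hr).2)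
    have hI0 : 0 ≤ ∫ s in 0..t, k₀ s := intervalIntegral.integral_nonneg ht.1 fun s _ => ENNReal.toReal_nonneg
    have e3 : ENNReal.ofReal (Real.exp (∫ s in 0..t, k₀ s)) ≤ EReal.exp ((∫⁻ s in Icc 0 T, hessianBound V (ρ s) : ℝ≥0∞) : EReal) := by
      rw [← EReal.exp_coe]
      refine EReal.exp_monotone ?_
      rw [← max_eq_left hI0, ← EReal.coe_ennreal_ofReal]
      exact EReal.coe_ennreal_le_coe_ennreal_iff.2 e2
    have hA : 0 ≤ ∫ s in 0..t, α s := intervalIntegral.integral_nonneg ht.1 fun s _ => hα0 s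
    refine le_trans ?_ (mul_le_mul_right e3 _)
    rw [← ENNReal.ofReal_mul (by positivity), ← ofReal_norm]
    refine ENNReal.ofReal_le_ofReal (key.trans ?_)
    rw [e1, Real.exp_add, mul_assoc, mul_comm (Real.exp (∫ s in 0..t, k₀ s))]
    have : Real.exp (t * (1 + |L T|)) ≤ Real.exp (T * (1 + |L T|)) := Real.exp_le_exp.2 (mul_le_mul_of_nonneg_right ht.2 (by positivity))
    gcongr
  · have hs' : s ∈ Icc 0 T := Ico_subset_Icc_self hs
    have hx : ‖(X s).1‖ₑ ≤ ρ₀ s ∧ ‖(Y s).1‖ₑ ≤ ρ₀ s := max_le_iff.1 (le_iSup₂_of_le s ⟨hs.1, le_rfl⟩ le_rfl)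
    have h1 : ‖gradient V (X s).1 - gradient V (Y s).1‖ ≤ k₀ s * ‖(X s).1 - (Y s).1‖ := by
      have := ENNReal.toReal_mono (ENNReal.mul_ne_top (hk s) enorm_ne_top) (hV.regular.enorm_gradient_sub_le' hx.1 hx.2)
      rwa [ENNReal.toReal_mul, toReal_enorm, toReal_enorm] at this
    have h2 : ‖F s (X s).1 - F s (Y s).1‖ ≤ |L T| * ‖(X s).1 - (Y s).1‖ :=
      (hF.lipschitz T s _ _ (by rw [abs_of_nonneg hs.1]; exact hs'.2)).trans (mul_le_mul_of_nonneg_right (le_abs_self _) (norm_nonneg _))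
    have h3 := h s hs' (Y s).1
    have h4 : ‖(X s).1 - (Y s).1‖ ≤ ‖X s - Y s‖ := norm_fst_le (X s - Y s)
    have h5 : ‖(X s).2 - (Y s).2‖ ≤ ‖X s - Y s‖ := norm_snd_le (X s - Y s)
    have hk0 : 0 ≤ k₀ s := ENNReal.toReal_nonneg
    have := hα0 s
    refine max_le ?_ ?_
    · refine h5.trans ?_
      nlinarith [mul_nonneg (add_nonneg hk0 (abs_nonneg (L T))) (norm_nonneg (X s - Y s))]
    · have e : -gradient V (X s).1 + F s (X s).1 - (-gradient V (Y s).1 + F' s (Y s).1)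
          = -(gradient V (X s).1 - gradient V (Y s).1) + (F s (X s).1 - F s (Y s).1) + (F s (Y s).1 - F' s (Y s).1) := by abel
      change ‖-gradient V (X s).1 + F s (X s).1 - (-gradient V (Y s).1 + F' s (Y s).1)‖ ≤ _
      rw [e]
      refine (norm_add₃_le).trans ?_
      rw [norm_neg]
      nlinarith [mul_le_mul_of_nonneg_left h4 (add_nonneg hk0 (abs_nonneg (L T))), norm_nonneg (X s - Y s)]

variable {σ₁ : Rd d → ℝ} {σ₂ : Rd n → ℝ}

variable {f₀ : Density d}

theorem drive_sub (hV : IsExternalPotential V) {a : Rd d → ℝ} {b : Rd n → ℝ} (ha : IsTest a) (hb : IsTest b) (hF : IsForce F M L)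
    (hF' : IsForce F' M' L') (hf₀ : 0 ≤ f₀) {t κ : ℝ} (hκ : 0 ≤ κ) {w : Phase d → ℝ≥0∞}
    (h : ∀ z, ‖flow V F 0 t z - flow V F' 0 t z‖ₑ ≤ ENNReal.ofReal κ * w z) (hw : ∫⁻ z, ENNReal.ofReal (f₀ z) * w z < ∞) :
    ‖drive hV ha hb hF f₀ t - drive hV ha hb hF' f₀ t‖ ≤ sobN 1 a * sobN 0 b * κ * (∫⁻ z, ENNReal.ofReal (f₀ z) * w z).toReal := by
  have n1 := sobN_nonneg 1 a
  have n0 := sobN_nonneg 0 b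
  set C := sobN 1 a * sobN 0 b
  have hC : 0 ≤ C := by positivity
  have hi : ∀ {F : ℝ → Rd d → Rd d} {M L : ℝ → ℝ} (hF : IsForce F M L), Integrable fun z => f₀ z • elem ha hb (flow V F 0 t z).1 := fun hF => by
    refine ((L1.integrable_coeFn f₀).norm.mul_const (sobN 0 a * sobN 0 b)).mono' ((L1.integrable_coeFn f₀).aestronglyMeasurable.smul
      (((continuous_elem ha hb).comp (continuous_fst.comp ((continuous_flow hV hF 0).comp (Continuous.prodMk_right t)))).aestronglyMeasurable)) (ae_of_all _ fun z => ?_)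
    rw [norm_smul, norm_elem]
  have e : drive hV ha hb hF f₀ t - drive hV ha hb hF' f₀ t = ∫ z, f₀ z • (elem ha hb (flow V F 0 t z).1 - elem ha hb (flow V F' 0 t z).1) := by
    simp only [drive, source, smul_sub]
    rw [integral_transport_mul hV hF f₀ t fun z => elem ha hb z.1, integral_transport_mul hV hF' f₀ t fun z => elem ha hb z.1,
      integral_sub (hi hF) (hi hF')]
  have key : ‖drive hV ha hb hF f₀ t - drive hV ha hb hF' f₀ t‖ₑ ≤ ENNReal.ofReal (C * κ) * ∫⁻ z, ENNReal.ofReal (f₀ z) * w z := by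
    rw [e]
    refine (enorm_integral_le_lintegral_enorm _).trans ?_
    rw [← lintegral_const_mul' _ _ ENNReal.ofReal_ne_top]
    refine lintegral_mono_ae ?_
    filter_upwards [(Lp.coeFn_nonneg f₀).2 hf₀] with z hz
    rw [enorm_smul, Real.enorm_of_nonneg hz, mul_left_comm]
    refine mul_le_mul_right ?_ _
    rw [ENNReal.ofReal_mul hC, mul_assoc]
    refine le_trans ?_ (mul_le_mul_right (h z) _)
    rw [← ofReal_norm, ← ofReal_norm, ← ENNReal.ofReal_mul hC]
    exact ENNReal.ofReal_le_ofReal ((norm_elem_sub_le ha hb _ _).trans (mul_le_mul_of_nonneg_left (norm_fst_le (flow V F 0 t z - flow V F' 0 t z)) hC))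
  have := ENNReal.toReal_mono (ENNReal.mul_ne_top ENNReal.ofReal_ne_top hw.ne) key
  rwa [ENNReal.toReal_mul, toReal_enorm, ENNReal.toReal_ofReal (by positivity)] at this

/-- Weak solutions with admissible initial density are unique. -/
theorem IsWeakSolution.unique (hn : 1 ≤ n) {c : ℝ} (hc : 0 < c) (hV : IsExternalPotential V) (h₁ : IsFormFunction σ₁) (h₂ : IsFormFunction σ₂)
    {Ψ₀ Ψ₁ : WaveField d n} {R₀ T : ℝ} (hR : 0 < R₀) (hT : 0 < T) (hf₀ : f₀ ∈ admissibleDensities c V σ₁ σ₂ Ψ₀ Ψ₁ R₀ T) {f f' : ℝ → Density d}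
    {Ψ Ψ' : ℝ → WaveField d n} (h : IsWeakSolution T c V σ₁ σ₂ Ψ₀ Ψ₁ f₀ f Ψ) (h' : IsWeakSolution T c V σ₁ σ₂ Ψ₀ Ψ₁ f₀ f' Ψ') :
    EqOn f' f (Icc 0 T) ∧ EqOn Ψ' Ψ (Icc 0 T) := by
  have ha := h₁.isTest
  have hb := h₂.isTest
  obtain ⟨hpos, hmass, hweight⟩ := hf₀
  have cΨ := continuous_comp_clamp hT.le h.continuous_field
  have cΨ' := continuous_comp_clamp hT.le h'.continuous_field
  have hF := isForce_of_continuous ha hb cΨ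
  have hF' := isForce_of_continuous ha hb cΨ'
  obtain ⟨e1, e2⟩ := h.eq_transport_waveSol hV h₁ h₂ hT hF fun t ht => by rw [clamp_of_mem ht]
  obtain ⟨e1', e2'⟩ := h'.eq_transport_waveSol hV h₁ h₂ hT hF' fun t ht => by rw [clamp_of_mem ht]
  have hg := continuous_drive hV ha hb hF f₀
  have hg' := continuous_drive hV ha hb hF' f₀
  have n1 := sobN_nonneg 1 σ₁
  have n0 := sobN_nonneg 0 σ₂
  obtain ⟨C, hCdef⟩ : ∃ C, C = sobN 1 σ₁ * sobN 0 σ₂ := ⟨_, rfl⟩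
  have hC : 0 ≤ C := by rw [hCdef]; positivity
  set E : ℝ → ℝ := fun t => ‖Ψ (clamp T t) - Ψ' (clamp T t)‖
  have cE : Continuous E := (cΨ.sub cΨ').norm
  set I : ℝ → ℝ := fun t => ∫ s in 0..t, E s
  have cI : Continuous I := intervalIntegral.continuous_primitive (fun _ _ => cE.intervalIntegrable _ _) 0
  set m := (weightedMass c V σ₁ σ₂ Ψ₀ Ψ₁ R₀ T f₀).toReal
  set B := Real.exp (T * (1 + |curveSup (fun t => Ψ (clamp T t)) T * (sobN 2 σ₁ * sobN 0 σ₂)|))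
  have hdrive : ∀ t ∈ Icc 0 T, ‖drive hV ha hb hF f₀ t - drive hV ha hb hF' f₀ t‖ ≤ C * (C * B * m) * I t := fun t ht => by
    have hI : 0 ≤ I t := intervalIntegral.integral_nonneg ht.1 fun s _ => norm_nonneg _
    have hI' : ∫ s in 0..t, E s * C = I t * C := intervalIntegral.integral_mul_const _ _
    have := drive_sub hV ha hb hF hF' hpos (t := t) (κ := I t * C * B) (by positivity) (fun z => ?_) hweight
    · exact this.trans_eq (by rw [← hCdef, show C * (C * B * m) * I t = C * (I t * C * B) * m by ring]; rfl)
    · rw [← hI']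
      refine enorm_flow_sub_le hV hF hF' (cE.mul_const C) (fun s => by positivity) (fun s _ x => hCdef ▸ norm_force_sub_le' ha hb _ _ x) z
        (fun s hs r hr => ⟨?_, ?_⟩) ht
      · exact enorm_flow_le_radius hn hc h₁ h₂ Ψ₀ Ψ₁ hV hF (continuous_transport hV hF f₀) hR (fun _ => (norm_transport hV hF f₀ _).trans_le hmass)
          (fun t ht => by rw [clamp_of_mem ht, e2 ht]) hr hs.2 z
      · exact enorm_flow_le_radius hn hc h₁ h₂ Ψ₀ Ψ₁ hV hF' (continuous_transport hV hF' f₀) hR (fun _ => (norm_transport hV hF' f₀ _).trans_le hmass)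
          (fun t ht => by rw [clamp_of_mem ht, e2' ht]) hr hs.2 z
  have hzero := eq_zero_of_norm_le_iterated_integral (T := T) (K := 2 * T * (C * (C * B * m))) (by positivity) cE (ContinuousLinearMap.id ℝ ℝ) fun t ht => by
    have hn1 := norm_waveSol_le c 0 0 (hg.sub hg') ht.1
    have hsub := waveSol_sub c Ψ₀ Ψ₁ Ψ₀ Ψ₁ hg hg' t
    rw [sub_self, sub_self, ← e2 ht, ← e2' ht] at hsub
    have hle : ∫ s in 0..t, ‖drive hV ha hb hF f₀ s - drive hV ha hb hF' f₀ s‖ ≤ C * (C * B * m) * ∫ s in 0..t, I s := by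
      rw [← intervalIntegral.integral_const_mul]
      exact intervalIntegral.integral_mono_on ht.1 ((hg.sub hg').norm.intervalIntegrable _ _) ((cI.const_mul _).intervalIntegrable _ _)
        fun s hs => hdrive s ⟨hs.1, hs.2.trans ht.2⟩
    simp only [ContinuousLinearMap.id_apply]
    rw [Real.norm_of_nonneg (norm_nonneg _)]
    simp only [clamp_of_mem ht]
    rw [hsub]
    rw [norm_zero, mul_zero, add_zero, zero_add] at hn1
    refine hn1.trans ?_
    have hK : 0 ≤ C * (C * B * m) := by positivity
    have hi0 : 0 ≤ ∫ s in 0..t, ‖drive hV ha hb hF f₀ s - drive hV ha hb hF' f₀ s‖ :=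
      intervalIntegral.integral_nonneg ht.1 fun s _ => norm_nonneg _
    calc _ ≤ 2 * T * ∫ s in 0..t, ‖drive hV ha hb hF f₀ s - drive hV ha hb hF' f₀ s‖ :=
          mul_le_mul_of_nonneg_right (by linarith [ht.2]) hi0
      _ ≤ 2 * T * (C * (C * B * m) * ∫ s in 0..t, I s) := mul_le_mul_of_nonneg_left hle (by positivity)
      _ ≤ _ := by rw [← mul_assoc]; exact mul_le_mul_of_nonneg_left (le_abs_self _) (by positivity)
  have hΨ : EqOn Ψ' Ψ (Icc 0 T) := fun t ht => by
    have := hzero t ht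
    simp only [ContinuousLinearMap.id_apply, E, clamp_of_mem ht, norm_eq_zero, sub_eq_zero] at this
    exact this.symm
  refine ⟨fun t ht => ?_, hΨ⟩
  rw [e1 ht, e1' ht]
  refine transport_congr hV hF' hF ht.1 (fun s hs => ?_) f₀
  have hs' : s ∈ Icc 0 T := ⟨hs.1, hs.2.trans ht.2⟩
  simp only [clamp_of_mem hs', hΨ hs']

end Uniqueness

section GradientSnd

variable {d n : ℕ}

theorem norm_sq_eq_integral {X E : Type*} [MeasurableSpace X] {μ : Measure X} [NormedAddCommGroup E] [InnerProductSpace ℝ E] (f : Lp E 2 μ) :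
    ‖f‖ ^ 2 = ∫ x, ‖f x‖ ^ 2 ∂μ := by
  rw [← real_inner_self_eq_norm_sq, L2.inner_def]
  simp only [real_inner_self_eq_norm_sq]

theorem inner_dirSnd (ζ : Freq d n) (j : Fin n) : inner ℝ ζ (WithLp.toLp 2 (dirSnd d j)) = ζ.ofLp.2 j := by
  simp [WithLp.prod_inner_apply, dirSnd, EuclideanSpace.inner_single_right]

theorem IsTest.fourierField_fderiv_ae {a : Rd d × Rd n → ℝ} (ha : IsTest a) (j : Fin n) :
    fourierField (ha.fderiv_apply (dirSnd d j)).wave =ᵐ[volume]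
      fun ζ => (2 * Real.pi * Complex.I * (ζ.ofLp.2 j : ℝ) : ℂ) * fourierField ha.wave ζ := by
  have hg : (fun x : Freq d n => inner ℝ x (WithLp.toLp 2 (dirSnd d j))).HasTemperateGrowth :=
    ((innerSL ℝ).flip (WithLp.toLp 2 (dirSnd d j))).hasTemperateGrowth
  filter_upwards [ha.fourierField_wave_ae, (ha.fderiv_apply (dirSnd d j)).fourierField_wave_ae] with ζ h1 h2
  rw [h1, h2, ← ha.lineDeriv_schwartz (WithLp.toLp 2 (dirSnd d j)), SchwartzMap.fourier_lineDerivOp_eq, SchwartzMap.smul_apply,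
    SchwartzMap.smulLeftCLM_apply_apply hg, inner_dirSnd]
  simp only [smul_eq_mul, Complex.real_smul]
  ring

theorem abs_coord_le (ζ : Freq d n) (j : Fin n) : |ζ.ofLp.2 j| ≤ ‖ζ.ofLp.2‖ := by
  rw [← Real.norm_eq_abs]; exact PiLp.norm_apply_le _ j

theorem continuous_coord (j : Fin n) : Continuous fun ζ : Freq d n => ζ.ofLp.2 j :=
  (EuclideanSpace.proj (𝕜 := ℝ) j).continuous.comp (continuous_snd.comp (WithLp.prod_continuous_ofLp 2 (Rd d) (Rd n)))

/-- A weak derivative in the transverse direction `j` acts as the multiplier `2 π i ζ_j`. -/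
theorem fourierField_of_weakDeriv {Ψ D : WaveField d n} {j : Fin n} (h : IsWeakDerivAlong Ψ (dirSnd d j) D) :
    fourierField D =ᵐ[volume] fun ζ => (2 * Real.pi * Complex.I * (ζ.ofLp.2 j : ℝ) : ℂ) * fourierField Ψ ζ := by
  filter_upwards [fourierField_ae_of_multiplier (D := D) (I := -Ψ) _ (fun a ha => ha.fourierField_fderiv_ae j) fun a ha => by
    rw [inner_neg_left, IsTest.inner_wave, IsTest.inner_wave, h.integral_eq a ha, neg_neg],
    Lp.coeFn_neg (fourierField Ψ)] with ζ h1 h2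
  rw [h1, map_neg, h2, Pi.neg_apply]
  simp [-WithLp.ofLp_fst, -WithLp.ofLp_snd]; left; left; exact map_ofNat _ 2

end GradientSnd

section FieldEnergy

variable {d n : ℕ}

variable {Ψ : WaveField d n} {c : ℝ} {w : Spec d n}

theorem HasWeakGradientSnd.exists_freq_smul {G : Lp (Rd n) 2 (volume : Measure (Rd d × Rd n))} (h : HasWeakGradientSnd Ψ G) (c : ℝ) :
    ∃ w : Spec d n, w =ᵐ[volume] (fun ζ => freq c ζ • fourierField Ψ ζ) ∧ ‖w‖ ^ 2 = c ^ 2 * ∫ q, ‖G q‖ ^ 2 := by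
  let D : Fin n → WaveField d n := fun j => (EuclideanSpace.proj (𝕜 := ℝ) j : Rd n →L[ℝ] ℝ).compLp G
  have hD : ∀ j, D j =ᵐ[volume] fun q => G q j := fun j => ContinuousLinearMap.coeFn_compLp _ G
  have hU : ∀ j, fourierField (D j) =ᵐ[volume] fun ζ => (2 * Real.pi * Complex.I * (ζ.ofLp.2 j : ℝ) : ℂ) * fourierField Ψ ζ :=
    fun j => fourierField_of_weakDeriv ((h (EuclideanSpace.basisFun (Fin n) ℝ j)).congr EventuallyEq.rfl (by
      filter_upwards [hD j] with q hq
      rw [hq]; simp [EuclideanSpace.inner_single_right]))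
  have hsum : ∀ᵐ ζ : Freq d n, ‖freq c ζ • fourierField Ψ ζ‖ ^ 2 = c ^ 2 * ∑ j, ‖fourierField (D j) ζ‖ ^ 2 := by
    filter_upwards [eventually_all.2 hU] with ζ h1
    have hn := EuclideanSpace.norm_sq_eq ζ.ofLp.2
    simp only [h1, norm_mul, norm_smul, mul_pow, ← Finset.sum_mul, Complex.norm_I, Complex.norm_real, RCLike.norm_ofNat, one_pow, mul_one,
      Real.norm_eq_abs, sq_abs, freq, ← Finset.mul_sum] at hn ⊢
    rw [hn]; ring
  have hi : ∀ j, Integrable fun ζ => ‖fourierField (D j) ζ‖ ^ 2 := fun j =>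
    (memLp_two_iff_integrable_sq_norm (Lp.aestronglyMeasurable _)).1 (Lp.memLp _)
  have hint : Integrable fun ζ => c ^ 2 * ∑ j, ‖fourierField (D j) ζ‖ ^ 2 := (integrable_finset_sum _ fun j _ => hi j).const_mul _
  have hm : MemLp (fun ζ => freq c ζ • fourierField Ψ ζ) 2 volume := (memLp_two_iff_integrable_sq_norm
    ((continuous_freq c).aestronglyMeasurable.smul (Lp.aestronglyMeasurable _))).2 (hint.congr (by filter_upwards [hsum] with ζ h using h.symm))
  have hGi : ∀ j, Integrable fun q => ‖D j q‖ ^ 2 := fun j => (memLp_two_iff_integrable_sq_norm (Lp.aestronglyMeasurable _)).1 (Lp.memLp _)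
  refine ⟨hm.toLp _, hm.coeFn_toLp, ?_⟩
  have e1 : ∫ q, ‖G q‖ ^ 2 = ∑ j, ‖D j‖ ^ 2 := by
    simp only [norm_sq_eq_integral]
    rw [← integral_finset_sum _ fun j _ => hGi j]
    refine integral_congr_ae ?_
    filter_upwards [eventually_all.2 hD] with q hq
    simp only [hq]
    exact EuclideanSpace.norm_sq_eq _
  rw [norm_sq_eq_integral, e1, integral_congr_ae (by filter_upwards [hm.coeFn_toLp, hsum] with ζ h1 h2 using by rw [h1, h2] :
    (fun ζ => ‖hm.toLp _ ζ‖ ^ 2) =ᵐ[volume] fun ζ => c ^ 2 * ∑ j, ‖fourierField (D j) ζ‖ ^ 2), integral_const_mul,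
    integral_finset_sum _ fun j _ => hi j]
  congr 1
  exact Finset.sum_congr rfl fun j _ => by rw [← norm_sq_eq_integral, LinearIsometry.norm_map]

def rieszM (c : ℝ) (j : Fin n) (ζ : Freq d n) : ℝ := ζ.ofLp.2 j / (c * ‖ζ.ofLp.2‖)

theorem measurable_rieszM (c : ℝ) (j : Fin n) : Measurable (rieszM c j : Freq d n → ℝ) := (continuous_coord j).measurable.div
  ((continuous_snd.comp (WithLp.prod_continuous_ofLp 2 (Rd d) (Rd n))).norm.measurable.const_mul c)

theorem abs_rieszM_le (c : ℝ) (j : Fin n) (ζ : Freq d n) : |rieszM c j ζ| ≤ |c|⁻¹ := by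
  rw [rieszM, abs_div, abs_mul, abs_norm, mul_comm, ← div_div, div_eq_mul_inv]
  exact mul_le_of_le_one_left (by positivity) (div_le_one_of_le₀ (abs_coord_le ζ j) (norm_nonneg _))

theorem rieszM_mul_freq (hc : c ≠ 0) (j : Fin n) (ζ : Freq d n) : rieszM c j ζ * freq c ζ = 2 * Real.pi * ζ.ofLp.2 j := by
  rw [rieszM, freq]
  rcases eq_or_ne ‖ζ.ofLp.2‖ 0 with h | h
  · have := abs_coord_le ζ j
    rw [h, abs_nonpos_iff] at this
    rw [this]; simp
  · field_simp

/-- The transverse derivatives of the field, from `w = ω UΨ`. -/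
def partialSnd (c : ℝ) (j : Fin n) : Spec d n →L[ℝ] WaveField d n := reField ∘L
  ((Complex.I • ContinuousLinearMap.id ℂ (Spec d n)).restrictScalars ℝ) ∘L multL (rieszM c j) (measurable_rieszM c j) _ (abs_rieszM_le c j)

/-- The transverse gradient of the field, from `w = ω UΨ`. -/
def gradientSnd (c : ℝ) : Spec d n →L[ℝ] Lp (Rd n) 2 (volume : Measure (Rd d × Rd n)) :=
  ∑ j, ((ContinuousLinearMap.toSpanSingleton ℝ (EuclideanSpace.basisFun (Fin n) ℝ j)).compLpL 2 volume) ∘L partialSnd c j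

theorem coeFn_finset_sum {X E ι : Type*} [MeasurableSpace X] {μ : Measure X} [NormedAddCommGroup E] {p : ℝ≥0∞} (s : Finset ι) (u : ι → Lp E p μ) :
    ⇑(∑ i ∈ s, u i) =ᵐ[μ] fun x => ∑ i ∈ s, u i x := by
  classical
  induction s using Finset.induction_on with
  | empty => exact Lp.coeFn_zero E p μ
  | insert i s hi ih =>
    rw [Finset.sum_insert hi]
    filter_upwards [Lp.coeFn_add (u i) (∑ i ∈ s, u i), ih] with x h1 h2
    rw [h1, Pi.add_apply, h2, Finset.sum_insert hi]

theorem gradientSnd_ae (c : ℝ) (w : Spec d n) :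
    gradientSnd c w =ᵐ[volume] fun q => ∑ j, partialSnd c j w q • EuclideanSpace.basisFun (Fin n) ℝ j := by
  have h1 : gradientSnd c w = ∑ j, ((ContinuousLinearMap.toSpanSingleton ℝ (EuclideanSpace.basisFun (Fin n) ℝ j)).compLp (partialSnd c j w)) := by
    rw [gradientSnd, ContinuousLinearMap.sum_apply]; rfl
  rw [h1]
  filter_upwards [coeFn_finset_sum Finset.univ fun j => ((ContinuousLinearMap.toSpanSingleton ℝ (EuclideanSpace.basisFun (Fin n) ℝ j)).compLp (partialSnd c j w)),
    eventually_all.2 fun j => ContinuousLinearMap.coeFn_compLp (ContinuousLinearMap.toSpanSingleton ℝ (EuclideanSpace.basisFun (Fin n) ℝ j)) (partialSnd c j w)] with q h2 h3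
  rw [h2]
  simp only [h3]
  rfl

section
variable (hc : c ≠ 0) (hw : w =ᵐ[volume] fun ζ => freq c ζ • fourierField Ψ ζ)
include hc hw

theorem integral_mul_fderiv_dirSnd (j : Fin n) {a : Rd d × Rd n → ℝ} (ha : IsTest a) :
    ∫ q, Ψ q * fderiv ℝ a q (dirSnd d j) = -∫ q, partialSnd c j w q * a q := by
  rw [← (ha.fderiv_apply (dirSnd d j)).inner_wave, ← ha.inner_wave]
  change _ = -inner ℝ (reField (Complex.I • mult (rieszM c j) w)) ha.wave
  rw [← re_inner_fourierField, ← Complex.ofReal_re (inner ℝ Ψ _), ← inner_fourierField, ← Complex.neg_re, L2.inner_def, L2.inner_def, ← integral_neg]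
  congr 1
  refine integral_congr_ae ?_
  filter_upwards [ha.fourierField_fderiv_ae j, hw, mult_ae_of_bound (measurable_rieszM c j) (abs_rieszM_le c j) w,
    Lp.coeFn_smul Complex.I (mult (rieszM c j) w)] with ζ h1 h2 h3 h4
  rw [h1, h4, Pi.smul_apply, h3, h2, smul_smul, rieszM_mul_freq hc, RCLike.inner_apply, RCLike.inner_apply, smul_eq_mul, Complex.real_smul]
  simp only [map_mul, Complex.conj_I, Complex.conj_ofReal]
  push_cast
  ring

theorem hasWeakGradientSnd_gradientSnd : HasWeakGradientSnd Ψ (gradientSnd c w) := by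
  have hloc : ∀ Ψ : WaveField d n, LocallyIntegrable Ψ volume := fun Ψ => (Lp.memLp Ψ).locallyIntegrable (by norm_num)
  intro e
  have hin : (fun q => inner ℝ (gradientSnd c w q) e) =ᵐ[volume] fun q => ∑ j, e j * partialSnd c j w q := by
    filter_upwards [gradientSnd_ae c w] with q hq
    rw [hq, sum_inner]
    exact Finset.sum_congr rfl fun j _ => by simp [inner_smul_left, EuclideanSpace.inner_single_left, mul_comm]
  refine IsWeakDerivAlong.congr ⟨hloc Ψ, LocallyIntegrable.congr (f := fun q => ∑ j, e j * partialSnd c j w q)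
    (locallyIntegrable_finset_sum _ fun j _ => (hloc (partialSnd c j w)).smul (e j)) EventuallyEq.rfl, fun φ hφ => ?_⟩ EventuallyEq.rfl hin.symm
  have he : ∀ q, fderiv ℝ φ q (0, e) = ∑ j, e j * fderiv ℝ φ q (dirSnd d j) := fun q => by
    have : ((0 : Rd d), e) = ∑ j, e j • dirSnd d j := by
      have h1 := (EuclideanSpace.basisFun (Fin n) ℝ).sum_repr e
      refine Prod.ext ?_ ?_
      · simp [dirSnd, Prod.fst_sum]
      · rw [Prod.snd_sum]; exact h1.symm
    rw [this, map_sum]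
    simp only [map_smul, smul_eq_mul]
  simp only [he, Finset.mul_sum, Finset.sum_mul]
  rw [integral_finset_sum _ fun j _ => ?_, integral_finset_sum _ fun j _ => ?_, ← Finset.sum_neg_distrib]
  · refine Finset.sum_congr rfl fun j _ => ?_
    simp only [mul_left_comm _ (e j), mul_assoc]
    rw [integral_const_mul, integral_const_mul, integral_mul_fderiv_dirSnd hc hw j hφ, mul_neg]
  · simp only [mul_assoc]; exact (hφ.integrable_mul (hloc _)).const_mul _
  · simp only [mul_left_comm _ (e j)]; exact ((hφ.fderiv_apply _).integrable_mul (hloc Ψ)).const_mul _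

end

end FieldEnergy

section FieldEnergy

section Abstract

variable {X : Type*} [MeasurableSpace X] {μ : Measure X} {ω : X → ℝ}

variable {g : ℝ → Lp ℂ 2 μ}

def duQ (ω : X → ℝ) (w b : Lp ℂ 2 μ) (g : ℝ → Lp ℂ 2 μ) (t : ℝ) : Lp ℂ 2 μ := mult (cosM ω t) (duW ω w g t) + mult (sinwM ω t) (duB ω b g t)

theorem continuous_duQ (hω : Measurable ω) (w b : Lp ℂ 2 μ) (hg : Continuous g) : Continuous (duQ ω w b g) :=
  ((isMultiplier_cosM hω).continuous_mult (continuous_duW hω w hg)).add ((isMultiplier_sinwM hω).continuous_mult (continuous_duB hω b hg))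

theorem duQ_ae (hω : Measurable ω) {a w : Lp ℂ 2 μ} (hw : w =ᵐ[μ] fun x => ω x • a x) (b : Lp ℂ 2 μ) (hg : Continuous g) (t : ℝ) :
    duQ ω w b g t =ᵐ[μ] fun x => ω x • duY ω a b g t x := by
  filter_upwards [duW_ae hω hw hg t, Lp.coeFn_add (mult (cosM ω t) (duW ω w g t)) (mult (sinwM ω t) (duB ω b g t)),
    Lp.coeFn_add (mult (cosM ω t) (duA ω a g t)) (mult (sinM ω t) (duB ω b g t)), (isMultiplier_cosM hω).ae t (duW ω w g t),
    (isMultiplier_cosM hω).ae t (duA ω a g t), (isMultiplier_sinwM hω).ae t (duB ω b g t), (isMultiplier_sinM hω).ae t (duB ω b g t)]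
    with x h1 h2 h3 h4 h5 h6 h7
  rw [duQ, duY, h2, h3, Pi.add_apply, Pi.add_apply, h4, h5, h6, h7, h1, smul_add, smul_smul, smul_smul, smul_smul, mul_sinM, mul_comm (ω x)]

theorem norm_sq_rotation (c s : ℝ) (h : c ^ 2 + s ^ 2 = 1) (B W : ℂ) : ‖c • B - s • W‖ ^ 2 + ‖c • W + s • B‖ ^ 2 = ‖B‖ ^ 2 + ‖W‖ ^ 2 := by
  simp only [Complex.sq_norm, Complex.normSq_apply, Complex.sub_re, Complex.sub_im, Complex.add_re, Complex.add_im, Complex.real_smul,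
    Complex.mul_re, Complex.mul_im, Complex.ofReal_re, Complex.ofReal_im]
  linear_combination (B.re ^ 2 + B.im ^ 2 + W.re ^ 2 + W.im ^ 2) * h

theorem norm_sq_duZ_add_norm_sq_duQ (hω : Measurable ω) (w b : Lp ℂ 2 μ) (g : ℝ → Lp ℂ 2 μ) (t : ℝ) :
    ‖duZ ω w b g t‖ ^ 2 + ‖duQ ω w b g t‖ ^ 2 = ‖duB ω b g t‖ ^ 2 + ‖duW ω w g t‖ ^ 2 := by
  have hi : ∀ f : Lp ℂ 2 μ, Integrable (fun x => ‖f x‖ ^ 2) μ := fun f =>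
    (memLp_two_iff_integrable_sq_norm (Lp.aestronglyMeasurable _)).1 (Lp.memLp _)
  simp only [norm_sq_eq_integral]
  rw [← integral_add (hi _) (hi _), ← integral_add (hi _) (hi _)]
  refine integral_congr_ae ?_
  filter_upwards [Lp.coeFn_sub (mult (cosM ω t) (duB ω b g t)) (mult (sinwM ω t) (duW ω w g t)),
    Lp.coeFn_add (mult (cosM ω t) (duW ω w g t)) (mult (sinwM ω t) (duB ω b g t)), (isMultiplier_cosM hω).ae t (duW ω w g t),
    (isMultiplier_cosM hω).ae t (duB ω b g t), (isMultiplier_sinwM hω).ae t (duB ω b g t), (isMultiplier_sinwM hω).ae t (duW ω w g t)]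
    with x h1 h2 h3 h4 h5 h6
  rw [duZ, duQ, h1, h2, Pi.sub_apply, Pi.add_apply, h3, h4, h5, h6]
  exact norm_sq_rotation _ _ (Real.cos_sq_add_sin_sq _) _ _

theorem real_inner_mult {m : ℝ → X → ℝ} (hm : IsMultiplier m) (t : ℝ) (g h : Lp ℂ 2 μ) : inner ℝ (mult (m t) g) h = inner ℝ g (mult (m t) h) := by
  rw [L2.inner_def, L2.inner_def]
  refine integral_congr_ae ?_
  filter_upwards [hm.ae t g, hm.ae t h] with x h1 h2
  rw [h1, h2, real_inner_smul_left, real_inner_smul_right]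

theorem hasDerivAt_energy (hω : Measurable ω) (w b : Lp ℂ 2 μ) (hg : Continuous g) (t : ℝ) :
    HasDerivAt (fun t => (‖duB ω b g t‖ ^ 2 + ‖duW ω w g t‖ ^ 2) / 2) (-inner ℝ (duZ ω w b g t) (g t)) t := by
  have h := (((hasDerivAt_duB hω b hg t).norm_sq).add ((hasDerivAt_duW hω w hg t).norm_sq)).div_const 2
  refine h.congr_deriv ?_
  rw [duZ, inner_sub_left, real_inner_mult (isMultiplier_cosM hω), real_inner_mult (isMultiplier_sinwM hω), inner_neg_right]
  ring

end Abstract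

variable {d n : ℕ}

set_option maxHeartbeats 2000000 in
theorem exists_field_energy {c : ℝ} (hc : c ≠ 0) {Ψ₀ : WaveField d n} (Ψ₁ : WaveField d n) {G₀ : Lp (Rd n) 2 (volume : Measure (Rd d × Rd n))}
    (h : HasWeakGradientSnd Ψ₀ G₀) {g : ℝ → WaveField d n} (hg : Continuous g) :
    ∃ (Ψt : ℝ → WaveField d n) (G : ℝ → Lp (Rd n) 2 (volume : Measure (Rd d × Rd n))), Continuous Ψt ∧ Continuous G ∧
      (∀ t, HasDerivAt (waveSol c Ψ₀ Ψ₁ g) (Ψt t) t) ∧ ∀ t, 0 ≤ t → HasWeakGradientSnd (waveSol c Ψ₀ Ψ₁ g t) (G t) ∧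
        1 / 2 * (∫ q, |Ψt t q| ^ 2) + c ^ 2 / 2 * (∫ q, ‖G t q‖ ^ 2)
          = 1 / 2 * (∫ q, |Ψ₁ q| ^ 2) + c ^ 2 / 2 * (∫ q, ‖G₀ q‖ ^ 2) - ∫ s in 0..t, inner ℝ (Ψt s) (g s) := by
  have hω : Measurable (freq c : Freq d n → ℝ) := (continuous_freq c).measurable
  have hgU : Continuous fun s => fourierField (g s) := fourierField.continuous.comp hg
  obtain ⟨w, hw, hwn⟩ := h.exists_freq_smul c
  set γ := fun s => fourierField (g s)
  set Z := duZ (freq c) w (fourierField Ψ₁) γ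
  set Q := duQ (freq c) w (fourierField Ψ₁) γ
  have cZ : Continuous Z := continuous_duZ hω _ _ hgU
  have hZ : ∀ t, HasDerivAt (waveSol c Ψ₀ Ψ₁ g) (reField (Z t)) t := fun t =>
    reField.hasFDerivAt.comp_hasDerivAt t (hasDerivAt_duY hω hw _ hgU t)
  have hUZ : ∀ t, 0 ≤ t → fourierField (reField (Z t)) = Z t := fun t ht => by
    have h1 := (fourierField.toContinuousLinearMap.hasFDerivAt.comp_hasDerivAt t (hZ t)).hasDerivWithinAt (s := Ici 0)
    have h2 := (hasDerivAt_duY hω hw (fourierField Ψ₁) hgU t).hasDerivWithinAt (s := Ici 0)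
    exact (uniqueDiffOn_Ici (0:ℝ) t ht).eq_deriv _ h1 (h2.congr (fun s hs => fourierField_waveSol c Ψ₀ Ψ₁ hg hs) (fourierField_waveSol c Ψ₀ Ψ₁ hg ht))
  refine ⟨fun t => reField (Z t), fun t => gradientSnd c (Q t), reField.continuous.comp cZ,
    (gradientSnd c).continuous.comp (continuous_duQ hω _ _ hgU), hZ, fun t ht => ?_⟩
  have hQ : Q t =ᵐ[volume] fun ζ => freq c ζ • fourierField (waveSol c Ψ₀ Ψ₁ g t) ζ := by
    rw [fourierField_waveSol c Ψ₀ Ψ₁ hg ht]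
    exact duQ_ae hω hw _ hgU t
  have hgrad := hasWeakGradientSnd_gradientSnd hc hQ
  refine ⟨hgrad, ?_⟩
  obtain ⟨w', hw', hwn'⟩ := hgrad.exists_freq_smul c
  obtain rfl : w' = Q t := Lp.ext (hw'.trans hQ.symm)
  have e0 : ∀ u : WaveField d n, ∫ q, |u q| ^ 2 = ‖u‖ ^ 2 := fun u => (norm_sq_eq_integral u).symm
  have hE := intervalIntegral.integral_eq_sub_of_hasDerivAt (a := 0) (b := t) (fun s _ => hasDerivAt_energy hω w (fourierField Ψ₁) hgU s)
    ((cZ.inner hgU).neg.intervalIntegrable _ _)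
  have hI : ∫ s in 0..t, -inner ℝ (Z s) (γ s) = -∫ s in 0..t, inner ℝ (reField (Z s)) (g s) := by
    rw [← intervalIntegral.integral_neg]
    refine intervalIntegral.integral_congr fun s hs => ?_
    rw [uIcc_of_le ht] at hs
    simp only [γ]
    rw [← hUZ s hs.1, LinearIsometry.inner_map_map, hUZ s hs.1]
  rw [hI, duB_zero, duW_zero, LinearIsometry.norm_map] at hE
  have hrot := norm_sq_duZ_add_norm_sq_duQ hω w (fourierField Ψ₁) γ t
  have hn : ‖reField (Z t)‖ = ‖Z t‖ := by rw [← fourierField.norm_map, hUZ t ht]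
  change ‖Z t‖ ^ 2 + ‖Q t‖ ^ 2 = _ at hrot
  simp only [e0, hn]
  linarith

end FieldEnergy

section TotalEnergy

variable {d n : ℕ} {V : Rd d → ℝ} {F : ℝ → Rd d → Rd d} {M L : ℝ → ℝ} {a : Rd d → ℝ} {b : Rd n → ℝ}

variable {t : ℝ} {Ψ : ℝ → WaveField d n} {f₀ : Density d}

theorem hasDerivAt_inner_of_eq_zero {H : Type*} [NormedAddCommGroup H] [InnerProductSpace ℝ H] {u v : ℝ → H} {u' : H} (hu : HasDerivAt u u' t)
    (h0 : u t = 0) (hv : ContinuousAt v t) : HasDerivAt (fun s => inner ℝ (u s) (v s)) (inner ℝ u' (v t)) t := by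
  rw [hasDerivAt_iff_tendsto_slope] at hu ⊢
  refine (hu.inner (hv.mono_left nhdsWithin_le_nhds)).congr fun s => ?_
  rw [slope_def_module, slope_def_module, h0, inner_zero_left, sub_zero, sub_zero, real_inner_smul_left, smul_eq_mul]

section
variable (hV : IsExternalPotential V) (hF : IsForce F M L)
include hV hF

/-- Along a characteristic, the energy of a particle changes at the rate `∂ₜΦ`. -/
theorem hasDerivAt_particleEnergy (ha : IsTest a) (hb : IsTest b) {Ψ' : WaveField d n} (hΨ : HasDerivAt Ψ Ψ' t) (ht : F t = force a b (Ψ t))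
    (z : Phase d) : HasDerivAt (fun s => ‖(flow V F 0 s z).2‖ ^ 2 / 2 + V (flow V F 0 s z).1 + potential a b (Ψ s) (flow V F 0 s z).1)
      (potential a b Ψ' (flow V F 0 t z).1) t := by
  have h := hasDerivAt_flow hV hF 0 t z
  set Z := fun s => flow V F 0 s z
  have hx : HasDerivAt (fun s => (Z s).1) (Z t).2 t := (hasFDerivAt_fst (𝕜 := ℝ) (p := Z t)).comp_hasDerivAt t h
  have hv : HasDerivAt (fun s => (Z s).2) (-gradient V (Z t).1 + F t (Z t).1) t := (hasFDerivAt_snd (𝕜 := ℝ) (p := Z t)).comp_hasDerivAt t h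
  have h1 := ((hv.norm_sq).div_const 2).add ((hV.differentiable (Z t).1).hasFDerivAt.comp_hasDerivAt t hx)
  have h2 := (differentiable_potential ha hb (Ψ t) (Z t).1).hasFDerivAt.comp_hasDerivAt t hx
  have h3 := hasDerivAt_inner_of_eq_zero (hΨ.sub_const (Ψ t)) (sub_self _) ((continuous_elem ha hb).continuousAt.comp hx.continuousAt)
  have h4 := h1.add (h2.add h3)
  refine (h4.congr_of_eventuallyEq (.of_forall fun s => ?_)).congr_deriv ?_
  · simp only [Pi.add_apply, Function.comp_apply]
    rw [inner_sub_left, ← potential_eq_inner ha hb, ← potential_eq_inner ha hb, add_sub_cancel]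
  · rw [← inner_gradient (hV.differentiable _), ← inner_gradient (differentiable_potential ha hb _ _), Function.comp_apply, ← potential_eq_inner ha hb,
      inner_add_right, inner_neg_right, ht, force, inner_neg_right, real_inner_comm (gradient V _), real_inner_comm (gradient (potential a b _) _)]
    ring

theorem integrable_transport_mul {h : Phase d → ℝ} (hi : Integrable fun z => f₀ z * h (flow V F 0 t z)) :
    Integrable fun z => transport hV hF f₀ t z * h z := by
  refine ((measurePreserving_flow hV hF t 0).integrable_comp_of_integrable hi).congr ?_
  filter_upwards [transport_ae_eq hV hF f₀ t] with z hz
  rw [Function.comp_apply, hz, flow_inv hV hF]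

theorem particle_energy (ha : IsTest a) (hb : IsTest b) {Ψt : ℝ → WaveField d n} (hΨ : ∀ t, HasDerivAt Ψ (Ψt t) t) (hΨt : Continuous Ψt) (ht : 0 ≤ t)
    (hFΨ : ∀ s ∈ Icc 0 t, F s = force a b (Ψ s)) (hi : Integrable fun z : Rd d × Rd d => f₀ z * (‖z.2‖ ^ 2 / 2 + V z.1)) :
    Integrable (particleEnergyDensity V (potential a b (Ψ t)) (transport hV hF f₀ t)) ∧
      ∫ z, particleEnergyDensity V (potential a b (Ψ t)) (transport hV hF f₀ t) z
        = (∫ z, particleEnergyDensity V (potential a b (Ψ 0)) f₀ z) + ∫ s in 0..t, inner ℝ (Ψt s) (drive hV ha hb hF f₀ s) := by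
  let q : ℝ × Phase d → ℝ := fun p => potential a b (Ψt p.1) (flow V F 0 p.1 p.2).1
  have hq : Continuous q := by
    simp only [q, potential_eq_inner ha hb]
    exact (hΨt.comp continuous_fst).inner ((continuous_elem ha hb).comp (continuous_fst.comp (continuous_flow hV hF 0)))
  have hH : ∀ z, ‖(flow V F 0 t z).2‖ ^ 2 / 2 + V (flow V F 0 t z).1 + potential a b (Ψ t) (flow V F 0 t z).1
      = ‖z.2‖ ^ 2 / 2 + V z.1 + potential a b (Ψ 0) z.1 + ∫ s in 0..t, q (s, z) := fun z => by
    have := intervalIntegral.integral_eq_sub_of_hasDerivAt (a := 0) (b := t)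
      (fun s hs => hasDerivAt_particleEnergy hV hF ha hb (hΨ s) (hFΨ s (by rwa [uIcc_of_le ht] at hs)) z)
      ((hq.comp (Continuous.prodMk_left z)).intervalIntegrable _ _)
    rw [flow_self hV hF] at this
    exact (sub_eq_iff_eq_add'.1 this.symm)
  have hJ : Integrable (fun p : ℝ × Phase d => f₀ p.2 * q p) ((volume.restrict (Ioc 0 t)).prod volume) := by
    have h1 : Integrable (fun s => ‖Ψt s‖ * (sobN 0 a * sobN 0 b)) (volume.restrict (Ioc 0 t)) :=
      ((hΨt.norm.mul_const _).integrableOn_Icc (a := 0) (b := t)).mono_set Ioc_subset_Icc_self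
    refine (h1.mul_prod (L1.integrable_coeFn f₀).norm).mono' ((L1.integrable_coeFn f₀).aestronglyMeasurable.comp_snd.mul hq.aestronglyMeasurable)
      (ae_of_all _ fun p => ?_)
    rw [norm_mul, mul_comm]
    exact mul_le_mul_of_nonneg_right (abs_potential_le ha hb _ _) (norm_nonneg _)
  have e1 : ∀ z, ∫ s in 0..t, q (s, z) = ∫ s in Ioc 0 t, q (s, z) := fun z => intervalIntegral.integral_of_le ht
  have i0 : Integrable fun z : Rd d × Rd d => particleEnergyDensity V (potential a b (Ψ 0)) f₀ z := by
    refine (hi.add (integrable_mul_of_bounded f₀ ((differentiable_potential ha hb (Ψ 0)).continuous.comp continuous_fst)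
      fun z => abs_potential_le ha hb (Ψ 0) z.1)).congr (ae_of_all _ fun z => ?_)
    simp only [Pi.add_apply, particleEnergyDensity, Function.comp_apply]
    ring
  have i1 : Integrable fun z => ∫ s in Ioc 0 t, f₀ z * q (s, z) := hJ.integral_prod_right
  have e2 : ∀ z, f₀ z * (‖(flow V F 0 t z).2‖ ^ 2 / 2 + V (flow V F 0 t z).1 + potential a b (Ψ t) (flow V F 0 t z).1)
      = particleEnergyDensity V (potential a b (Ψ 0)) f₀ z + ∫ s in Ioc 0 t, f₀ z * q (s, z) := fun z => by
    rw [hH, e1, integral_const_mul, particleEnergyDensity, mul_add]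
  refine ⟨integrable_transport_mul hV hF (h := fun z => ‖z.2‖ ^ 2 / 2 + V z.1 + potential a b (Ψ t) z.1)
    ((i0.add i1).congr (ae_of_all _ fun z => (e2 z).symm)), ?_⟩
  refine (integral_transport_mul hV hF f₀ t fun z => ‖z.2‖ ^ 2 / 2 + V z.1 + potential a b (Ψ t) z.1).trans ?_
  simp only [smul_eq_mul, e2]
  rw [integral_add i0 i1, intervalIntegral.integral_of_le ht, ← integral_integral_swap (f := fun s z => f₀ z * q (s, z)) hJ]
  congr 1
  refine integral_ext fun s => ?_
  simp only [drive, inner_source]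
  exact (integral_transport_mul hV hF f₀ s fun z => potential a b (Ψt s) z.1).symm

end

variable {σ₁ : Rd d → ℝ} {σ₂ : Rd n → ℝ}

theorem IsWeakSolution.energy {c : ℝ} (hc : c ≠ 0) (hV : IsExternalPotential V) (h₁ : IsFormFunction σ₁) (h₂ : IsFormFunction σ₂)
    {Ψ₀ Ψ₁ : WaveField d n} {f₀ : Density d} {G₀ : Lp (Rd n) 2 (volume : Measure (Rd d × Rd n))} (hG : HasWeakGradientSnd Ψ₀ G₀)
    (hi : Integrable fun z : Rd d × Rd d => f₀ z * (‖z.2‖ ^ 2 / 2 + V z.1)) {T : ℝ} (hT : 0 < T) {f : ℝ → Density d} {Ψ : ℝ → WaveField d n}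
    (h : IsWeakSolution T c V σ₁ σ₂ Ψ₀ Ψ₁ f₀ f Ψ) :
    ∃ (Ψt : ℝ → WaveField d n) (G : ℝ → Lp (Rd n) 2 (volume : Measure (Rd d × Rd n))), ContinuousOn Ψt (Icc 0 T) ∧ ContinuousOn G (Icc 0 T) ∧
      ∀ t ∈ Icc 0 T, HasDerivWithinAt Ψ (Ψt t) (Icc 0 T) t ∧ HasWeakGradientSnd (Ψ t) (G t) ∧
        Integrable (particleEnergyDensity V (potential σ₁ σ₂ (Ψ t)) (f t)) volume ∧
        totalEnergy c V σ₁ σ₂ (f t) (Ψ t) (Ψt t) (G t) = totalEnergy c V σ₁ σ₂ f₀ Ψ₀ Ψ₁ G₀ := by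
  have ha := h₁.isTest
  have hb := h₂.isTest
  have hF := isForce_of_continuous ha hb (continuous_comp_clamp hT.le h.continuous_field)
  obtain ⟨e1, e2⟩ := h.eq_transport_waveSol hV h₁ h₂ hT hF fun t ht => by rw [clamp_of_mem ht]
  obtain ⟨Ψt, G, cΨt, cG, hD, hE⟩ := exists_field_energy hc Ψ₁ hG (continuous_drive hV ha hb hF f₀)
  refine ⟨Ψt, G, cΨt.continuousOn, cG.continuousOn, fun t ht => ?_⟩
  obtain ⟨p1, p2⟩ := particle_energy hV hF ha hb hD cΨt ht.1 (fun s hs => by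
    have hs' : s ∈ Icc 0 T := ⟨hs.1, hs.2.trans ht.2⟩
    rw [clamp_of_mem hs', e2 hs']) hi
  obtain ⟨q1, q2⟩ := hE t ht.1
  rw [waveSol_zero] at p2
  refine ⟨(hD t).hasDerivWithinAt.congr e2 (e2 ht), ?_⟩
  rw [e1 ht, e2 ht]
  refine ⟨q1, p1, ?_⟩
  rw [totalEnergy, totalEnergy, q2, p2]
  ring

end TotalEnergy

end VlasovWave

end

theorem corollary1 (d n : ℕ) (hd : 1 ≤ d) (hn : 1 ≤ n) (c : ℝ) (hc : 0 < c)
    (V : Rd d → ℝ) (hV : IsExternalPotential V)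
    (σ₁ : Rd d → ℝ) (hσ₁ : IsFormFunction σ₁) (σ₂ : Rd n → ℝ) (hσ₂ : IsFormFunction σ₂)
    (Ψ₀ Ψ₁ : WaveField d n) :
    -- well-posedness on `[0,T]` for densities in `E_{R₀,T}`
    (∀ R₀ T : ℝ, 0 < R₀ → 0 < T →
      ∀ f₀ ∈ admissibleDensities c V σ₁ σ₂ Ψ₀ Ψ₁ R₀ T,
        ∃ (f : ℝ → Density d) (Ψ : ℝ → WaveField d n),
          IsWeakSolution T c V σ₁ σ₂ Ψ₀ Ψ₁ f₀ f Ψ ∧ (∀ t ∈ Icc 0 T, 0 ≤ f t) ∧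
          -- uniqueness
          (∀ (f' : ℝ → Density d) (Ψ' : ℝ → WaveField d n),
            IsWeakSolution T c V σ₁ σ₂ Ψ₀ Ψ₁ f₀ f' Ψ' →
              EqOn f' f (Icc 0 T) ∧ EqOn Ψ' Ψ (Icc 0 T)) ∧
          -- continuous dependence on the parameters
          (∀ ε : ℝ, 0 < ε → ∃ δ : ℝ, 0 < δ ∧
            ∀ (σ₁' : Rd d → ℝ) (σ₂' : Rd n → ℝ) (Ψ₀' Ψ₁' : WaveField d n) (f₀' : Density d),
              IsFormFunction σ₁' → IsFormFunction σ₂' → 0 ≤ f₀' →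
              w32Norm (fun x => σ₁' x - σ₁ x) < ENNReal.ofReal δ →
              eLpNorm (fun y => σ₂' y - σ₂ y) 2 volume < ENNReal.ofReal δ →
              ‖Ψ₀' - Ψ₀‖ < δ → ‖Ψ₁' - Ψ₁‖ < δ → ‖f₀' - f₀‖ < δ →
              ∀ (f' : ℝ → Density d) (Ψ' : ℝ → WaveField d n),
                IsWeakSolution T c V σ₁' σ₂' Ψ₀' Ψ₁' f₀' f' Ψ' →
                ∀ t ∈ Icc 0 T, ‖f' t - f t‖ < ε ∧ ‖Ψ' t - Ψ t‖ < ε)) ∧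
    -- existence of a global weak solution for every non-negative integrable density
    (∀ f₀ : Density d, 0 ≤ f₀ →
      ∃ (f : ℝ → Density d) (Ψ : ℝ → WaveField d n),
        ContinuousOn f (Ici 0) ∧ ContinuousOn Ψ (Ici 0) ∧ (∀ t ∈ Ici (0 : ℝ), 0 ≤ f t) ∧
        ∀ T : ℝ, 0 < T → IsWeakSolution T c V σ₁ σ₂ Ψ₀ Ψ₁ f₀ f Ψ) ∧
    -- conservation of the total energy for data with finite energy
    (∀ (f₀ : Density d) (G₀ : Lp (Rd n) 2 (volume : Measure (Rd d × Rd n))), 0 ≤ f₀ →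
      HasWeakGradientSnd Ψ₀ G₀ →
      Integrable (fun z : Rd d × Rd d => f₀ z * (‖z.2‖ ^ 2 / 2 + V z.1)) volume →
      ∀ (T : ℝ), 0 < T → ∀ (f : ℝ → Density d) (Ψ : ℝ → WaveField d n),
        IsWeakSolution T c V σ₁ σ₂ Ψ₀ Ψ₁ f₀ f Ψ →
        ∃ (Ψt : ℝ → WaveField d n) (G : ℝ → Lp (Rd n) 2 (volume : Measure (Rd d × Rd n))),
          ContinuousOn Ψt (Icc 0 T) ∧ ContinuousOn G (Icc 0 T) ∧
          ∀ t ∈ Icc 0 T,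
            HasDerivWithinAt Ψ (Ψt t) (Icc 0 T) t ∧
            HasWeakGradientSnd (Ψ t) (G t) ∧
            Integrable (particleEnergyDensity V (potential σ₁ σ₂ (Ψ t)) (f t)) volume ∧
            totalEnergy c V σ₁ σ₂ (f t) (Ψ t) (Ψt t) (G t)
              = totalEnergy c V σ₁ σ₂ f₀ Ψ₀ Ψ₁ G₀) := by
  refine ⟨fun R₀ T hR hT f₀ hf₀ => ?_, fun f₀ hf₀ => ?_, fun f₀ G₀ _ hG hi T hT f Ψ h => h.energy hc.ne' hV hσ₁ hσ₂ hG hi hT⟩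
  · obtain ⟨f, Ψ, -, -, hpos, hsol⟩ := exists_global_solution c Ψ₀ Ψ₁ f₀ hV hσ₁ hσ₂ hf₀.1
    have huniq : ∀ f' Ψ', IsWeakSolution T c V σ₁ σ₂ Ψ₀ Ψ₁ f₀ f' Ψ' → EqOn f' f (Icc 0 T) ∧ EqOn Ψ' Ψ (Icc 0 T) := fun f' Ψ' h' =>
      (hsol T hT).unique hn hc hV hσ₁ hσ₂ hR hT hf₀ h'
    exact ⟨f, Ψ, hsol T hT, fun t _ => hpos t, huniq, fun ε hε => continuous_dependence hV hσ₁ hσ₂ hT huniq hε⟩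
  · obtain ⟨f, Ψ, hf, hΨ, hpos, hsol⟩ := exists_global_solution c Ψ₀ Ψ₁ f₀ hV hσ₁ hσ₂ hf₀
    exact ⟨f, Ψ, hf.continuousOn, hΨ.continuousOn, fun t _ => hpos t, hsol⟩
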